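/- \textbf{Setting.} Let $d\ge 3$, $\varepsilon>0$, $\alpha\ge 0$. On $\mathcal H=\mathbb C^2\otimes\mathcal F_s(L^2(\mathbb R^d))$, viewed as the symmetric square integrable $\mathbb C^2$-valued functions $F(Q)$ of finite sets $Q\subset\mathbb R^d$ with respect to the measure $\frac1{|Q|!}\prod_{q\in Q}dq$, let $$(HF)(Q)=\Big[\varepsilon\sigma_3+\sum_{q\in Q}\omega(q)\Big]F(Q)+\alpha\sigma_1\Big[\sum_{q\in Q}\lambda(q)F(Q\setminus q)+\int\overline{\lambda(k)}\,F(Q\cup k)\,dk\Big]$$ with the domain of $H|_{\alpha=0}$. Assume: $\omega:\mathbb R^d\to(0,\infty)$ is $C^1$ with a unique non-degenerate minimum at $0$, $\omega(0)=\kappa$, $\partial\omega(q)\ne0$ for $q\neq0$ and $|\partial\omega|/\omega\to0$ at infinity; $\lambda:\mathbb R^d\to\mathbb C$ is $C^1$ with $|\lambda|\le h$ and $|\partial\lambda|\le Ch$ for a square integrable $h:\mathbb R^d\to(0,1]$ and a constant $C>0$; and for each $x\ge\kappa$, $\lambda$ is not identically $0$ on $\{\omega=x\}$. Put $\lambda^0_{0,n}=-\varepsilon+n\kappa$.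 Let $B_n$ and $A_n$ be the compressions of $H$ to the vectors with more than $n$, respectively at most $n$, bosons; let $C_n$ be the part of $H$ that maps the former into the latter; let $M_n(z)=(B_n-z)^{-1}C_n^*$, $m(z)=C_0M_0(z)$ (a $2\times2$ matrix) and $A(\xi)=A_1-C_1M_1(\xi)$. Let $\eta>0$, let $e<\lambda^0_{0,1}-\eta$ be real with $\det(\varepsilon\sigma_3-m(e)-e)=0$ (these are the eigenvalues $e_0,e_1$, or $e_0$ only), let $f\in\mathbb C^2$ be a unit null vector of $\varepsilon\sigma_3-m(e)-e$, and let $F_0=(f,-M_0(e)f)$. Put $\xi(q)=e+\omega(q)$ and $G=\{q:\xi(q)<\lambda^0_{0,2}-\eta\}$. For $q\in G$ let $\delta_q$ be the delta function at $q$ in the one-boson space, and let $$\psi_q=\lim_{t\downarrow0}\,it\,\big(A(\xi(q))-\xi(q)+it\big)^{-1}(0,\delta_q f),\qquad F_q=\big(\psi_q,\,-M_1(\xi(q))\psi_q\big),\qquad F_\varphi=\int_GF_q\,\varphi(q)\,dq ,$$ where $A(\xi)$ and $M_1(\xi)$ act on $\delta_q f$ through their integral kernels and the limit $t\downarrow0$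 is taken in the norm of $\mathcal H$ after integration against $\varphi\in C_c^\infty(G)$. Let $\mathcal K$ be the closed linear span of the $F_\varphi$, $\varphi\in C_c^\infty(G)$. \textbf{Statement.} For every $\eta>0$ there is $\alpha_0>0$, depending only on $d,\varepsilon,\omega,\lambda,\eta$, such that for all $0\le\alpha<\alpha_0$ and all $e,f$ as above the following holds. $F_0$ is an eigenvector of $H$ with eigenvalue $e$. The vectors $F_\varphi$ exist, and $\varphi\mapsto F_\varphi$ extends to a bounded bijection of $L_2(G)$ onto $\mathcal K$. The space $\mathcal K$ lies in the domain of $H$ and is invariant under $H$, and $HF_\varphi=F_{\xi\varphi}$. Let $\nu_x$ be the Gelfand--Leray measure of $\xi$ on $\chi_x=\{\xi=x\}$, so that $dq=d\nu_x\,dx$ and $L_2(G)=\int^\oplus_{[e+\kappa,\lambda^0_{0,2}-\eta)}L_2(\chi_x,\nu_x)\,dx$. There are self-adjoint operators $M_x$ on $L_2(\chi_x,\nu_x)$ with $\|M_x\|<1$, forming a decomposable operator $M=\int^\oplus M_x\,dx$ on $L_2(G)$, such that $$(F_{\varphi_1},F_{\varphi_2})_{\mathcal H}=\|F_0\|^2\,\big((I+M)\varphi_1,\varphi_2\big)_{L_2(G)},\qquad\varphi_1,\varphi_2\in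 L_2(G).$$ The direct integral $$B=\int^\oplus\|F_0\|^{-1}(I+M_x)^{-1/2}\,dx$$ is a bounded operator on $L_2(G)$. Carried over to $\mathcal K$ by $\varphi\mapsto F_\varphi$, it is a bounded operator on $\mathcal K$ that commutes with $H|_{\mathcal K}$. Moreover $$(F_{B\varphi_1},F_{B\varphi_2})_{\mathcal H}=(\varphi_1,\varphi_2)_{L_2(G)},\qquad\varphi_1,\varphi_2\in L_2(G).$$ Thus $\varphi\mapsto F_{B\varphi}$ is a unitary map of $L_2(G)$ onto $\mathcal K$, and $HF_{B\varphi}=F_{B(\xi\varphi)}$; that is, $H|_{\mathcal K}$ is unitarily equivalent to multiplication by $\xi$ in $L_2(G)$. -/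

import Mathlib

open MeasureTheory Filter Topology
open scoped ENNReal

noncomputable section

namespace SpinBoson

/-- Boson momentum space. -/
abbrev Mom (d : ℕ) : Type := EuclideanSpace ℝ (Fin d)

/-- Spin space `ℂ²`. -/
abbrev Spin : Type := EuclideanSpace ℂ (Fin 2)

/-- Boson configurations: `⟨n, k⟩` is the configuration of the `n` momenta `k 0, …, k (n-1)`. -/
abbrev Config (d : ℕ) : Type := Σ n : ℕ, (Fin n → Mom d)

/-- The Lebesgue-Poisson measure: `(1/n!) dk₁ … dkₙ` on `n`-boson configurations. -/
def lebesguePoisson (d : ℕ) : Measure (Config d) :=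
  Measure.sum fun n =>
    ((n.factorial : ℝ≥0∞)⁻¹) • (volume : Measure (Fin n → Mom d)).map (fun k => (⟨n, k⟩ : Config d))

/-- Relabelling of the momenta, by one permutation for each number of bosons. -/
def relabel {d : ℕ} (s : ∀ n : ℕ, Equiv.Perm (Fin n)) (Q : Config d) : Config d :=
  ⟨Q.1, fun j => Q.2 (s Q.1 j)⟩

lemma measurable_sigma_mk {d : ℕ} (n : ℕ) :
    Measurable (fun k : Fin n → Mom d => (⟨n, k⟩ : Config d)) := by
  intro t ht
  exact (MeasurableSpace.measurableSet_iInf.1 ht) n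

lemma measurable_relabel {d : ℕ} (s : ∀ n : ℕ, Equiv.Perm (Fin n)) :
    Measurable (relabel s : Config d → Config d) := by
  intro t ht
  refine MeasurableSpace.measurableSet_iInf.2 fun n => ?_
  have h1 : Measurable (fun k : Fin n → Mom d => fun j => k (s n j)) := by fun_prop
  exact h1 (measurable_sigma_mk n ht)

lemma measurePreserving_relabel {d : ℕ} (s : ∀ n : ℕ, Equiv.Perm (Fin n)) :
    MeasurePreserving (relabel s : Config d → Config d)
      (lebesguePoisson d) (lebesguePoisson d) := by
  refine ⟨measurable_relabel s, ?_⟩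
  unfold lebesguePoisson
  rw [Measure.map_sum (measurable_relabel s).aemeasurable]
  congr 1
  funext n
  rw [Measure.map_smul, Measure.map_map (measurable_relabel s) (measurable_sigma_mk n)]
  have hp : MeasurePreserving (fun k : Fin n → Mom d => fun j => k (s n j)) volume volume := by
    have h := volume_measurePreserving_piCongrLeft (fun _ : Fin n => Mom d) (s n).symm
    have he : (fun k : Fin n → Mom d => fun j => k (s n j))
        = ⇑(MeasurableEquiv.piCongrLeft (fun _ : Fin n => Mom d) (s n).symm) := by
      funext k j
      have h2 := Equiv.piCongrLeft_apply_apply (fun _ : Fin n => Mom d) (s n).symm k (s n j)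
      rw [Equiv.symm_apply_apply] at h2
      rw [MeasurableEquiv.coe_piCongrLeft, h2]
    rw [he]
    exact h
  have hc : (relabel s ∘ (fun k : Fin n → Mom d => (⟨n, k⟩ : Config d)))
      = (fun k : Fin n → Mom d => (⟨n, k⟩ : Config d)) ∘ (fun k : Fin n → Mom d => fun j => k (s n j)) := rfl
  rw [hc, ← Measure.map_map (measurable_sigma_mk n) hp.measurable, hp.map_eq]

/-- All square integrable spin-valued functions of labelled configurations. -/
abbrev FullSpace (d : ℕ) : Type := Lp Spin 2 (lebesguePoisson d)

/-- The permutation symmetric elements. -/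
def symmetricSubspace (d : ℕ) : Submodule ℂ (FullSpace d) :=
  ⨅ s : ∀ n : ℕ, Equiv.Perm (Fin n),
    LinearMap.eqLocus
      (Lp.compMeasurePreservingₗᵢ ℂ (relabel s) (measurePreserving_relabel s)).toLinearMap
      LinearMap.id

/-- The Hilbert space `ℂ² ⊗ (symmetric Fock space over L²(ℝᵈ))` of the spin-boson model,
realised as the symmetric `ℂ²`-valued square integrable functions of finite configurations. -/
abbrev Fock (d : ℕ) : Type := symmetricSubspace d

lemma isClosed_symmetricSubspace (d : ℕ) :
    IsClosed (symmetricSubspace d : Set (FullSpace d)) := by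
  unfold symmetricSubspace
  rw [Submodule.coe_iInf]
  refine isClosed_iInter fun s => ?_
  exact isClosed_eq (Lp.compMeasurePreservingₗᵢ ℂ (relabel s)
    (measurePreserving_relabel s)).continuous continuous_id

instance (d : ℕ) : CompleteSpace (Fock d) :=
  (isClosed_symmetricSubspace d).completeSpace_coe

/-- A representative, as a function of configurations, of an element of the Fock space. -/
def Fock.rep {d : ℕ} (F : Fock d) : Config d → Spin := fun Q => (F : FullSpace d) Q

/-! ### Data of the model and the standing assumptions -/

/-- Half level spacing `ε`, dispersion law `ω`, form factor `λ`, coupling constant `α`. -/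
structure Model (d : ℕ) where
  eps : ℝ
  om : Mom d → ℝ
  lam : Mom d → ℂ
  alpha : ℝ

/-- `ω > 0` is `C¹`, with a unique non-degenerate minimum at `0`, no other critical point, and
`|∂ω| / ω → 0` at infinity. (As `ω` is only `C¹`, non-degeneracy is expressed by a positive
definite derivative of `∂ω` at `0`.) -/
structure DispersionLaw {d : ℕ} (om : Mom d → ℝ) : Prop where
  contDiff : ContDiff ℝ 1 om
  pos : ∀ q, 0 < om q
  unique_min : ∀ q, q ≠ 0 → om 0 < om q
  nondegenerate : ∃ A : Mom d →L[ℝ] Mom d →L[ℝ] ℝ,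
    HasFDerivAt (fderiv ℝ om) A 0 ∧ ∀ v, v ≠ 0 → 0 < A v v
  no_critical : ∀ q, q ≠ 0 → fderiv ℝ om q ≠ 0
  slow_growth : Tendsto (fun q => ‖fderiv ℝ om q‖ / om q) (cocompact (Mom d)) (𝓝 0)

/-- `λ` is `C¹`, and `λ`, `∂λ` are dominated by a square integrable `h : ℝᵈ → (0,1]`. -/
structure FormFactor {d : ℕ} (lam : Mom d → ℂ) : Prop where
  contDiff : ContDiff ℝ 1 lam
  dominated : ∃ h : Mom d → ℝ, MemLp h 2 volume ∧ (∀ q, 0 < h q ∧ h q ≤ 1) ∧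
    (∀ q, ‖lam q‖ ≤ h q) ∧ ∃ C > 0, ∀ q, ‖fderiv ℝ lam q‖ ≤ C * h q

/-- `λ` does not vanish identically on any level set `{ω = x}`, `x ≥ κ = ω(0)`. -/
def NonvanishingOnLevels {d : ℕ} (om : Mom d → ℝ) (lam : Mom d → ℂ) : Prop :=
  ∀ x, om 0 ≤ x → ∃ q, om q = x ∧ lam q ≠ 0

/-! ### The Hamiltonian -/

def sigma3 : Matrix (Fin 2) (Fin 2) ℂ := !![1, 0; 0, -1]

def sigma1 : Matrix (Fin 2) (Fin 2) ℂ := !![0, 1; 1, 0]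

/-- Action of a `2 × 2` matrix on a spin vector. -/
def act (A : Matrix (Fin 2) (Fin 2) ℂ) (v : Spin) : Spin := WithLp.toLp 2 (A.mulVec v.ofLp)

variable {d : ℕ}

namespace Model

/-- `ω(Q) = ∑_{q ∈ Q} ω(q)`. -/
def omQ (p : Model d) (Q : Config d) : ℝ := ∑ j, p.om (Q.2 j)

/-- `∑_{q ∈ Q} φ(q) F(Q \ q)`. -/
def addOne (φ : Mom d → ℂ) (F : Config d → Spin) : Config d → Spin
  | ⟨0, _⟩ => 0
  | ⟨n + 1, k⟩ => ∑ j : Fin (n + 1), φ (k j) • F ⟨n, fun i => k (j.succAbove i)⟩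

/-- Creation part of the interaction: `α σ₁ ∑_{q ∈ Q} λ(q) F(Q \ q)`. -/
def cre (p : Model d) (F : Config d → Spin) (Q : Config d) : Spin :=
  (p.alpha : ℂ) • act sigma1 (addOne p.lam F Q)

/-- Annihilation part of the interaction: `α σ₁ ∫ conj λ(q) F(Q ∪ q) dq`. -/
def ann (p : Model d) (F : Config d → Spin) (Q : Config d) : Spin :=
  (p.alpha : ℂ) • act sigma1
    (∫ q : Mom d, (starRingEnd ℂ (p.lam q)) • F ⟨Q.1 + 1, Fin.cons q Q.2⟩)

/-- The expression `(ε σ₃ + ω(Q)) F(Q) + α σ₁ (∑ λ(q) F(Q \ q) + ∫ conj λ(q) F(Q ∪ q) dq)`. -/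
def ham (p : Model d) (F : Config d → Spin) (Q : Config d) : Spin :=
  (p.eps : ℂ) • act sigma3 (F Q) + (p.omQ Q : ℂ) • F Q + p.cre F Q + p.ann F Q

/-- The domain of the free Hamiltonian, which is that of the spin-boson Hamiltonian. -/
def InDomain (p : Model d) (F : Fock d) : Prop :=
  MemLp (fun Q => (p.omQ Q : ℂ) • F.rep Q) 2 (lebesguePoisson d)

/-- The graph of the spin-boson Hamiltonian `H`: `F ∈ D(H)` and `H F = G`. -/
def HamRel (p : Model d) (F G : Fock d) : Prop :=
  p.InDomain F ∧ ∀ᵐ Q ∂(lebesguePoisson d), G.rep Q = p.ham F.rep Q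

/-- `κ = min ω = ω(0)`. -/
def kappa (p : Model d) : ℝ := p.om 0

/-- The free `n`-boson threshold `λ⁰_{0,n} = -ε + n κ`. -/
def threshold (p : Model d) (n : ℕ) : ℝ := -p.eps + n * p.kappa

/-! ### Elimination of the components with more than `n` bosons -/

open Classical in
/-- `(Bₙ - z)⁻¹ g`, where `Bₙ` is the compression of `H` to the space of vectors with more than
`n` bosons, and only the components of `g` with more than `n` bosons matter. (The value is `0`
when there is no solution.) -/
def resB (p : Model d) (n : ℕ) (z : ℂ) (g : Config d → Spin) : Fock d :=
  if h : ∃ u : Fock d, p.InDomain u ∧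
      (∀ᵐ Q ∂(lebesguePoisson d), Q.1 ≤ n → u.rep Q = 0) ∧
      (∀ᵐ Q ∂(lebesguePoisson d), n < Q.1 → p.ham u.rep Q - z • u.rep Q = g Q)
  then h.choose else 0

/-- The vector of boson number zero with spin `c`. -/
def vac (c : Spin) (Q : Config d) : Spin := if Q.1 = 0 then c else 0

/-- `μ₀(z) c = M₀(z) c = (B₀ - z)⁻¹ C₀* c`. -/
def mu0 (p : Model d) (z : ℂ) (c : Spin) : Fock d := p.resB 0 z (p.cre (vac c))

/-- `m(z) = C₀ (B₀ - z)⁻¹ C₀*`, acting on `ℂ²`. -/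
def mVec (p : Model d) (z : ℂ) (c : Spin) : Spin := p.ann (p.mu0 z c).rep ⟨0, Fin.elim0⟩

/-- The matrix of `m(z)`. -/
def mMat (p : Model d) (z : ℂ) : Matrix (Fin 2) (Fin 2) ℂ :=
  Matrix.of fun i j => p.mVec z (EuclideanSpace.single j 1) i

/-- `M₁(z) g = (B₁ - z)⁻¹ C₁* g`; only the one-boson component of `g` matters. -/
def M1 (p : Model d) (z : ℂ) (g : Fock d) : Fock d :=
  p.resB 1 z (fun Q => if Q.1 = 2 then p.cre g.rep Q else 0)

/-- The coefficient function `μ₁⁽¹⁾(z; · ; k) c` of `M₁(z)`. Together with `μ₀` it represents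
`M₁(z)` by `(M₁(z) f)(Q) = ∑_{q ∈ Q} μ₀(z - ω(q); Q \ q) f(q) + ∫ μ₁⁽¹⁾(z; Q; k) f(k) dk`,
and it solves the corresponding fixed point equation
`(B₁ - z) μ₁⁽¹⁾(z; · ; k) = - α conj λ(k) σ₁ μ₀(z - ω(k); ·)` on more than one boson. -/
def mu1 (p : Model d) (z : ℂ) (k : Mom d) (c : Spin) : Fock d :=
  p.resB 1 z (fun Q => -((p.alpha : ℂ) * starRingEnd ℂ (p.lam k)) •
    act sigma1 ((p.mu0 (z - p.om k) c).rep Q))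

/-- The kernel `D₁₁(z; q; k) c` (evaluated at the one-boson configuration `Q = {q}`), in terms of
which `(C₁ (B₁ - z)⁻¹ C₁* f)(q) = m(z - ω(q)) f(q) + ∫ D₁₁(z; q; k) f(k) dk`. -/
def D11 (p : Model d) (z : ℂ) (k : Mom d) (c : Spin) (Q : Config d) : Spin :=
  p.ann (p.mu1 z k c).rep Q +
    ((p.alpha : ℂ) * starRingEnd ℂ (p.lam k)) • act sigma1 ((p.mu0 (z - p.om k) c).rep Q)

open Classical in
/-- The resolvent `(A(ξ) - z)⁻¹ g` of the generalised Friedrichs operator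
`A(ξ) = A₁ - C₁ (B₁ - ξ)⁻¹ C₁*` on the space of vectors with at most one boson, where `A₁` is the
compression of `H` to that space. -/
def resA (p : Model d) (xi : ℝ) (z : ℂ) (g : Config d → Spin) : Fock d :=
  if h : ∃ u : Fock d, p.InDomain u ∧
      (∀ᵐ Q ∂(lebesguePoisson d), 1 < Q.1 → u.rep Q = 0) ∧
      (∀ᵐ Q ∂(lebesguePoisson d), Q.1 ≤ 1 →
        p.ham u.rep Q - (if Q.1 = 1 then p.ann (p.M1 xi u).rep Q else 0) - z • u.rep Q = g Q)
  then h.choose else 0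

/-- `f` is a normalised null vector of `ε σ₃ - m(e) - e`; in particular
`det (ε σ₃ - m(e) - e) = 0`. -/
def IsNullVector (p : Model d) (e : ℝ) (f : Spin) : Prop :=
  ‖f‖ = 1 ∧ act ((p.eps : ℂ) • sigma3 - p.mMat e - (e : ℂ) • 1) f = 0

/-- `F₀ = (f, -M₀(e) f)`, the eigenvector of `H` with eigenvalue `e`. -/
def IsBoundState (p : Model d) (e : ℝ) (f : Spin) (F₀ : Fock d) : Prop :=
  ∀ᵐ Q ∂(lebesguePoisson d), F₀.rep Q = vac f Q - (p.mu0 e f).rep Q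

/-! ### The generalised eigenvectors of the one-boson branch

For a momentum `k` put `ξ = ξ(k) = e + ω(k)`. As `m(ξ - ω(k)) = m(e)`, the delta function
`δ_k ⊗ f` at `k` is a generalised eigenvector, with eigenvalue `ξ`, of
`A₀(ξ) = ε σ₃ + ω - m(ξ - ω)`. The generalised eigenvector of `A(ξ)` is
`ψ_k = lim_{t ↓ 0} i t (A(ξ) - ξ + i t)⁻¹ (0, δ_k ⊗ f)`, and that of `H` is
`F_k = (ψ_k, - M₁(ξ) ψ_k)`. -/

/-- `ξ(q) = e + ω(q)`. -/
def xi (p : Model d) (e : ℝ) (q : Mom d) : ℝ := e + p.om q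

/-- The regular part of `A(ξ)` applied to the delta function `δ_k ⊗ c`, that is
`A(ξ) (0, δ_k ⊗ c) - (0, δ_k ⊗ (ε σ₃ + ω(k) - m(ξ - ω(k))) c)`. Its zero-boson component
is `α σ₁ conj λ(k) c` and its one-boson component is `- D₁₁(ξ; · ; k) c`. -/
def couplingA (p : Model d) (x : ℝ) (k : Mom d) (c : Spin) (Q : Config d) : Spin :=
  if Q.1 = 0 then ((p.alpha : ℂ) * starRingEnd ℂ (p.lam k)) • act sigma1 c
  else if Q.1 = 1 then -p.D11 x k c Q
  else 0

/-- The regular part `g` of the regularised eigenvector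
`i t (A(ξ) - ξ + i t)⁻¹ (0, δ_k ⊗ f) = (0, δ_k ⊗ f) + g`, where `ξ = ξ(k)`. -/
def psiReg (p : Model d) (e : ℝ) (f : Spin) (t : ℝ) (k : Mom d) : Fock d :=
  -p.resA (p.xi e k) ((p.xi e k : ℂ) - t * Complex.I) (p.couplingA (p.xi e k) k f)

/-- The regular part of the regularised generalised eigenvector
`(ψ, - M₁(ξ) ψ)`, `ψ = (0, δ_k ⊗ f) + g`, of `H`. -/
def eigReg (p : Model d) (e : ℝ) (f : Spin) (t : ℝ) (k : Mom d) : Fock d :=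
  p.psiReg e f t k - p.M1 (p.xi e k) (p.psiReg e f t k) - p.mu1 (p.xi e k) k f

/-- The contribution to `∫ F_k φ(k) dk` of the remaining, singular part of `F_k`, that is, of
`δ_k ⊗ f` and of `- ∑_{q ∈ Q} μ₀(ξ(k) - ω(q); Q \ q) f δ(q - k)`; here `ξ(k) - ω(k) = e`. -/
def eigSing (p : Model d) (e : ℝ) (f : Spin) (φ : Mom d → ℂ) (Q : Config d) : Spin :=
  addOne φ (fun Q' => vac f Q' - (p.mu0 e f).rep Q') Q

/-- `F = F_φ = ∫ F_k φ(k) dk`. -/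
def IsPacket (p : Model d) (e : ℝ) (f : Spin) (φ : Mom d → ℂ) (F : Fock d) : Prop :=
  ∃ S : Fock d, (∀ᵐ Q ∂(lebesguePoisson d), S.rep Q = p.eigSing e f φ Q) ∧
    (∀ t : ℝ, 0 < t → Integrable (fun k => φ k • p.eigReg e f t k) volume) ∧
    Tendsto (fun t : ℝ => S + ∫ k : Mom d, φ k • p.eigReg e f t k) (𝓝[>] 0) (𝓝 F)

/-- The domain `G = {q : e + ω(q) < λ⁰_{0,2} - η}`. -/
def G (p : Model d) (η e : ℝ) : Set (Mom d) := {q | p.xi e q < p.threshold 2 - η}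

/-- Smooth functions with compact support in `G`. -/
def IsTest (p : Model d) (η e : ℝ) (φ : Mom d → ℂ) : Prop :=
  ContDiff ℝ (⊤ : ℕ∞) φ ∧ HasCompactSupport φ ∧ tsupport φ ⊆ p.G η e

/-- The branch subspace: closed linear span of the vectors `F_φ`, `φ` a test function on `G`. -/
def branch (p : Model d) (η e : ℝ) (f : Spin) : Submodule ℂ (Fock d) :=
  (Submodule.span ℂ {F | ∃ φ, p.IsTest η e φ ∧ p.IsPacket e f φ F}).topologicalClosure

/-- `L²(G)`. -/
abbrev L2G (p : Model d) (η e : ℝ) : Type := Lp ℂ 2 (volume.restrict (p.G η e))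

/-- The energy range `[e + κ, λ⁰_{0,2} - η)`. -/
def range (p : Model d) (η e : ℝ) : Set ℝ := Set.Ico (e + p.kappa) (p.threshold 2 - η)

/-- `ν x` is the Gelfand-Leray measure of the function `ξ` on its level surface `{ξ = x}`, that is,
it is carried by this surface and `dq = dν_x dx` on `G`. This determines `ν x` for a.e. `x`. -/
def IsGelfandLeray (p : Model d) (η e : ℝ) (ν : ProbabilityTheory.Kernel ℝ (Mom d)) : Prop :=
  (∀ x, ν x {q | p.xi e q ≠ x} = 0) ∧
  ∀ g : Mom d → ℝ≥0∞, Measurable g →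
    ∫⁻ q in p.G η e, g q = ∫⁻ x in p.range η e, ∫⁻ q, g q ∂(ν x)

/-- `A` is the direct integral of the fibre operators `a x`, for the decomposition
`L²(G) = ∫^⊕ L²({ξ = x}, ν x) dx`, in which the fibres of `φ` are its restrictions to the level
surfaces. -/
def IsDirectIntegral (p : Model d) (η e : ℝ) (ν : ProbabilityTheory.Kernel ℝ (Mom d))
    (A : p.L2G η e →L[ℂ] p.L2G η e)
    (a : ∀ x : ℝ, Lp ℂ 2 (ν x) →L[ℂ] Lp ℂ 2 (ν x)) : Prop :=
  ∀ φ : p.L2G η e, ∀ᵐ x ∂(volume.restrict (p.range η e)),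
    ∃ hφ : MemLp (fun q => φ q) 2 (ν x),
      ∀ᵐ q ∂(ν x), (A φ) q = (a x (hφ.toLp (fun q => φ q))) q

end Model

/-- `r = A ^ (-1/2)`: `r` is positive and `r²` is the inverse of `A`. -/
def IsInvSqrt {E : Type*} [NormedAddCommGroup E] [InnerProductSpace ℂ E]
    (r A : E →L[ℂ] E) : Prop :=
  r.IsPositive ∧ r ∘L r ∘L A = ContinuousLinearMap.id ℂ E ∧
    A ∘L r ∘L r = ContinuousLinearMap.id ℂ E

end SpinBoson

end

/-! The vectors `F_φ` are defined by a stationary limit, but the theorem is obtained from a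
time-dependent one: `φ ↦ F_φ` is a wave operator. Let `F₀` be the bound state, `J φ = a*(φ) F₀` on
`L²(G)`, `S = (H + c)⁻¹`, and let `Y` be multiplication by `y = (ξ + c)⁻¹`. The canonical
commutation relations and `H F₀ = e F₀` give `(H + c) a*(ψ) F₀ = a*((ξ + c) ψ) F₀ + α ⟨λ, ψ⟩ σ₁ F₀`
(`ham_creation`). With `ψ = y φ` and `S` applied to both sides, `S J - J Y` becomes the rank one
operator `-⟨u, ·⟩ S σ₁ F₀`, where `u = α y λ` (`resolvent_commutator`). All operators in the
scattering problem are thus bounded.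

The operators `exp (-i s S) J exp (i s Y)` converge strongly as `s → ∞`. Pearson's argument
(`cauchySeq_wave`) gives this on vectors whose correlation functions are uniformly square
integrable. Such vectors are dense (`dense_isKato`), because `ω` has no critical point off the
origin and so `y` pushes Lebesgue measure to an absolutely continuous one. The limit `Ω` satisfies
`Ω Y = S Ω`, which is `H Ω φ = Ω (ξ φ)`. The commutation relations also give `⟨a*(φ) F₀, a*(ψ) F₀⟩ =
⟨φ, ψ⟩ ‖F₀‖² + ⟨a(ψ) F₀, a(φ) F₀⟩`. Along the flow the last term tends to zero by the
Riemann-Lebesgue lemma (`tendsto_annL_phase`). Hence `Ω` is exactly `‖F₀‖` times an isometry: `M_x =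
0`, and `B` is the scalar `‖F₀‖⁻¹`.

It remains to see that `Ω φ = F_φ`. The elimination of components is a Schur complement, and when it
is undone the several terms of the regularised eigenvector collapse: its regular part is `-α conj
λ(k) v`, where `(H - ξ(k) + i t P) v = σ₁ F₀` and `P` projects onto at most one boson (`eigReg_eq`).
With `1` in place of `P`, the limit would be the usual Abelian formula for a wave operator. Here the
damping acts on the range of `P` only. It is nevertheless effective at the energies of the branch,
because the compression of `H` to more than one boson lies above them (`ResolventBound.coercive`).
At the other energies an artificial damping `-i t D²` is added, with `D` a spectral cut-off of `S`;
as `D` vanishes near the values of `y`, this changes the packets only by `O(t)`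
(`exists_regularization`). A Duhamel formula with the resulting uniformly dissipative generator then
gives the Abelian limit (`tendsto_regularized_wave`, `tendsto_packet`).

The range of `Ω` is closed, and test functions are dense in `L²(G)`, so the range is the branch
subspace. The fibre measures come from a disintegration over the values of `ξ`. -/

noncomputable section

namespace SpinBoson

set_option linter.unusedSectionVars false

/-! ### Exponentials of bounded operators -/

section Group

variable {E : Type*} [NormedAddCommGroup E] [InnerProductSpace ℂ E] [CompleteSpace E]

/-- The one-parameter group `exp (-i s Z)`. -/
def grp (Z : E →L[ℂ] E) (s : ℝ) : E →L[ℂ] E := NormedSpace.exp (s • (-Complex.I • Z))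

@[simp] lemma grp_zero (Z : E →L[ℂ] E) : grp Z 0 = 1 := by simp [grp]

lemma hasDerivAt_grp (Z : E →L[ℂ] E) (s : ℝ) :
    HasDerivAt (grp Z) (-Complex.I • (Z * grp Z s)) s := by
  have h := hasDerivAt_exp_smul_const' (𝕂 := ℝ) (-Complex.I • Z) s
  rw [smul_mul_assoc] at h
  exact h

lemma commute_grp (Z : E →L[ℂ] E) (s : ℝ) : Commute Z (grp Z s) := by
  have h : Commute Z (s • (-Complex.I • Z)) :=
    ((Commute.refl Z).smul_right _).smul_right _
  exact h.exp_right

lemma hasDerivAt_grp_apply (Z : E →L[ℂ] E) (v : E) (s : ℝ) :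
    HasDerivAt (fun s => grp Z s v) (-Complex.I • Z (grp Z s v)) s := by
  have h := ((ContinuousLinearMap.apply ℂ E v).restrictScalars ℝ).hasFDerivAt.comp_hasDerivAt s
    (hasDerivAt_grp Z s)
  exact h

lemma grp_apply_comm (Z : E →L[ℂ] E) (v : E) (s : ℝ) : grp Z s (Z v) = Z (grp Z s v) :=
  (DFunLike.congr_fun (commute_grp Z s).eq v).symm

lemma continuous_grp_apply (Z : E →L[ℂ] E) (v : E) : Continuous fun s => grp Z s v :=
  continuous_iff_continuousAt.2 fun s => (hasDerivAt_grp_apply Z v s).continuousAt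

lemma continuous_grp (Z : E →L[ℂ] E) : Continuous (grp Z) :=
  continuous_iff_continuousAt.2 fun s => (hasDerivAt_grp Z s).continuousAt

lemma grp_add (Z : E →L[ℂ] E) (s t : ℝ) : grp Z (s + t) = grp Z s * grp Z t := by
  unfold grp
  rw [add_smul]
  let _ : NormedAlgebra ℚ (E →L[ℂ] E) := NormedAlgebra.restrictScalars ℚ ℂ _
  refine NormedSpace.exp_add_of_commute ?_
  exact ((Commute.refl _).smul_right _).smul_left _

lemma hasDerivAt_norm_sq {γ : ℝ → E} {γ' : E} {s : ℝ} (h : HasDerivAt γ γ' s) :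
    HasDerivAt (fun s => ‖γ s‖ ^ 2) (2 * (inner ℂ (γ s) γ').re) s := by
  have h1 := (h.inner (𝕜 := ℂ) h)
  have h2 := (Complex.reCLM.hasFDerivAt.comp_hasDerivAt s h1)
  have h3 : (Complex.reCLM ∘ fun t => inner ℂ (γ t) (γ t)) = fun s => ‖γ s‖ ^ 2 := by
    funext t
    simp [inner_self_eq_norm_sq_to_K, ← Complex.ofReal_pow]
  rw [h3] at h2
  refine h2.congr_deriv ?_
  have h4 : (inner ℂ γ' (γ s)).re = (inner ℂ (γ s) γ').re := by
    rw [← inner_conj_symm]; exact Complex.conj_re _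
  simp only [Complex.reCLM_apply, Complex.add_re, h4]
  ring

/-- If `Im ⟨v, Z v⟩ ≤ -γ ‖v‖²` then `exp (-i s Z)` decays like `exp (-γ s)`. -/
lemma norm_grp_apply_le (Z : E →L[ℂ] E) (γ : ℝ)
    (hZ : ∀ v, (inner ℂ v (Z v)).im ≤ -γ * ‖v‖ ^ 2) (v : E) {s : ℝ} (hs : 0 ≤ s) :
    ‖grp Z s v‖ ≤ Real.exp (-γ * s) * ‖v‖ := by
  have hd : ∀ s, HasDerivAt (fun s => Real.exp (2 * γ * s) * ‖grp Z s v‖ ^ 2)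
      (Real.exp (2 * γ * s) * (2 * γ) * ‖grp Z s v‖ ^ 2 + Real.exp (2 * γ * s) *
        (2 * (inner ℂ (grp Z s v) (-Complex.I • Z (grp Z s v))).re)) s := by
    intro s
    have h1 : HasDerivAt (fun s => Real.exp (2 * γ * s)) (Real.exp (2 * γ * s) * (2 * γ)) s := by
      have := ((hasDerivAt_id s).const_mul (2 * γ)).exp
      simpa using this
    exact h1.mul (hasDerivAt_norm_sq (hasDerivAt_grp_apply Z v s))
  -- `Re ⟨v, -i Z v⟩ = Im ⟨v, Z v⟩`, so the hypothesis makes the derivative of the weighted square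
  -- norm nonpositive.
  have hanti : Antitone (fun s => Real.exp (2 * γ * s) * ‖grp Z s v‖ ^ 2) := by
    refine antitone_of_deriv_nonpos (fun s => (hd s).differentiableAt) fun s => ?_
    rw [(hd s).deriv]
    have h1 := hZ (grp Z s v)
    have h2 : (inner ℂ (grp Z s v) (-Complex.I • Z (grp Z s v))).re
        = (inner ℂ (grp Z s v) (Z (grp Z s v))).im := by
      rw [inner_smul_right]; simp
    rw [h2]
    have h3 := Real.exp_pos (2 * γ * s)
    nlinarith
  have h := hanti hs
  simp only [mul_zero, Real.exp_zero, grp_zero, one_mul] at h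
  have h4 : (Real.exp (γ * s) * ‖grp Z s v‖) ^ 2 ≤ ‖v‖ ^ 2 := by
    rw [mul_pow, ← Real.exp_nat_mul]
    have e : ((2 : ℕ) : ℝ) * (γ * s) = 2 * γ * s := by push_cast; ring
    rw [e]
    exact h
  have h6 := (abs_le_of_sq_le_sq' h4 (norm_nonneg v)).2
  rw [neg_mul, Real.exp_neg, inv_mul_eq_div, le_div_iff₀ (Real.exp_pos _)]
  linarith

lemma inner_apply_im_eq_zero {S : E →L[ℂ] E} (hS : IsSelfAdjoint S) (v : E) :
    (inner ℂ v (S v)).im = 0 := by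
  have h := hS.isSymmetric v v
  have h2 := inner_conj_symm (𝕜 := ℂ) v (S v)
  simp only [ContinuousLinearMap.coe_coe] at h
  rw [h] at h2
  exact Complex.conj_eq_iff_im.1 h2

lemma grp_mul_grp_neg (Z : E →L[ℂ] E) (s : ℝ) (v : E) : grp Z s (grp Z (-s) v) = v := by
  have h := grp_add Z s (-s)
  rw [add_neg_cancel, grp_zero] at h
  exact (DFunLike.congr_fun h v).symm

/-- A self-adjoint generator satisfies the decay estimate with rate `0`, which gives contractions
for `s ≥ 0`. Applied to `-S` the same estimate covers negative times, and a group of contractions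
consists of isometries. -/
lemma norm_grp_apply {S : E →L[ℂ] E} (hS : IsSelfAdjoint S) (s : ℝ) (v : E) :
    ‖grp S s v‖ = ‖v‖ := by
  have key : ∀ {T : E →L[ℂ] E}, IsSelfAdjoint T → ∀ {s : ℝ}, 0 ≤ s → ∀ v, ‖grp T s v‖ ≤ ‖v‖ := by
    intro T hT s hs v
    have := norm_grp_apply_le T 0 (fun v => by rw [inner_apply_im_eq_zero hT]; simp) v hs
    simpa using this
  have hneg : ∀ s, grp S (-s) = grp (-S) s := by
    intro s; unfold grp; congr 1; simp
  have hle : ∀ s v, ‖grp S s v‖ ≤ ‖v‖ := by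
    intro s v
    rcases le_total 0 s with h | h
    · exact key hS h v
    · have := key hS.neg (neg_nonneg.2 h) v
      rwa [← hneg, neg_neg] at this
  refine le_antisymm (hle s v) ?_
  have h1 := hle (-s) (grp S s v)
  have h2 := grp_mul_grp_neg S (-s) v
  rw [neg_neg] at h2
  rwa [h2] at h1

lemma inner_grp_grp {S : E →L[ℂ] E} (hS : IsSelfAdjoint S) (s : ℝ) (v w : E) :
    inner ℂ (grp S s v) (grp S s w) = inner ℂ v w := by
  have h := (LinearMap.norm_map_iff_inner_map_map (𝕜 := ℂ) (grp S s)).1 (norm_grp_apply hS s)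
  exact h v w

end Group

/-! ### Wave operators -/

section Scattering

variable {E F : Type*} [NormedAddCommGroup E] [InnerProductSpace ℂ E] [CompleteSpace E]
  [NormedAddCommGroup F] [InnerProductSpace ℂ F] [CompleteSpace F]

/-- A one-parameter unitary group with bounded generator `i Y` whose orbits tend weakly to `0`. -/
structure Flow (Y : F →L[ℂ] F) (U : ℝ → F →L[ℂ] F) : Prop where
  zero : ∀ φ, U 0 φ = φ
  add : ∀ s t φ, U (s + t) φ = U s (U t φ)
  comm : ∀ s φ, U s (Y φ) = Y (U s φ)
  deriv : ∀ φ s, HasDerivAt (fun s => U s φ) (Complex.I • Y (U s φ)) s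
  norm : ∀ s φ, ‖U s φ‖ = ‖φ‖
  weak : ∀ v φ, Tendsto (fun s => inner ℂ v (U s φ)) atTop (𝓝 0)

/-- `φ` is a Kato vector of the group `U`: its correlation functions are uniformly square
integrable. -/
def IsKato (U : ℝ → F →L[ℂ] F) (φ : F) : Prop :=
  ∃ K : ℝ, ∀ v : F, ∀ A : ℝ, 0 ≤ A → ∫ a in (0 : ℝ)..A, ‖inner ℂ v (U a φ)‖ ^ 2 ≤ K * ‖v‖ ^ 2

lemma Flow.continuous {Y : F →L[ℂ] F} {U : ℝ → F →L[ℂ] F} (hU : Flow Y U) (φ : F) :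
    Continuous fun s => U s φ :=
  continuous_iff_continuousAt.2 fun s => (hU.deriv φ s).continuousAt

lemma hasDerivAt_grp_comp (Z : E →L[ℂ] E) {γ : ℝ → E} {γ' : E} {s : ℝ} (h : HasDerivAt γ γ' s) :
    HasDerivAt (fun s => grp Z s (γ s)) (-Complex.I • Z (grp Z s (γ s)) + grp Z s γ') s := by
  have h1 : HasDerivAt (fun s => (grp Z s).restrictScalars ℝ)
      ((-Complex.I • (Z * grp Z s)).restrictScalars ℝ) s :=
    (ContinuousLinearMap.restrictScalarsL ℂ E E ℝ ℝ).hasFDerivAt.comp_hasDerivAt s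
      (hasDerivAt_grp Z s)
  exact h1.clm_apply h

/-- The wave operators `exp (-i s S) J U(s)` at finite time. -/
def wave (S : E →L[ℂ] E) (J : F →L[ℂ] E) (U : ℝ → F →L[ℂ] F) (s : ℝ) : F →L[ℂ] E :=
  grp S s ∘L J ∘L U s

variable {S : E →L[ℂ] E} {J : F →L[ℂ] E} {Y : F →L[ℂ] F} {U : ℝ → F →L[ℂ] F} {u : F} {x : E}

lemma wave_zero (hU : Flow Y U) (φ : F) : wave S J U 0 φ = J φ := by
  simp [wave, hU.zero]

lemma norm_wave_apply_le (hS : IsSelfAdjoint S) (hU : Flow Y U) (s : ℝ) (φ : F) :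
    ‖wave S J U s φ‖ ≤ ‖J‖ * ‖φ‖ := by
  simp only [wave, ContinuousLinearMap.comp_apply, norm_grp_apply hS]
  exact (J.le_opNorm _).trans (by rw [hU.norm])

/-- Cook's formula: the derivative is `-i exp (-i s S) (S J - J Y) U(s) φ`. With a rank one
commutator only the scalar correlation `⟨u, U(s) φ⟩` and the orbit of one fixed vector remain. -/
lemma hasDerivAt_wave (hU : Flow Y U)
    (hJ : ∀ φ, S (J φ) - J (Y φ) = -(inner ℂ u φ : ℂ) • x) (φ : F) (s : ℝ) :
    HasDerivAt (fun s => wave S J U s φ)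
      ((Complex.I * inner ℂ u (U s φ)) • grp S s x) s := by
  have h1 : HasDerivAt (fun s => J (U s φ)) (J (Complex.I • Y (U s φ))) s :=
    (J.restrictScalars ℝ).hasFDerivAt.comp_hasDerivAt s (hU.deriv φ s)
  refine (hasDerivAt_grp_comp S h1).congr_deriv ?_
  have h2 : J (Y (U s φ)) = S (J (U s φ)) + (inner ℂ u (U s φ) : ℂ) • x := by
    have := hJ (U s φ)
    rw [neg_smul] at this
    rw [← sub_eq_zero] at this ⊢
    rw [← neg_eq_zero, ← this]; abel
  rw [map_smul, h2, ← grp_apply_comm]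
  simp only [map_smul, map_add, smul_add, neg_smul, smul_smul]
  abel

/-- Intertwining at finite time, up to a rank one error whose coefficient tends to zero along the
flow. -/
lemma wave_flow (hU : Flow Y U)
    (hJ : ∀ φ, S (J φ) - J (Y φ) = -(inner ℂ u φ : ℂ) • x) (φ : F) (s : ℝ) :
    wave S J U s (Y φ) = S (wave S J U s φ) + (inner ℂ u (U s φ) : ℂ) • grp S s x := by
  have h2 : J (Y (U s φ)) = S (J (U s φ)) + (inner ℂ u (U s φ) : ℂ) • x := by
    have := hJ (U s φ)
    rw [neg_smul] at this
    rw [← sub_eq_zero] at this ⊢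
    rw [← neg_eq_zero, ← this]; abel
  simp only [wave, ContinuousLinearMap.comp_apply, hU.comm, h2, map_add, map_smul, grp_apply_comm]

lemma norm_wave_sub_le (hS : IsSelfAdjoint S) (hU : Flow Y U)
    (hJ : ∀ φ, S (J φ) - J (Y φ) = -(inner ℂ u φ : ℂ) • x) (φ : F) {s t C : ℝ} (hst : s ≤ t)
    (hC : ∀ τ, s ≤ τ → ‖inner ℂ u (U τ φ)‖ ≤ C) :
    ‖wave S J U t φ - wave S J U s φ‖ ≤ C * ‖x‖ * (t - s) := by
  refine norm_image_sub_le_of_norm_deriv_le_segment' (f := fun s => wave S J U s φ)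
    (f' := fun s => (Complex.I * inner ℂ u (U s φ)) • grp S s x)
    (fun τ _ => (hasDerivAt_wave hU hJ φ τ).hasDerivWithinAt) (fun τ hτ => ?_) t ⟨hst, le_rfl⟩
  rw [norm_smul, norm_mul, Complex.norm_I, one_mul, norm_grp_apply hS]
  exact mul_le_mul_of_nonneg_right (hC τ hτ.1) (norm_nonneg _)

/-- The window `[s, t]` seen from `U a φ` is the window `[s + a, t + a]` seen from `φ`, where the
correlations with `u` are small by weak convergence. This disposes of the boundary term at `a → ∞`
in Pearson's argument. -/
lemma tendsto_wave_sub_flow (hS : IsSelfAdjoint S) (hU : Flow Y U)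
    (hJ : ∀ φ, S (J φ) - J (Y φ) = -(inner ℂ u φ : ℂ) • x) (φ : F) {s t : ℝ} (hs : 0 ≤ s)
    (hst : s ≤ t) :
    Tendsto (fun a => ‖(wave S J U t - wave S J U s) (U a φ)‖ ^ 2) atTop (𝓝 0) := by
  have h0 : Tendsto (fun a => ‖(wave S J U t - wave S J U s) (U a φ)‖) atTop (𝓝 0) := by
    rw [Metric.tendsto_atTop]
    intro ε hε
    have hpos : 0 < ‖x‖ * (t - s) + 1 := by
      have := mul_nonneg (norm_nonneg x) (sub_nonneg.2 hst); linarith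
    obtain ⟨N, hN⟩ := (Metric.tendsto_atTop.1 (hU.weak u φ)) (ε / (‖x‖ * (t - s) + 1))
      (div_pos hε hpos)
    refine ⟨N, fun a ha => ?_⟩
    have h1 := norm_wave_sub_le hS hU hJ (U a φ) hst (C := ε / (‖x‖ * (t - s) + 1)) (fun τ hτ => by
      rw [← hU.add]
      have := hN (τ + a) (by linarith)
      rw [dist_zero_right] at this
      exact this.le)
    rw [Real.dist_eq, sub_zero, abs_of_nonneg (norm_nonneg _), sub_apply]
    refine h1.trans_lt ?_
    rw [mul_assoc, div_mul_eq_mul_div, div_lt_iff₀ hpos]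
    nlinarith
  simpa using h0.pow 2

/-- With `X` the difference of the wave operators at `t` and `s`, the derivative of `‖X U(a) φ‖²` in
`a` contains only products of a correlation with `u` at a late time and a correlation with `X* exp
(-i r S) x`, `r = s, t`. Each product is split by `2 p q ≤ δ⁻¹ p² + δ q²`: the first kind has small
tails, the second is uniformly bounded on Kato vectors. -/
lemma norm_sq_wave_sub_le (hS : IsSelfAdjoint S) (hU : Flow Y U)
    (hJ : ∀ φ, S (J φ) - J (Y φ) = -(inner ℂ u φ : ℂ) • x) (φ : F) (s t A δ : ℝ)
    (hδ : 0 < δ) (hA : 0 ≤ A) :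
    ‖(wave S J U t - wave S J U s) φ‖ ^ 2 ≤ ‖(wave S J U t - wave S J U s) (U A φ)‖ ^ 2 +
      ∫ a in (0 : ℝ)..A,
        (δ⁻¹ * (‖inner ℂ u (U (t + a) φ)‖ ^ 2 + ‖inner ℂ u (U (s + a) φ)‖ ^ 2) +
        δ * (‖inner ℂ ((wave S J U t - wave S J U s).adjoint (grp S t x)) (U a φ)‖ ^ 2 +
          ‖inner ℂ ((wave S J U t - wave S J U s).adjoint (grp S s x)) (U a φ)‖ ^ 2)) := by
  set X := wave S J U t - wave S J U s with hX
  have hXd : ∀ a, HasDerivAt (fun a => X (U a φ)) (X (Complex.I • Y (U a φ))) a := fun a =>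
    (X.restrictScalars ℝ).hasFDerivAt.comp_hasDerivAt a (hU.deriv φ a)
  have hXY : ∀ ψ, X (Y ψ) = S (X ψ) + ((inner ℂ u (U t ψ) : ℂ) • grp S t x
      - (inner ℂ u (U s ψ) : ℂ) • grp S s x) := by
    intro ψ
    simp only [hX, sub_apply, wave_flow hU hJ, map_sub]
    abel
  have hd : ∀ a, HasDerivAt (fun a => ‖X (U a φ)‖ ^ 2)
      (2 * (inner ℂ (X (U a φ)) (Complex.I • ((inner ℂ u (U (t + a) φ) : ℂ) • grp S t x
        - (inner ℂ u (U (s + a) φ) : ℂ) • grp S s x))).re) a := by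
    intro a
    refine (hasDerivAt_norm_sq (hXd a)).congr_deriv ?_
    congr 1
    rw [map_smul, hXY, smul_add, inner_add_right, Complex.add_re, hU.add, hU.add]
    -- The generator `S` only rotates `X (U a φ)` and does not change its norm.
    have : (inner ℂ (X (U a φ)) (Complex.I • S (X (U a φ)))).re = 0 := by
      rw [inner_smul_right]
      simp [inner_apply_im_eq_zero hS]
    rw [this, zero_add]
  have hcU : ∀ ψ : F, Continuous fun a => U a ψ := hU.continuous
  have hcint : Continuous fun a => (2 * (inner ℂ (X (U a φ)) (Complex.I •
      ((inner ℂ u (U (t + a) φ) : ℂ) • grp S t x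
        - (inner ℂ u (U (s + a) φ) : ℂ) • grp S s x))).re) := by
    have h1 : ∀ r : ℝ, Continuous fun a => U (r + a) φ := fun r =>
      (hcU φ).comp (continuous_const.add continuous_id)
    have h2 := h1 t
    have h3 := h1 s
    have h4 := hcU φ
    fun_prop
  have hFTC := intervalIntegral.integral_eq_sub_of_hasDerivAt (fun a _ => hd a)
    (hcint.intervalIntegrable 0 A)
  rw [hU.zero] at hFTC
  have hcR : Continuous fun a => (δ⁻¹ * (‖inner ℂ u (U (t + a) φ)‖ ^ 2 +
      ‖inner ℂ u (U (s + a) φ)‖ ^ 2) +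
        δ * (‖inner ℂ (X.adjoint (grp S t x)) (U a φ)‖ ^ 2 +
          ‖inner ℂ (X.adjoint (grp S s x)) (U a φ)‖ ^ 2)) := by
    have h1 : ∀ r : ℝ, Continuous fun a => U (r + a) φ := fun r =>
      (hcU φ).comp (continuous_const.add continuous_id)
    have h2 := h1 t
    have h3 := h1 s
    have h4 := hcU φ
    fun_prop
  have hneg := hcint.neg
  simp only [Pi.neg_def] at hneg
  have hle := intervalIntegral.integral_mono_on (μ := volume) hA (hneg.intervalIntegrable 0 A)
    (hcR.intervalIntegrable 0 A) (fun a _ => ?_)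
  · simp only [intervalIntegral.integral_neg] at hle
    linarith
  · have hab : ∀ p q : ℝ, 2 * (p * q) ≤ δ⁻¹ * p ^ 2 + δ * q ^ 2 := by
      intro p q
      have h := sq_nonneg (p - δ * q)
      have h2 : δ⁻¹ * p ^ 2 + δ * q ^ 2 - 2 * (p * q) = δ⁻¹ * (p - δ * q) ^ 2 := by
        field_simp
        ring
      have := mul_nonneg (inv_pos.2 hδ).le h
      linarith
    have hin : ∀ r : ℝ, ‖inner ℂ (X (U a φ)) (grp S r x)‖
        = ‖inner ℂ (X.adjoint (grp S r x)) (U a φ)‖ := by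
      intro r
      rw [ContinuousLinearMap.adjoint_inner_left, ← inner_conj_symm, RCLike.norm_conj]
    have hb : |(inner ℂ (X (U a φ)) (Complex.I • ((inner ℂ u (U (t + a) φ) : ℂ) • grp S t x
        - (inner ℂ u (U (s + a) φ) : ℂ) • grp S s x))).re| ≤
        ‖inner ℂ u (U (t + a) φ)‖ * ‖inner ℂ (X.adjoint (grp S t x)) (U a φ)‖ +
        ‖inner ℂ u (U (s + a) φ)‖ * ‖inner ℂ (X.adjoint (grp S s x)) (U a φ)‖ := by
      refine (Complex.abs_re_le_norm _).trans ?_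
      rw [inner_smul_right, norm_mul, Complex.norm_I, one_mul, inner_sub_right, inner_smul_right,
        inner_smul_right, ← hin, ← hin]
      refine (norm_sub_le _ _).trans ?_
      rw [norm_mul, norm_mul]
    have h1 := neg_le_abs ((inner ℂ (X (U a φ)) (Complex.I • ((inner ℂ u (U (t + a) φ) : ℂ) •
      grp S t x - (inner ℂ u (U (s + a) φ) : ℂ) • grp S s x))).re)
    have h2 := hab ‖inner ℂ u (U (t + a) φ)‖ ‖inner ℂ (X.adjoint (grp S t x)) (U a φ)‖
    have h3 := hab ‖inner ℂ u (U (s + a) φ)‖ ‖inner ℂ (X.adjoint (grp S s x)) (U a φ)‖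
    linarith

/-- Pearson's argument: the wave operators converge on Kato vectors. -/
lemma cauchySeq_wave (hS : IsSelfAdjoint S) (hU : Flow Y U)
    (hJ : ∀ φ, S (J φ) - J (Y φ) = -(inner ℂ u φ : ℂ) • x) {φ : F} (hφ : IsKato U φ) :
    CauchySeq fun s => wave S J U s φ := by
  obtain ⟨K, hK⟩ := hφ
  have hcc : Continuous fun a => ‖inner ℂ u (U a φ)‖ ^ 2 := by
    have := hU.continuous φ
    fun_prop
  -- `Λ` is increasing and, by the Kato bound, bounded, so its tails `ℓ - Λ t` become small.
  set Λ : ℝ → ℝ := fun A => ∫ a in (0 : ℝ)..A, ‖inner ℂ u (U a φ)‖ ^ 2 with hΛ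
  have hmono : MonotoneOn Λ (Set.Ici 0) := by
    intro a ha b hb hab
    have := intervalIntegral.integral_add_adjacent_intervals (μ := volume)
      (hcc.intervalIntegrable 0 a) (hcc.intervalIntegrable a b)
    have h2 : 0 ≤ ∫ a in a..b, ‖inner ℂ u (U a φ)‖ ^ 2 :=
      intervalIntegral.integral_nonneg hab fun _ _ => by positivity
    simp only [hΛ]; linarith
  set ℓ := sSup (Λ '' Set.Ici 0) with hℓ
  have hbdd : BddAbove (Λ '' Set.Ici 0) := ⟨K * ‖u‖ ^ 2, by
    rintro _ ⟨A, hA, rfl⟩; exact hK u A hA⟩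
  have hleℓ : ∀ A, 0 ≤ A → Λ A ≤ ℓ := fun A hA => le_csSup hbdd ⟨A, hA, rfl⟩
  have hshift : ∀ t A, 0 ≤ t → 0 ≤ A →
      ∫ a in (0 : ℝ)..A, ‖inner ℂ u (U (t + a) φ)‖ ^ 2 ≤ ℓ - Λ t := by
    intro t A ht hA
    rw [intervalIntegral.integral_comp_add_left (fun a => ‖inner ℂ u (U a φ)‖ ^ 2) t, add_zero]
    have := intervalIntegral.integral_add_adjacent_intervals (μ := volume)
      (hcc.intervalIntegrable 0 t) (hcc.intervalIntegrable t (t + A))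
    have := hleℓ (t + A) (by linarith)
    simp only [hΛ] at *
    linarith
  set M := (2 * ‖J‖ * ‖x‖) ^ 2 with hM
  have hKM : 0 ≤ |K| * M := by positivity
  have hmain : ∀ s t δ : ℝ, 0 ≤ s → s ≤ t → 0 < δ →
      ‖wave S J U t φ - wave S J U s φ‖ ^ 2 ≤
        δ⁻¹ * ((ℓ - Λ t) + (ℓ - Λ s)) + δ * (2 * (|K| * M)) := by
    intro s t δ hs hst hδ
    have hlim := tendsto_wave_sub_flow hS hU hJ φ hs hst
    refine ge_of_tendsto (x := (atTop : Filter ℝ)) (f := fun A =>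
      ‖(wave S J U t - wave S J U s) (U A φ)‖ ^ 2 +
        (δ⁻¹ * ((ℓ - Λ t) + (ℓ - Λ s)) + δ * (2 * (|K| * M)))) ?_ ?_
    · simpa using hlim.add_const (δ⁻¹ * ((ℓ - Λ t) + (ℓ - Λ s)) + δ * (2 * (|K| * M)))
    · filter_upwards [eventually_ge_atTop (0 : ℝ)] with A hA
      have h := norm_sq_wave_sub_le hS hU hJ φ s t A δ hδ hA
      refine h.trans (add_le_add_right ?_ _)
      set X := wave S J U t - wave S J U s
      -- `X` is bounded by `2 ‖J‖` whatever the times are, and the Kato constant does not depend on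
      -- the vector. The terms with weight `δ` are therefore bounded uniformly in `s`, `t` and `A`.
      have hXn : ∀ r, ‖X.adjoint (grp S r x)‖ ^ 2 ≤ M := by
        intro r
        rw [hM]
        refine pow_le_pow_left₀ (norm_nonneg _) ?_ 2
        refine (ContinuousLinearMap.le_opNorm _ _).trans ?_
        rw [norm_grp_apply hS, LinearIsometryEquiv.norm_map]
        refine mul_le_mul_of_nonneg_right ?_ (norm_nonneg _)
        refine ContinuousLinearMap.opNorm_le_bound _ (by positivity) fun ψ => ?_
        change ‖wave S J U t ψ - wave S J U s ψ‖ ≤ _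
        refine (norm_sub_le _ _).trans ?_
        have h1 := norm_wave_apply_le (J := J) hS hU t ψ
        have h2 := norm_wave_apply_le (J := J) hS hU s ψ
        linarith
      have hKa : ∀ r, ∫ a in (0 : ℝ)..A, ‖inner ℂ (X.adjoint (grp S r x)) (U a φ)‖ ^ 2
          ≤ |K| * M := by
        intro r
        refine (hK _ A hA).trans ?_
        exact mul_le_mul (le_abs_self K) (hXn r) (by positivity) (abs_nonneg K)
      have hc0 : ∀ v, Continuous fun a => ‖inner ℂ v (U a φ)‖ ^ 2 := by
        intro v
        have := hU.continuous φ
        fun_prop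
      have hc1 : ∀ r : ℝ, Continuous fun a => ‖inner ℂ u (U (r + a) φ)‖ ^ 2 := fun r =>
        (hc0 u).comp (continuous_const.add continuous_id)
      rw [intervalIntegral.integral_add, intervalIntegral.integral_const_mul,
        intervalIntegral.integral_const_mul, intervalIntegral.integral_add,
        intervalIntegral.integral_add]
      · have h1 := hshift t A (hs.trans hst) hA
        have h2 := hshift s A hs hA
        have h3 := hKa t
        have h4 := hKa s
        have h5 := mul_le_mul_of_nonneg_left (add_le_add h1 h2) (inv_pos.2 hδ).le
        have h6 := mul_le_mul_of_nonneg_left (add_le_add h3 h4) hδ.le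
        linarith
      all_goals apply Continuous.intervalIntegrable
      · exact hc0 _
      · exact hc0 _
      · exact hc1 _
      · exact hc1 _
      · exact continuous_const.mul ((hc1 t).add (hc1 s))
      · exact continuous_const.mul ((hc0 _).add (hc0 _))
  rw [Metric.cauchySeq_iff']
  intro ε hε
  -- `δ` is fixed first, to make the bounded but not decaying terms small. Only then is `N` chosen
  -- so late that the two tails, each below `δ ε² / 4`, compensate `δ⁻¹`.
  obtain ⟨δ, hδ, hδε⟩ : ∃ δ : ℝ, 0 < δ ∧ δ * (2 * (|K| * M)) < ε ^ 2 / 2 := by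
    refine ⟨ε ^ 2 / 2 / (2 * (|K| * M) + 1), by positivity, ?_⟩
    rw [div_mul_eq_mul_div, div_lt_iff₀ (by positivity)]
    have : 0 < ε ^ 2 / 2 := by positivity
    nlinarith
  obtain ⟨_, ⟨N, hN, rfl⟩, hNℓ⟩ := exists_lt_of_lt_csSup (⟨_, ⟨0, Set.mem_Ici.2 le_rfl, rfl⟩⟩ :
    (Λ '' Set.Ici 0).Nonempty) (show ℓ - δ * ε ^ 2 / 4 < ℓ by
      have : 0 < δ * ε ^ 2 / 4 := by positivity
      linarith)
  refine ⟨N, fun t ht => ?_⟩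
  have h := hmain N t δ hN ht hδ
  have h1 : Λ N ≤ Λ t := hmono hN (le_trans hN ht : (0 : ℝ) ≤ t) ht
  have h2 : δ⁻¹ * ((ℓ - Λ t) + (ℓ - Λ N)) < ε ^ 2 / 2 := by
    rw [inv_mul_eq_div, div_lt_iff₀ hδ]
    linarith
  rw [dist_eq_norm]
  refine lt_of_pow_lt_pow_left₀ 2 hε.le ?_
  linarith

/-- Existence of the wave operator. -/
theorem exists_wave_limit (hS : IsSelfAdjoint S) (hU : Flow Y U)
    (hJ : ∀ φ, S (J φ) - J (Y φ) = -(inner ℂ u φ : ℂ) • x)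
    (hdense : Dense {φ : F | IsKato U φ}) :
    ∃ Ω : F →L[ℂ] E, ∀ φ, Tendsto (fun s => wave S J U s φ) atTop (𝓝 (Ω φ)) := by
  have hC : ∀ φ, CauchySeq fun s => wave S J U s φ := by
    intro φ
    rw [Metric.cauchySeq_iff']
    intro ε hε
    have hpos : 0 < 4 * (‖J‖ + 1) := by positivity
    obtain ⟨ψ, hψ, hd⟩ := Metric.dense_iff.1 hdense φ (ε / (4 * (‖J‖ + 1))) (by positivity)
    rw [Metric.mem_ball, dist_comm, dist_eq_norm] at hψ
    obtain ⟨N, hN⟩ := Metric.cauchySeq_iff'.1 (cauchySeq_wave hS hU hJ hd) (ε / 2) (by positivity)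
    refine ⟨N, fun t ht => ?_⟩
    have h1 : ∀ s, dist (wave S J U s φ) (wave S J U s ψ) ≤ ε / 4 := by
      intro s
      rw [dist_eq_norm, ← map_sub]
      refine (norm_wave_apply_le hS hU s _).trans ?_
      rw [lt_div_iff₀ hpos] at hψ
      nlinarith [norm_nonneg (φ - ψ), norm_nonneg J]
    have h2 := hN t ht
    have h3 := h1 t
    have h4 := h1 N
    rw [dist_comm] at h4
    have h5 := dist_triangle4 (wave S J U t φ) (wave S J U t ψ) (wave S J U N ψ) (wave S J U N φ)
    linarith
  choose Ω hΩ using fun φ => cauchySeq_tendsto_of_complete (hC φ)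
  have hlin : Tendsto (fun s φ => wave S J U s φ) atTop (𝓝 Ω) := tendsto_pi_nhds.2 hΩ
  exact ⟨continuousLinearMapOfTendsto (fun s => wave S J U s) hlin, hΩ⟩

/-- Abelian averages of a function vanishing at infinity. -/
lemma tendsto_abel_average {a : ℝ → ℝ} (ha : Continuous a) (ha0 : ∀ s, 0 ≤ a s) {M : ℝ}
    (haM : ∀ s, 0 ≤ s → a s ≤ M) (hlim : Tendsto a atTop (𝓝 0)) {c : ℝ} (hc : 0 < c) :
    Tendsto (fun t => ∫ s in Set.Ioi (0 : ℝ), t * Real.exp (-(c * t) * s) * a s) (𝓝[>] 0)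
      (𝓝 0) := by
  have hM : 0 ≤ M := (ha0 0).trans (haM 0 le_rfl)
  rw [Metric.tendsto_nhds]
  intro ε hε
  -- As `∫ t exp (-c t s) ds = 1 / c`, the threshold `ε c / 2` makes the times after `T` contribute
  -- at most `ε / 2`. The earlier ones contribute at most `t M T'`.
  obtain ⟨T, hT⟩ := (Metric.tendsto_atTop.1 hlim) (ε * c / 2) (by positivity)
  set T' := max T 0 with hT'
  have hsmall : ∀ᶠ t : ℝ in 𝓝[>] 0, t * (M * T') < ε / 2 := by
    have h1 : Tendsto (fun t : ℝ => t * (M * T')) (𝓝[>] 0) (𝓝 (0 * (M * T'))) :=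
      (tendsto_nhdsWithin_of_tendsto_nhds tendsto_id).mul_const _
    rw [zero_mul] at h1
    exact h1.eventually_lt_const (by positivity)
  filter_upwards [hsmall, self_mem_nhdsWithin] with t ht ht0
  have ht0 : 0 < t := ht0
  have hct : 0 < c * t := mul_pos hc ht0
  have hexp : IntegrableOn (fun s => Real.exp (-(c * t) * s)) (Set.Ioi 0) :=
    exp_neg_integrableOn_Ioi 0 hct
  have hIexp : ∫ s in Set.Ioi (0 : ℝ), Real.exp (-(c * t) * s) = (c * t)⁻¹ := by
    rw [integral_exp_mul_Ioi (by linarith)]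
    simp [div_eq_mul_inv]
  have hindint : Integrable (Set.indicator (Set.Ioc 0 T') (fun _ : ℝ => t * M)) := by
    rw [integrable_indicator_iff measurableSet_Ioc]
    exact integrableOn_const (by simp)
  have hg : IntegrableOn (fun s => t * (ε * c / 2) * Real.exp (-(c * t) * s) +
      Set.indicator (Set.Ioc 0 T') (fun _ => t * M) s) (Set.Ioi 0) := by
    exact (hexp.const_mul _).add hindint.integrableOn
  have hbound : ∀ s ∈ Set.Ioi (0 : ℝ), t * Real.exp (-(c * t) * s) * a s ≤
      t * (ε * c / 2) * Real.exp (-(c * t) * s) +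
        Set.indicator (Set.Ioc 0 T') (fun _ => t * M) s := by
    intro s hs
    have hs : 0 < s := hs
    have he := Real.exp_pos (-(c * t) * s)
    have he1 : Real.exp (-(c * t) * s) ≤ 1 := Real.exp_le_one_iff.2 (by nlinarith)
    by_cases h : s ≤ T'
    · rw [Set.indicator_of_mem (Set.mem_Ioc.2 ⟨hs, h⟩)]
      have h1 := haM s hs.le
      have h2 : t * Real.exp (-(c * t) * s) * a s ≤ t * 1 * M := by
        gcongr
        exact ha0 s
      have h3 : 0 ≤ t * (ε * c / 2) * Real.exp (-(c * t) * s) := by positivity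
      linarith
    · rw [Set.indicator_of_notMem (fun h' => h h'.2)]
      have h1 := hT s ((le_max_left T 0).trans (not_le.1 h).le)
      rw [Real.dist_eq, sub_zero, abs_of_nonneg (ha0 s)] at h1
      have : t * Real.exp (-(c * t) * s) * a s ≤ t * Real.exp (-(c * t) * s) * (ε * c / 2) := by
        gcongr
      linarith
  have hnonneg : 0 ≤ ∫ s in Set.Ioi (0 : ℝ), t * Real.exp (-(c * t) * s) * a s :=
    setIntegral_nonneg measurableSet_Ioi fun s _ =>
      mul_nonneg (mul_nonneg ht0.le (Real.exp_pos _).le) (ha0 s)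
  have hint : IntegrableOn (fun s => t * Real.exp (-(c * t) * s) * a s) (Set.Ioi 0) := by
    refine hg.mono' (by fun_prop) ?_
    filter_upwards [ae_restrict_mem measurableSet_Ioi] with s hs
    rw [Real.norm_of_nonneg (mul_nonneg (mul_nonneg ht0.le (Real.exp_pos _).le) (ha0 s))]
    exact hbound s hs
  have hle := setIntegral_mono_on hint hg measurableSet_Ioi hbound
  have hind : ∫ s in Set.Ioi (0 : ℝ), Set.indicator (Set.Ioc 0 T') (fun _ => t * M) s
      = T' * (t * M) := by
    have hsub : Set.Ioc 0 T' ⊆ Set.Ioi 0 := fun s hs => hs.1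
    rw [setIntegral_indicator measurableSet_Ioc, Set.inter_eq_right.2 hsub]
    simp [hT']
  rw [integral_add (hexp.const_mul _), integral_const_mul, hIexp, hind] at hle
  · rw [Real.dist_eq, sub_zero, abs_of_nonneg hnonneg]
    have h1 : t * (ε * c / 2) * (c * t)⁻¹ = ε / 2 := by field_simp
    rw [h1] at hle
    linarith
  · exact hindint.integrableOn

lemma integrableOn_smul_grp {Z : E →L[ℂ] E} {γ : ℝ} (hγ : 0 < γ)
    (hZ : ∀ v s, 0 ≤ s → ‖grp Z s v‖ ≤ Real.exp (-γ * s) * ‖v‖) {c : ℝ → ℂ} (hc : Continuous c)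
    {M : ℝ} (hM : ∀ s, ‖c s‖ ≤ M) (v : E) :
    IntegrableOn (fun s => c s • grp Z s v) (Set.Ioi 0) := by
  have hexp : IntegrableOn (fun s => Real.exp (-γ * s)) (Set.Ioi 0) :=
    exp_neg_integrableOn_Ioi 0 hγ
  refine (hexp.const_mul (M * ‖v‖)).mono' ?_ ?_
  · exact (hc.smul (continuous_grp_apply Z v)).aestronglyMeasurable
  · filter_upwards [ae_restrict_mem measurableSet_Ioi] with s hs
    rw [norm_smul]
    have h1 := hZ v s (le_of_lt hs)
    have h2 := mul_le_mul (hM s) h1 (norm_nonneg _) ((norm_nonneg _).trans (hM s))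
    linarith

/-- Convergence of regularised wave operators. -/
theorem tendsto_regularized_wave (hS : IsSelfAdjoint S) (hU : Flow Y U)
    (hJ : ∀ φ, S (J φ) - J (Y φ) = -(inner ℂ u φ : ℂ) • x)
    {Z : ℝ → E →L[ℂ] E} {c₀ C : ℝ} (hc₀ : 0 < c₀)
    (hZ : ∀ᶠ t in 𝓝[>] 0, (∀ v s, 0 ≤ s → ‖grp (Z t) s v‖ ≤ Real.exp (-(c₀ * t) * s) * ‖v‖) ∧
      ‖Z t - S‖ ≤ C * t)
    {φ : F} {w : E} (hw : Tendsto (fun s => wave S J U s φ) atTop (𝓝 w)) :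
    Tendsto (fun t => J φ + Complex.I • ∫ s in Set.Ioi (0 : ℝ),
      (inner ℂ u (U s φ) : ℂ) • grp (Z t) s x) (𝓝[>] 0) (𝓝 w) := by
  have hcw : Continuous fun s => wave S J U s φ :=
    continuous_iff_continuousAt.2 fun s => (hasDerivAt_wave hU hJ φ s).continuousAt
  have hwn : ‖w‖ ≤ ‖J‖ * ‖φ‖ := le_of_tendsto hw.norm
    (Eventually.of_forall fun s => norm_wave_apply_le hS hU s φ)
  have hb : ∀ s, ‖wave S J U s φ - w‖ ≤ 2 * (‖J‖ * ‖φ‖) := by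
    intro s
    have := norm_sub_le (wave S J U s φ) w
    have := norm_wave_apply_le (J := J) hS hU s φ
    linarith
  have hlim : Tendsto (fun s => ‖wave S J U s φ - w‖) atTop (𝓝 0) := by
    have := (hw.sub_const w).norm
    simpa using this
  have hav := (tendsto_abel_average (a := fun s => ‖wave S J U s φ - w‖) (by fun_prop)
    (fun s => norm_nonneg _) (fun s _ => hb s) hlim hc₀).const_mul C
  rw [mul_zero] at hav
  rw [tendsto_iff_norm_sub_tendsto_zero]
  refine squeeze_zero' (Eventually.of_forall fun _ => norm_nonneg _) ?_ hav
  filter_upwards [hZ, self_mem_nhdsWithin] with t hZt ht0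
  obtain ⟨hZt, hZS⟩ := hZt
  have ht0 : 0 < t := ht0
  have hγ : 0 < c₀ * t := mul_pos hc₀ ht0
  have hcon : Continuous fun s => (inner ℂ u (U s φ) : ℂ) := by
    have := hU.continuous φ
    fun_prop
  have hint1 : IntegrableOn (fun s => (inner ℂ u (U s φ) : ℂ) • grp (Z t) s x) (Set.Ioi 0) :=
    integrableOn_smul_grp hγ hZt hcon (M := ‖u‖ * ‖φ‖) (fun s => by
      refine (norm_inner_le_norm _ _).trans ?_; rw [hU.norm]) x
  set δ : ℝ → E := fun s => wave S J U s φ - w with hδ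
  have hδd : ∀ s, HasDerivAt δ ((Complex.I * inner ℂ u (U s φ)) • grp S s x) s := fun s =>
    (hasDerivAt_wave hU hJ φ s).sub_const w
  set b : ℝ → E := fun s => grp (Z t) s ((Z t - S) (grp S (-s) (δ s))) with hbdef
  have hnegS : ∀ s, grp S (-s) = grp (-S) s := by
    intro s; unfold grp; congr 1; simp
  -- Duhamel interpolation: this curve starts at `J φ - w` and tends to zero. Integrating its
  -- derivative expresses the error of the regularised formula exactly by the integral of `b`.
  have hd : ∀ s, HasDerivAt (fun s => grp (Z t) s (grp S (-s) (δ s)))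
      (-Complex.I • b s + Complex.I • ((inner ℂ u (U s φ) : ℂ) • grp (Z t) s x)) s := by
    intro s
    have h1 := hasDerivAt_grp_comp (Z t) (hasDerivAt_grp_comp (-S) (hδd s))
    simp only [← hnegS] at h1
    refine h1.congr_deriv ?_
    have h2 : grp S (-s) (grp S s x) = x := by
      have := grp_mul_grp_neg S (-s) x
      rwa [neg_neg] at this
    simp only [hbdef, map_smul, map_add, h2, sub_apply, map_sub, grp_apply_comm,
      neg_apply, map_neg, smul_sub, smul_smul, smul_neg, neg_smul]
    abel
  have hδc : Continuous δ := hcw.sub continuous_const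
  have hbc : Continuous b := by
    have h1 : Continuous fun s => grp S (-s) (δ s) :=
      ((continuous_grp S).comp continuous_neg).clm_apply hδc
    exact (continuous_grp (Z t)).clm_apply ((Z t - S).continuous.comp h1)
  -- The factor `t` from `‖Z t - S‖` turns the integral of `‖b‖` into an Abelian average of `‖W(s) φ
  -- - w‖`, with `W(s)` the wave operator at time `s`, which vanishes in the limit.
  have hbb : ∀ s, 0 ≤ s → ‖b s‖ ≤ C * (t * Real.exp (-(c₀ * t) * s) * ‖δ s‖) := by
    intro s hs
    refine (hZt _ s hs).trans ?_
    have h1 : ‖(Z t - S) (grp S (-s) (δ s))‖ ≤ C * t * ‖δ s‖ := by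
      refine (ContinuousLinearMap.le_of_opNorm_le _ hZS _).trans ?_
      rw [norm_grp_apply hS]
    have := mul_le_mul_of_nonneg_left h1 (Real.exp_pos (-(c₀ * t) * s)).le
    linarith
  have hexp : IntegrableOn (fun s => Real.exp (-(c₀ * t) * s)) (Set.Ioi 0) :=
    exp_neg_integrableOn_Ioi 0 hγ
  have hdom : IntegrableOn (fun s => C * (t * Real.exp (-(c₀ * t) * s) * ‖δ s‖)) (Set.Ioi 0) := by
    refine (hexp.const_mul (|C| * t * (2 * (‖J‖ * ‖φ‖)))).mono' (by fun_prop) ?_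
    filter_upwards with s
    rw [norm_mul, norm_mul, norm_mul, norm_norm, Real.norm_of_nonneg ht0.le,
      Real.norm_of_nonneg (Real.exp_pos _).le, Real.norm_eq_abs]
    have := mul_le_mul_of_nonneg_left (hb s)
      (show 0 ≤ |C| * t * Real.exp (-(c₀ * t) * s) by positivity)
    linarith
  have hbint : IntegrableOn b (Set.Ioi 0) := by
    refine hdom.mono' hbc.aestronglyMeasurable ?_
    filter_upwards [ae_restrict_mem measurableSet_Ioi] with s hs
    exact hbb s (le_of_lt hs)
  have hzero : Tendsto (fun s => grp (Z t) s (grp S (-s) (δ s))) atTop (𝓝 0) := by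
    rw [tendsto_zero_iff_norm_tendsto_zero]
    refine squeeze_zero' (Eventually.of_forall fun _ => norm_nonneg _) ?_ hlim
    filter_upwards [eventually_ge_atTop (0 : ℝ)] with s hs
    refine (hZt _ s hs).trans ?_
    rw [norm_grp_apply hS]
    refine mul_le_of_le_one_left (norm_nonneg _) (Real.exp_le_one_iff.2 ?_)
    nlinarith
  have hFTC := integral_Ioi_of_hasDerivAt_of_tendsto (a := (0 : ℝ))
    (hd 0).continuousAt.continuousWithinAt
    (fun s _ => hd s) ((hbint.smul _).add (hint1.smul _)) hzero
  have hsplit := integral_add (hbint.smul (-Complex.I)) (hint1.smul Complex.I)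
  simp only [Pi.smul_apply] at hsplit
  rw [hsplit, integral_smul, integral_smul] at hFTC
  have hδ0 : grp (Z t) 0 (grp S (-0) (δ 0)) = J φ - w := by
    simp [hδ, wave_zero hU]
  rw [hδ0] at hFTC
  have hkey : J φ + Complex.I • (∫ s in Set.Ioi (0 : ℝ), (inner ℂ u (U s φ) : ℂ) • grp (Z t) s x)
      - w = Complex.I • ∫ s in Set.Ioi (0 : ℝ), b s := by
    rw [neg_smul] at hFTC
    have h3 := congrArg (fun v => v + (J φ - w)
      + Complex.I • ∫ s in Set.Ioi (0 : ℝ), b s) hFTC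
    simp only [zero_sub] at h3
    calc _ = _ := by abel
      _ = _ := h3
      _ = _ := by abel
  rw [hkey, norm_smul, Complex.norm_I, one_mul, ← integral_const_mul]
  refine norm_integral_le_of_norm_le hdom ?_
  filter_upwards [ae_restrict_mem measurableSet_Ioi] with s hs
  exact hbb s (le_of_lt hs)

/-- The wave operator intertwines the generators. -/
lemma wave_limit_intertwines (hS : IsSelfAdjoint S) (hU : Flow Y U)
    (hJ : ∀ φ, S (J φ) - J (Y φ) = -(inner ℂ u φ : ℂ) • x) {Ω : F →L[ℂ] E}
    (hΩ : ∀ φ, Tendsto (fun s => wave S J U s φ) atTop (𝓝 (Ω φ))) (φ : F) :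
    Ω (Y φ) = S (Ω φ) := by
  have h1 := hΩ (Y φ)
  simp only [wave_flow hU hJ] at h1
  have h2 : Tendsto (fun s => (inner ℂ u (U s φ) : ℂ) • grp S s x) atTop (𝓝 0) := by
    rw [tendsto_zero_iff_norm_tendsto_zero]
    have := (hU.weak u φ).norm.mul_const ‖x‖
    simpa [norm_smul, norm_grp_apply hS] using this
  have h3 := ((S.continuous.tendsto _).comp (hΩ φ)).add h2
  rw [add_zero] at h3
  exact tendsto_nhds_unique h1 h3

/-- The unitary factor `exp (-i s S)` drops out of scalar products, so the Gram form of the wave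
operator is the limit of that of `J U(s)`. -/
lemma tendsto_inner_wave (hS : IsSelfAdjoint S) {Ω : F →L[ℂ] E}
    (hΩ : ∀ φ, Tendsto (fun s => wave S J U s φ) atTop (𝓝 (Ω φ))) (φ ψ : F) :
    Tendsto (fun s => (inner ℂ (J (U s φ)) (J (U s ψ)) : ℂ)) atTop
      (𝓝 (inner ℂ (Ω φ) (Ω ψ))) := by
  have h := (hΩ φ).inner (𝕜 := ℂ) (hΩ ψ)
  simpa only [wave, ContinuousLinearMap.comp_apply, inner_grp_grp hS] using h

end Scattering

/-! ### Resolvents of form-bounded perturbations -/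

section Resolvent

variable {E : Type*} [NormedAddCommGroup E] [InnerProductSpace ℂ E] [CompleteSpace E]

lemma bijective_one_add {K : E →L[ℂ] E} (hK : ‖K‖ ≤ 1 / 2) :
    Function.Bijective fun w => w + K w := by
  have h1 : ‖-K‖ < 1 := by rw [norm_neg]; linarith
  have h2 := isUnit_one_sub_of_norm_lt_one h1
  have h3 := ContinuousLinearMap.isUnit_iff_bijective.1 h2
  convert h3 using 1
  funext w
  simp

/-- Invertibility of a relatively bounded perturbation, from lower bounds of it and of its
adjoint. -/
lemma bijective_of_bounds {S₀ K Θ : E →L[ℂ] E} (hS₀ : IsSelfAdjoint S₀)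
    (hinj : Function.Injective S₀) (hsymm : ∀ v, S₀ (K v) = K.adjoint (S₀ v)) (hK : ‖K‖ ≤ 1 / 2)
    {C : ℝ} (hb : ∀ w, ‖S₀ w‖ ≤ C * ‖w + K w + Θ (S₀ w)‖)
    (hb' : ∀ w, ‖S₀ w‖ ≤ C * ‖w + K w + Θ.adjoint (S₀ w)‖) :
    Function.Bijective fun w => w + K w + Θ (S₀ w) := by
  set Γ : E →L[ℂ] E := 1 + K + Θ ∘L S₀ with hΓ
  have hΓa : ∀ w, Γ w = w + K w + Θ (S₀ w) := fun w => by simp [hΓ]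
  have hfun : (fun w => w + K w + Θ (S₀ w)) = Γ := by funext w; rw [hΓa]
  rw [hfun]
  -- `Θ` acts on `S₀ w` only, which the hypothesis controls, and `K` costs half of `‖w‖`; so the
  -- whole of `w` is controlled and the range is closed.
  have hlow : ∀ w, ‖w‖ ≤ 2 * (1 + ‖Θ‖ * |C|) * ‖Γ w‖ := by
    intro w
    have h1 : w = Γ w - K w - Θ (S₀ w) := by rw [hΓa]; abel
    have h2 : ‖w‖ ≤ ‖Γ w‖ + ‖K w‖ + ‖Θ (S₀ w)‖ := by
      calc ‖w‖ = ‖Γ w - K w - Θ (S₀ w)‖ := by rw [← h1]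
        _ ≤ _ := (norm_sub_le _ _).trans (add_le_add_left (norm_sub_le _ _) _)
    have h3 : ‖K w‖ ≤ 1 / 2 * ‖w‖ := K.le_of_opNorm_le hK w
    have h4 : ‖Θ (S₀ w)‖ ≤ ‖Θ‖ * (|C| * ‖Γ w‖) := by
      refine (Θ.le_opNorm _).trans (mul_le_mul_of_nonneg_left ?_ (norm_nonneg _))
      refine (hb w).trans ?_
      rw [← hΓa]
      exact mul_le_mul_of_nonneg_right (le_abs_self C) (norm_nonneg _)
    nlinarith
  have hKu : ∀ v, v + K.adjoint v = 0 → v = 0 := by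
    have hK' : ‖K.adjoint‖ ≤ 1 / 2 := by rwa [LinearIsometryEquiv.norm_map]
    intro v hv
    exact (bijective_one_add hK').1 (by simpa using hv)
  have hker : LinearMap.ker (Γ : E →ₗ[ℂ] E) = ⊥ := by
    rw [LinearMap.ker_eq_bot']
    intro w hw
    have := hlow w
    rw [show Γ w = 0 from hw, norm_zero, mul_zero] at this
    exact norm_le_zero_iff.1 this
  have hanti : AntilipschitzWith (Real.toNNReal (2 * (1 + ‖Θ‖ * |C|))) Γ := by
    refine ContinuousLinearMap.antilipschitz_of_bound _ fun w => ?_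
    rw [Real.coe_toNNReal _ (by positivity)]
    exact hlow w
  have hclosed : IsClosed (LinearMap.range (Γ : E →ₗ[ℂ] E) : Set E) := by
    have := hanti.isClosed_range Γ.uniformContinuous
    exact this
  have hrange : LinearMap.range (Γ : E →ₗ[ℂ] E) = ⊤ := by
    have : CompleteSpace (LinearMap.range (Γ : E →ₗ[ℂ] E)) := hclosed.completeSpace_coe
    rw [← Submodule.orthogonal_eq_bot_iff, Submodule.eq_bot_iff]
    intro v hv
    have h1 : Γ.adjoint v = 0 := by
      refine ext_inner_left ℂ fun w => ?_
      rw [ContinuousLinearMap.adjoint_inner_right, inner_zero_right]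
      exact (Submodule.mem_orthogonal _ v).1 hv (Γ w) ⟨w, rfl⟩
    have hadj : ∀ v, Γ.adjoint v = v + K.adjoint v + S₀ (Θ.adjoint v) := by
      intro v
      refine ext_inner_left ℂ fun w => ?_
      rw [ContinuousLinearMap.adjoint_inner_right, hΓa, inner_add_left, inner_add_left,
        inner_add_right, inner_add_right, ContinuousLinearMap.adjoint_inner_right]
      congr 1
      rw [← ContinuousLinearMap.adjoint_inner_right]
      exact hS₀.isSymmetric _ _
    -- A vector `v` orthogonal to the range satisfies `(1 + K*) v = -S₀ Θ* v`. If `(1 + K) w = -Θ*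
    -- v`, then `S₀ w` solves the same equation by the symmetry of `K`, so `v = S₀ w`. Thus `v` lies
    -- in the range of `S₀`, where the lower bound for the adjoint applies.
    obtain ⟨w, hw⟩ := (bijective_one_add hK).2 (-(Θ.adjoint v))
    simp only at hw
    have h2 : v = S₀ w := by
      rw [← sub_eq_zero]
      apply hKu
      rw [map_sub, ← hsymm]
      have h3 := congrArg S₀ hw
      rw [map_add, map_neg] at h3
      rw [hadj] at h1
      calc v - S₀ w + (K.adjoint v - S₀ (K w))
          = (v + K.adjoint v + S₀ (Θ.adjoint v)) - (S₀ w + S₀ (K w) + S₀ (Θ.adjoint v)) := by abel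
        _ = 0 := by rw [h1, h3]; abel
    have h4 : S₀ (w + K w + Θ.adjoint (S₀ w)) = 0 := by
      rw [← h2, hw]; simp
    have h5 : w + K w + Θ.adjoint (S₀ w) = 0 := hinj (by rw [h4, map_zero])
    have h6 := hb' w
    rw [h5, norm_zero, mul_zero, ← h2] at h6
    exact norm_le_zero_iff.1 h6
  exact ⟨LinearMap.ker_eq_bot.1 hker, LinearMap.range_eq_top.1 hrange⟩

/-- A free resolvent `S₀ = H₀⁻¹`, a relatively bounded symmetric perturbation `V` with `K = V S₀`,
a projection `P` reducing `S₀`, and a number `e` with `H₀ + V ≥ e (1 - P)`. -/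
structure FormBound (S₀ K P : E →L[ℂ] E) (e : ℝ) : Prop where
  selfAdjoint : IsSelfAdjoint S₀
  injective : Function.Injective S₀
  symm : ∀ v, S₀ (K v) = K.adjoint (S₀ v)
  norm_le : ‖K‖ ≤ 1 / 2
  proj_selfAdjoint : IsSelfAdjoint P
  proj_idem : ∀ v, P (P v) = P v
  proj_comm : ∀ v, P (S₀ v) = S₀ (P v)
  pos : 0 < e
  form : ∀ w, e * ‖S₀ w - P (S₀ w)‖ ^ 2 ≤ (inner ℂ (S₀ w) (w + K w)).re

variable {S₀ K P : E →L[ℂ] E} {e : ℝ}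

lemma inner_proj {P : E →L[ℂ] E} (hP : IsSelfAdjoint P) (hPP : ∀ v, P (P v) = P v) (v : E) :
    (inner ℂ v (P v) : ℂ) = ((‖P v‖ ^ 2 : ℝ) : ℂ) := by
  rw [← hPP v, ← ContinuousLinearMap.coe_coe, ← hP.isSymmetric]
  simp [hPP, inner_self_eq_norm_sq_to_K]

lemma norm_sq_proj {P : E →L[ℂ] E} (hP : IsSelfAdjoint P) (hPP : ∀ v, P (P v) = P v) (v : E) :
    ‖v‖ ^ 2 = ‖P v‖ ^ 2 + ‖v - P v‖ ^ 2 := by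
  have h := hP.isSymmetric v (v - P v)
  simp only [ContinuousLinearMap.coe_coe, map_sub, hPP, sub_self, inner_zero_right] at h
  have h2 := norm_add_sq_eq_norm_sq_add_norm_sq_of_inner_eq_zero (𝕜 := ℂ) (P v) (v - P v) h
  rw [add_sub_cancel] at h2
  nlinarith

lemma norm_proj_le {P : E →L[ℂ] E} (hP : IsSelfAdjoint P) (hPP : ∀ v, P (P v) = P v) (v : E) :
    ‖P v‖ ≤ ‖v‖ := by
  have h := norm_sq_proj hP hPP v
  have h2 := sq_nonneg ‖v - P v‖
  exact (abs_le_of_sq_le_sq' (by linarith) (norm_nonneg v)).2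

lemma norm_sub_proj_le {P : E →L[ℂ] E} (hP : IsSelfAdjoint P) (hPP : ∀ v, P (P v) = P v) (v : E) :
    ‖v - P v‖ ≤ ‖v‖ := by
  have h := norm_sq_proj hP hPP v
  have h2 := sq_nonneg ‖P v‖
  exact (abs_le_of_sq_le_sq' (by linarith) (norm_nonneg v)).2

lemma FormBound.inner_im (h : FormBound S₀ K P e) (w : E) :
    (inner ℂ (S₀ w) (w + K w)).im = 0 := by
  have h1 : (inner ℂ (S₀ w) (w + K w) : ℂ) = inner ℂ (w + K w) (S₀ w) := by
    rw [inner_add_right, inner_add_left]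
    congr 1
    · exact h.selfAdjoint.isSymmetric w w
    · rw [← ContinuousLinearMap.adjoint_inner_left, ← h.symm]
      exact h.selfAdjoint.isSymmetric _ _
  have h2 := inner_conj_symm (𝕜 := ℂ) (S₀ w) (w + K w)
  rw [← h1] at h2
  exact Complex.conj_eq_iff_im.1 h2

/-- Bounds of the solutions of `(H - m + i t P) u = g`. -/
lemma FormBound.norm_le_of_im (h : FormBound S₀ K P e) {m t : ℝ} (hm : m < e) (ht : t ≠ 0)
    (w : E) : ‖S₀ w‖ ≤ (e - m)⁻¹ * (1 + e / |t|) *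
      ‖w + K w + (-(m : ℂ) • S₀ w + (Complex.I * t) • P (S₀ w))‖ := by
  set u := S₀ w with hu
  set g := w + K w + (-(m : ℂ) • u + (Complex.I * t) • P u) with hg
  have hq : (inner ℂ u g : ℂ) = inner ℂ u (w + K w) +
      ((-m * ‖u‖ ^ 2 : ℝ) : ℂ) + Complex.I * ((t * ‖P u‖ ^ 2 : ℝ) : ℂ) := by
    rw [hg]
    simp only [inner_add_right, inner_smul_right,
      inner_proj h.proj_selfAdjoint h.proj_idem, inner_self_eq_norm_sq_to_K]
    push_cast
    simp only [Complex.coe_algebraMap]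
    ring
  have hre : (inner ℂ u g : ℂ).re = (inner ℂ u (w + K w) : ℂ).re - m * ‖u‖ ^ 2 := by
    rw [hq]; simp [-Complex.ofReal_mul, -Complex.ofReal_neg, -Complex.ofReal_pow]; ring
  have him : (inner ℂ u g : ℂ).im = t * ‖P u‖ ^ 2 := by
    rw [hq, Complex.add_im, Complex.add_im, hu, h.inner_im w]
    simp [-Complex.ofReal_mul, -Complex.ofReal_neg, -Complex.ofReal_pow]
  have h1 := h.form w
  rw [← hu] at h1
  have h2 := norm_sq_proj h.proj_selfAdjoint h.proj_idem u
  -- The imaginary part of `⟨u, g⟩` sees the damping alone and controls `P u`; the real part, with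
  -- the form bound, controls `u - P u`.
  have h3 : |t| * ‖P u‖ ^ 2 ≤ ‖u‖ * ‖g‖ := by
    have := Complex.abs_im_le_norm (inner ℂ u g : ℂ)
    rw [him, abs_mul, abs_of_nonneg (sq_nonneg ‖P u‖)] at this
    exact this.trans (norm_inner_le_norm _ _)
  have h4 : (inner ℂ u g : ℂ).re ≤ ‖u‖ * ‖g‖ :=
    (Complex.re_le_norm _).trans (norm_inner_le_norm _ _)
  have htp : 0 < |t| := abs_pos.2 ht
  have h5 : ‖P u‖ ^ 2 ≤ ‖u‖ * ‖g‖ / |t| := by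
    rw [le_div_iff₀ htp]; linarith
  have h6 : (e - m) * ‖u‖ ^ 2 ≤ ‖u‖ * ((1 + e / |t|) * ‖g‖) := by
    have h7 := mul_le_mul_of_nonneg_left h5 h.pos.le
    have h8 : e * (‖u‖ * ‖g‖ / |t|) = ‖u‖ * (e / |t| * ‖g‖) := by ring
    have h9 : (e - m) * ‖u‖ ^ 2 = e * ‖u - P u‖ ^ 2 - m * ‖u‖ ^ 2 + e * ‖P u‖ ^ 2 := by
      rw [h2]; ring
    linarith
  have hem : 0 < e - m := by linarith
  rw [mul_assoc, inv_mul_eq_div, le_div_iff₀ hem]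
  rcases eq_or_lt_of_le (norm_nonneg u) with h0 | h0
  · rw [← h0, zero_mul]
    have := h.pos
    positivity
  · refine le_of_mul_le_mul_left ?_ h0
    linarith

/-- Passing to the adjoint only reverses the sign of `t`, and the a priori bound depends on `|t|`,
so it serves both for the operator and for its adjoint. -/
lemma FormBound.bijective_im (h : FormBound S₀ K P e) {m t : ℝ} (hm : m < e) (ht : t ≠ 0) :
    Function.Bijective fun w => w + K w + (-(m : ℂ) • S₀ w + (Complex.I * t) • P (S₀ w)) := by
  set Θ : E →L[ℂ] E := -(m : ℂ) • 1 + (Complex.I * t) • P with hΘ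
  have hadj : ∀ v, Θ.adjoint v = -(m : ℂ) • v + (Complex.I * (-t : ℝ)) • P v := by
    intro v
    refine ext_inner_left ℂ fun w => ?_
    rw [ContinuousLinearMap.adjoint_inner_right]
    have h1 : (inner ℂ (P w) v : ℂ) = inner ℂ w (P v) := h.proj_selfAdjoint.isSymmetric w v
    simp only [hΘ, add_apply, smul_apply, one_apply_eq_self, inner_add_left,
      inner_smul_left, inner_add_right, inner_smul_right, h1]
    simp
  exact bijective_of_bounds (Θ := Θ) h.selfAdjoint h.injective h.symm h.norm_le
    (fun w => h.norm_le_of_im hm ht w) (fun w => by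
      rw [hadj]
      have := h.norm_le_of_im hm (neg_ne_zero.2 ht) w
      rwa [abs_neg] at this)

/-- Solvability of `(B - m) u = g` for the compression `B` of `H` to the range of `1 - P`. -/
lemma FormBound.bijective_compression (h : FormBound S₀ K P e) {m : ℝ} (hm : m < e) :
    Function.Bijective fun w => w + (K (w - P w) - P (K (w - P w))) +
      (-(m : ℂ) • (S₀ w - P (S₀ w))) := by
  set Q : E →L[ℂ] E := 1 - P with hQ
  have hQa : ∀ v, Q v = v - P v := fun v => by simp [hQ]
  have hPsym : ∀ v w, (inner ℂ (P v) w : ℂ) = inner ℂ v (P w) :=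
    h.proj_selfAdjoint.isSymmetric
  have hQsym : ∀ v w, (inner ℂ (Q v) w : ℂ) = inner ℂ v (Q w) := fun v w => by
    rw [hQa, hQa, inner_sub_left, inner_sub_right, hPsym]
  have hQn : ∀ v, ‖Q v‖ ≤ ‖v‖ := fun v => by
    rw [hQa]; exact norm_sub_proj_le h.proj_selfAdjoint h.proj_idem v
  have hQS : ∀ v, Q (S₀ v) = S₀ (Q v) := fun v => by
    rw [hQa, hQa, map_sub, h.proj_comm]
  have hQQ : ∀ v, Q (Q v) = Q v := fun v => by
    simp only [hQa, map_sub, h.proj_idem, sub_self, sub_zero]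
  have hPQ : ∀ v, P (Q v) = 0 := fun v => by
    simp only [hQa, map_sub, h.proj_idem, sub_self]
  set K' : E →L[ℂ] E := Q ∘L K ∘L Q with hK'
  have hK'a : ∀ v, K' v = Q (K (Q v)) := fun v => rfl
  have hK'adj : ∀ v, K'.adjoint v = Q (K.adjoint (Q v)) := by
    intro v
    refine ext_inner_left ℂ fun w => ?_
    rw [ContinuousLinearMap.adjoint_inner_right, hK'a, hQsym,
      ← ContinuousLinearMap.adjoint_inner_right, hQsym]
  set Θ : E →L[ℂ] E := -(m : ℂ) • Q with hΘ
  have hΘadj : ∀ v, Θ.adjoint v = Θ v := by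
    intro v
    refine ext_inner_left ℂ fun w => ?_
    rw [ContinuousLinearMap.adjoint_inner_right, hΘ]
    simp only [smul_apply, inner_smul_left, inner_smul_right, hQsym]
    simp
  have hbound : ∀ w, ‖S₀ w‖ ≤ (‖S₀‖ + (e - m)⁻¹) * ‖w + K' w + Θ (S₀ w)‖ := by
    intro w
    set g := w + K' w + Θ (S₀ w) with hg
    have hem : 0 < e - m := by linarith
    -- On the range of `P` the equation is trivial and returns the data; on the range of `Q` the
    -- form bound leaves the positive margin `e - m`.
    have hPg : P g = P w := by
      rw [hg, map_add, map_add, hK'a, hPQ, hΘ, smul_apply, map_smul, hPQ]; simp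
    have ha : ‖P (S₀ w)‖ ≤ ‖S₀‖ * ‖g‖ := by
      rw [h.proj_comm, ← hPg]
      exact (S₀.le_opNorm _).trans (mul_le_mul_of_nonneg_left
        (norm_proj_le h.proj_selfAdjoint h.proj_idem g) (norm_nonneg _))
    have hb : ‖Q (S₀ w)‖ ≤ (e - m)⁻¹ * ‖g‖ := by
      set b := Q (S₀ w) with hb
      have hf := h.form (Q w)
      rw [← hQS, ← hQa, hQQ, ← hb] at hf
      have h1 : (inner ℂ b g : ℂ) = inner ℂ b (Q w + K (Q w)) - m * ((‖b‖ ^ 2 : ℝ) : ℂ) := by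
        have e1 : (inner ℂ b w : ℂ) = inner ℂ b (Q w) := by
          rw [← hQsym, hb, hQQ]
        have e2 : (inner ℂ b (Q (K (Q w))) : ℂ) = inner ℂ b (K (Q w)) := by
          rw [← hQsym, hb, hQQ]
        rw [hg, inner_add_right, inner_add_right, hK'a, e1, e2, inner_add_right, hΘ, smul_apply,
          ← hb, inner_smul_right, inner_self_eq_norm_sq_to_K]
        push_cast
        simp only [Complex.coe_algebraMap]
        ring
      have h2 : (inner ℂ b g : ℂ).re = (inner ℂ b (Q w + K (Q w))).re - m * ‖b‖ ^ 2 := by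
        rw [h1, Complex.sub_re, Complex.re_ofReal_mul, Complex.ofReal_re]
      have h3 : (inner ℂ b g : ℂ).re ≤ ‖b‖ * ‖g‖ :=
        (Complex.re_le_norm _).trans (norm_inner_le_norm _ _)
      rw [inv_mul_eq_div, le_div_iff₀ hem]
      rcases eq_or_lt_of_le (norm_nonneg b) with h0 | h0
      · rw [← h0, zero_mul]; positivity
      · refine le_of_mul_le_mul_left ?_ h0
        nlinarith
    calc ‖S₀ w‖ = ‖P (S₀ w) + Q (S₀ w)‖ := by rw [hQa]; simp
      _ ≤ _ := (norm_add_le _ _).trans (by rw [add_mul]; exact add_le_add ha hb)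
  have hmain := bijective_of_bounds (K := K') (Θ := Θ) h.selfAdjoint h.injective (fun v => by
      rw [hK'a, hK'adj, ← hQS, h.symm, hQS]) (by
      refine ContinuousLinearMap.opNorm_le_bound _ (by norm_num) fun v => ?_
      rw [hK'a]
      refine (hQn _).trans ((K.le_of_opNorm_le h.norm_le _).trans ?_)
      exact mul_le_mul_of_nonneg_left (hQn v) (by norm_num))
    hbound (fun w => by rw [hΘadj]; exact hbound w)
  convert hmain using 1
  funext w
  simp [hK'a, hQa, hΘ]

/-- The resolvent `S = S₀ (1 + K)⁻¹ = (H₀ + V)⁻¹`. -/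
lemma FormBound.exists_resolvent (h : FormBound S₀ K P e) :
    ∃ S : E →L[ℂ] E, IsSelfAdjoint S ∧ Function.Injective S ∧ (∀ w, S (w + K w) = S₀ w) ∧
      ∀ v, e * ‖S v - P (S v)‖ ^ 2 ≤ (inner ℂ (S v) v).re := by
  have hb := bijective_one_add h.norm_le
  set A : E →L[ℂ] E := 1 + K with hA
  have hAa : ∀ w, A w = w + K w := fun w => by simp [hA]
  have hA' : Function.Bijective A := by rwa [show ⇑A = fun w => w + K w from funext hAa]
  set e' := ContinuousLinearEquiv.ofBijective A (LinearMap.ker_eq_bot.2 hA'.1)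
    (LinearMap.range_eq_top.2 hA'.2) with he'
  have hinv : ∀ w, e'.symm (w + K w) = w := by
    intro w
    rw [ContinuousLinearEquiv.symm_apply_eq, ← hAa]
    rfl
  refine ⟨S₀ ∘L (e'.symm : E →L[ℂ] E), ?_, ?_, ?_, ?_⟩
  · rw [ContinuousLinearMap.isSelfAdjoint_iff_isSymmetric]
    intro v v'
    obtain ⟨w, rfl⟩ := hb.2 v
    obtain ⟨w', rfl⟩ := hb.2 v'
    simp only [ContinuousLinearMap.coe_coe, ContinuousLinearMap.comp_apply,
      ContinuousLinearEquiv.coe_coe, hinv]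
    rw [inner_add_right, inner_add_left]
    congr 1
    · exact h.selfAdjoint.isSymmetric w w'
    · rw [← ContinuousLinearMap.adjoint_inner_left, ← h.symm]
      exact h.selfAdjoint.isSymmetric _ _
  · exact h.injective.comp e'.symm.injective
  · intro w
    simp [hinv]
  · intro v
    obtain ⟨w, rfl⟩ := hb.2 v
    simpa [hinv] using h.form w

end Resolvent

/-! ### Dissipative regularization of the resolvent -/

section Regularization

variable {E : Type*} [NormedAddCommGroup E] [InnerProductSpace ℂ E] [CompleteSpace E]
  {S P : E →L[ℂ] E} {e : ℝ}

/-- `S = (H + c)⁻¹` is self-adjoint and `H + c ≥ e (1 - P)` with an orthogonal projection `P`. -/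
structure ResolventBound (S P : E →L[ℂ] E) (e : ℝ) : Prop where
  selfAdjoint : IsSelfAdjoint S
  proj_selfAdjoint : IsSelfAdjoint P
  proj_idem : ∀ v, P (P v) = P v
  pos : 0 < e
  form : ∀ v, e * ‖S v - P (S v)‖ ^ 2 ≤ (inner ℂ (S v) v).re

/-- A continuous cut-off: `1` below `a`, `0` above `b`. -/
def cutoff (a b u : ℝ) : ℝ := max 0 (min 1 ((b - u) / (b - a)))

lemma continuous_cutoff (a b : ℝ) : Continuous (cutoff a b) := by
  unfold cutoff; fun_prop

lemma cutoff_of_le {a b u : ℝ} (hab : a < b) (h : u ≤ a) : cutoff a b u = 1 := by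
  unfold cutoff
  have h1 : 1 ≤ (b - u) / (b - a) := by
    rw [le_div_iff₀ (by linarith)]; linarith
  rw [min_eq_left h1]; simp

lemma cutoff_of_ge {a b u : ℝ} (hab : a < b) (h : b ≤ u) : cutoff a b u = 0 := by
  unfold cutoff
  have h1 : (b - u) / (b - a) ≤ 0 := div_nonpos_of_nonpos_of_nonneg (by linarith) (by linarith)
  rw [max_eq_left ((min_le_right _ _).trans h1)]

lemma abs_cutoff_le (a b u : ℝ) : |cutoff a b u| ≤ 1 := by
  unfold cutoff
  rw [abs_of_nonneg (le_max_left _ _)]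
  exact max_le zero_le_one (min_le_left _ _)

lemma re_inner_cfc_nonneg (S : E →L[ℂ] E) {g : ℝ → ℝ} (hg : ∀ u, 0 ≤ g u) (v : E) :
    0 ≤ (inner ℂ v (cfc g S v)).re := by
  have h := cfc_nonneg (a := S) (f := g) (fun u _ => hg u)
  rw [ContinuousLinearMap.nonneg_iff_isPositive] at h
  exact h.re_inner_nonneg_right v

/-- Away from the spectral region selected by the cut-off, `P S` is bounded below. -/
lemma ResolventBound.coercive (h : ResolventBound S P e) {a b : ℝ} (ha : e⁻¹ < a) (hab : a < b) :
    ∃ C : ℝ, 0 < C ∧ ∀ v, ‖v‖ ^ 2 ≤ C * (‖P (S v)‖ ^ 2 + ‖cfc (cutoff a b) S v‖ ^ 2) := by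
  have ha0 : 0 < a := (inv_pos.2 h.pos).trans ha
  have hSa := h.selfAdjoint
  have hcont : ContinuousOn (cutoff a b) (spectrum ℝ S) := (continuous_cutoff a b).continuousOn
  set D := cfc (cutoff a b) S with hD
  set N := cfc (fun u => 1 - cutoff a b u) S with hN
  have hND : N = 1 - D := by
    rw [hN, cfc_sub (fun _ => (1 : ℝ)) (cutoff a b) S, cfc_const_one ℝ S]
  have hNsa : IsSelfAdjoint N := cfc_predicate _ _
  have hc1 : ContinuousOn (fun u => 1 - cutoff a b u) (spectrum ℝ S) :=
    continuousOn_const.sub hcont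
  have hNS : ∀ v, S (N v) = N (S v) := by
    intro v
    have : S * N = N * S := by
      have h1 : cfc (fun u : ℝ => u) S = S := cfc_id' ℝ S
      have h2 := (cfc_commute_cfc (fun u : ℝ => u) (fun u => 1 - cutoff a b u) S).eq
      rwa [h1] at h2
    exact DFunLike.congr_fun this v
  have hNsym : ∀ v w, (inner ℂ (N v) w : ℂ) = inner ℂ v (N w) := hNsa.isSymmetric
  have hSsym : ∀ v w, (inner ℂ (S v) w : ℂ) = inner ℂ v (S w) := hSa.isSymmetric
  have hidS : cfc (fun u : ℝ => u) S = S := cfc_id' ℝ S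
  -- two consequences of the functional calculus
  have hpos1 : ∀ v, (inner ℂ (S (N v)) (N v)).re ≤ a⁻¹ * ‖S (N v)‖ ^ 2 := by
    intro v
    have h1 := re_inner_cfc_nonneg S (g := fun u => (1 - cutoff a b u) * (1 - cutoff a b u) *
      (a⁻¹ * (u * u) - u)) (fun u => by
        rcases le_total u a with hu | hu
        · rw [cutoff_of_le hab hu]; simp
        · refine mul_nonneg (mul_self_nonneg _) ?_
          have : a⁻¹ * (u * u) - u = a⁻¹ * u * (u - a) := by field_simp
          rw [this]
          exact mul_nonneg (mul_nonneg (inv_pos.2 ha0).le (ha0.le.trans hu)) (by linarith)) v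
    rw [cfc_mul (fun u => (1 - cutoff a b u) * (1 - cutoff a b u)) (fun u => a⁻¹ * (u * u) - u) S
      (hc1.mul hc1) (by fun_prop), cfc_mul _ _ S hc1 hc1, cfc_sub (fun u => a⁻¹ * (u * u))
      (fun u => u) S (by fun_prop) (by fun_prop), cfc_const_mul a⁻¹ (fun u : ℝ => u * u) S
      (by fun_prop), cfc_mul (fun u : ℝ => u) (fun u => u) S (by fun_prop) (by fun_prop), hidS,
      ← hN] at h1
    simp only [mul_apply_eq_comp, sub_apply, smul_apply, map_sub, inner_sub_right]
      at h1
    have e1 : (inner ℂ v (N (N (a⁻¹ • S (S v)))) : ℂ) = ((a⁻¹ : ℝ) : ℂ) * ((‖S (N v)‖ ^ 2 : ℝ) : ℂ) := by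
      rw [← hNsym]
      have : N (a⁻¹ • S (S v)) = ((a⁻¹ : ℝ) : ℂ) • S (S (N v)) := by
        have hs : (a⁻¹ • S (S v)) = ((a⁻¹ : ℝ) : ℂ) • S (S v) := rfl
        rw [hs, map_smul, ← hNS, ← hNS]
      rw [this, inner_smul_right, ← hSsym, inner_self_eq_norm_sq_to_K]
      simp
    have e2 : (inner ℂ v (N (N (S v))) : ℂ) = inner ℂ (S (N v)) (N v) := by
      rw [← hNsym, ← hNS, hSsym]
    rw [e1, e2, Complex.sub_re, Complex.re_ofReal_mul,
      Complex.ofReal_re] at h1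
    linarith
  have hpos2 : ∀ v, a ^ 2 * ‖N v‖ ^ 2 ≤ ‖S (N v)‖ ^ 2 := by
    intro v
    have h1 := re_inner_cfc_nonneg S (g := fun u => (1 - cutoff a b u) * (1 - cutoff a b u) *
      (u * u - a ^ 2)) (fun u => by
        rcases le_total u a with hu | hu
        · rw [cutoff_of_le hab hu]; simp
        · refine mul_nonneg (mul_self_nonneg _) ?_
          nlinarith) v
    rw [cfc_mul (fun u => (1 - cutoff a b u) * (1 - cutoff a b u)) (fun u => u * u - a ^ 2) S
      (hc1.mul hc1) (by fun_prop), cfc_mul _ _ S hc1 hc1, cfc_sub (fun u => u * u)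
      (fun _ => a ^ 2) S (by fun_prop) (by fun_prop), cfc_const (a ^ 2) S,
      cfc_mul (fun u : ℝ => u) (fun u => u) S (by fun_prop) (by fun_prop), hidS, ← hN] at h1
    simp only [mul_apply_eq_comp, sub_apply, map_sub, inner_sub_right] at h1
    have e1 : (inner ℂ v (N (N (S (S v)))) : ℂ) = ((‖S (N v)‖ ^ 2 : ℝ) : ℂ) := by
      rw [← hNsym, ← hNS, ← hNS, ← hSsym, inner_self_eq_norm_sq_to_K]
      simp
    have e2 : (inner ℂ v (N (N ((algebraMap ℝ (E →L[ℂ] E)) (a ^ 2) v))) : ℂ)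
        = ((a ^ 2 : ℝ) : ℂ) * ((‖N v‖ ^ 2 : ℝ) : ℂ) := by
      rw [← hNsym]
      have : (algebraMap ℝ (E →L[ℂ] E)) (a ^ 2) v = ((a ^ 2 : ℝ) : ℂ) • v := by
        rw [Algebra.algebraMap_eq_smul_one]
        rfl
      rw [this, map_smul, inner_smul_right, inner_self_eq_norm_sq_to_K]
      simp
    rw [e1, e2, Complex.sub_re, Complex.re_ofReal_mul, Complex.ofReal_re, Complex.ofReal_re] at h1
    linarith
  -- On vectors cut off to the spectrum of `S` above `a`, the form of `H + c` is at most `a⁻¹ < e`,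
  -- whereas the form bound gives `e` off the range of `P`. The surplus `q` has to be carried by
  -- `P`.
  set q := e - a⁻¹ with hq
  have hq0 : 0 < q := by
    rw [hq, sub_pos]
    exact inv_lt_of_inv_lt₀ h.pos ha
  have hlow : ∀ v, q * ‖S (N v)‖ ^ 2 ≤ e * ‖P (S (N v))‖ ^ 2 := by
    intro v
    have h1 := h.form (N v)
    have h2 := hpos1 v
    have h3 := norm_sq_proj h.proj_selfAdjoint h.proj_idem (S (N v))
    have h4 : (e - a⁻¹) * ‖S (N v)‖ ^ 2 = e * ‖P (S (N v))‖ ^ 2 +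
        e * ‖S (N v) - P (S (N v))‖ ^ 2 - a⁻¹ * ‖S (N v)‖ ^ 2 := by
      linear_combination e * h3
    rw [hq]
    linarith
  refine ⟨2 * (2 * e / (q * a ^ 2)) + (4 * ‖S‖ ^ 2 * e / (q * a ^ 2) + 2), ?_, fun v => ?_⟩
  · have := h.pos
    positivity
  have hv : N v = v - D v := by rw [hND]; simp
  have hn : ‖v‖ ≤ ‖N v‖ + ‖D v‖ := by
    calc ‖v‖ = ‖N v + D v‖ := by rw [hv]; simp
      _ ≤ _ := norm_add_le _ _
  have hps : ‖P (S (N v))‖ ≤ ‖P (S v)‖ + ‖S‖ * ‖D v‖ := by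
    rw [hv, map_sub, map_sub]
    refine (norm_sub_le _ _).trans (add_le_add_right ?_ _)
    exact (norm_proj_le h.proj_selfAdjoint h.proj_idem _).trans (S.le_opNorm _)
  have h1 : q * a ^ 2 * ‖N v‖ ^ 2 ≤ e * (‖P (S v)‖ + ‖S‖ * ‖D v‖) ^ 2 := by
    calc q * a ^ 2 * ‖N v‖ ^ 2 = q * (a ^ 2 * ‖N v‖ ^ 2) := by ring
      _ ≤ q * ‖S (N v)‖ ^ 2 := mul_le_mul_of_nonneg_left (hpos2 v) hq0.le
      _ ≤ e * ‖P (S (N v))‖ ^ 2 := hlow v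
      _ ≤ _ := mul_le_mul_of_nonneg_left (pow_le_pow_left₀ (norm_nonneg _) hps 2) h.pos.le
  have hqa : 0 < q * a ^ 2 := by positivity
  have h2 : ‖N v‖ ^ 2 ≤ e / (q * a ^ 2) * (‖P (S v)‖ + ‖S‖ * ‖D v‖) ^ 2 := by
    rw [div_mul_eq_mul_div, le_div_iff₀ hqa]; linarith
  have h3 : ‖v‖ ^ 2 ≤ 2 * ‖N v‖ ^ 2 + 2 * ‖D v‖ ^ 2 := by
    have := pow_le_pow_left₀ (norm_nonneg _) hn 2
    nlinarith [sq_nonneg (‖N v‖ - ‖D v‖)]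
  have h4 : (‖P (S v)‖ + ‖S‖ * ‖D v‖) ^ 2 ≤ 2 * ‖P (S v)‖ ^ 2 + 2 * (‖S‖ ^ 2 * ‖D v‖ ^ 2) := by
    nlinarith [sq_nonneg (‖P (S v)‖ - ‖S‖ * ‖D v‖)]
  have hr : 0 ≤ e / (q * a ^ 2) := by
    have := h.pos
    positivity
  have h5 := mul_le_mul_of_nonneg_left h4 hr
  have h6 : 2 * (2 * e / (q * a ^ 2)) = 4 * (e / (q * a ^ 2)) := by ring
  have h7 : 4 * ‖S‖ ^ 2 * e / (q * a ^ 2) = 4 * ‖S‖ ^ 2 * (e / (q * a ^ 2)) := by ring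
  rw [h6, h7]
  set r := e / (q * a ^ 2)
  have h8 : 0 ≤ (4 * ‖S‖ ^ 2 * r + 2) * ‖P (S v)‖ ^ 2 := by positivity
  have h9 : 0 ≤ 4 * r * ‖D v‖ ^ 2 := by positivity
  nlinarith

/-- The resolvents `(H + c + i t P)⁻¹` for small `t`. -/
lemma ResolventBound.exists_dissipative (h : ResolventBound S P e) {t : ℝ} (ht : 0 < t)
    (htS : t * ‖S‖ ≤ 1 / 2) :
    ∃ T : E →L[ℂ] E, (∀ v, T v + (Complex.I * t) • S (P (T v)) = S v) ∧
      (∀ u w, u + (Complex.I * t) • S (P u) = S w → u = T w) ∧ ‖T - S‖ ≤ 2 * ‖S‖ ^ 2 * t := by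
  have hPn : ‖P‖ ≤ 1 := ContinuousLinearMap.opNorm_le_bound _ zero_le_one fun v => by
    rw [one_mul]; exact norm_proj_le h.proj_selfAdjoint h.proj_idem v
  set A : E →L[ℂ] E := (Complex.I * t) • (S ∘L P) with hA
  have hAn : ‖A‖ ≤ t * ‖S‖ := by
    rw [hA, norm_smul, norm_mul, Complex.norm_I, one_mul, Complex.norm_of_nonneg ht.le]
    refine mul_le_mul_of_nonneg_left ?_ ht.le
    refine (ContinuousLinearMap.opNorm_comp_le _ _).trans ?_
    exact mul_le_of_le_one_right (norm_nonneg _) hPn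
  have hb := bijective_one_add (hAn.trans htS)
  set B : E →L[ℂ] E := 1 + A with hB
  have hBa : ∀ w, B w = w + A w := fun w => by simp [hB]
  have hB' : Function.Bijective B := by rwa [show ⇑B = fun w => w + A w from funext hBa]
  set e' := ContinuousLinearEquiv.ofBijective B (LinearMap.ker_eq_bot.2 hB'.1)
    (LinearMap.range_eq_top.2 hB'.2) with he'
  have hinv : ∀ w, B (e'.symm w) = w := fun w => e'.apply_symm_apply w
  refine ⟨(e'.symm : E →L[ℂ] E) ∘L S, fun v => ?_, fun u w huw => ?_, ?_⟩
  · have := hinv (S v)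
    rw [hBa] at this
    simpa [hA] using this
  · have h1 : e' u = S w := by
      rw [← huw]
      change B u = _
      rw [hBa]
      simp [hA]
    simp [← h1]
  · refine ContinuousLinearMap.opNorm_le_bound _ (by positivity) fun v => ?_
    simp only [sub_apply, ContinuousLinearMap.comp_apply, ContinuousLinearEquiv.coe_coe]
    set w := e'.symm (S v) with hw
    have h1 : w + A w = S v := by rw [← hBa]; exact hinv _
    have h2 : ‖A w‖ ≤ t * ‖S‖ * ‖w‖ := A.le_of_opNorm_le hAn w
    have h3 : ‖w‖ ≤ 2 * ‖S v‖ := by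
      have : ‖w‖ ≤ ‖S v‖ + ‖A w‖ := by
        calc ‖w‖ = ‖S v - A w‖ := by rw [← h1]; simp
          _ ≤ _ := norm_sub_le _ _
      have h4 : t * ‖S‖ * ‖w‖ ≤ 1 / 2 * ‖w‖ := mul_le_mul_of_nonneg_right htS (norm_nonneg _)
      linarith
    have h5 : w - S v = -A w := by rw [← h1]; abel
    rw [h5, norm_neg]
    refine h2.trans ?_
    have h6 := S.le_opNorm v
    have h7 : t * ‖S‖ * ‖w‖ ≤ t * ‖S‖ * (2 * (‖S‖ * ‖v‖)) := by
      refine mul_le_mul_of_nonneg_left ?_ (by positivity)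
      linarith
    refine h7.trans (le_of_eq (by ring))

/-- `T = (H + c + i t P)⁻¹`, so writing `v = (H + c + i t P) T v` leaves only the damping term in
the imaginary part. The dissipation is therefore seen through `P T v` only, not through all of `v`.
-/
lemma ResolventBound.inner_dissipative_im (h : ResolventBound S P e) {t : ℝ} {T : E →L[ℂ] E}
    (hT : ∀ v, T v + (Complex.I * t) • S (P (T v)) = S v) (v : E) :
    (inner ℂ v (T v)).im = -t * ‖P (T v)‖ ^ 2 := by
  set z := v - (Complex.I * t) • P (T v) with hz
  have h1 : T v = S z := by
    rw [hz, map_sub, map_smul, ← hT v]; simp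
  have h2 : v = z + (Complex.I * t) • P (T v) := by rw [hz]; simp
  have h3 : (inner ℂ v (T v) : ℂ) = inner ℂ z (S z) +
      -(Complex.I * ((t * ‖P (T v)‖ ^ 2 : ℝ) : ℂ)) := by
    have h4 : (inner ℂ (P (T v)) (T v) : ℂ) = ((‖P (T v)‖ ^ 2 : ℝ) : ℂ) := by
      rw [← inner_proj h.proj_selfAdjoint h.proj_idem]
      exact h.proj_selfAdjoint.isSymmetric _ _
    generalize T v = τ at *
    conv_lhs => rw [h2]
    rw [inner_add_left, inner_smul_left, h4, ← h1]
    push_cast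
    simp
    ring
  rw [h3, Complex.add_im, inner_apply_im_eq_zero h.selfAdjoint]
  simp [-Complex.ofReal_mul, -Complex.ofReal_pow]

end Regularization

/-! ### Regularized wave operators -/

section Regularization

variable {E : Type*} [NormedAddCommGroup E] [InnerProductSpace ℂ E] [CompleteSpace E]
  {S P : E →L[ℂ] E} {e : ℝ}

/-- A local inverse of `y - S` below the cut-off. -/
lemma exists_local_inverse (hS : IsSelfAdjoint S) {a b y₀ : ℝ} (hab : a < b) (hb : b < y₀) {y : ℝ}
    (hy : y₀ ≤ y) :
    ∃ B : E →L[ℂ] E, ‖B‖ ≤ (y₀ - b)⁻¹ ∧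
      (∀ v, B ((y : ℂ) • v - S v) = cfc (cutoff a b) S v) ∧
      (∀ v, (y : ℂ) • B v - S (B v) = cfc (cutoff a b) S v) := by
  -- The maximum with `y - b` removes the zero of `y - u`. It changes the quotient only for `u > b`,
  -- where the cut-off vanishes.
  have hpos : ∀ u, 0 < max (y - u) (y - b) := fun u => lt_max_of_lt_right (by linarith)
  set g : ℝ → ℝ := fun u => cutoff a b u / max (y - u) (y - b) with hg
  have hgc : Continuous g := by
    refine (continuous_cutoff a b).div (by fun_prop) fun u => (hpos u).ne'
  have hgid : ∀ u, g u * (y - u) = cutoff a b u := by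
    intro u
    rcases le_total u b with hu | hu
    · rw [hg]
      simp only
      rw [max_eq_left (by linarith)]
      field_simp [show y - u ≠ 0 by linarith [hpos u]]
    · rw [hg]
      simp only
      rw [cutoff_of_ge hab hu]; simp
  have hid : cfc (fun u : ℝ => y - u) S = y • (1 : E →L[ℂ] E) - S := by
    rw [cfc_sub (fun _ => y) (fun u : ℝ => u) S (by fun_prop) (by fun_prop), cfc_const y S,
      cfc_id' ℝ S, Algebra.algebraMap_eq_smul_one]
  have h1 : cfc g S * (y • (1 : E →L[ℂ] E) - S) = cfc (cutoff a b) S := by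
    rw [← hid, ← cfc_mul g (fun u => y - u) S hgc.continuousOn (by fun_prop)]
    congr 1
    funext u
    exact hgid u
  have h2 : (y • (1 : E →L[ℂ] E) - S) * cfc g S = cfc (cutoff a b) S := by
    rw [← h1, ← hid]
    exact (cfc_commute_cfc (fun u : ℝ => y - u) g S).eq
  refine ⟨cfc g S, ?_, fun v => ?_, fun v => ?_⟩
  · refine norm_cfc_le (inv_nonneg.2 (by linarith)) fun u _ => ?_
    rw [hg, Real.norm_eq_abs, abs_div, abs_of_pos (hpos u), div_le_iff₀ (hpos u)]
    refine (abs_cutoff_le a b u).trans ?_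
    rw [inv_mul_eq_div, le_div_iff₀ (by linarith), one_mul]
    exact le_max_of_le_right (by linarith)
  · exact DFunLike.congr_fun h1 v
  · exact DFunLike.congr_fun h2 v

/-- `Z t` is `(H + c + i t P)⁻¹ - i t D²`, where `D` is the cut-off of `S` between two points of
`(e⁻¹, y₀)`. By `coercive` the two dampings together give decay at a rate proportional to `t`. The
last part compares the true damped solution with the resolvent of `Z t`: `x` is the main term, and
`d` carries the first order effect of `i t P` on the source `S χ`. The artificial damping is off
resonance for `y ≥ y₀` and costs only `O(t)`. -/
lemma ResolventBound.exists_regularization (h : ResolventBound S P e) {y₀ : ℝ} (hy₀ : e⁻¹ < y₀) :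
    ∃ (Z : ℝ → E →L[ℂ] E) (c₀ C₀ : ℝ), 0 < c₀ ∧
      (∀ᶠ t : ℝ in 𝓝[>] 0, (∀ v, (inner ℂ v (Z t v)).im ≤ -(c₀ * t) * ‖v‖ ^ 2) ∧
        ‖Z t - S‖ ≤ C₀ * t) ∧
      ∀ (χ : E) (y₁ C₁ : ℝ), ∃ C : ℝ, ∀ᶠ t : ℝ in 𝓝[>] 0, ∀ (y : ℝ) (u x d : E), y₀ ≤ y → y ≤ y₁ →
        u = S (χ + ((y⁻¹ : ℝ) : ℂ) • u - (Complex.I * t) • P u) → ‖u‖ ≤ C₁ / t →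
        (y : ℂ) • x - Z t x = S χ → (y : ℂ) • d - Z t d = -(Complex.I * t) • S (P (S χ)) →
        ‖((y⁻¹ : ℝ) : ℂ) • u - x - d‖ ≤ C * t := by
  obtain ⟨b, hb1, hb2⟩ := exists_between hy₀
  obtain ⟨a, ha1, hab⟩ := exists_between hb1
  obtain ⟨C, hC, hcoer⟩ := h.coercive ha1 hab
  have hy₀pos : 0 < y₀ := (inv_pos.2 h.pos).trans hy₀
  have hPn : ∀ v, ‖P v‖ ≤ ‖v‖ := norm_proj_le h.proj_selfAdjoint h.proj_idem
  set D := cfc (cutoff a b) S with hD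
  have hDn : ‖D‖ ≤ 1 := norm_cfc_le zero_le_one fun u _ => abs_cutoff_le a b u
  have hDsa : IsSelfAdjoint D := cfc_predicate _ _
  have hsmall : ∀ᶠ t : ℝ in 𝓝[>] 0, 0 < t ∧ t * ‖S‖ ≤ 1 / 2 := by
    have h1 : Tendsto (fun t : ℝ => t * ‖S‖) (𝓝[>] 0) (𝓝 (0 * ‖S‖)) :=
      (tendsto_nhdsWithin_of_tendsto_nhds tendsto_id).mul_const _
    rw [zero_mul] at h1
    filter_upwards [h1.eventually_lt_const (show (0 : ℝ) < 1 / 2 by norm_num),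
      self_mem_nhdsWithin] with t ht ht0
    exact ⟨ht0, ht.le⟩
  have hT : ∀ t : ℝ, ∃ T : E →L[ℂ] E, (0 < t ∧ t * ‖S‖ ≤ 1 / 2) →
      (∀ v, T v + (Complex.I * t) • S (P (T v)) = S v) ∧
      (∀ u w, u + (Complex.I * t) • S (P u) = S w → u = T w) ∧ ‖T - S‖ ≤ 2 * ‖S‖ ^ 2 * t := by
    intro t
    by_cases ht : 0 < t ∧ t * ‖S‖ ≤ 1 / 2
    · obtain ⟨T, hT⟩ := h.exists_dissipative ht.1 ht.2
      exact ⟨T, fun _ => hT⟩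
    · exact ⟨0, fun h' => absurd h' ht⟩
  choose T hT using hT
  set Cs := 2 * ‖S‖ ^ 2 with hCs
  have hCs0 : 0 ≤ Cs := by positivity
  have hZa : ∀ t v, (T t - (Complex.I * t) • (D ∘L D)) v
      = T t v - (Complex.I * t) • D (D v) := fun t v => rfl
  have hdiff : ∀ t, 0 < t ∧ t * ‖S‖ ≤ 1 / 2 →
      ‖T t - (Complex.I * t) • (D ∘L D) - S‖ ≤ (Cs + 1) * t := by
    intro t ht
    have h1 : T t - (Complex.I * t) • (D ∘L D) - S = (T t - S) - (Complex.I * t) • (D ∘L D) := by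
      abel
    have h2 : ‖(Complex.I * t) • (D ∘L D)‖ ≤ t := by
      rw [norm_smul, norm_mul, Complex.norm_I, one_mul, Complex.norm_of_nonneg ht.1.le]
      refine mul_le_of_le_one_right ht.1.le ?_
      refine (ContinuousLinearMap.opNorm_comp_le _ _).trans ?_
      exact mul_le_one₀ hDn (norm_nonneg _) hDn
    rw [h1]
    refine (norm_sub_le _ _).trans ?_
    have := (hT t ht).2.2
    linarith
  -- Coercivity is known for `P S` but the dissipation involves `P T`; the difference is `O(t) ‖v‖`
  -- and is absorbed for small `t`, at the price of the constant `4 C`.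
  have hdiss : ∀ᶠ t : ℝ in 𝓝[>] 0, ∀ v,
      (inner ℂ v ((T t - (Complex.I * t) • (D ∘L D)) v)).im ≤ -((4 * C)⁻¹ * t) * ‖v‖ ^ 2 := by
    have hsm2 : ∀ᶠ t : ℝ in 𝓝[>] 0, 2 * C * (Cs * t) ^ 2 ≤ 1 / 2 := by
      have h1 : Tendsto (fun t : ℝ => 2 * C * (Cs * t) ^ 2) (𝓝[>] 0)
          (𝓝 (2 * C * (Cs * 0) ^ 2)) := by
        apply tendsto_nhdsWithin_of_tendsto_nhds
        exact Continuous.tendsto (by fun_prop) 0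
      rw [mul_zero, zero_pow two_ne_zero, mul_zero] at h1
      filter_upwards [h1.eventually_lt_const (show (0 : ℝ) < 1 / 2 by norm_num)] with t ht
      exact ht.le
    filter_upwards [hsmall, hsm2] with t ht ht2 v
    have hDD : (inner ℂ v (D (D v)) : ℂ) = ((‖D v‖ ^ 2 : ℝ) : ℂ) := by
      have : (inner ℂ (D v) (D v) : ℂ) = inner ℂ v (D (D v)) := hDsa.isSymmetric v (D v)
      rw [← this, inner_self_eq_norm_sq_to_K]; simp
    have h1 : (inner ℂ v ((T t - (Complex.I * t) • (D ∘L D)) v)).im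
        = -t * ‖P (T t v)‖ ^ 2 - t * ‖D v‖ ^ 2 := by
      rw [hZa, inner_sub_right, inner_smul_right, hDD, Complex.sub_im,
        h.inner_dissipative_im (hT t ht).1]
      simp [-Complex.ofReal_pow, mul_assoc, ← Complex.ofReal_mul]
    rw [h1]
    have h2 := hcoer v
    have h3 : ‖P (S v)‖ ≤ ‖P (T t v)‖ + Cs * t * ‖v‖ := by
      have h4 : P (S v) = P (T t v) - P ((T t - S) v) := by simp
      rw [h4]
      refine (norm_sub_le _ _).trans (add_le_add_right ?_ _)
      exact (hPn _).trans (ContinuousLinearMap.le_of_opNorm_le _ (hT t ht).2.2 v)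
    have h5 : ‖P (S v)‖ ^ 2 ≤ 2 * ‖P (T t v)‖ ^ 2 + 2 * (Cs * t) ^ 2 * ‖v‖ ^ 2 := by
      have := pow_le_pow_left₀ (norm_nonneg _) h3 2
      nlinarith [sq_nonneg (‖P (T t v)‖ - Cs * t * ‖v‖)]
    have h6 : ‖v‖ ^ 2 / 2 ≤ 2 * C * (‖P (T t v)‖ ^ 2 + ‖D v‖ ^ 2) := by
      have h7 := mul_le_mul_of_nonneg_right ht2 (sq_nonneg ‖v‖)
      have h8 := mul_le_mul_of_nonneg_left h5 hC.le
      have h9 : 0 ≤ C * ‖D v‖ ^ 2 := by positivity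
      nlinarith
    have h7 : (4 * C)⁻¹ * ‖v‖ ^ 2 ≤ ‖P (T t v)‖ ^ 2 + ‖D v‖ ^ 2 := by
      rw [inv_mul_eq_div, div_le_iff₀ (by positivity)]
      linarith
    have := mul_le_mul_of_nonneg_left h7 ht.1.le
    linarith
  refine ⟨fun t => T t - (Complex.I * t) • (D ∘L D), (4 * C)⁻¹, Cs + 1, by positivity, ?_, ?_⟩
  · filter_upwards [hdiss, hsmall] with t h1 h2
    exact ⟨h1, hdiff t h2⟩
  intro χ y₁ C₁
  set β := (y₀ - b)⁻¹ with hβ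
  have hβ0 : 0 ≤ β := inv_nonneg.2 (by linarith)
  set Cd := β * ((Cs + ‖S‖) * ‖χ‖ + Cs * (y₀⁻¹ * C₁)) with hCd
  refine ⟨4 * C * (‖S‖ * (Cs * ‖χ‖) + (Cs + 1) * (β * Cd)) + β * Cd, ?_⟩
  have ht1 : ∀ᶠ t : ℝ in 𝓝[>] 0, t ≤ 1 := by
    have h1 : Tendsto (fun t : ℝ => t) (𝓝[>] 0) (𝓝 0) :=
      tendsto_nhdsWithin_of_tendsto_nhds tendsto_id
    filter_upwards [h1.eventually_lt_const one_pos] with t ht using ht.le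
  filter_upwards [hdiss, hsmall, ht1] with t hdt ht ht1 y u x d hy hyy hu hun hx hd
  have ht0 := ht.1
  have hypos : 0 < y := hy₀pos.trans_le hy
  obtain ⟨hT1, hT2, hT3⟩ := hT t ht
  obtain ⟨B, hBn, hB1, hB2⟩ := exists_local_inverse h.selfAdjoint hab hb2 hy
  rw [← hD] at hB1 hB2
  set Zt := T t - (Complex.I * t) • (D ∘L D) with hZt
  -- Dissipativity bounds the inverse of `y - Z` by `4 C / t`, so residuals of size `O(t²)` are
  -- harmless.
  have hlow : ∀ v, ‖v‖ * (4 * C)⁻¹ * t ≤ ‖(y : ℂ) • v - Zt v‖ := by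
    intro v
    have h1 := hdt v
    have h2 : (inner ℂ v ((y : ℂ) • v - Zt v)).im = -(inner ℂ v (Zt v)).im := by
      rw [inner_sub_right, inner_smul_right, inner_self_eq_norm_sq_to_K, Complex.sub_im]
      simp [← Complex.ofReal_pow, ← Complex.ofReal_mul]
    have h3 := (Complex.abs_im_le_norm _).trans (norm_inner_le_norm (𝕜 := ℂ) v ((y : ℂ) • v - Zt v))
    rw [h2] at h3
    have h4 := (le_abs_self _).trans h3
    rcases eq_or_lt_of_le (norm_nonneg v) with h0 | h0
    · rw [← h0]; simp
    · refine le_of_mul_le_mul_left ?_ h0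
      linarith
  set p := ((y⁻¹ : ℝ) : ℂ) • u with hp
  have hyp : (y : ℂ) • p = u := by
    rw [hp, smul_smul, ← Complex.ofReal_mul, mul_inv_cancel₀ hypos.ne']; simp
  have huT : u = T t (χ + p) := by
    refine hT2 u _ ?_
    conv_lhs => enter [1]; rw [hu]
    rw [map_sub, map_smul]
    abel
  have hpT : (y : ℂ) • p - T t p = T t χ := by
    rw [hyp]
    conv_lhs => enter [1]; rw [huT]
    rw [map_add]; abel
  have hpn : ‖p‖ * t ≤ y₀⁻¹ * C₁ := by
    have h0 : ‖p‖ = y⁻¹ * ‖u‖ := by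
      rw [hp, norm_smul, Complex.norm_of_nonneg (inv_pos.2 hypos).le]
    have h1 : y⁻¹ ≤ y₀⁻¹ := inv_anti₀ hy₀pos hy
    have h2 : ‖u‖ * t ≤ C₁ := by rwa [← le_div_iff₀ ht0]
    have h3 : 0 ≤ ‖u‖ * t := by positivity
    rw [h0, mul_assoc]
    exact mul_le_mul h1 h2 h3 (inv_pos.2 hy₀pos).le
  -- `p` itself is only `O(t⁻¹)`, but `(y - S) p` is bounded since `‖T - S‖ = O(t)`. The local
  -- inverse `B` of `y - S` turns this into a bound of `D p` uniform in `t`.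
  have hDp : ‖D p‖ ≤ Cd := by
    rw [← hB1]
    have h1 : (y : ℂ) • p - S p = T t χ + (T t - S) p := by
      rw [← hpT, sub_apply]; abel
    rw [h1]
    refine (B.le_of_opNorm_le hBn _).trans (mul_le_mul_of_nonneg_left ?_ hβ0)
    refine (norm_add_le _ _).trans (add_le_add ?_ ?_)
    · have h2 : T t χ = (T t - S) χ + S χ := by simp
      rw [h2, add_mul]
      refine (norm_add_le _ _).trans (add_le_add ?_ (S.le_opNorm χ))
      refine (ContinuousLinearMap.le_of_opNorm_le _ hT3 χ).trans ?_
      refine mul_le_mul_of_nonneg_right ?_ (norm_nonneg _)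
      exact mul_le_of_le_one_right hCs0 ht1
    · refine (ContinuousLinearMap.le_of_opNorm_le _ hT3 p).trans ?_
      rw [mul_assoc, mul_comm t]
      exact mul_le_mul_of_nonneg_left hpn hCs0
  have hCd0 : 0 ≤ Cd := (norm_nonneg _).trans hDp
  -- A corrector for the artificial damping: it solves `(y - S) r = i t D² p` and is `O(t)`.
  set r := (Complex.I * t) • B (D p) with hr
  have hBD : ‖B (D p)‖ ≤ β * Cd :=
    (B.le_of_opNorm_le hBn _).trans (mul_le_mul_of_nonneg_left hDp hβ0)
  have hrn : ‖r‖ ≤ t * (β * Cd) := by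
    rw [hr, norm_smul, norm_mul, Complex.norm_I, one_mul, Complex.norm_of_nonneg ht0.le]
    exact mul_le_mul_of_nonneg_left hBD ht0.le
  have hZp : (y : ℂ) • p - Zt p = T t χ + (Complex.I * t) • D (D p) := by
    rw [hZt, hZa, ← hpT]; abel
  have hZr : (y : ℂ) • r - Zt r = (Complex.I * t) • D (D p)
      - (Complex.I * t) • (Zt - S) (B (D p)) := by
    have hgen : ∀ q : E, (y : ℂ) • ((Complex.I * t) • q) - Zt ((Complex.I * t) • q) =
        (Complex.I * t) • (((y : ℂ) • q - S q) - (Zt - S) q) := by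
      intro q
      have e1 : (Zt - S) q = Zt q - S q := rfl
      rw [map_smul, smul_comm, ← smul_sub, e1]
      congr 1
      abel
    rw [hr, hgen, hB2, smul_sub]
  have hTχ : T t χ = S χ - (Complex.I * t) • S (P (S χ)) -
      (Complex.I * t) • S (P ((T t - S) χ)) := by
    have h1 := hT1 χ
    have h2 : S (P (T t χ)) = S (P (S χ)) + S (P ((T t - S) χ)) := by
      rw [← map_add, ← map_add]; simp
    rw [h2, smul_add] at h1
    rw [sub_sub]
    exact eq_sub_of_add_eq h1
  -- Both remaining terms carry a further factor `O(t)`, from `Z - S` and from `T - S`.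
  have hfin : (y : ℂ) • (p - x - d - r) - Zt (p - x - d - r) =
      (Complex.I * t) • ((Zt - S) (B (D p)) - S (P ((T t - S) χ))) := by
    have h1 : (y : ℂ) • (p - x - d - r) - Zt (p - x - d - r) = ((y : ℂ) • p - Zt p) -
        ((y : ℂ) • x - Zt x) - ((y : ℂ) • d - Zt d) - ((y : ℂ) • r - Zt r) := by
      simp only [smul_sub, map_sub]; abel
    rw [h1, hZp, hx, hd, hZr, hTχ, smul_sub, neg_smul]
    abel
  have hn := hlow (p - x - d - r)
  rw [hfin, norm_smul, norm_mul, Complex.norm_I, one_mul, Complex.norm_of_nonneg ht0.le] at hn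
  have hn2 : ‖(Zt - S) (B (D p)) - S (P ((T t - S) χ))‖ ≤
      t * (‖S‖ * (Cs * ‖χ‖) + (Cs + 1) * (β * Cd)) := by
    refine (norm_sub_le _ _).trans ?_
    have h1 : ‖(Zt - S) (B (D p))‖ ≤ (Cs + 1) * t * (β * Cd) :=
      (ContinuousLinearMap.le_of_opNorm_le _ (hdiff t ht) _).trans
        (mul_le_mul_of_nonneg_left hBD (by positivity))
    have h2 : ‖S (P ((T t - S) χ))‖ ≤ ‖S‖ * (Cs * t * ‖χ‖) :=
      (S.le_opNorm _).trans (mul_le_mul_of_nonneg_left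
        ((hPn _).trans (ContinuousLinearMap.le_of_opNorm_le _ hT3 χ)) (norm_nonneg _))
    linarith
  have hn3 : ‖p - x - d - r‖ ≤ 4 * C * (‖S‖ * (Cs * ‖χ‖) + (Cs + 1) * (β * Cd)) * t := by
    have h1 := hn.trans (mul_le_mul_of_nonneg_left hn2 ht0.le)
    have h2 : ‖p - x - d - r‖ * (4 * C)⁻¹ ≤ t * (‖S‖ * (Cs * ‖χ‖) + (Cs + 1) * (β * Cd)) := by
      refine le_of_mul_le_mul_left ?_ ht0
      linarith
    rw [mul_inv_le_iff₀ (by positivity)] at h2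
    linarith
  have h10 : p - x - d = (p - x - d - r) + r := by abel
  rw [h10]
  refine (norm_add_le _ _).trans ?_
  linarith

/-- The resolvent of `Z` as the Laplace transform of `exp (-i s Z)`. -/
lemma laplace_grp {Z : E →L[ℂ] E} {γ : ℝ} (hγ : 0 < γ)
    (hZ : ∀ v s, 0 ≤ s → ‖grp Z s v‖ ≤ Real.exp (-γ * s) * ‖v‖) (y : ℝ) (v : E) :
    (y : ℂ) • (∫ s in Set.Ioi (0 : ℝ), Complex.exp (Complex.I * (s * y : ℝ)) • grp Z s v)
      - Z (∫ s in Set.Ioi (0 : ℝ), Complex.exp (Complex.I * (s * y : ℝ)) • grp Z s v)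
      = Complex.I • v := by
  set w : ℝ → E := fun s => Complex.exp (Complex.I * (s * y : ℝ)) • grp Z s v with hw
  have hnorm : ∀ s : ℝ, ‖Complex.exp (Complex.I * (s * y : ℝ))‖ = 1 := fun s => by
    rw [mul_comm]; exact Complex.norm_exp_ofReal_mul_I _
  have hint : IntegrableOn w (Set.Ioi 0) :=
    integrableOn_smul_grp hγ hZ (by fun_prop) (M := 1) (fun s => (hnorm s).le) v
  have hd : ∀ s, HasDerivAt w (Complex.I • ((y : ℂ) • w s - Z (w s))) s := by
    intro s
    have h1 : HasDerivAt (fun s : ℝ => Complex.exp (Complex.I * (s * y : ℝ)))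
        (Complex.exp (Complex.I * (s * y : ℝ)) * (Complex.I * (y : ℂ))) s := by
      have h2 : HasDerivAt (fun s : ℝ => Complex.I * ((s * y : ℝ) : ℂ)) (Complex.I * (y : ℂ)) s := by
        have := (((hasDerivAt_id s).mul_const y).ofReal_comp).const_mul Complex.I
        simpa using this
      exact h2.cexp
    refine (h1.smul (hasDerivAt_grp_apply Z v s)).congr_deriv ?_
    simp only [hw, smul_smul, map_smul, smul_sub]
    rw [add_comm, sub_eq_add_neg, ← neg_smul]
    congr 2 <;> ring
  have hlim : Tendsto w atTop (𝓝 0) := by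
    rw [tendsto_zero_iff_norm_tendsto_zero]
    have h1 : Tendsto (fun s => Real.exp (-γ * s) * ‖v‖) atTop (𝓝 (0 * ‖v‖)) := by
      refine Tendsto.mul_const _ (Real.tendsto_exp_atBot.comp ?_)
      exact tendsto_id.const_mul_atTop_of_neg (by linarith)
    rw [zero_mul] at h1
    refine squeeze_zero' (Eventually.of_forall fun _ => norm_nonneg _) ?_ h1
    filter_upwards [eventually_ge_atTop (0 : ℝ)] with s hs
    rw [hw]
    simp only
    rw [norm_smul, hnorm, one_mul]
    exact hZ v s hs
  have hFTC := integral_Ioi_of_hasDerivAt_of_tendsto (a := (0 : ℝ))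
    (hd 0).continuousAt.continuousWithinAt (fun s _ => hd s)
    (((hint.smul (y : ℂ)).sub (Z.integrable_comp hint)).smul _) hlim
  have hsplit := integral_sub (hint.smul (y : ℂ)) (Z.integrable_comp hint)
  simp only [Pi.smul_apply] at hsplit
  rw [integral_smul, hsplit, integral_smul, Z.integral_comp_comm hint] at hFTC
  have hw0 : w 0 = v := by simp [hw]
  rw [hw0, zero_sub] at hFTC
  have h5 := congrArg (fun v => -Complex.I • v) hFTC
  simp only [smul_smul, neg_mul, Complex.I_mul_I, neg_neg, one_smul, smul_neg, neg_smul] at h5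
  exact h5

end Regularization

/-! ### Limits of damped wave packets -/

section Packets

variable {E F X : Type*} [NormedAddCommGroup E] [InnerProductSpace ℂ E] [CompleteSpace E]
  [NormedAddCommGroup F] [InnerProductSpace ℂ F] [CompleteSpace F] [MeasurableSpace X]

/-- The vector-valued Laplace transform of the group `exp (-i s Z)`. -/
def lap (Z : E →L[ℂ] E) (y : ℝ) (v : E) : E :=
  ∫ s in Set.Ioi (0 : ℝ), Complex.exp (Complex.I * (s * y : ℝ)) • grp Z s v

lemma integrable_lap_integrand {μ : Measure X} [SFinite μ] {Z : E →L[ℂ] E} {γ : ℝ} (hγ : 0 < γ)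
    (hZ : ∀ v s, 0 ≤ s → ‖grp Z s v‖ ≤ Real.exp (-γ * s) * ‖v‖) {y : X → ℝ} (hy : Measurable y)
    {ψ : X → ℂ} (hψ : Integrable ψ μ) (v : E) :
    Integrable (fun z : X × ℝ => ψ z.1 • Complex.exp (Complex.I * (z.2 * y z.1 : ℝ)) • grp Z z.2 v)
      (μ.prod (volume.restrict (Set.Ioi 0))) := by
  have hexp : IntegrableOn (fun s => Real.exp (-γ * s)) (Set.Ioi 0) :=
    exp_neg_integrableOn_Ioi 0 hγ
  refine (hψ.norm.mul_prod (hexp.mul_const ‖v‖)).mono' ?_ ?_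
  · refine AEStronglyMeasurable.smul ?_ (AEStronglyMeasurable.smul ?_ ?_)
    · exact hψ.aestronglyMeasurable.comp_fst
    · refine Measurable.aestronglyMeasurable ?_
      fun_prop
    · exact ((continuous_grp_apply Z v).stronglyMeasurable.comp_measurable
        measurable_snd).aestronglyMeasurable
  · have h1 : ∀ᵐ z : X × ℝ ∂(μ.prod (volume.restrict (Set.Ioi 0))), z.2 ∈ Set.Ioi (0 : ℝ) :=
      Measure.quasiMeasurePreserving_snd.ae (ae_restrict_mem measurableSet_Ioi)
    filter_upwards [h1] with z hz
    have h2 : ‖Complex.exp (Complex.I * (z.2 * y z.1 : ℝ))‖ = 1 := by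
      rw [mul_comm]; exact Complex.norm_exp_ofReal_mul_I _
    rw [norm_smul, norm_smul, h2, one_mul]
    exact mul_le_mul_of_nonneg_left (hZ v z.2 (le_of_lt hz)) (norm_nonneg _)

/-- Fubini exchanges the integral over the momenta with the time integral. The momentum integral
then yields the correlation function of a packet, the form in which the regularised wave operator is
written. -/
lemma integral_smul_lap {μ : Measure X} [SFinite μ] {Z : E →L[ℂ] E} {γ : ℝ} (hγ : 0 < γ)
    (hZ : ∀ v s, 0 ≤ s → ‖grp Z s v‖ ≤ Real.exp (-γ * s) * ‖v‖) {y : X → ℝ} (hy : Measurable y)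
    {ψ : X → ℂ} (hψ : Integrable ψ μ) (v : E) :
    Integrable (fun k => ψ k • lap Z (y k) v) μ ∧
    ∫ k, ψ k • lap Z (y k) v ∂μ = ∫ s in Set.Ioi (0 : ℝ),
      (∫ k, ψ k * Complex.exp (Complex.I * (s * y k : ℝ)) ∂μ) • grp Z s v := by
  have h := integrable_lap_integrand hγ hZ hy hψ v
  have h1 : ∀ k, ψ k • lap Z (y k) v = ∫ s in Set.Ioi (0 : ℝ),
      ψ k • Complex.exp (Complex.I * (s * y k : ℝ)) • grp Z s v := fun k => by
    rw [lap, integral_smul]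
  refine ⟨?_, ?_⟩
  · simp only [h1]
    exact h.integral_prod_left
  · simp only [h1]
    rw [integral_integral_swap h]
    refine integral_congr_ae (Eventually.of_forall fun s => ?_)
    simp only [smul_smul]
    exact integral_smul_const _ _

variable {S P : E →L[ℂ] E} {e : ℝ} {J : F →L[ℂ] E} {Y : F →L[ℂ] F} {U : ℝ → F →L[ℂ] F} {u : F}

/-- The regularised wave packets, defined by the solutions `v t k` of
`(H + c - y(k)⁻¹ + i t P) v = χ`, converge to the wave operator. -/
theorem ResolventBound.tendsto_packet {μ : Measure X} [SFinite μ] (h : ResolventBound S P e)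
    (hU : Flow Y U) {χ : E}
    (hJ : ∀ φ, S (J φ) - J (Y φ) = -(inner ℂ u φ : ℂ) • S χ) {y : X → ℝ} (hy : Measurable y)
    {y₀ y₁ : ℝ} (hy₀ : e⁻¹ < y₀) (hyr : ∀ᵐ k ∂μ, y₀ ≤ y k ∧ y k ≤ y₁) {θ : X → ℂ}
    (hθ : Integrable θ μ) {φ : F}
    (hc : ∀ s, (inner ℂ u (U s φ) : ℂ)
      = ∫ k, (θ k * y k) * Complex.exp (Complex.I * (s * y k : ℝ)) ∂μ)
    {v : ℝ → X → E} {C₁ : ℝ}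
    (hv : ∀ t : ℝ, 0 < t → ∀ᵐ k ∂μ,
      v t k = S (χ + (((y k)⁻¹ : ℝ) : ℂ) • v t k - (Complex.I * t) • P (v t k)))
    (hvn : ∀ t : ℝ, 0 < t → t ≤ 1 → ∀ᵐ k ∂μ, ‖v t k‖ ≤ C₁ / t)
    (hvi : ∀ t : ℝ, 0 < t → Integrable (fun k => θ k • v t k) μ)
    {w : E} (hw : Tendsto (fun s => wave S J U s φ) atTop (𝓝 w)) :
    Tendsto (fun t => J φ - ∫ k, θ k • v t k ∂μ) (𝓝[>] 0) (𝓝 w) := by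
  obtain ⟨Z, c₀, C₀, hc₀, hZ, hmain⟩ := h.exists_regularization hy₀
  obtain ⟨C, hC⟩ := hmain χ y₁ C₁
  have hdecay : ∀ᶠ t : ℝ in 𝓝[>] 0,
      (∀ v s, 0 ≤ s → ‖grp (Z t) s v‖ ≤ Real.exp (-(c₀ * t) * s) * ‖v‖) ∧ ‖Z t - S‖ ≤ C₀ * t := by
    filter_upwards [hZ] with t ht
    exact ⟨fun v s hs => norm_grp_apply_le (Z t) (c₀ * t) ht.1 v hs, ht.2⟩
  have hreg := tendsto_regularized_wave h.selfAdjoint hU hJ hc₀ hdecay hw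
  -- The comparison estimates `y⁻¹ v`, not `v`; the factor `y` moved into `ψ` restores `θ v = ψ (y⁻¹
  -- v)`.
  set ψ : X → ℂ := fun k => θ k * y k with hψdef
  have hψ : Integrable ψ μ := by
    refine (hθ.bdd_mul (c := max |y₀| |y₁|) (f := fun k => (y k : ℂ))
      (Complex.measurable_ofReal.comp hy).aestronglyMeasurable ?_).congr ?_
    · filter_upwards [hyr] with k hk
      rw [Complex.norm_real, Real.norm_eq_abs]
      exact abs_le_max_abs_abs hk.1 hk.2
    · exact Eventually.of_forall fun k => mul_comm _ _
  set x₀ := S (P (S χ)) with hx₀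
  have hcb : ∀ s, ‖(inner ℂ u (U s φ) : ℂ)‖ ≤ ‖u‖ * ‖φ‖ := fun s => by
    refine (norm_inner_le_norm _ _).trans ?_; rw [hU.norm]
  have hcc : Continuous fun s => (inner ℂ u (U s φ) : ℂ) := by
    have := hU.continuous φ
    fun_prop
  -- The integral of the correction `d` is `t` times a damped time integral of the correlations,
  -- hence an Abelian average, which vanishes because the flow tends weakly to zero.
  have hav := (tendsto_abel_average (a := fun s => ‖(inner ℂ u (U s φ) : ℂ)‖) (by fun_prop)
    (fun s => norm_nonneg _) (fun s _ => hcb s)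
    (by simpa using (hU.weak u φ).norm) hc₀).const_mul ‖x₀‖
  rw [mul_zero] at hav
  have hlin : Tendsto (fun t : ℝ => C * t * ∫ k, ‖ψ k‖ ∂μ) (𝓝[>] 0) (𝓝 0) := by
    have : Tendsto (fun t : ℝ => C * t * ∫ k, ‖ψ k‖ ∂μ) (𝓝 0) (𝓝 (C * 0 * ∫ k, ‖ψ k‖ ∂μ)) :=
      Continuous.tendsto (by fun_prop) 0
    rw [mul_zero, zero_mul] at this
    exact tendsto_nhdsWithin_of_tendsto_nhds this
  have hdiff : Tendsto (fun t => (J φ - ∫ k, θ k • v t k ∂μ) - (J φ + Complex.I •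
      ∫ s in Set.Ioi (0 : ℝ), (inner ℂ u (U s φ) : ℂ) • grp (Z t) s (S χ))) (𝓝[>] 0) (𝓝 0) := by
    rw [tendsto_zero_iff_norm_tendsto_zero]
    refine squeeze_zero' (Eventually.of_forall fun _ => norm_nonneg _) ?_
      (by have h := hlin.add hav; rwa [add_zero] at h)
    have ht1 : ∀ᶠ t : ℝ in 𝓝[>] 0, t ≤ 1 := by
      have h1 : Tendsto (fun t : ℝ => t) (𝓝[>] 0) (𝓝 0) :=
        tendsto_nhdsWithin_of_tendsto_nhds tendsto_id
      filter_upwards [h1.eventually_lt_const one_pos] with t ht using ht.le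
    filter_upwards [hdecay, hC, self_mem_nhdsWithin, ht1] with t htd htC ht0 ht1
    have ht0 : 0 < t := ht0
    have hγ : 0 < c₀ * t := mul_pos hc₀ ht0
    obtain ⟨hi1, he1⟩ := integral_smul_lap hγ htd.1 hy hψ (S χ)
    obtain ⟨hi2, he2⟩ := integral_smul_lap hγ htd.1 hy hψ x₀
    have hc' : ∀ s : ℝ, ∫ k, ψ k * Complex.exp (Complex.I * (s * y k : ℝ)) ∂μ
        = inner ℂ u (U s φ) := fun s => (hc s).symm
    simp only [hc'] at he1 he2
    have hsol := laplace_grp hγ htd.1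
    -- As `(y - Z) lap = i v`, the main term is `-i lap (S χ)`, and the correction with source `-i t
    -- S P S χ` is `-t lap x₀`.
    have hpt : ∀ᵐ k ∂μ, ‖θ k • v t k - (-Complex.I) • (ψ k • lap (Z t) (y k) (S χ))
        - (-(t : ℂ)) • (ψ k • lap (Z t) (y k) x₀)‖ ≤ C * t * ‖ψ k‖ := by
      filter_upwards [hyr, hv t ht0, hvn t ht0 ht1] with k hk hk2 hk3
      have hk0 : y k ≠ 0 := ((inv_pos.2 h.pos).trans (hy₀.trans_le hk.1)).ne'
      have h1 := htC (y k) (v t k) (-Complex.I • lap (Z t) (y k) (S χ))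
        (-(t : ℂ) • lap (Z t) (y k) x₀) hk.1 hk.2 hk2 hk3 (by
          rw [map_smul, smul_comm, ← smul_sub, lap, hsol, smul_smul]; simp) (by
          rw [map_smul, smul_comm, ← smul_sub, lap, hsol, smul_smul, hx₀]
          congr 1
          ring)
      have h2 : θ k • v t k = ψ k • (((y k)⁻¹ : ℝ) : ℂ) • v t k := by
        rw [smul_smul, hψdef]
        congr 1
        simp only
        rw [mul_assoc, ← Complex.ofReal_mul, mul_inv_cancel₀ hk0]; simp
      rw [h2, smul_comm (-Complex.I), smul_comm (-(t : ℂ)), ← smul_sub, ← smul_sub, norm_smul,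
        mul_comm]
      exact mul_le_mul_of_nonneg_right h1 (norm_nonneg _)
    have hint := norm_integral_le_of_norm_le (hψ.norm.const_mul (C * t)) hpt
    have hs1 := integral_sub (f := fun k => θ k • v t k)
      (g := fun k => -Complex.I • (ψ k • lap (Z t) (y k) (S χ))) (hvi t ht0)
      (hi1.smul (-Complex.I))
    have hs2 := integral_sub (f := fun k => θ k • v t k -
      -Complex.I • (ψ k • lap (Z t) (y k) (S χ)))
      (g := fun k => -(t : ℂ) • (ψ k • lap (Z t) (y k) x₀))
      ((hvi t ht0).sub (hi1.smul (-Complex.I))) (hi2.smul (-(t : ℂ)))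
    rw [integral_const_mul, hs2, hs1, integral_smul, integral_smul, he1, he2] at hint
    set I1 := ∫ s in Set.Ioi (0 : ℝ), (inner ℂ u (U s φ) : ℂ) • grp (Z t) s (S χ)
    set I2 := ∫ s in Set.Ioi (0 : ℝ), (inner ℂ u (U s φ) : ℂ) • grp (Z t) s x₀ with hI2
    have hI2n : ‖(t : ℂ) • I2‖ ≤ ‖x₀‖ * ∫ s in Set.Ioi (0 : ℝ),
        t * Real.exp (-(c₀ * t) * s) * ‖(inner ℂ u (U s φ) : ℂ)‖ := by
      rw [hI2, ← integral_smul, ← integral_const_mul]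
      refine norm_integral_le_of_norm_le ?_ ?_
      · have hexp : IntegrableOn (fun s => Real.exp (-(c₀ * t) * s)) (Set.Ioi 0) :=
          exp_neg_integrableOn_Ioi 0 hγ
        refine (hexp.const_mul (‖x₀‖ * t * (‖u‖ * ‖φ‖))).mono' (by fun_prop) ?_
        filter_upwards with s
        rw [norm_mul, norm_mul, norm_mul, norm_norm, norm_norm, Real.norm_of_nonneg ht0.le,
          Real.norm_of_nonneg (Real.exp_pos _).le]
        have := mul_le_mul_of_nonneg_left (hcb s)
          (show 0 ≤ ‖x₀‖ * t * Real.exp (-(c₀ * t) * s) by positivity)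
        linarith
      · filter_upwards [ae_restrict_mem measurableSet_Ioi] with s hs
        rw [norm_smul, norm_smul, Complex.norm_of_nonneg ht0.le]
        have h1 := htd.1 x₀ s (le_of_lt hs)
        have := mul_le_mul_of_nonneg_left h1
          (show 0 ≤ t * ‖(inner ℂ u (U s φ) : ℂ)‖ by positivity)
        linarith
    have e1 : (J φ - ∫ k, θ k • v t k ∂μ) - (J φ + Complex.I • I1) =
        -((∫ k, θ k • v t k ∂μ) - -Complex.I • I1 - -(t : ℂ) • I2) + (t : ℂ) • I2 := by
      simp only [neg_smul]
      abel
    rw [e1]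
    refine (norm_add_le _ _).trans ?_
    rw [norm_neg]
    exact add_le_add hint hI2n
  have := hdiff.add hreg
  simpa using this

end Packets

/-! ### Push-forward of Lebesgue measure under functions without critical points -/

/-- Near a point with `h' ≠ 0` the function is injective. The change of variables gives the integral
of `|h'|` over the set as the measure of a subset of `N`, that is zero, although `|h'| > 0` there.
-/
lemma volume_preimage_null_of_deriv_ne_zero {h : ℝ → ℝ} (hh : ContDiff ℝ 1 h) {N : Set ℝ}
    (hN : MeasurableSet N) (hN₀ : volume N = 0) :
    volume {t | deriv h t ≠ 0 ∧ h t ∈ N} = 0 := by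
  have hd : Continuous (deriv h) := hh.continuous_deriv le_rfl
  have hmeas : MeasurableSet {t | deriv h t ≠ 0 ∧ h t ∈ N} :=
    (hd.measurable (measurableSet_singleton 0).compl).inter (hh.continuous.measurable hN)
  refine measure_null_of_locally_null _ fun t ht => ?_
  have hs : HasStrictDerivAt h (deriv h t) t := (hh.contDiffAt).hasStrictDerivAt one_ne_zero
  set e := hs.hasStrictFDerivAt_equiv ht.1 |>.toOpenPartialHomeomorph h with he
  have heq : ⇑e = h := rfl
  have hsrc : t ∈ e.source := HasStrictFDerivAt.mem_toOpenPartialHomeomorph_source _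
  set V := e.source ∩ {t | deriv h t ≠ 0 ∧ h t ∈ N} with hV
  have hVm : MeasurableSet V := e.open_source.measurableSet.inter hmeas
  have hinj : Set.InjOn h V := fun a ha b hb hab => e.injOn ha.1 hb.1 hab
  have key := lintegral_image_eq_lintegral_abs_deriv_mul hVm
    (fun x _ => ((hh.differentiable one_ne_zero) x).hasDerivAt.hasDerivWithinAt) hinj (fun _ => 1)
  have hz : volume (h '' V) = 0 := measure_mono_null (by rintro _ ⟨a, ha, rfl⟩; exact ha.2.2) hN₀
  refine ⟨V, ?_, ?_⟩
  · rw [hV, Set.inter_comm]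
    exact inter_mem_nhdsWithin _ (e.open_source.mem_nhds hsrc)
  · rw [Measure.restrict_eq_zero.2 hz, lintegral_zero_measure] at key
    have h2 := (lintegral_eq_zero_iff (by fun_prop)).1 key.symm
    have h3 : ∀ᵐ x ∂(volume.restrict V), False := by
      filter_upwards [h2, ae_restrict_mem hVm] with x hx hxV
      have : deriv h x ≠ 0 := hxV.2.1
      simp [this] at hx
    rw [ae_iff] at h3
    simpa using h3

/-- Almost everywhere, a `C¹` function avoids a null set of values off its critical points. -/
lemma ae_notMem_of_fderiv_ne_zero {d : ℕ} {g : Mom d → ℝ} (hg : ContDiff ℝ 1 g) {N : Set ℝ}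
    (hN : MeasurableSet N) (hN₀ : volume N = 0) :
    ∀ᵐ q : Mom d, fderiv ℝ g q ≠ 0 → g q ∉ N := by
  have hd : Continuous (fderiv ℝ g) := hg.continuous_fderiv one_ne_zero
  have hi : ∀ i : Fin d, ∀ᵐ q : Mom d,
      q ∈ {q : Mom d | fderiv ℝ g q (EuclideanSpace.single i 1) ≠ 0 ∧ g q ∈ N}ᶜ := by
    intro i
    set v : Mom d := EuclideanSpace.single i 1 with hv
    have hm : MeasurableSet {q : Mom d | fderiv ℝ g q v ≠ 0 ∧ g q ∈ N}ᶜ := by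
      have h1 : Continuous fun q => fderiv ℝ g q v := by fun_prop
      exact ((h1.measurable (measurableSet_singleton 0).compl).inter
        (hg.continuous.measurable hN)).compl
    -- By Fubini it suffices to consider lines in a coordinate direction; along them the derivative
    -- is a partial derivative, and at a noncritical point some partial derivative does not vanish.
    refine ae_mem_of_ae_add_linearMap_mem (LinearMap.toSpanSingleton ℝ (Mom d) v)
      volume volume hm fun y => ?_
    have hline : ContDiff ℝ 1 fun t : ℝ => g (y + t • v) := by fun_prop
    have h1 := volume_preimage_null_of_deriv_ne_zero hline hN hN₀
    have h2 : ∀ t : ℝ, deriv (fun t : ℝ => g (y + t • v)) t = fderiv ℝ g (y + t • v) v := by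
      intro t
      have hl : HasDerivAt (fun t : ℝ => y + t • v) v t := by
        simpa using ((hasDerivAt_id t).smul_const v).const_add y
      exact ((hg.differentiable one_ne_zero _).hasFDerivAt.comp_hasDerivAt t hl).deriv
    simp only [h2] at h1
    have h3 : ∀ᵐ t : ℝ, ¬ (fderiv ℝ g (y + t • v) v ≠ 0 ∧ g (y + t • v) ∈ N) := by
      rw [ae_iff]; simpa using h1
    filter_upwards [h3] with t ht
    simpa [LinearMap.toSpanSingleton_apply] using ht
  filter_upwards [ae_all_iff.2 hi] with q hq hne hqN
  refine hne ?_
  have hz : ∀ i, fderiv ℝ g q (EuclideanSpace.single i 1) = 0 := fun i => by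
    by_contra hc
    exact hq i ⟨hc, hqN⟩
  have : (fderiv ℝ g q : Mom d →ₗ[ℝ] ℝ) = 0 := by
    refine (EuclideanSpace.basisFun (Fin d) ℝ).toBasis.ext fun i => ?_
    simpa using hz i
  ext w
  exact congrArg (fun L : Mom d →ₗ[ℝ] ℝ => L w) this

/-- Off the origin, a null set in positive dimension, `ω` has no critical point. -/
lemma DispersionLaw.map_absolutelyContinuous {d : ℕ} (hd : 0 < d) {om : Mom d → ℝ}
    (hom : DispersionLaw om) : (volume : Measure (Mom d)).map om ≪ volume := by
  refine Measure.AbsolutelyContinuous.mk fun N hN hN₀ => ?_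
  rw [Measure.map_apply hom.contDiff.continuous.measurable hN]
  have : Nonempty (Fin d) := ⟨⟨0, hd⟩⟩
  have h0 : ∀ᵐ q : Mom d, q ≠ 0 := by
    rw [ae_iff]; simp
  have h1 : ∀ᵐ q : Mom d, om q ∉ N := by
    filter_upwards [h0, ae_notMem_of_fderiv_ne_zero hom.contDiff hN hN₀] with q hq h
    exact h (hom.no_critical q hq)
  rw [ae_iff] at h1
  simp only [not_not] at h1
  exact h1

/-! ### The Gelfand-Leray kernel -/

section Leray

variable {β : Type*} [MeasurableSpace β] [StandardBorelSpace β] [Nonempty β]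

/-- A finite measure equivalent to `μ` is carried to the graph of `g` and disintegrated over the
values of `g`. The marginal has a Lebesgue density by hypothesis, so reweighting the conditional
measures makes Lebesgue measure the base. -/
lemma exists_fibre_kernel (μ : Measure β) [SigmaFinite μ] {g : β → ℝ} (hg : Measurable g)
    (hμ : μ.map g ≪ volume) {R : Set ℝ} (hR : MeasurableSet R) (hgR : ∀ᵐ q ∂μ, g q ∈ R) :
    ∃ ν : ProbabilityTheory.Kernel ℝ β, (∀ x, ν x {q | g q ≠ x} = 0) ∧
      ∀ f : β → ℝ≥0∞, Measurable f → ∫⁻ q, f q ∂μ = ∫⁻ x in R, ∫⁻ q, f q ∂(ν x) := by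
  set θ := μ.toFinite with hθ
  set ρ := θ.map (fun q => (g q, q)) with hρ
  have hgm : Measurable fun q => (g q, q) := by fun_prop
  set r := ρ.fst.rnDeriv volume with hr
  set w := μ.rnDeriv θ with hw
  have hrm : Measurable r := Measure.measurable_rnDeriv _ _
  have hwm : Measurable w := Measure.measurable_rnDeriv _ _
  have hset : MeasurableSet {z : ℝ × β | g z.2 = z.1} :=
    measurableSet_eq_fun (by fun_prop) (by fun_prop)
  -- Three factors: the density of the marginal, the density of `μ` with respect to the finite
  -- measure, and an indicator that puts the fibre on its level set for every `x` and not only for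
  -- almost every `x`.
  set D : ℝ → β → ℝ≥0∞ := fun x q =>
    r x * w q * ({z : ℝ × β | g z.2 = z.1}).indicator 1 (x, q) with hD
  have hDm : Measurable (Function.uncurry D) := by
    have : Measurable fun z : ℝ × β =>
        r z.1 * w z.2 * ({z : ℝ × β | g z.2 = z.1}).indicator 1 z :=
      ((hrm.comp measurable_fst).mul (hwm.comp measurable_snd)).mul
        (measurable_one.indicator hset)
    exact this
  refine ⟨ρ.condKernel.withDensity D, fun x => ?_, fun f hf => ?_⟩
  · rw [ProbabilityTheory.Kernel.withDensity_apply _ hDm,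
      withDensity_apply (D x) (show MeasurableSet {q | g q ≠ x} from
        (measurableSet_eq_fun hg measurable_const).compl)]
    refine (setLIntegral_congr_fun (show MeasurableSet {q | g q ≠ x} from
        (measurableSet_eq_fun hg measurable_const).compl)
      (fun q hq => ?_)).trans lintegral_zero
    have : (x, q) ∉ {z : ℝ × β | g z.2 = z.1} := hq
    simp [hD, this]
  · have hfst : ρ.fst = θ.map g := by
      rw [Measure.fst, hρ, Measure.map_map measurable_fst hgm]; rfl
    have hθμ : θ ≪ μ := MeasureTheory.toFinite_absolutelyContinuous μ
    have hac : ρ.fst ≪ volume := hfst ▸ (hθμ.map hg).trans hμ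
    have hfR : ∀ᵐ x ∂ρ.fst, x ∈ R := by
      rw [hfst]
      exact (ae_map_iff hg.aemeasurable hR).2 (hθμ.ae_le hgR)
    have hdens : ρ.fst = (volume.restrict R).withDensity r := by
      conv_lhs => rw [← Measure.restrict_eq_self_of_ae_mem hfR,
        ← Measure.withDensity_rnDeriv_eq _ _ hac]
      exact restrict_withDensity hR _
    have hwd : μ = θ.withDensity w := (Measure.withDensity_rnDeriv_eq _ _
      (MeasureTheory.absolutelyContinuous_toFinite μ)).symm
    conv_lhs => rw [hwd]
    rw [lintegral_withDensity_eq_lintegral_mul _ hwm hf]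
    have e1 : ∫⁻ q, (w * f) q ∂θ = ∫⁻ z : ℝ × β,
        w z.2 * f z.2 * ({z : ℝ × β | g z.2 = z.1}).indicator 1 z ∂ρ := by
      rw [hρ, lintegral_map _ hgm]
      · refine lintegral_congr fun q => ?_
        simp
      · exact (((hwm.comp measurable_snd).mul (hf.comp measurable_snd)).mul
          (measurable_one.indicator hset))
    have hm2 : Measurable fun z : ℝ × β =>
        w z.2 * f z.2 * ({z : ℝ × β | g z.2 = z.1}).indicator 1 z :=
      ((hwm.comp measurable_snd).mul (hf.comp measurable_snd)).mul (measurable_one.indicator hset)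
    rw [e1]
    conv_lhs => rw [← ρ.disintegrate ρ.condKernel]
    rw [Measure.lintegral_compProd hm2]
    conv_lhs => rw [hdens]
    rw [lintegral_withDensity_eq_lintegral_mul _ hrm hm2.lintegral_kernel_prod_right']
    refine lintegral_congr fun x => ?_
    rw [ProbabilityTheory.Kernel.lintegral_withDensity _ hDm _ hf]
    simp only [Pi.mul_apply]
    rw [← lintegral_const_mul _ (show Measurable fun b => w b * f b *
      ({z : ℝ × β | g z.2 = z.1}).indicator 1 (x, b) from hm2.comp measurable_prodMk_left)]
    refine lintegral_congr fun q => ?_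
    simp only [hD]; ring

end Leray

namespace Model

lemma measurableSet_G {p : Model d} (hom : DispersionLaw p.om) (η e : ℝ) :
    MeasurableSet (p.G η e) := by
  have := hom.contDiff.continuous.measurable
  exact measurableSet_lt (by unfold xi; fun_prop) measurable_const

lemma isOpen_G {p : Model d} (hom : DispersionLaw p.om) (η e : ℝ) : IsOpen (p.G η e) := by
  have := hom.contDiff.continuous
  exact isOpen_lt (by unfold xi; fun_prop) continuous_const

lemma measurable_xi {p : Model d} (hom : DispersionLaw p.om) (e : ℝ) : Measurable (p.xi e) := by
  have := hom.contDiff.continuous.measurable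
  unfold xi; fun_prop

lemma kappa_le {p : Model d} (hom : DispersionLaw p.om) (q : Mom d) : p.kappa ≤ p.om q := by
  rcases eq_or_ne q 0 with rfl | h
  · exact le_rfl
  · exact (hom.unique_min q h).le

lemma map_xi_absolutelyContinuous {p : Model d} (hd : 0 < d) (hom : DispersionLaw p.om) (e : ℝ) :
    (volume : Measure (Mom d)).map (p.xi e) ≪ volume := by
  have h1 : (volume : Measure (Mom d)).map (p.xi e)
      = ((volume : Measure (Mom d)).map p.om).map (fun x => e + x) := by
    rw [Measure.map_map (by fun_prop) hom.contDiff.continuous.measurable]; rfl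
  rw [h1, ← (measurePreserving_add_left (volume : Measure ℝ) e).map_eq]
  exact (hom.map_absolutelyContinuous hd).map (by fun_prop)

lemma exists_isGelfandLeray {p : Model d} (hd : 0 < d) (hom : DispersionLaw p.om) (η e : ℝ) :
    ∃ ν : ProbabilityTheory.Kernel ℝ (Mom d), p.IsGelfandLeray η e ν := by
  have h1 : (volume.restrict (p.G η e)).map (p.xi e) ≪ volume :=
    (Measure.absolutelyContinuous_of_le (Measure.map_mono Measure.restrict_le_self
      (measurable_xi hom e))).trans (map_xi_absolutelyContinuous hd hom e)
  exact exists_fibre_kernel (volume.restrict (p.G η e)) (measurable_xi hom e) h1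
    (R := p.range η e) measurableSet_Ico (by
      filter_upwards [ae_restrict_mem (measurableSet_G hom η e)] with q hq
      exact ⟨by unfold xi; linarith [kappa_le hom q], hq⟩)

/-- Testing the disintegration on the indicator of a measurable null set that contains the
exceptional set. -/
lemma IsGelfandLeray.ae_ae {p : Model d} {η e : ℝ} {ν : ProbabilityTheory.Kernel ℝ (Mom d)}
    (hν : p.IsGelfandLeray η e ν) {s : Mom d → Prop}
    (hs : ∀ᵐ q ∂(volume.restrict (p.G η e)), s q) :
    ∀ᵐ x ∂(volume.restrict (p.range η e)), ∀ᵐ q ∂(ν x), s q := by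
  set N := toMeasurable (volume.restrict (p.G η e)) {q | ¬ s q} with hN
  have hN₀ : volume.restrict (p.G η e) N = 0 := by rw [hN, measure_toMeasurable]; exact hs
  have hNm : MeasurableSet N := measurableSet_toMeasurable _ _
  have h1 := hν.2 (N.indicator 1) (measurable_one.indicator hNm)
  rw [lintegral_indicator_one hNm, hN₀] at h1
  have h2 : Measurable fun x => ν x N := ν.measurable_coe hNm
  simp only [lintegral_indicator_one hNm] at h1
  filter_upwards [(lintegral_eq_zero_iff h2).1 h1.symm] with x hx
  exact measure_mono_null (subset_toMeasurable _ _) hx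

lemma IsGelfandLeray.ae_memLp {p : Model d} {η e : ℝ} {ν : ProbabilityTheory.Kernel ℝ (Mom d)}
    (hν : p.IsGelfandLeray η e ν) (φ : p.L2G η e) :
    ∀ᵐ x ∂(volume.restrict (p.range η e)), MemLp (fun q => φ q) 2 (ν x) := by
  have hφ := (Lp.memLp φ).eLpNorm_lt_top
  have hm : Measurable fun q => ‖φ q‖ₑ ^ (2 : ℝ) :=
    (Lp.stronglyMeasurable φ).measurable.enorm.pow_const _
  have h1 := hν.2 _ hm
  have h2 : ∫⁻ q in p.G η e, ‖φ q‖ₑ ^ (2 : ℝ) ≠ ∞ := by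
    have := lintegral_rpow_enorm_lt_top_of_eLpNorm_lt_top two_ne_zero ENNReal.ofNat_ne_top hφ
    simpa using this.ne
  rw [h1] at h2
  filter_upwards [ae_lt_top (hm.lintegral_kernel) h2] with x hx
  refine ⟨(Lp.stronglyMeasurable φ).aestronglyMeasurable, ?_⟩
  rw [eLpNorm_lt_top_iff_lintegral_rpow_enorm_lt_top two_ne_zero ENNReal.ofNat_ne_top]
  simpa using hx

end Model

/-! ### Multiplication operators -/

section Multiplication

variable {X V : Type*} [MeasurableSpace X] {μ : Measure X}
  [NormedAddCommGroup V] [InnerProductSpace ℂ V]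

/-- Essentially bounded measurable functions. -/
structure EssBdd (g : X → ℂ) (μ : Measure X) : Prop where
  meas : AEStronglyMeasurable g μ
  bound : ∃ C : ℝ, 0 ≤ C ∧ ∀ᵐ x ∂μ, ‖g x‖ ≤ C

lemma EssBdd.of_le {g : X → ℂ} {C : ℝ} (hg : AEStronglyMeasurable g μ) (hC : 0 ≤ C)
    (h : ∀ᵐ x ∂μ, ‖g x‖ ≤ C) : EssBdd g μ := ⟨hg, C, hC, h⟩

lemma EssBdd.memLp {g : X → ℂ} (hg : EssBdd g μ) {f : X → V} (hf : MemLp f 2 μ) :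
    MemLp (fun x => g x • f x) 2 μ := by
  obtain ⟨C, hC, hb⟩ := hg.bound
  refine hf.of_le_mul (c := C) (hg.meas.smul hf.1) ?_
  filter_upwards [hb] with x hx
  rw [norm_smul]; gcongr

lemma EssBdd.mul {g h : X → ℂ} (hg : EssBdd g μ) (hh : EssBdd h μ) :
    EssBdd (fun x => g x * h x) μ := by
  obtain ⟨C, hC, hb⟩ := hg.bound
  obtain ⟨D, hD, hd⟩ := hh.bound
  refine .of_le (hg.meas.mul hh.meas) (mul_nonneg hC hD) ?_
  filter_upwards [hb, hd] with x h1 h2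
  rw [norm_mul]; gcongr

/-- Multiplication by a bounded function, as an operator on `L²`. -/
def mulOp (g : X → ℂ) (hg : EssBdd g μ) : Lp V 2 μ →L[ℂ] Lp V 2 μ :=
  LinearMap.mkContinuousOfExistsBound
    { toFun := fun φ => (hg.memLp (Lp.memLp φ)).toLp _
      map_add' := fun φ ψ => by
        rw [← MemLp.toLp_add]
        refine MemLp.toLp_congr _ _ ?_
        filter_upwards [Lp.coeFn_add φ ψ] with x hx
        rw [hx, Pi.add_apply, smul_add, Pi.add_apply]
      map_smul' := fun c φ => by
        rw [RingHom.id_apply, ← MemLp.toLp_const_smul]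
        refine MemLp.toLp_congr _ _ ?_
        filter_upwards [Lp.coeFn_smul c φ] with x hx
        simp [hx, smul_comm c] }
    (by
      obtain ⟨C, hC, hb⟩ := hg.bound
      refine ⟨C, fun φ => Lp.norm_le_mul_norm_of_ae_le_mul ?_⟩
      filter_upwards [hb, (hg.memLp (Lp.memLp φ)).coeFn_toLp] with x hx h2
      simp only [LinearMap.coe_mk, AddHom.coe_mk]
      rw [h2, norm_smul]; gcongr)

lemma mulOp_coeFn (g : X → ℂ) (hg : EssBdd g μ) (φ : Lp V 2 μ) :
    mulOp g hg φ =ᵐ[μ] fun x => g x • φ x := (hg.memLp (Lp.memLp φ)).coeFn_toLp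

lemma norm_mulOp_le {g : X → ℂ} (hg : EssBdd g μ) {C : ℝ} (hC : 0 ≤ C)
    (hb : ∀ᵐ x ∂μ, ‖g x‖ ≤ C) : ‖(mulOp g hg : Lp V 2 μ →L[ℂ] Lp V 2 μ)‖ ≤ C := by
  refine ContinuousLinearMap.opNorm_le_bound _ hC fun φ => Lp.norm_le_mul_norm_of_ae_le_mul ?_
  filter_upwards [hb, mulOp_coeFn g hg φ] with x hx h2
  rw [h2, norm_smul]; gcongr

lemma mulOp_mulOp {g h : X → ℂ} (hg : EssBdd g μ) (hh : EssBdd h μ) (φ : Lp V 2 μ) :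
    mulOp g hg (mulOp h hh φ) = mulOp (fun x => g x * h x) (hg.mul hh) φ := by
  refine Lp.ext ?_
  filter_upwards [mulOp_coeFn g hg (mulOp h hh φ), mulOp_coeFn h hh φ,
    mulOp_coeFn _ (hg.mul hh) φ] with x h1 h2 h3
  rw [h1, h2, h3, smul_smul]

lemma inner_mulOp (v φ : Lp V 2 μ) {g : X → ℂ} (hg : EssBdd g μ) :
    inner ℂ v (mulOp g hg φ) = ∫ x, g x * inner ℂ (v x) (φ x) ∂μ := by
  rw [L2.inner_def]
  refine integral_congr_ae ?_
  filter_upwards [mulOp_coeFn g hg φ] with x hx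
  rw [hx, inner_smul_right]

/-- The function `exp (i s y)`. -/
def phase (y : X → ℝ) (s : ℝ) (x : X) : ℂ := Complex.exp (Complex.I * (s * y x : ℝ))

lemma norm_phase (y : X → ℝ) (s : ℝ) (x : X) : ‖phase y s x‖ = 1 := by
  unfold phase; rw [mul_comm]; exact Complex.norm_exp_ofReal_mul_I _

lemma measurable_phase {y : X → ℝ} (hy : Measurable y) (s : ℝ) : Measurable (phase y s) := by
  unfold phase; fun_prop

lemma essBdd_phase {y : X → ℝ} (hy : Measurable y) (s : ℝ) : EssBdd (phase y s) μ :=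
  .of_le (measurable_phase hy s).aestronglyMeasurable zero_le_one
    (.of_forall fun x => (norm_phase y s x).le)

lemma essBdd_ofReal {y : X → ℝ} (hy : Measurable y) {C : ℝ} (hC : 0 ≤ C)
    (hb : ∀ᵐ x ∂μ, |y x| ≤ C) : EssBdd (fun x => (y x : ℂ)) μ :=
  .of_le (by fun_prop) hC (by filter_upwards [hb] with x hx; simpa using hx)

/-- Multiplication by `exp (i s y)`. -/
def phaseOp {y : X → ℝ} (hy : Measurable y) (s : ℝ) : Lp V 2 μ →L[ℂ] Lp V 2 μ :=
  mulOp (phase y s) (essBdd_phase hy s)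

lemma phase_add (y : X → ℝ) (s t : ℝ) (x : X) : phase y (s + t) x = phase y s x * phase y t x := by
  unfold phase; rw [← Complex.exp_add]; push_cast; ring_nf

lemma phaseOp_add {y : X → ℝ} (hy : Measurable y) (s t : ℝ) (φ : Lp V 2 μ) :
    phaseOp hy (s + t) φ = phaseOp hy s (phaseOp hy t φ) := by
  rw [phaseOp, phaseOp, phaseOp, mulOp_mulOp]
  refine Lp.ext ?_
  filter_upwards [mulOp_coeFn _ (essBdd_phase hy (s + t)) φ, mulOp_coeFn _
    ((essBdd_phase hy s).mul (essBdd_phase hy t)) φ] with x h1 h2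
  rw [h1, h2, phase_add]

lemma phaseOp_zero {y : X → ℝ} (hy : Measurable y) (φ : Lp V 2 μ) : phaseOp hy 0 φ = φ := by
  refine Lp.ext ?_
  filter_upwards [mulOp_coeFn _ (essBdd_phase hy 0) φ] with x h1
  rw [phaseOp, h1]; simp [phase]

lemma norm_phaseOp {y : X → ℝ} (hy : Measurable y) (s : ℝ) (φ : Lp V 2 μ) :
    ‖phaseOp hy s φ‖ = ‖φ‖ := by
  have h : ∀ (s : ℝ) (φ : Lp V 2 μ), ‖phaseOp hy s φ‖ ≤ ‖φ‖ := fun s φ => by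
    have := ContinuousLinearMap.le_of_opNorm_le _
      (norm_mulOp_le (V := V) (essBdd_phase (μ := μ) hy s) zero_le_one
      (.of_forall fun x => (norm_phase y s x).le)) φ
    simpa [phaseOp] using this
  refine le_antisymm (h s φ) ?_
  have := h (-s) (phaseOp hy s φ)
  rwa [← phaseOp_add, neg_add_cancel, phaseOp_zero] at this

/-- As `y` is bounded, `|exp (i z) - 1 - i z| ≤ |z|²` holds with `z = s y` uniformly in the point,
and the remainder is `O(s²)` in norm. -/
lemma hasDerivAt_phaseOp_zero {y : X → ℝ} (hy : Measurable y) {C : ℝ} (hC : 0 ≤ C)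
    (hb : ∀ᵐ x ∂μ, |y x| ≤ C) (φ : Lp V 2 μ) :
    HasDerivAt (fun s => phaseOp hy s φ)
      (Complex.I • mulOp (fun x => (y x : ℂ)) (essBdd_ofReal hy hC hb) φ) 0 := by
  rw [hasDerivAt_iff_isLittleO]
  have key : ∀ s : ℝ, |s| * C ≤ 1 → ‖phaseOp hy s φ - phaseOp hy 0 φ - (s - 0) •
      (Complex.I • mulOp (fun x => (y x : ℂ)) (essBdd_ofReal hy hC hb) φ)‖
      ≤ C ^ 2 * ‖φ‖ * ‖s ^ 2‖ := by
    intro s hs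
    rw [phaseOp_zero, sub_zero]
    have : C ^ 2 * ‖φ‖ * ‖s ^ 2‖ = (C ^ 2 * ‖s ^ 2‖) * ‖φ‖ := by ring
    rw [this]
    refine Lp.norm_le_mul_norm_of_ae_le_mul ?_
    filter_upwards [Lp.coeFn_sub (phaseOp hy s φ - φ) (s • (Complex.I • mulOp (fun x => (y x : ℂ))
        (essBdd_ofReal hy hC hb) φ)), Lp.coeFn_sub (phaseOp hy s φ) φ,
      Lp.coeFn_smul s (Complex.I • mulOp (fun x => (y x : ℂ)) (essBdd_ofReal hy hC hb) φ),
      Lp.coeFn_smul Complex.I (mulOp (fun x => (y x : ℂ)) (essBdd_ofReal hy hC hb) φ),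
      mulOp_coeFn _ (essBdd_phase hy s) φ, mulOp_coeFn _ (essBdd_ofReal hy hC hb) φ, hb]
      with x h1 h2 h3 h4 h5 h6 h7
    rw [h1, Pi.sub_apply, h2, Pi.sub_apply, h3, Pi.smul_apply, h4, Pi.smul_apply, h6]
    have e1 : phaseOp hy s φ x = phase y s x • φ x := h5
    rw [e1]
    have e2 : phase y s x • φ x - φ x - s • Complex.I • (y x : ℂ) • φ x
        = (phase y s x - 1 - Complex.I * (s * y x : ℝ)) • φ x := by
      rw [sub_smul, sub_smul, one_smul, ← Complex.coe_smul, smul_smul, smul_smul]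
      push_cast; ring_nf
    have hn : ‖Complex.I * ((s * y x : ℝ) : ℂ)‖ = |s| * |y x| := by
      rw [norm_mul, Complex.norm_I, one_mul, Complex.norm_real, Real.norm_eq_abs, abs_mul]
    have hle : |s| * |y x| ≤ |s| * C := by gcongr
    rw [e2, norm_smul]
    gcongr
    refine (Complex.norm_exp_sub_one_sub_id_le (hn.le.trans (hle.trans hs))).trans ?_
    rw [hn, mul_pow, Real.norm_eq_abs, abs_pow, mul_comm]
    gcongr
  have hO : (fun s : ℝ => phaseOp hy s φ - phaseOp hy 0 φ - (s - 0) •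
      (Complex.I • mulOp (fun x => (y x : ℂ)) (essBdd_ofReal hy hC hb) φ)) =O[𝓝 0]
      fun s : ℝ => s ^ 2 := by
    refine Asymptotics.IsBigO.of_bound (C ^ 2 * ‖φ‖) ?_
    have : Tendsto (fun s : ℝ => |s| * C) (𝓝 0) (𝓝 0) := by
      have h : Continuous fun s : ℝ => |s| * C := by fun_prop
      simpa using h.tendsto 0
    filter_upwards [this.eventually (ge_mem_nhds zero_lt_one)] with s hs using key s hs
  refine hO.trans_isLittleO ?_
  simpa using Asymptotics.isLittleO_pow_id (𝕜 := ℝ) one_lt_two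

/-- Riemann-Lebesgue lemma, for the push-forward of an integrable density. -/
lemma tendsto_integral_phase {y : X → ℝ} (hy : Measurable y) (hac : μ.map y ≪ volume)
    {ψ : X → ℂ} (hψ : Integrable ψ μ) :
    Tendsto (fun s : ℝ => ∫ k, ψ k * phase y s k ∂μ) atTop (𝓝 0) := by
  have hint : ∀ {f : X → ℂ}, Integrable f μ → ∀ s, Integrable (fun k => f k * phase y s k) μ :=
    fun hf s => hf.mul_bdd (c := 1) (measurable_phase hy s).aestronglyMeasurable
      (.of_forall fun x => (norm_phase y s x).le)
  -- For an indicator, the push-forward has an integrable density, whose Fourier transform vanishes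
  -- at infinity. The general case follows because the integral is bounded by the `L¹` norm
  -- uniformly in `s`.
  refine Integrable.induction (μ := μ) (E := ℂ)
    (fun ψ => Tendsto (fun s : ℝ => ∫ k, ψ k * phase y s k ∂μ) atTop (𝓝 0)) ?_ ?_ ?_ ?_ hψ
  · intro c A hA hμA
    have hfin : IsFiniteMeasure (μ.restrict A) := ⟨by simpa using hμA⟩
    have h1 : ∀ s : ℝ, ∫ k, A.indicator (fun _ => c) k * phase y s k ∂μ
        = c * ∫ k in A, phase y s k ∂μ := fun s => by
      rw [← integral_const_mul, ← integral_indicator hA]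
      congr 1; ext k; by_cases hk : k ∈ A <;> simp [hk]
    have hac' : (μ.restrict A).map y ≪ volume :=
      (Measure.absolutelyContinuous_of_le (Measure.map_mono Measure.restrict_le_self hy)).trans hac
    have h2 : ∀ s : ℝ, ∫ k in A, phase y s k ∂μ = ∫ x : ℝ, Real.fourierChar
        (-(x * (-(s / (2 * Real.pi))))) •
        ((((μ.restrict A).map y).rnDeriv volume x).toReal : ℂ) := fun s => by
      have e1 : ∫ k in A, phase y s k ∂μ
          = ∫ x : ℝ, Complex.exp (Complex.I * (s * x : ℝ)) ∂((μ.restrict A).map y) := by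
        rw [integral_map hy.aemeasurable (by fun_prop)]; rfl
      rw [e1, ← integral_rnDeriv_smul hac']
      congr 1; ext x
      rw [Circle.smul_def, Real.fourierChar_apply, Complex.real_smul, smul_eq_mul, mul_comm]
      congr 2
      have : (2 * Real.pi : ℝ) ≠ 0 := by positivity
      have h3 : 2 * Real.pi * -(x * -(s / (2 * Real.pi))) = s * x := by field_simp
      rw [h3, mul_comm]
    simp_rw [h1, h2]
    rw [show (0 : ℂ) = c * 0 by simp]
    refine Tendsto.const_mul c ((Real.tendsto_integral_exp_smul_cocompact _).comp ?_)
    rw [cocompact_eq_atBot_atTop]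
    refine Tendsto.mono_right ?_ le_sup_left
    exact tendsto_neg_atTop_atBot.comp (tendsto_id.atTop_div_const (by positivity))
  · intro f g _ hf hg h1 h2
    have : ∀ s : ℝ, ∫ k, (f + g) k * phase y s k ∂μ
        = ∫ k, f k * phase y s k ∂μ + ∫ k, g k * phase y s k ∂μ := fun s => by
      rw [← integral_add (hint hf s) (hint hg s)]
      simp [add_mul]
    simp_rw [this]
    simpa using h1.add h2
  · refine isClosed_of_closure_subset fun f hf => ?_
    rw [Set.mem_ofPred_eq, Metric.tendsto_atTop]
    intro δ hδ
    obtain ⟨g, hg, hfg⟩ := Metric.mem_closure_iff.1 hf (δ / 2) (by positivity)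
    obtain ⟨N, hN⟩ := Metric.tendsto_atTop.1 hg (δ / 2) (by positivity)
    refine ⟨N, fun s hs => ?_⟩
    have h1 := hN s hs
    rw [dist_zero_right] at h1 ⊢
    have hfi := L1.integrable_coeFn f
    have hgi := L1.integrable_coeFn g
    have h2 : ‖∫ k, f k * phase y s k ∂μ - ∫ k, g k * phase y s k ∂μ‖ ≤ dist f g := by
      rw [← integral_sub (hint hfi s) (hint hgi s), dist_eq_norm, L1.norm_eq_integral_norm]
      refine (norm_integral_le_integral_norm _).trans_eq (integral_congr_ae ?_)
      filter_upwards [Lp.coeFn_sub f g] with k hk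
      rw [hk, Pi.sub_apply, ← sub_mul, norm_mul, norm_phase, mul_one]
    calc _ ≤ ‖∫ k, f k * phase y s k ∂μ - ∫ k, g k * phase y s k ∂μ‖
          + ‖∫ k, g k * phase y s k ∂μ‖ := by
            simpa using norm_add_le (∫ k, f k * phase y s k ∂μ - ∫ k, g k * phase y s k ∂μ)
              (∫ k, g k * phase y s k ∂μ)
      _ < δ := by linarith
  · intro f g hfg _ h
    refine h.congr fun s => integral_congr_ae ?_
    filter_upwards [hfg] with k hk
    rw [hk]

lemma inner_phaseOp {y : X → ℝ} (hy : Measurable y) (s : ℝ) (v φ : Lp V 2 μ) :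
    inner ℂ v (phaseOp hy s φ) = ∫ x, inner ℂ (v x) (φ x) * phase y s x ∂μ := by
  rw [phaseOp, inner_mulOp]
  simp_rw [mul_comm]

lemma flow_phaseOp {V : Type*} [NormedAddCommGroup V] [InnerProductSpace ℂ V] [CompleteSpace V]
    {y : X → ℝ} (hy : Measurable y) {C : ℝ} (hC : 0 ≤ C)
    (hb : ∀ᵐ x ∂μ, |y x| ≤ C) (hac : μ.map y ≪ volume) :
    Flow (F := Lp V 2 μ) (mulOp (fun x => (y x : ℂ)) (essBdd_ofReal hy hC hb)) (phaseOp hy) where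
  zero := phaseOp_zero hy
  add s t φ := phaseOp_add hy s t φ
  comm s φ := by
    rw [phaseOp, mulOp_mulOp, mulOp_mulOp]
    refine Lp.ext ?_
    filter_upwards [mulOp_coeFn _ ((essBdd_phase hy s).mul (essBdd_ofReal hy hC hb)) φ, mulOp_coeFn
      _ ((essBdd_ofReal hy hC hb).mul (essBdd_phase hy s)) φ] with x h1 h2
    rw [h1, h2, mul_comm]
  deriv φ s := by
    have h := (hasDerivAt_phaseOp_zero hy hC hb (phaseOp hy s φ))
    have h2 := HasDerivAt.comp_add_const (f := fun t => phaseOp hy t (phaseOp hy s φ)) s (-s)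
      (by rw [add_neg_cancel]; exact h)
    simp only [← phaseOp_add, neg_add_cancel_right] at h2
    exact h2
  norm := norm_phaseOp hy
  weak v φ := by
    simp_rw [inner_phaseOp]
    exact tendsto_integral_phase hy hac (L2.integrable_inner v φ)

end Multiplication

/-! ### Kato vectors of multiplication groups -/

section Kato

variable {X : Type*} [MeasurableSpace X] {μ : Measure X} [SFinite μ]

/-- The Fourier transform of the Gaussian `exp (-b s²)`. -/
def gaussKernel (b t : ℝ) : ℝ := √(Real.pi / b) * Real.exp (-(1 / (4 * b)) * t ^ 2)

lemma gaussKernel_nonneg (b t : ℝ) : 0 ≤ gaussKernel b t := by unfold gaussKernel; positivity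

lemma continuous_gaussKernel (b : ℝ) : Continuous (gaussKernel b) := by
  unfold gaussKernel; fun_prop

lemma integral_gaussKernel {b : ℝ} (hb : 0 < b) : ∫ t, gaussKernel b t = 2 * Real.pi := by
  unfold gaussKernel
  rw [integral_const_mul, integral_gaussian, ← Real.sqrt_mul (by positivity)]
  have : Real.pi / b * (Real.pi / (1 / (4 * b))) = (2 * Real.pi) ^ 2 := by field_simp; ring
  rw [this, Real.sqrt_sq (by positivity)]

lemma lintegral_gaussKernel {b : ℝ} (hb : 0 < b) :
    ∫⁻ t, ENNReal.ofReal (gaussKernel b t) = ENNReal.ofReal (2 * Real.pi) := by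
  rw [← integral_gaussKernel hb, ofReal_integral_eq_lintegral_ofReal]
  · unfold gaussKernel
    exact (integrable_exp_neg_mul_sq (by positivity)).const_mul _
  · exact .of_forall fun t => gaussKernel_nonneg b t

lemma integral_gauss_mul_exp {b : ℝ} (hb : 0 < b) (t : ℝ) :
    ∫ s : ℝ, (Real.exp (-b * s ^ 2) : ℂ) * Complex.exp (Complex.I * (s * t : ℝ))
      = (gaussKernel b t : ℂ) := by
  have h := fourierIntegral_gaussian (b := (b : ℂ)) (by simpa using hb) (t : ℂ)
  have e1 : ∀ s : ℝ, (Real.exp (-b * s ^ 2) : ℂ) * Complex.exp (Complex.I * (s * t : ℝ))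
      = Complex.exp (Complex.I * t * s) * Complex.exp (-b * s ^ 2) := fun s => by
    push_cast; rw [mul_comm]; ring_nf
  simp_rw [e1]
  rw [h, gaussKernel]
  have e2 : ((Real.pi : ℂ) / b) ^ (1 / 2 : ℂ) = ((√(Real.pi / b) : ℝ) : ℂ) := by
    rw [Real.sqrt_eq_rpow, Complex.ofReal_cpow (by positivity)]; push_cast; rfl
  rw [e2]
  push_cast
  congr 2
  ring

lemma mul_le_sq_add_sq_ennreal (a b : ℝ≥0∞) : a * b ≤ a ^ 2 + b ^ 2 := by
  rcases le_total a b with h | h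
  · calc a * b ≤ b * b := by gcongr
      _ ≤ a ^ 2 + b ^ 2 := by rw [← sq]; exact le_add_self
  · calc a * b ≤ a * a := by gcongr
      _ ≤ a ^ 2 + b ^ 2 := by rw [← sq]; exact le_self_add

/-- Local smoothness: if the push-forward of `|φ|²` under `y` has a bounded density, then the
Fourier transforms of the push-forwards of `conj v φ` are uniformly square integrable. -/
lemma integral_sq_correlation_le {y : X → ℝ} (hy : Measurable y) {v φ : X → ℂ}
    (hvm : Measurable v) (hφm : Measurable φ) (hf : Integrable (fun k => v k * φ k) μ)
    {n : ℝ≥0∞} (hn : n ≠ ∞)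
    (hφ : ∀ g : ℝ → ℝ≥0∞, Measurable g → ∫⁻ k, g (y k) * ‖φ k‖ₑ ^ 2 ∂μ ≤ n * ∫⁻ x, g x)
    (hv : ∫⁻ k, ‖v k‖ₑ ^ 2 ∂μ ≠ ∞) {A : ℝ} (hA : 0 ≤ A) :
    ∫ a in (0 : ℝ)..A, ‖∫ k, v k * φ k * phase y a k ∂μ‖ ^ 2 ≤
      Real.exp 1 * (2 * (n.toReal * (2 * Real.pi))) * (∫⁻ k, ‖v k‖ₑ ^ 2 ∂μ).toReal := by
  set B : ℝ := A + 1 with hB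
  have hB0 : 0 < B := by positivity
  -- With this `b` the weight `exp (1 - b a²)` is at least `1` on `[0, A]`, so the sharp time
  -- cut-off can be replaced by a Gaussian; `B = A + 1` stays positive at `A = 0`.
  set b : ℝ := 1 / B ^ 2 with hbdef
  have hb : 0 < b := by positivity
  set f : X → ℂ := fun k => v k * φ k with hfdef
  set c : ℝ → ℂ := fun s => ∫ k, f k * phase y s k ∂μ with hc
  have hphs : ∀ k, Continuous fun s => phase y s k := fun k => by unfold phase; fun_prop
  have hcc : Continuous c := by
    refine continuous_of_dominated (bound := fun k => ‖f k‖) ?_ ?_ hf.norm ?_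
    · intro s
      exact hf.1.mul (measurable_phase hy s).aestronglyMeasurable
    · intro s
      exact .of_forall fun k => by rw [norm_mul, norm_phase, mul_one]
    · exact .of_forall fun k => continuous_const.mul (hphs k)
  set Fz : X × X → ℂ := fun z => f z.1 * (starRingEnd ℂ) (f z.2) with hFz
  have hfc : Integrable (fun k => (starRingEnd ℂ) (f k)) μ :=
    (LinearIsometryEquiv.integrable_comp_iff (Complex.conjLIE)).2 hf
  have hFi : Integrable Fz (μ.prod μ) := hf.mul_prod hfc
  set D : X × X → ℝ := fun z => y z.1 - y z.2 with hD
  have hDm : Measurable D := by fun_prop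
  have hcs : ∀ s, ((‖c s‖ ^ 2 : ℝ) : ℂ) = ∫ z, Fz z * phase D s z ∂(μ.prod μ) := fun s => by
    have h1 : (starRingEnd ℂ) (c s) = ∫ k, (starRingEnd ℂ) (f k * phase y s k) ∂μ :=
      (integral_conj).symm
    rw [Complex.ofReal_pow, ← Complex.mul_conj', h1, hc, ← integral_prod_mul]
    congr 1; ext z
    have : phase D s z = phase y s z.1 * (starRingEnd ℂ) (phase y s z.2) := by
      unfold phase
      rw [← Complex.exp_conj, ← Complex.exp_add]
      congr 1
      simp only [hD, map_mul, Complex.conj_I, Complex.conj_ofReal]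
      push_cast; ring
    rw [this, map_mul]; ring
  have hgi : Integrable (fun s : ℝ => (Real.exp (-b * s ^ 2) : ℂ)) :=
    (integrable_exp_neg_mul_sq hb).ofReal
  have hjm : Measurable fun z : ℝ × (X × X) => phase D z.1 z.2 := by unfold phase; fun_prop
  have hprod : Integrable (Function.uncurry fun (s : ℝ) (z : X × X) =>
      (Real.exp (-b * s ^ 2) : ℂ) * (Fz z * phase D s z)) (volume.prod (μ.prod μ)) := by
    have h1 := (hgi.mul_prod hFi).mul_bdd (c := 1) hjm.aestronglyMeasurable
      (.of_forall fun z => (norm_phase D z.1 z.2).le)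
    refine h1.congr (.of_forall fun z => ?_)
    simp only [Function.uncurry]; ring
  have hswap := integral_integral_swap hprod
  -- `‖c s‖²` is a double integral with phase `exp (i s (y k - y l))`. The Gaussian integral over
  -- `s` turns it into a positive kernel in `y k - y l`.
  have hL : ∫ s : ℝ, Real.exp (-b * s ^ 2) * ‖c s‖ ^ 2
      = ‖∫ z, Fz z * (gaussKernel b (D z) : ℂ) ∂(μ.prod μ)‖ := by
    have h1 : ((∫ s : ℝ, Real.exp (-b * s ^ 2) * ‖c s‖ ^ 2 : ℝ) : ℂ)
        = ∫ z, Fz z * (gaussKernel b (D z) : ℂ) ∂(μ.prod μ) := by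
      rw [← integral_complex_ofReal]
      calc _ = ∫ s : ℝ, ∫ z, (Real.exp (-b * s ^ 2) : ℂ) * (Fz z * phase D s z) ∂(μ.prod μ) := by
            congr 1; ext s
            rw [Complex.ofReal_mul, hcs, integral_const_mul]
        _ = _ := by
            rw [hswap]; congr 1; ext z
            rw [← integral_gauss_mul_exp hb, ← integral_const_mul]
            congr 1; ext s
            unfold phase; ring
    rw [← h1, Complex.norm_real, Real.norm_eq_abs, abs_of_nonneg]
    exact integral_nonneg fun s => by positivity
  have hgm : Measurable fun t => ENNReal.ofReal (gaussKernel b t) :=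
    (continuous_gaussKernel b).measurable.ennreal_ofReal
  -- A Schur estimate: in each term after the arithmetic-geometric mean inequality, `v` and `φ`
  -- depend on different variables. Integrating over that of `φ` uses the bounded density, and the
  -- total mass of the kernel is `2 π` for every `b`, so the bound does not depend on `A`.
  have hbound : ‖∫ z, Fz z * (gaussKernel b (D z) : ℂ) ∂(μ.prod μ)‖ₑ
      ≤ 2 * (n * ENNReal.ofReal (2 * Real.pi)) * ∫⁻ k, ‖v k‖ₑ ^ 2 ∂μ := by
    have hone : ∀ x : ℝ, ∫⁻ k, ENNReal.ofReal (gaussKernel b (x - y k)) * ‖φ k‖ₑ ^ 2 ∂μ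
        ≤ n * ENNReal.ofReal (2 * Real.pi) := fun x => by
      refine (hφ (fun t => ENNReal.ofReal (gaussKernel b (x - t)))
        (hgm.comp (by fun_prop))).trans_eq ?_
      rw [lintegral_sub_left_eq_self (fun t => ENNReal.ofReal (gaussKernel b t)) x,
        lintegral_gaussKernel hb]
    have hsym : ∀ x t : ℝ, gaussKernel b (x - t) = gaussKernel b (t - x) := fun x t => by
      unfold gaussKernel; congr 3; ring
    set P : X → X → ℝ≥0∞ := fun k l =>
      ‖v k‖ₑ ^ 2 * (ENNReal.ofReal (gaussKernel b (y k - y l)) * ‖φ l‖ₑ ^ 2) with hP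
    have hPm : Measurable (Function.uncurry P) := by
      have h1 : Measurable fun z : X × X => ENNReal.ofReal (gaussKernel b (y z.1 - y z.2)) :=
        hgm.comp (by fun_prop)
      have h2 : Measurable fun z : X × X => ‖v z.1‖ₑ ^ 2 := by fun_prop
      have h3 : Measurable fun z : X × X => ‖φ z.2‖ₑ ^ 2 := by fun_prop
      exact h2.mul (h1.mul h3)
    have hPi : ∫⁻ k, ∫⁻ l, P k l ∂μ ∂μ
        ≤ (n * ENNReal.ofReal (2 * Real.pi)) * ∫⁻ k, ‖v k‖ₑ ^ 2 ∂μ := by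
      rw [mul_comm, ← lintegral_mul_const _ (by fun_prop)]
      refine lintegral_mono fun k => ?_
      have hm : Measurable fun l => ENNReal.ofReal (gaussKernel b (y k - y l)) * ‖φ l‖ₑ ^ 2 := by
        have h1 : Measurable fun l => ENNReal.ofReal (gaussKernel b (y k - y l)) :=
          hgm.comp (by fun_prop)
        exact h1.mul (by fun_prop)
      rw [hP, lintegral_const_mul _ hm]
      gcongr
      exact hone _
    calc _ ≤ ∫⁻ z, ‖Fz z * (gaussKernel b (D z) : ℂ)‖ₑ ∂(μ.prod μ) :=
          enorm_integral_le_lintegral_enorm _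
      _ ≤ ∫⁻ z, (P z.1 z.2 + P z.2 z.1) ∂(μ.prod μ) := by
          refine lintegral_mono fun z => ?_
          have hg : ‖(gaussKernel b (D z) : ℂ)‖ₑ = ENNReal.ofReal (gaussKernel b (D z)) := by
            rw [← ofReal_norm, Complex.norm_real, Real.norm_of_nonneg (gaussKernel_nonneg _ _)]
          have hconj : ‖(starRingEnd ℂ) (f z.2)‖ₑ = ‖f z.2‖ₑ := by
            rw [← ofReal_norm, RCLike.norm_conj, ofReal_norm]
          simp only [hFz]
          rw [enorm_mul, enorm_mul, hconj, hg]
          simp only [hfdef, enorm_mul, hP, hsym (y z.2) (y z.1), hD]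
          calc _ = (‖v z.1‖ₑ * ‖φ z.2‖ₑ) * (‖v z.2‖ₑ * ‖φ z.1‖ₑ)
                * ENNReal.ofReal (gaussKernel b (y z.1 - y z.2)) := by ring
            _ ≤ ((‖v z.1‖ₑ * ‖φ z.2‖ₑ) ^ 2 + (‖v z.2‖ₑ * ‖φ z.1‖ₑ) ^ 2)
                * ENNReal.ofReal (gaussKernel b (y z.1 - y z.2)) := by
                gcongr; exact mul_le_sq_add_sq_ennreal _ _
            _ = _ := by ring
      _ = ∫⁻ z, P z.1 z.2 ∂(μ.prod μ) + ∫⁻ z, P z.2 z.1 ∂(μ.prod μ) :=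
          lintegral_add_left hPm _
      _ = ∫⁻ k, ∫⁻ l, P k l ∂μ ∂μ + ∫⁻ k, ∫⁻ l, P k l ∂μ ∂μ := by
          congr 1
          · exact lintegral_prod _ hPm.aemeasurable
          · exact lintegral_prod_symm _ (hPm.comp measurable_swap).aemeasurable
      _ ≤ _ := by rw [← two_mul, mul_assoc]; gcongr
  have hreal : ∫ s : ℝ, Real.exp (-b * s ^ 2) * ‖c s‖ ^ 2
      ≤ 2 * (n.toReal * (2 * Real.pi)) * (∫⁻ k, ‖v k‖ₑ ^ 2 ∂μ).toReal := by
    rw [hL, ← toReal_enorm]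
    refine (ENNReal.toReal_mono ?_ hbound).trans_eq ?_
    · finiteness
    · rw [ENNReal.toReal_mul, ENNReal.toReal_mul, ENNReal.toReal_mul,
        ENNReal.toReal_ofReal (by positivity)]; simp
  have hMb : ∀ s, ‖c s‖ ^ 2 ≤ (∫ k, ‖f k‖ ∂μ) ^ 2 := fun s => by
    gcongr
    refine (norm_integral_le_integral_norm _).trans_eq ?_
    congr 1; ext k; rw [norm_mul, norm_phase, mul_one]
  have hint : Integrable fun s : ℝ => Real.exp (-b * s ^ 2) * ‖c s‖ ^ 2 :=
    (integrable_exp_neg_mul_sq hb).mul_bdd (c := (∫ k, ‖f k‖ ∂μ) ^ 2)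
      (by fun_prop) (.of_forall fun s => by
        rw [Real.norm_of_nonneg (by positivity)]; exact hMb s)
  calc ∫ a in (0 : ℝ)..A, ‖c a‖ ^ 2
      ≤ ∫ a in (0 : ℝ)..A, Real.exp 1 * (Real.exp (-b * a ^ 2) * ‖c a‖ ^ 2) := by
        refine intervalIntegral.integral_mono_on hA
          ((hcc.norm.pow 2).intervalIntegrable _ _)
          (Continuous.intervalIntegrable (by fun_prop) _ _) fun a ha => ?_
        rw [← mul_assoc, ← Real.exp_add]
        have : 0 ≤ 1 + -b * a ^ 2 := by
          have h1 : a ^ 2 ≤ B ^ 2 := by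
            have := ha.1; have := ha.2; gcongr; linarith
          have h2 : b * a ^ 2 ≤ 1 := by
            rw [hbdef, one_div, inv_mul_le_iff₀ (by positivity)]; linarith
          linarith
        exact le_mul_of_one_le_left (by positivity) (Real.one_le_exp this)
    _ = Real.exp 1 * ∫ a in (0 : ℝ)..A, Real.exp (-b * a ^ 2) * ‖c a‖ ^ 2 :=
        intervalIntegral.integral_const_mul _ _
    _ ≤ Real.exp 1 * ∫ a : ℝ, Real.exp (-b * a ^ 2) * ‖c a‖ ^ 2 := by
        gcongr
        rw [intervalIntegral.integral_of_le hA]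
        exact setIntegral_le_integral hint (.of_forall fun s => by positivity)
    _ ≤ _ := by rw [mul_assoc]; gcongr

lemma lintegral_enorm_sq_coeFn {V : Type*} [NormedAddCommGroup V] (v : Lp V 2 μ) :
    ∫⁻ k, ‖v k‖ₑ ^ 2 ∂μ = ENNReal.ofReal (‖v‖ ^ 2) := by
  have h := Lp.enorm_def v
  rw [eLpNorm_eq_lintegral_rpow_enorm_toReal two_ne_zero ENNReal.ofNat_ne_top] at h
  rw [ENNReal.ofReal_pow (norm_nonneg _), ofReal_norm, h, ← ENNReal.rpow_natCast,
    ← ENNReal.rpow_mul]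
  simp

lemma isKato_of_bounded_density {y : X → ℝ} (hy : Measurable y) (φ : Lp ℂ 2 μ) {n : ℝ≥0∞}
    (hn : n ≠ ∞)
    (hφ : ∀ g : ℝ → ℝ≥0∞, Measurable g → ∫⁻ k, g (y k) * ‖φ k‖ₑ ^ 2 ∂μ ≤ n * ∫⁻ x, g x) :
    IsKato (phaseOp hy) φ := by
  refine ⟨Real.exp 1 * (2 * (n.toReal * (2 * Real.pi))), fun v A hA => ?_⟩
  have hvm : Measurable fun k => (starRingEnd ℂ) (v k) :=
    Complex.continuous_conj.measurable.comp (Lp.stronglyMeasurable v).measurable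
  have hconj : ∀ k, ‖(starRingEnd ℂ) (v k)‖ₑ = ‖v k‖ₑ := fun k => by
    rw [← ofReal_norm, RCLike.norm_conj, ofReal_norm]
  have hi : Integrable (fun k => (starRingEnd ℂ) (v k) * φ k) μ := by
    refine (L2.integrable_inner v φ).congr (.of_forall fun k => ?_)
    simp [mul_comm]
  have h := integral_sq_correlation_le hy hvm (Lp.stronglyMeasurable φ).measurable hi hn hφ
    (by simp_rw [hconj]; rw [lintegral_enorm_sq_coeFn]; finiteness) hA
  simp_rw [hconj] at h
  rw [lintegral_enorm_sq_coeFn, ENNReal.toReal_ofReal (by positivity)] at h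
  refine le_trans (le_of_eq ?_) h
  congr 1; ext a
  rw [inner_phaseOp]
  congr 3; ext k
  simp [mul_comm]

/-- If `r` is the density of the push-forward of `|φ|²` under `y`, the restriction of `φ` to `{r ∘ y
≤ n}` has a push-forward with density at most `n`, hence is a Kato vector. These restrictions tend
to `φ`, because `r ∘ y` is finite almost everywhere. -/
lemma dense_isKato {y : X → ℝ} (hy : Measurable y) (hac : μ.map y ≪ volume) :
    Dense {φ : Lp ℂ 2 μ | IsKato (phaseOp hy) φ} := by
  intro φ
  have hwm : Measurable fun k => ‖φ k‖ₑ ^ 2 := (Lp.stronglyMeasurable φ).measurable.enorm.pow_const _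
  set m := (μ.withDensity fun k => ‖φ k‖ₑ ^ 2).map y with hm
  have hfin : IsFiniteMeasure m := by
    refine ⟨?_⟩
    rw [hm, Measure.map_apply hy .univ, withDensity_apply _ (hy .univ), Set.preimage_univ,
      Measure.restrict_univ, lintegral_enorm_sq_coeFn]
    exact ENNReal.ofReal_lt_top
  have hmac : m ≪ volume := ((withDensity_absolutelyContinuous μ _).map hy).trans hac
  set r := m.rnDeriv volume with hr
  have hrm : Measurable r := Measure.measurable_rnDeriv _ _
  have hrfin : ∀ᵐ k ∂μ, r (y k) < ∞ :=
    ae_of_ae_map hy.aemeasurable (hac.ae_le (Measure.rnDeriv_lt_top m volume))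
  set S : ℕ → Set X := fun n => {k | r (y k) ≤ n} with hS
  have hSm : ∀ n, MeasurableSet (S n) := fun n => measurableSet_le (hrm.comp hy) measurable_const
  have hbd : ∀ n, EssBdd ((S n).indicator (fun _ => (1 : ℂ))) μ := fun n =>
    .of_le ((measurable_const.indicator (hSm n)).aestronglyMeasurable) zero_le_one
      (.of_forall fun k => by by_cases hk : k ∈ S n <;> simp [hk])
  set ψ : ℕ → Lp ℂ 2 μ := fun n => mulOp _ (hbd n) φ with hψ
  have hψK : ∀ n, IsKato (phaseOp hy) (ψ n) := fun n => by
    refine isKato_of_bounded_density hy (ψ n) (n := n) (ENNReal.natCast_ne_top n) fun g hg => ?_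
    have hind : Measurable ({x | r x ≤ n}.indicator g) :=
      hg.indicator (measurableSet_le hrm measurable_const)
    calc ∫⁻ k, g (y k) * ‖ψ n k‖ₑ ^ 2 ∂μ
        = ∫⁻ k, ‖φ k‖ₑ ^ 2 * ({x | r x ≤ n}.indicator g) (y k) ∂μ := by
          refine lintegral_congr_ae ?_
          filter_upwards [mulOp_coeFn _ (hbd n) φ] with k hk
          have e : ψ n k = (S n).indicator (fun _ => (1 : ℂ)) k • φ k := hk
          rw [e]
          by_cases h : r (y k) ≤ n
          · have h' : k ∈ S n := h
            rw [Set.indicator_of_mem h', Set.indicator_of_mem (s := {x | r x ≤ n}) h, one_smul,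
              mul_comm]
          · have h' : k ∉ S n := h
            rw [Set.indicator_of_notMem h', Set.indicator_of_notMem (s := {x | r x ≤ n}) h]
            simp
      _ = ∫⁻ x, {x | r x ≤ n}.indicator g x ∂m := by
          rw [hm, lintegral_map hind hy]
          exact (lintegral_withDensity_eq_lintegral_mul _ hwm (hind.comp hy)).symm
      _ = ∫⁻ x, r x * {x | r x ≤ n}.indicator g x := by
          conv_lhs => rw [← Measure.withDensity_rnDeriv_eq m volume hmac]
          rw [lintegral_withDensity_eq_lintegral_mul _ hrm hind]; rfl
      _ ≤ ∫⁻ x, n * g x := by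
          refine lintegral_mono fun x => ?_
          by_cases h : r x ≤ n
          · rw [Set.indicator_of_mem (s := {x | r x ≤ n}) h]; gcongr
          · rw [Set.indicator_of_notMem (s := {x | r x ≤ n}) h]; simp
      _ = n * ∫⁻ x, g x := lintegral_const_mul _ hg
  refine mem_closure_of_tendsto (f := ψ) (b := atTop) ?_ (.of_forall hψK)
  rw [tendsto_iff_norm_sub_tendsto_zero]
  have hsq : Tendsto (fun n => ∫ k, ‖(ψ n - φ) k‖ ^ 2 ∂μ) atTop (𝓝 (∫ _, (0 : ℝ) ∂μ)) := by
    have hcf : ∀ n, ∀ᵐ k ∂μ, (ψ n - φ) k = (S n).indicator (fun _ => (1 : ℂ)) k • φ k - φ k :=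
      fun n => by
        filter_upwards [Lp.coeFn_sub (ψ n) φ, mulOp_coeFn _ (hbd n) φ] with k h1 h2
        rw [h1, Pi.sub_apply]; congr 1
    refine tendsto_integral_of_dominated_convergence (fun k => ‖φ k‖ ^ 2) (fun n => ?_) ?_ ?_ ?_
    · exact ((Lp.aestronglyMeasurable _).norm.pow 2)
    · exact (memLp_two_iff_integrable_sq_norm (Lp.aestronglyMeasurable φ)).1 (Lp.memLp φ)
    · intro n
      filter_upwards [hcf n] with k hk
      rw [hk, Real.norm_of_nonneg (by positivity)]
      by_cases h : k ∈ S n <;> simp [h]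
    · filter_upwards [ae_all_iff.2 hcf, hrfin] with k hk hrk
      obtain ⟨N, hN⟩ := ENNReal.exists_nat_gt hrk.ne
      refine tendsto_const_nhds.congr' ?_
      filter_upwards [eventually_ge_atTop N] with n hn
      have : k ∈ S n := hN.le.trans (by exact_mod_cast hn)
      rw [hk n, Set.indicator_of_mem this]; simp
  have hnorm : ∀ n, ∫ k, ‖(ψ n - φ) k‖ ^ 2 ∂μ = ‖ψ n - φ‖ ^ 2 := fun n => by
    have h := L2.inner_def (𝕜 := ℂ) (ψ n - φ) (ψ n - φ)
    rw [inner_self_eq_norm_sq_to_K] at h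
    simp_rw [inner_self_eq_norm_sq_to_K] at h
    norm_cast at h
    rw [h]
  simp_rw [hnorm] at hsq
  rw [integral_zero] at hsq
  have := hsq.sqrt
  simpa [Real.sqrt_sq] using this

end Kato

/-! ### Density of test functions -/

namespace Model


lemma IsTest.memLp {p : Model d} {η e : ℝ} {φ : Mom d → ℂ} (hφ : p.IsTest η e φ) :
    MemLp φ 2 (volume.restrict (p.G η e)) :=
  (hφ.1.continuous.memLp_of_hasCompactSupport hφ.2.1).restrict _

/-- A function orthogonal to all test functions is orthogonal to the real ones in particular, and so
vanishes almost everywhere on the open set `G`. -/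
lemma dense_test {p : Model d} (hom : DispersionLaw p.om) (η e : ℝ) :
    Dense (Submodule.span ℂ {u : p.L2G η e | ∃ φ, p.IsTest η e φ ∧
      ∀ᵐ q ∂(volume.restrict (p.G η e)), u q = φ q} : Set (p.L2G η e)) := by
  rw [Submodule.dense_iff_topologicalClosure_eq_top, Submodule.topologicalClosure_eq_top_iff,
    Submodule.eq_bot_iff]
  intro u hu
  have hG := isOpen_G hom η e
  have hui : LocallyIntegrable u (volume.restrict (p.G η e)) :=
    (Lp.memLp u).locallyIntegrable one_le_two
  have key := hG.ae_eq_zero_of_integral_contDiff_smul_eq_zero (μ := volume.restrict (p.G η e))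
    (f := u) (hui.locallyIntegrableOn _) fun g hg hgc hgs => by
      have ht : p.IsTest η e (fun q => (g q : ℂ)) :=
        ⟨Complex.ofRealCLM.contDiff.comp hg, hgc.comp_left Complex.ofReal_zero,
          (tsupport_comp_subset Complex.ofReal_zero g).trans hgs⟩
      have h := hu (ht.memLp.toLp _) (Submodule.subset_span ⟨_, ht, ht.memLp.coeFn_toLp⟩)
      rw [L2.inner_def] at h
      rw [← h]
      refine integral_congr_ae ?_
      filter_upwards [ht.memLp.coeFn_toLp] with q hq
      rw [hq]; simp [mul_comm]
  refine Lp.ext ?_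
  filter_upwards [key, ae_restrict_mem (measurableSet_G hom η e), Lp.coeFn_zero ℂ 2
    (volume.restrict (p.G η e))] with q h1 h2 h3
  rw [h3, h1 h2]; rfl

end Model

open Model (addOne)

variable {d : ℕ}

/-! ### The Lebesgue-Poisson measure -/


instance (d : ℕ) : SFinite (lebesguePoisson d) := by unfold lebesguePoisson; infer_instance

lemma measurableEmbedding_mk (n : ℕ) :
    MeasurableEmbedding (fun k : Fin n → Mom d => (⟨n, k⟩ : Config d)) where
  injective := fun _ _ h => sigma_mk_injective h
  measurable := measurable_sigma_mk n
  measurableSet_image' s hs := by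
    refine MeasurableSpace.measurableSet_iInf.2 fun m => ?_
    change MeasurableSet ((fun k : Fin m → Mom d => (⟨m, k⟩ : Config d)) ⁻¹'
      ((fun k : Fin n → Mom d => (⟨n, k⟩ : Config d)) '' s))
    rcases eq_or_ne m n with rfl | h
    · have hinj : Function.Injective fun k : Fin m → Mom d => (⟨m, k⟩ : Config d) :=
        fun _ _ h => sigma_mk_injective h
      rwa [hinj.preimage_image]
    · convert! MeasurableSet.empty
      ext k
      simp only [Set.mem_preimage, Set.mem_image, Sigma.mk.injEq, Set.mem_empty_iff_false,
        iff_false, not_exists, not_and]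
      exact fun _ _ h' => (h h'.symm).elim

lemma measurable_config {γ : Type*} [MeasurableSpace γ] {f : Config d → γ}
    (hf : ∀ n, Measurable fun k : Fin n → Mom d => f ⟨n, k⟩) : Measurable f := fun _ ht =>
  MeasurableSpace.measurableSet_iInf.2 fun n => hf n ht

lemma measurable_card : Measurable fun Q : Config d => Q.1 :=
  measurable_config fun _ => measurable_const

lemma ae_config_iff {P : Config d → Prop} :
    (∀ᵐ Q ∂lebesguePoisson d, P Q) ↔ ∀ n, ∀ᵐ k : Fin n → Mom d, P ⟨n, k⟩ := by
  unfold lebesguePoisson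
  rw [Measure.ae_sum_iff]
  refine forall_congr' fun n => ?_
  rw [Measure.ae_ennreal_smul_measure_iff (by simp), (measurableEmbedding_mk n).ae_map_iff]

lemma lintegral_config (g : Config d → ℝ≥0∞) :
    ∫⁻ Q, g Q ∂lebesguePoisson d = ∑' n : ℕ, (n.factorial : ℝ≥0∞)⁻¹ * ∫⁻ k, g ⟨n, k⟩ := by
  unfold lebesguePoisson
  rw [lintegral_sum_measure]
  refine tsum_congr fun n => ?_
  rw [lintegral_smul_measure, (measurableEmbedding_mk n).lintegral_map, smul_eq_mul]

lemma measurable_of_levels {β γ : Type*} [MeasurableSpace β] [MeasurableSpace γ]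
    {f : Config d × β → γ} (hf : ∀ n, Measurable fun z : (Fin n → Mom d) × β => f (⟨n, z.1⟩, z.2)) :
    Measurable f := fun t ht => by
  have hemb : ∀ n, MeasurableEmbedding
      (Prod.map (fun k : Fin n → Mom d => (⟨n, k⟩ : Config d)) (id : β → β)) := fun n =>
    (measurableEmbedding_mk n).prodMap MeasurableEmbedding.id
  have : f ⁻¹' t = ⋃ n, Prod.map (fun k : Fin n → Mom d => (⟨n, k⟩ : Config d)) (id : β → β) ''
      ((fun z : (Fin n → Mom d) × β => f (⟨n, z.1⟩, z.2)) ⁻¹' t) := by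
    ext ⟨⟨n, k⟩, b⟩
    simp only [Set.mem_preimage, Set.mem_iUnion, Set.mem_image, Prod.exists, Prod.map_apply, id]
    constructor
    · exact fun h => ⟨n, k, b, h, rfl⟩
    · rintro ⟨m, l, b', h, h'⟩
      rw [← h']; exact h
  rw [this]
  exact .iUnion fun n => (hemb n).measurableSet_image' (hf n ht)

/-- `Q ∪ {q}`. -/
abbrev insertMom (Q : Config d) (q : Mom d) : Config d := ⟨Q.1 + 1, Fin.cons q Q.2⟩

lemma measurable_finCons (n : ℕ) :
    Measurable fun z : (Fin n → Mom d) × Mom d => (Fin.cons z.2 z.1 : Fin (n + 1) → Mom d) := by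
  refine measurable_pi_iff.2 fun i => ?_
  refine Fin.cases ?_ (fun i => ?_) i
  · simpa using measurable_snd
  · simp only [Fin.cons_succ]
    exact (measurable_pi_apply i).comp measurable_fst

lemma measurable_insertMom : Measurable fun z : Config d × Mom d => insertMom z.1 z.2 :=
  measurable_of_levels fun n => (measurable_sigma_mk (n + 1)).comp (measurable_finCons n)

/-! ### Removing and adding one momentum -/

lemma measurePreserving_remove {n : ℕ} (j : Fin (n + 1)) :
    MeasurePreserving (fun k : Fin (n + 1) → Mom d => (k j, fun i => k (j.succAbove i)))
      volume (volume.prod volume) :=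
  volume_preserving_piFinSuccAbove (fun _ => Mom d) j

lemma lintegral_remove {n : ℕ} (j : Fin (n + 1)) {h : Mom d → (Fin n → Mom d) → ℝ≥0∞}
    (hh : Measurable (Function.uncurry h)) :
    ∫⁻ k : Fin (n + 1) → Mom d, h (k j) (fun i => k (j.succAbove i)) = ∫⁻ k, ∫⁻ q, h q k := by
  have := (measurePreserving_remove (d := d) j).lintegral_comp hh
  rw [lintegral_prod_symm _ hh.aemeasurable] at this
  exact this

lemma ae_remove {n : ℕ} {P : (Fin n → Mom d) → Prop} (hP : ∀ᵐ k, P k) (j : Fin (n + 1)) :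
    ∀ᵐ k : Fin (n + 1) → Mom d, P fun i => k (j.succAbove i) :=
  (Measure.quasiMeasurePreserving_snd.comp
    (measurePreserving_remove (d := d) j).quasiMeasurePreserving).ae hP

lemma measurePreserving_cons (n : ℕ) :
    MeasurePreserving (fun z : (Fin n → Mom d) × Mom d => (Fin.cons z.2 z.1 : Fin (n + 1) → Mom d))
      (volume.prod volume) volume := by
  have h := ((volume_preserving_piFinSuccAbove (fun _ : Fin (n + 1) => Mom d) 0).symm).comp
    (Measure.measurePreserving_swap (μ := (volume : Measure (Fin n → Mom d)))
      (ν := (volume : Measure (Mom d))))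
  convert! h using 1
  ext z
  simp [MeasurableEquiv.piFinSuccAbove, Fin.insertNthEquiv]

lemma lintegral_cons {n : ℕ} {h : (Fin (n + 1) → Mom d) → ℝ≥0∞} (hh : Measurable h) :
    ∫⁻ k, ∫⁻ q, h (Fin.cons q k) = ∫⁻ k, h k := by
  rw [← (measurePreserving_cons n).lintegral_comp hh]
  exact (lintegral_prod _ (hh.comp (measurable_finCons n)).aemeasurable).symm

lemma ae_cons {n : ℕ} {P : (Fin (n + 1) → Mom d) → Prop} (hP : ∀ᵐ k, P k) :
    ∀ᵐ k : Fin n → Mom d, ∀ᵐ q : Mom d, P (Fin.cons q k) :=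
  Measure.ae_ae_of_ae_prod ((measurePreserving_cons n).quasiMeasurePreserving.ae hP)

lemma ae_insertMom {P : Config d → Prop} (hP : ∀ᵐ Q ∂lebesguePoisson d, P Q) :
    ∀ᵐ Q ∂lebesguePoisson d, ∀ᵐ q : Mom d, P (insertMom Q q) :=
  ae_config_iff.2 fun n => ae_cons (ae_config_iff.1 hP (n + 1))

/-- `∑_{q ∈ Q} g(q, Q \ q)`. -/
def sumRemove {A : Type*} [AddCommMonoid A] (g : Mom d → Config d → A) : Config d → A
  | ⟨0, _⟩ => 0
  | ⟨n + 1, k⟩ => ∑ j : Fin (n + 1), g (k j) ⟨n, fun i => k (j.succAbove i)⟩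

lemma inv_factorial_succ_mul (n : ℕ) :
    (((n + 1).factorial : ℝ≥0∞))⁻¹ * (n + 1 : ℕ) = (n.factorial : ℝ≥0∞)⁻¹ := by
  have h1 : ((n + 1 : ℕ) : ℝ≥0∞) ≠ 0 := by simp
  have h2 : ((n + 1 : ℕ) : ℝ≥0∞) ≠ ∞ := ENNReal.natCast_ne_top _
  rw [Nat.factorial_succ, Nat.cast_mul, ENNReal.mul_inv (.inl h1) (.inl h2), mul_comm,
    ← mul_assoc, ENNReal.mul_inv_cancel h1 h2, one_mul]

/-- Mecke formula. -/
lemma lintegral_sumRemove {g : Mom d → Config d → ℝ≥0∞} (hg : Measurable (Function.uncurry g)) :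
    ∫⁻ Q, sumRemove g Q ∂lebesguePoisson d = ∫⁻ Q, (∫⁻ q, g q Q) ∂lebesguePoisson d := by
  rw [lintegral_config, lintegral_config, tsum_eq_zero_add' ENNReal.summable]
  simp only [sumRemove, lintegral_zero, mul_zero, zero_add]
  refine tsum_congr fun n => ?_
  have hgn : Measurable (Function.uncurry fun q (k : Fin n → Mom d) => g q ⟨n, k⟩) :=
    hg.comp (measurable_fst.prodMk ((measurable_sigma_mk n).comp measurable_snd))
  have hgj : ∀ j : Fin (n + 1), Measurable fun k : Fin (n + 1) → Mom d =>
      g (k j) ⟨n, fun i => k (j.succAbove i)⟩ :=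
    fun j => hgn.comp (measurePreserving_remove (d := d) j).measurable
  rw [lintegral_finsetSum _ fun j _ => hgj j]
  simp_rw [fun j => lintegral_remove (d := d) j hgn]
  rw [Finset.sum_const, Finset.card_univ, Fintype.card_fin, nsmul_eq_mul, ← mul_assoc,
    inv_factorial_succ_mul]

/-- Adding a momentum passes from `n` to `n + 1` bosons; the mismatch of the factorials is the
factor `n + 1`, the boson number of the larger configuration. -/
lemma lintegral_insertMom {h : Config d → ℝ≥0∞} (hh : Measurable h) :
    ∫⁻ Q, (∫⁻ q, h (insertMom Q q)) ∂lebesguePoisson d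
      = ∫⁻ Q, Q.1 * h Q ∂lebesguePoisson d := by
  rw [lintegral_config, lintegral_config]
  conv_rhs => rw [tsum_eq_zero_add' ENNReal.summable]
  simp only [Nat.cast_zero, zero_mul, lintegral_zero, mul_zero, zero_add]
  refine tsum_congr fun n => ?_
  have hm : Measurable fun k : Fin (n + 1) → Mom d => h ⟨n + 1, k⟩ :=
    hh.comp (measurable_sigma_mk _)
  rw [lintegral_const_mul _ hm, ← mul_assoc, inv_factorial_succ_mul, ← lintegral_cons hm]

/-! ### Symmetric functions of configurations -/

/-- Almost everywhere invariance under relabelling. -/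
def IsSymm {A : Type*} (F : Config d → A) : Prop :=
  ∀ (n : ℕ) (π : Equiv.Perm (Fin n)), ∀ᵐ k : Fin n → Mom d, F ⟨n, fun j => k (π j)⟩ = F ⟨n, k⟩

lemma isSymm_iff_relabel {A : Type*} {F : Config d → A} :
    IsSymm F ↔ ∀ s, (fun Q => F (relabel s Q)) =ᵐ[lebesguePoisson d] F := by
  refine ⟨fun h s => ae_config_iff.2 fun n => h n (s n), fun h n π => ?_⟩
  have := ae_config_iff.1 (h (Function.update (fun m => (1 : Equiv.Perm (Fin m))) n π)) n
  simpa [relabel] using this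

lemma IsSymm.congr {A : Type*} {F F' : Config d → A} (h : IsSymm F)
    (hF : F =ᵐ[lebesguePoisson d] F') : IsSymm F' := by
  rw [isSymm_iff_relabel] at h ⊢
  intro s
  have h2 := (measurePreserving_relabel s).quasiMeasurePreserving.ae_eq hF
  exact h2.symm.trans ((h s).trans hF)

/-- Removing the entry `j` and putting it back in front is a cyclic permutation of the labels. -/
lemma IsSymm.insert_remove {A : Type*} {G : Config d → A} (h : IsSymm G) {n : ℕ}
    (j : Fin (n + 1)) : ∀ᵐ k : Fin (n + 1) → Mom d,
      G ⟨n + 1, Fin.cons (k j) fun i => k (j.succAbove i)⟩ = G ⟨n + 1, k⟩ := by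
  filter_upwards [h (n + 1) (Equiv.symm j.cycleRange)] with k hk
  rw [← hk]
  congr 2
  ext i
  refine Fin.cases ?_ (fun i => ?_) i
  · rw [Fin.cons_zero, Fin.cycleRange_symm_zero]
  · rw [Fin.cons_succ, Fin.cycleRange_symm_succ]

/-- The permutation induced on the labels that remain when `j` is removed; it is needed for the
symmetry of creation. -/
lemma exists_perm_succAbove {n : ℕ} (π : Equiv.Perm (Fin (n + 1))) (j : Fin (n + 1)) :
    ∃ τ : Equiv.Perm (Fin n), ∀ i, π (j.succAbove i) = (π j).succAbove (τ i) := by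
  refine ⟨((finSuccAboveEquiv j).trans (π.subtypeEquiv (q := fun x => x ≠ π j) fun a => by
    simp)).trans (finSuccAboveEquiv (π j)).symm, fun i => ?_⟩
  have h := (finSuccAboveEquiv (π j)).apply_symm_apply
    ((π.subtypeEquiv (q := fun x => x ≠ π j) fun a => by simp) (finSuccAboveEquiv j i))
  exact (congrArg Subtype.val h).symm

/-- A relabelling permutes the terms of the sum, and each reduced configuration undergoes the
induced permutation, which the symmetry of `F` absorbs. -/
lemma IsSymm.addOne {F : Config d → Spin} (hF : IsSymm F) (φ : Mom d → ℂ) :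
    IsSymm (addOne φ F) := by
  intro n π
  cases n with
  | zero => exact .of_forall fun k => rfl
  | succ n =>
    choose τ hτ using exists_perm_succAbove π
    have h : ∀ j, ∀ᵐ k : Fin (n + 1) → Mom d,
        F ⟨n, fun i => k ((π j).succAbove (τ j i))⟩ = F ⟨n, fun i => k ((π j).succAbove i)⟩ :=
      fun j => ae_remove (hF n (τ j)) (π j)
    filter_upwards [ae_all_iff.2 h] with k hk
    simp only [Model.addOne, hτ, hk]
    exact Equiv.sum_comp π fun j => φ (k j) • F ⟨n, fun i => k (j.succAbove i)⟩

/-- `∫ conj φ(q) F(Q ∪ q) dq`. -/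
def annOne (φ : Mom d → ℂ) (F : Config d → Spin) (Q : Config d) : Spin :=
  ∫ q : Mom d, (starRingEnd ℂ (φ q)) • F (insertMom Q q)

lemma IsSymm.annOne {F : Config d → Spin} (hF : IsSymm F) (φ : Mom d → ℂ) :
    IsSymm (annOne φ F) := by
  intro n π
  have h := ae_cons (hF (n + 1) (Equiv.Perm.decomposeFin.symm (0, π)))
  filter_upwards [h] with k hk
  refine integral_congr_ae ?_
  filter_upwards [hk] with q hq
  simp only [insertMom] at hq ⊢
  rw [← hq]
  congr 3
  ext i
  refine Fin.cases ?_ (fun i => ?_) i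
  · simp
  · simp

/-! ### Creation and annihilation -/


lemma measurable_addOne {φ : Mom d → ℂ} (hφ : Measurable φ) {F : Config d → Spin}
    (hF : Measurable F) : Measurable (addOne φ F) := by
  refine measurable_config fun n => ?_
  cases n with
  | zero => exact measurable_const
  | succ n =>
    simp only [Model.addOne]
    refine Finset.measurable_sum _ fun j _ => ?_
    have h1 : Measurable fun k : Fin (n + 1) → Mom d => φ (k j) := hφ.comp (measurable_pi_apply j)
    have h2 : Measurable fun k : Fin (n + 1) → Mom d =>
        F ⟨n, fun i => k (j.succAbove i)⟩ :=
      hF.comp ((measurable_sigma_mk n).comp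
        (measurable_pi_lambda _ fun i => measurable_pi_apply _))
    exact h1.smul h2

lemma measurable_annOne_integrand {φ : Mom d → ℂ} (hφ : Measurable φ) {F : Config d → Spin}
    (hF : Measurable F) :
    Measurable fun z : Config d × Mom d => (starRingEnd ℂ (φ z.2)) • F (insertMom z.1 z.2) :=
  (Complex.continuous_conj.measurable.comp (hφ.comp measurable_snd)).smul
    (hF.comp measurable_insertMom)

lemma measurable_annOne {φ : Mom d → ℂ} (hφ : Measurable φ) {F : Config d → Spin}
    (hF : Measurable F) : Measurable (annOne φ F) := by
  have h := (measurable_annOne_integrand hφ hF).stronglyMeasurable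
  exact (h.integral_prod_right (ν := volume)).measurable

lemma addOne_congr {φ φ' : Mom d → ℂ} (hφ : φ =ᵐ[volume] φ') {F F' : Config d → Spin}
    (hF : F =ᵐ[lebesguePoisson d] F') : addOne φ F =ᵐ[lebesguePoisson d] addOne φ' F' := by
  refine ae_config_iff.2 fun n => ?_
  cases n with
  | zero => exact .of_forall fun k => rfl
  | succ n =>
    have h1 : ∀ j : Fin (n + 1), ∀ᵐ k : Fin (n + 1) → Mom d, φ (k j) = φ' (k j) := fun j =>
      (Measure.quasiMeasurePreserving_fst.comp
        (measurePreserving_remove (d := d) j).quasiMeasurePreserving).ae hφ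
    have h2 := fun j : Fin (n + 1) => ae_remove (ae_config_iff.1 hF n) j
    filter_upwards [ae_all_iff.2 h1, ae_all_iff.2 h2] with k h1 h2
    simp only [Model.addOne, h1, h2]

lemma annOne_congr {φ φ' : Mom d → ℂ} (hφ : φ =ᵐ[volume] φ') {F F' : Config d → Spin}
    (hF : F =ᵐ[lebesguePoisson d] F') : annOne φ F =ᵐ[lebesguePoisson d] annOne φ' F' := by
  filter_upwards [ae_insertMom hF] with Q hQ
  refine integral_congr_ae ?_
  filter_upwards [hQ, hφ] with q h1 h2
  rw [h1, h2]

lemma addOne_add (φ : Mom d → ℂ) (F G : Config d → Spin) :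
    addOne φ (fun Q => F Q + G Q) = fun Q => addOne φ F Q + addOne φ G Q := by
  ext ⟨n, k⟩ : 1
  cases n with
  | zero => simp [Model.addOne]
  | succ n => simp [Model.addOne, smul_add, Finset.sum_add_distrib]

lemma addOne_smul (φ : Mom d → ℂ) (c : ℂ) (F : Config d → Spin) :
    addOne φ (fun Q => c • F Q) = fun Q => c • addOne φ F Q := by
  ext ⟨n, k⟩ : 1
  cases n with
  | zero => simp [Model.addOne]
  | succ n => simp only [Model.addOne, Finset.smul_sum, smul_comm c]

lemma addOne_add_left (φ ψ : Mom d → ℂ) (F : Config d → Spin) :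
    addOne (fun q => φ q + ψ q) F = fun Q => addOne φ F Q + addOne ψ F Q := by
  ext ⟨n, k⟩ : 1
  cases n with
  | zero => simp [Model.addOne]
  | succ n => simp [Model.addOne, add_smul, Finset.sum_add_distrib]

lemma addOne_smul_left (c : ℂ) (φ : Mom d → ℂ) (F : Config d → Spin) :
    addOne (fun q => c * φ q) F = fun Q => c • addOne φ F Q := by
  ext ⟨n, k⟩ : 1
  cases n with
  | zero => simp [Model.addOne]
  | succ n => simp only [Model.addOne, Finset.smul_sum, mul_smul]

lemma annOne_smul (φ : Mom d → ℂ) (c : ℂ) (F : Config d → Spin) :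
    annOne φ (fun Q => c • F Q) = fun Q => c • annOne φ F Q := by
  ext Q : 1
  unfold annOne
  rw [← integral_smul]
  simp_rw [smul_comm c]

/-! ### Bounds -/

lemma enorm_sum_sq_le {m : ℕ} (v : Fin m → Spin) :
    ‖∑ j, v j‖ₑ ^ 2 ≤ m * ∑ j, ‖v j‖ₑ ^ 2 := by
  have h1 : ‖∑ j, v j‖ ^ 2 ≤ m * ∑ j, ‖v j‖ ^ 2 :=
    calc ‖∑ j, v j‖ ^ 2 ≤ (∑ j, ‖v j‖) ^ 2 := by gcongr; exact norm_sum_le _ _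
      _ ≤ _ := by simpa using sq_sum_le_card_mul_sum_sq (s := Finset.univ) (f := fun j => ‖v j‖)
  have h2 := ENNReal.ofReal_le_ofReal h1
  rw [ENNReal.ofReal_pow (norm_nonneg _), ofReal_norm, ENNReal.ofReal_mul (by positivity),
    ENNReal.ofReal_natCast, ENNReal.ofReal_sum_of_nonneg fun j _ => by positivity] at h2
  simpa only [ENNReal.ofReal_pow (norm_nonneg _), ofReal_norm] using h2

lemma enorm_addOne_sq_le (φ : Mom d → ℂ) (F : Config d → Spin) (Q : Config d) :
    ‖addOne φ F Q‖ₑ ^ 2 ≤ Q.1 * sumRemove (fun q Q' => ‖φ q‖ₑ ^ 2 * ‖F Q'‖ₑ ^ 2) Q := by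
  obtain ⟨n, k⟩ := Q
  cases n with
  | zero => simp [Model.addOne]
  | succ n =>
    refine (enorm_sum_sq_le _).trans_eq ?_
    simp only [sumRemove, enorm_smul, mul_pow]

/-- The Cauchy-Schwarz inequality for the sum over the bosons costs the boson number, and the Mecke
formula moves the rest to configurations with one boson less. The weight `W` permits iteration in
products of two field operators. -/
lemma lintegral_addOne_le {φ : Mom d → ℂ} (hφ : Measurable φ) {F : Config d → Spin}
    (hF : Measurable F) (W : ℕ → ℝ≥0∞) :
    ∫⁻ Q, W Q.1 * ‖addOne φ F Q‖ₑ ^ 2 ∂lebesguePoisson d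
      ≤ (∫⁻ q, ‖φ q‖ₑ ^ 2) * ∫⁻ Q, W (Q.1 + 1) * (Q.1 + 1 : ℕ) * ‖F Q‖ₑ ^ 2 ∂lebesguePoisson d := by
  have hW : ∀ V : ℕ → ℝ≥0∞, Measurable fun Q : Config d => V Q.1 := fun V =>
    (Measurable.of_discrete (f := V)).comp measurable_card
  have hg : Measurable (Function.uncurry fun (q : Mom d) (Q : Config d) =>
      W (Q.1 + 1) * (Q.1 + 1 : ℕ) * ‖F Q‖ₑ ^ 2 * ‖φ q‖ₑ ^ 2) :=
    ((((hW fun n => W (n + 1) * (n + 1 : ℕ)).comp measurable_snd).mul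
      ((hF.comp measurable_snd).enorm.pow_const 2))).mul
      ((hφ.comp measurable_fst).enorm.pow_const 2)
  calc _ ≤ ∫⁻ Q, sumRemove (fun q Q' => W (Q'.1 + 1) * (Q'.1 + 1 : ℕ) * ‖F Q'‖ₑ ^ 2 * ‖φ q‖ₑ ^ 2) Q
        ∂lebesguePoisson d := by
        refine lintegral_mono fun Q => ?_
        refine (mul_le_mul_right (enorm_addOne_sq_le φ F Q) _).trans_eq ?_
        obtain ⟨n, k⟩ := Q
        cases n with
        | zero => simp [sumRemove]
        | succ n =>
          simp only [sumRemove, Finset.mul_sum]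
          refine Finset.sum_congr rfl fun j _ => by ring
    _ = _ := by
        rw [lintegral_sumRemove hg, mul_comm, ← lintegral_mul_const]
        · refine lintegral_congr fun Q => ?_
          rw [← lintegral_const_mul _ (by fun_prop)]
        · exact (hW fun n => W (n + 1) * (n + 1 : ℕ)).mul (hF.enorm.pow_const 2)

lemma lintegral_mul_sq_le {X : Type*} [MeasurableSpace X] {μ : Measure X} {f g : X → ℝ≥0∞}
    (hf : AEMeasurable f μ) (hg : AEMeasurable g μ) :
    (∫⁻ x, f x * g x ∂μ) ^ 2 ≤ (∫⁻ x, f x ^ 2 ∂μ) * ∫⁻ x, g x ^ 2 ∂μ := by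
  have h := ENNReal.lintegral_mul_le_Lp_mul_Lq μ (p := 2) (q := 2)
    Real.HolderConjugate.two_two hf hg
  have h2 : (∫⁻ x, (f * g) x ∂μ) ^ 2 ≤ ((∫⁻ a, f a ^ (2 : ℝ) ∂μ) ^ (1 / (2 : ℝ)) *
      (∫⁻ a, g a ^ (2 : ℝ) ∂μ) ^ (1 / (2 : ℝ))) ^ 2 := by gcongr
  refine h2.trans_eq ?_
  rw [mul_pow, ← ENNReal.rpow_natCast, ← ENNReal.rpow_natCast, ← ENNReal.rpow_mul,
    ← ENNReal.rpow_mul]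
  simp

lemma enorm_annOne_sq_le {φ : Mom d → ℂ} (hφ : AEMeasurable φ) {F : Config d → Spin}
    (hF : Measurable F) (Q : Config d) :
    ‖annOne φ F Q‖ₑ ^ 2 ≤ (∫⁻ q, ‖φ q‖ₑ ^ 2) * ∫⁻ q, ‖F (insertMom Q q)‖ₑ ^ 2 := by
  have h1 : Measurable fun q => F (insertMom Q q) :=
    hF.comp (measurable_insertMom.comp measurable_prodMk_left)
  refine le_trans ?_ (lintegral_mul_sq_le hφ.enorm h1.enorm.aemeasurable)
  gcongr
  refine (enorm_integral_le_lintegral_enorm _).trans_eq (lintegral_congr fun q => ?_)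
  rw [enorm_smul, ← ofReal_norm, RCLike.norm_conj, ofReal_norm]

/-- The Cauchy-Schwarz inequality in the inserted momentum; the integral over it then becomes the
boson number. -/
lemma lintegral_annOne_le {φ : Mom d → ℂ} (hφ : AEMeasurable φ) {F : Config d → Spin}
    (hF : Measurable F) (W : ℕ → ℝ≥0∞) :
    ∫⁻ Q, W (Q.1 + 1) * ‖annOne φ F Q‖ₑ ^ 2 ∂lebesguePoisson d
      ≤ (∫⁻ q, ‖φ q‖ₑ ^ 2) * ∫⁻ Q, Q.1 * (W Q.1 * ‖F Q‖ₑ ^ 2) ∂lebesguePoisson d := by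
  have hW : Measurable fun Q : Config d => W Q.1 :=
    (Measurable.of_discrete (f := W)).comp measurable_card
  have hFW : Measurable fun Q : Config d => W Q.1 * ‖F Q‖ₑ ^ 2 := hW.mul (hF.enorm.pow_const 2)
  have hFi : Measurable fun Q : Config d =>
      ∫⁻ q, W (insertMom Q q).1 * ‖F (insertMom Q q)‖ₑ ^ 2 :=
    Measurable.lintegral_prod_right' (hFW.comp measurable_insertMom)
  rw [← lintegral_insertMom hFW, ← lintegral_const_mul _ hFi]
  refine lintegral_mono fun Q => ?_
  refine (mul_le_mul_right (enorm_annOne_sq_le hφ hF Q) _).trans_eq ?_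
  have hFm : Measurable fun q => F (insertMom Q q) :=
    hF.comp (measurable_insertMom.comp measurable_prodMk_left)
  have e : ∫⁻ q, W (insertMom Q q).1 * ‖F (insertMom Q q)‖ₑ ^ 2
      = W (Q.1 + 1) * ∫⁻ q, ‖F (insertMom Q q)‖ₑ ^ 2 :=
    lintegral_const_mul (μ := (volume : Measure (Mom d))) (W (Q.1 + 1)) (hFm.enorm.pow_const 2)
  rw [e]; ring

lemma memLp_two_iff_lintegral {X V : Type*} [MeasurableSpace X] {μ : Measure X}
    [NormedAddCommGroup V] {f : X → V} :
    MemLp f 2 μ ↔ AEStronglyMeasurable f μ ∧ ∫⁻ x, ‖f x‖ₑ ^ 2 ∂μ < ∞ := by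
  unfold MemLp
  rw [eLpNorm_lt_top_iff_lintegral_rpow_enorm_lt_top two_ne_zero ENNReal.ofNat_ne_top]
  simp

/-- The integral over all configurations of the inserted function would produce the boson number,
which need not be integrable against `‖F‖²`. The weight `1 / N` cancels it, and for a fixed
configuration this weight is a positive constant. -/
lemma ae_memLp_insertMom {F : Config d → Spin} (hF : Measurable F)
    (hF2 : MemLp F 2 (lebesguePoisson d)) :
    ∀ᵐ Q ∂lebesguePoisson d, MemLp (fun q => F (insertMom Q q)) 2 volume := by
  have hW : Measurable fun Q : Config d => ((Q.1 : ℝ≥0∞))⁻¹ :=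
    (Measurable.of_discrete (f := fun n : ℕ => ((n : ℝ≥0∞))⁻¹)).comp measurable_card
  have hm : Measurable fun Q : Config d => (Q.1 : ℝ≥0∞)⁻¹ * ‖F Q‖ₑ ^ 2 :=
    hW.mul (hF.enorm.pow_const 2)
  have h1 : ∫⁻ Q, (∫⁻ q, ((insertMom Q q).1 : ℝ≥0∞)⁻¹ * ‖F (insertMom Q q)‖ₑ ^ 2)
      ∂lebesguePoisson d ≠ ∞ := by
    rw [lintegral_insertMom hm]
    refine ((lintegral_mono fun Q => ?_).trans_lt (memLp_two_iff_lintegral.1 hF2).2).ne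
    rw [← mul_assoc]
    exact mul_le_of_le_one_left' (ENNReal.mul_inv_le_one _)
  filter_upwards [ae_lt_top (Measurable.lintegral_prod_right' (hm.comp measurable_insertMom)) h1]
    with Q hQ
  have hFm : Measurable fun q => F (insertMom Q q) :=
    hF.comp (measurable_insertMom.comp measurable_prodMk_left)
  refine memLp_two_iff_lintegral.2 ⟨hFm.aestronglyMeasurable, ?_⟩
  have e : ∫⁻ q, ((insertMom Q q).1 : ℝ≥0∞)⁻¹ * ‖F (insertMom Q q)‖ₑ ^ 2
      = ((Q.1 + 1 : ℕ) : ℝ≥0∞)⁻¹ * ∫⁻ q, ‖F (insertMom Q q)‖ₑ ^ 2 :=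
    lintegral_const_mul (μ := (volume : Measure (Mom d))) ((Q.1 + 1 : ℕ) : ℝ≥0∞)⁻¹
      (hFm.enorm.pow_const 2)
  replace hQ := e.symm.trans_lt hQ
  by_contra hc
  rw [not_lt, top_le_iff] at hc
  rw [hc, ENNReal.mul_top (by simp)] at hQ
  exact lt_irrefl _ hQ

lemma integrable_conj_smul {φ : Mom d → ℂ} (hφ : MemLp φ 2 volume) {f : Mom d → Spin}
    (hf : MemLp f 2 volume) : Integrable (fun q => (starRingEnd ℂ (φ q)) • f q) :=
  memLp_one_iff_integrable.1 (hf.smul (r := 1) hφ.star)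

lemma ae_integrable_annOne {φ : Mom d → ℂ} (hφ : MemLp φ 2 volume) {F : Config d → Spin}
    (hF : Measurable F) (hF2 : MemLp F 2 (lebesguePoisson d)) :
    ∀ᵐ Q ∂lebesguePoisson d, Integrable fun q => (starRingEnd ℂ (φ q)) • F (insertMom Q q) := by
  filter_upwards [ae_memLp_insertMom hF hF2] with Q hQ using integrable_conj_smul hφ hQ

lemma annOne_add {φ : Mom d → ℂ} (hφ : MemLp φ 2 volume) {F G : Config d → Spin}
    (hF : Measurable F) (hF2 : MemLp F 2 (lebesguePoisson d))
    (hG : Measurable G) (hG2 : MemLp G 2 (lebesguePoisson d)) :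
    annOne φ (fun Q => F Q + G Q) =ᵐ[lebesguePoisson d] fun Q => annOne φ F Q + annOne φ G Q := by
  filter_upwards [ae_integrable_annOne hφ hF hF2, ae_integrable_annOne hφ hG hG2] with Q h1 h2
  unfold annOne
  rw [← integral_add h1 h2]
  simp_rw [smul_add]

/-! ### The spin matrices -/

/-- A `2 × 2` matrix as an operator on spin space. -/
def actL (A : Matrix (Fin 2) (Fin 2) ℂ) : Spin →L[ℂ] Spin :=
  LinearMap.toContinuousLinearMap
    { toFun := act A
      map_add' := fun v w => by
        simp only [act, WithLp.ofLp_add, Matrix.mulVec_add, WithLp.toLp_add]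
      map_smul' := fun c v => by
        simp only [act, WithLp.ofLp_smul, Matrix.mulVec_smul, WithLp.toLp_smul, RingHom.id_apply] }

lemma actL_apply (A : Matrix (Fin 2) (Fin 2) ℂ) (v : Spin) : actL A v = act A v := rfl

lemma norm_act_sigma3 (v : Spin) : ‖act sigma3 v‖ = ‖v‖ := by
  rw [EuclideanSpace.norm_eq, EuclideanSpace.norm_eq]
  simp [act, sigma3, Fin.sum_univ_two, dotProduct]

lemma norm_act_sigma1 (v : Spin) : ‖act sigma1 v‖ = ‖v‖ := by
  rw [EuclideanSpace.norm_eq, EuclideanSpace.norm_eq]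
  simp [act, sigma1, Fin.sum_univ_two, dotProduct, add_comm]

lemma inner_act_sigma3 (v w : Spin) : inner ℂ (act sigma3 v) w = inner ℂ v (act sigma3 w) := by
  simp [act, sigma3, dotProduct, PiLp.inner_apply, Fin.sum_univ_two]

lemma inner_act_sigma1 (v w : Spin) : inner ℂ (act sigma1 v) w = inner ℂ v (act sigma1 w) := by
  simp [act, sigma1, dotProduct, PiLp.inner_apply, Fin.sum_univ_two, add_comm]

lemma addOne_act (A : Matrix (Fin 2) (Fin 2) ℂ) (φ : Mom d → ℂ) (F : Config d → Spin) :
    addOne φ (fun Q => act A (F Q)) = fun Q => act A (addOne φ F Q) := by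
  ext ⟨n, k⟩ : 1
  cases n with
  | zero => exact ((actL A).map_zero).symm
  | succ n => simp only [Model.addOne, ← actL_apply, map_sum, map_smul]

lemma annOne_act (A : Matrix (Fin 2) (Fin 2) ℂ) {φ : Mom d → ℂ} (hφ : MemLp φ 2 volume)
    {F : Config d → Spin} (hF : Measurable F) (hF2 : MemLp F 2 (lebesguePoisson d)) :
    annOne φ (fun Q => act A (F Q)) =ᵐ[lebesguePoisson d] fun Q => act A (annOne φ F Q) := by
  filter_upwards [ae_integrable_annOne hφ hF hF2] with Q h1
  unfold annOne
  rw [← actL_apply, ← ContinuousLinearMap.integral_comp_comm _ h1]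
  simp only [map_smul, actL_apply]

/-! ### Commutation relations -/

lemma cons_succ_succAbove {n : ℕ} (q : Mom d) (k : Fin (n + 1) → Mom d) (j : Fin (n + 1)) :
    (fun i => (Fin.cons q k : Fin (n + 2) → Mom d) (j.succ.succAbove i))
      = Fin.cons q fun i => k (j.succAbove i) := by
  ext i : 1
  refine Fin.cases ?_ (fun i => ?_) i
  · simp
  · simp

lemma cons_zero_succAbove {n : ℕ} (q : Mom d) (k : Fin n → Mom d) :
    (fun i => (Fin.cons q k : Fin (n + 1) → Mom d) (Fin.succAbove 0 i)) = k := by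
  ext i : 1
  simp

/-- The canonical commutation relation: from `Q ∪ q` one removes either the inserted `q`, which
produces the scalar product, or a momentum of `Q`, which produces the product in the opposite order.
-/
lemma annOne_addOne {φ ψ : Mom d → ℂ} (hφ : MemLp φ 2 volume) (hψ : MemLp ψ 2 volume)
    {F : Config d → Spin} (hF : Measurable F) (hF2 : MemLp F 2 (lebesguePoisson d)) :
    annOne φ (addOne ψ F) =ᵐ[lebesguePoisson d] fun Q =>
      addOne ψ (annOne φ F) Q + (∫ q, starRingEnd ℂ (φ q) * ψ q) • F Q := by
  have hi : Integrable fun q => starRingEnd ℂ (φ q) * ψ q :=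
    (hφ.star.integrable_mul hψ)
  refine ae_config_iff.2 fun n => ?_
  cases n with
  | zero =>
    refine .of_forall fun k => ?_
    simp only [annOne, Model.addOne, Fin.sum_univ_succ, Finset.univ_eq_empty,
      Finset.sum_empty, add_zero, Fin.cons_zero, zero_add, smul_smul, cons_zero_succAbove]
    rw [integral_smul_const]
  | succ n =>
    have h := fun j : Fin (n + 1) =>
      ae_remove (ae_config_iff.1 (ae_integrable_annOne hφ hF hF2) n) j
    filter_upwards [ae_all_iff.2 h] with k hk
    have e : ∀ q, (starRingEnd ℂ (φ q)) • addOne ψ F (insertMom ⟨n + 1, k⟩ q)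
        = ((starRingEnd ℂ (φ q)) * ψ q) • F ⟨n + 1, k⟩ + ∑ j : Fin (n + 1), ψ (k j) •
          ((starRingEnd ℂ (φ q)) • F (insertMom ⟨n, fun i => k (j.succAbove i)⟩ q)) := fun q => by
      simp only [insertMom, Model.addOne, Fin.sum_univ_succ (n := n + 1), Fin.cons_zero,
        cons_zero_succAbove, Fin.cons_succ, cons_succ_succAbove, smul_add, smul_smul,
        Finset.smul_sum, mul_comm (ψ _)]
    unfold annOne
    simp_rw [e]
    have hj : ∀ j : Fin (n + 1), Integrable fun q => ψ (k j) •
        ((starRingEnd ℂ (φ q)) • F (insertMom ⟨n, fun i => k (j.succAbove i)⟩ q)) :=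
      fun j => (hk j).smul (ψ (k j))
    rw [integral_add (hi.smul_const _) (integrable_finsetSum _ fun j _ => hj j),
      integral_finsetSum _ (fun j _ => hj j), integral_smul_const, add_comm]
    simp only [integral_smul, Model.addOne]

/-- Two momenta are removed in either order; `succAbove` and `predAbove` give the involution between
the two enumerations of the ordered pairs. -/
lemma addOne_comm (φ ψ : Mom d → ℂ) (F : Config d → Spin) :
    addOne φ (addOne ψ F) = addOne ψ (addOne φ F) := by
  ext ⟨n, k⟩ : 1
  match n with
  | 0 => rfl
  | 1 => simp [Model.addOne]
  | n + 2 =>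
    simp only [Model.addOne, Finset.smul_sum, ← Finset.sum_product']
    refine Finset.sum_nbij' (fun z => (z.1.succAbove z.2, z.2.predAbove z.1))
      (fun z => (z.1.succAbove z.2, z.2.predAbove z.1)) (by simp) (by simp) ?_ ?_ ?_
    · rintro ⟨i, j⟩ -
      simp [Fin.succAbove_succAbove_predAbove, Fin.predAbove_predAbove_succAbove]
    · rintro ⟨i, j⟩ -
      simp [Fin.succAbove_succAbove_predAbove, Fin.predAbove_predAbove_succAbove]
    · rintro ⟨i, j⟩ -
      simp only [Fin.succAbove_succAbove_predAbove, Fin.succAbove_succAbove_succAbove_predAbove]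
      rw [smul_comm]

lemma omQ_smul_addOne (p : Model d) (φ : Mom d → ℂ) (F : Config d → Spin) (Q : Config d) :
    (p.omQ Q : ℂ) • addOne φ F Q = addOne (fun q => (p.om q : ℂ) * φ q) F Q
      + addOne φ (fun Q => (p.omQ Q : ℂ) • F Q) Q := by
  obtain ⟨n, k⟩ := Q
  cases n with
  | zero => simp [Model.addOne]
  | succ n =>
    simp only [Model.addOne, Finset.smul_sum, ← Finset.sum_add_distrib]
    refine Finset.sum_congr rfl fun j _ => ?_
    have : p.omQ ⟨n + 1, k⟩ = p.om (k j) + p.omQ ⟨n, fun i => k (j.succAbove i)⟩ :=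
      Fin.sum_univ_succAbove _ j
    rw [this]
    push_cast
    rw [add_smul, smul_smul, smul_comm (φ (k j))]

/-! ### Creation is adjoint to annihilation -/

lemma MemLp.integrable_inner {X : Type*} [MeasurableSpace X] {μ : Measure X} {V : Type*}
    [NormedAddCommGroup V] [InnerProductSpace ℂ V] {f g : X → V} (hf : MemLp f 2 μ)
    (hg : MemLp g 2 μ) : Integrable (fun x => inner ℂ (f x) (g x)) μ := by
  refine (L2.integrable_inner (𝕜 := ℂ) (hf.toLp f) (hg.toLp g)).congr ?_
  filter_upwards [hf.coeFn_toLp, hg.coeFn_toLp] with x h1 h2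
  rw [h1, h2]

lemma hasSum_integral_config {V : Type*} [NormedAddCommGroup V] [NormedSpace ℝ V]
    {f : Config d → V} (hf : Integrable f (lebesguePoisson d)) :
    HasSum (fun n : ℕ => (n.factorial : ℝ)⁻¹ • ∫ k, f ⟨n, k⟩) (∫ Q, f Q ∂lebesguePoisson d) := by
  unfold lebesguePoisson at hf ⊢
  convert! hasSum_integral_measure hf using 2 with n
  rw [integral_smul_measure, (measurableEmbedding_mk n).integral_map]
  simp

lemma memLp_level {F : Config d → Spin} (hF : Measurable F)
    (hF2 : MemLp F 2 (lebesguePoisson d)) (n : ℕ) :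
    MemLp (fun k : Fin n → Mom d => F ⟨n, k⟩) 2 volume := by
  refine memLp_two_iff_lintegral.2
    ⟨(hF.comp (measurable_sigma_mk n)).aestronglyMeasurable, ?_⟩
  have h := (memLp_two_iff_lintegral.1 hF2).2
  rw [lintegral_config] at h
  have h2 := (ENNReal.le_tsum n).trans_lt h
  by_contra hc
  rw [not_lt, top_le_iff] at hc
  rw [hc, ENNReal.mul_top (by simp)] at h2
  exact lt_irrefl _ h2

/-- By the symmetry of `G` the `n + 1` terms of the creation sum have equal integrals, and each of
them becomes the annihilation integral after splitting off one momentum. -/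
lemma integral_level_inner_addOne {φ : Mom d → ℂ} (hφ : MemLp φ 2 volume) {n : ℕ}
    {F : Config d → Spin} {G : Config d → Spin}
    (hF2 : MemLp (fun k : Fin n → Mom d => F ⟨n, k⟩) 2 volume)
    (hG2 : MemLp (fun k : Fin (n + 1) → Mom d => G ⟨n + 1, k⟩) 2 volume) (hGs : IsSymm G) :
    ∫ k : Fin (n + 1) → Mom d, inner ℂ (addOne φ F ⟨n + 1, k⟩) (G ⟨n + 1, k⟩)
      = (n + 1 : ℕ) * ∫ k : Fin n → Mom d, inner ℂ (F ⟨n, k⟩) (annOne φ G ⟨n, k⟩) := by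
  set f : (Fin n → Mom d) × Mom d → Spin := fun z => φ z.2 • F ⟨n, z.1⟩ with hf
  set g : (Fin n → Mom d) × Mom d → Spin := fun z => G ⟨n + 1, Fin.cons z.2 z.1⟩ with hg
  have hgm : MemLp g 2 (volume.prod volume) := hG2.comp_measurePreserving (measurePreserving_cons n)
  have hfm : MemLp f 2 (volume.prod volume) := by
    have h1 := (memLp_two_iff_integrable_sq_norm hF2.1).1 hF2
    have h2 := (memLp_two_iff_integrable_sq_norm hφ.1).1 hφ
    refine (memLp_two_iff_integrable_sq_norm (hφ.1.comp_snd.smul hF2.1.comp_fst)).2 ?_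
    refine (h1.mul_prod h2).congr (.of_forall fun z => ?_)
    simp only [norm_smul, Pi.smul_apply', mul_pow]; ring
  have hfg : Integrable (fun z => inner ℂ (f z) (g z)) (volume.prod volume) :=
    MemLp.integrable_inner hfm hgm
  have hsw : ∀ j : Fin (n + 1), MeasurePreserving
      (fun k : Fin (n + 1) → Mom d => ((fun i => k (j.succAbove i) : Fin n → Mom d), k j))
      volume (volume.prod volume) := fun j =>
    (Measure.measurePreserving_swap (μ := (volume : Measure (Mom d)))
      (ν := (volume : Measure (Fin n → Mom d)))).comp (measurePreserving_remove (d := d) j)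
  have hj : ∀ j : Fin (n + 1), Integrable (fun k : Fin (n + 1) → Mom d =>
      inner ℂ (φ (k j) • F ⟨n, fun i => k (j.succAbove i)⟩) (G ⟨n + 1, k⟩)) ∧
      ∫ k : Fin (n + 1) → Mom d,
      inner ℂ (φ (k j) • F ⟨n, fun i => k (j.succAbove i)⟩) (G ⟨n + 1, k⟩)
        = ∫ z, inner ℂ (f z) (g z) ∂(volume.prod volume) := fun j => by
    have e : (fun k : Fin (n + 1) → Mom d =>
        inner ℂ (φ (k j) • F ⟨n, fun i => k (j.succAbove i)⟩) (G ⟨n + 1, k⟩))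
        =ᵐ[volume] fun k => inner ℂ (f (fun i => k (j.succAbove i), k j))
          (g (fun i => k (j.succAbove i), k j)) := by
      filter_upwards [hGs.insert_remove j] with k hk
      simp only [hf, hg, hk]
    refine ⟨((hsw j).integrable_comp_of_integrable hfg).congr e.symm, ?_⟩
    rw [integral_congr_ae e, ← (hsw j).map_eq, integral_map (hsw j).aemeasurable]
    rw [(hsw j).map_eq]; exact hfg.1
  have hsum : ∀ k : Fin (n + 1) → Mom d, inner ℂ (addOne φ F ⟨n + 1, k⟩) (G ⟨n + 1, k⟩)
      = ∑ j, inner ℂ (φ (k j) • F ⟨n, fun i => k (j.succAbove i)⟩) (G ⟨n + 1, k⟩) := fun k => by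
    simp only [Model.addOne, sum_inner]
  simp_rw [hsum]
  rw [integral_finsetSum _ fun j _ => (hj j).1]
  simp_rw [fun j => (hj j).2]
  rw [Finset.sum_const, Finset.card_univ, Fintype.card_fin, nsmul_eq_mul, integral_prod _ hfg]
  congr 1
  have hgk : ∀ᵐ k : Fin n → Mom d, MemLp (fun q => g (k, q)) 2 volume := by
    have h1 := ((memLp_two_iff_integrable_sq_norm hgm.1).1 hgm).prod_right_ae
    filter_upwards [h1, hgm.1.prodMk_left] with k h2 h3
    exact (memLp_two_iff_integrable_sq_norm h3).2 h2
  refine integral_congr_ae ?_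
  filter_upwards [hgk] with k hk
  have hi : Integrable fun q => (starRingEnd ℂ (φ q)) • g (k, q) := integrable_conj_smul hφ hk
  change _ = inner ℂ (F ⟨n, k⟩) (∫ q, (starRingEnd ℂ (φ q)) • g (k, q))
  rw [← integral_inner hi]
  simp only [hf, inner_smul_left, inner_smul_right]

/-- The factor `n + 1` from each level is cancelled by the factorials of the Lebesgue-Poisson
measure; the level without bosons contributes nothing on the creation side. -/
lemma integral_inner_addOne {φ : Mom d → ℂ} (hφ : MemLp φ 2 volume) {F G : Config d → Spin}
    (hF : Measurable F) (hG : Measurable G) (hF2 : MemLp F 2 (lebesguePoisson d))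
    (hG2 : MemLp G 2 (lebesguePoisson d)) (hGs : IsSymm G)
    (h1 : MemLp (addOne φ F) 2 (lebesguePoisson d))
    (h2 : MemLp (annOne φ G) 2 (lebesguePoisson d)) :
    ∫ Q, inner ℂ (addOne φ F Q) (G Q) ∂lebesguePoisson d
      = ∫ Q, inner ℂ (F Q) (annOne φ G Q) ∂lebesguePoisson d := by
  have hA := hasSum_integral_config (MemLp.integrable_inner h1 hG2)
  have hB := hasSum_integral_config (MemLp.integrable_inner hF2 h2)
  have hA' := (hasSum_nat_add_iff' 1).2 hA
  rw [Finset.sum_range_one] at hA'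
  have h0 : ∫ k : Fin 0 → Mom d, inner ℂ (addOne φ F ⟨0, k⟩) (G ⟨0, k⟩) = 0 := by
    simp [Model.addOne]
  rw [h0, smul_zero, sub_zero] at hA'
  refine hA'.unique ?_
  convert hB using 2 with n
  rw [integral_level_inner_addOne hφ (memLp_level hF hF2 n) (memLp_level hG hG2 (n + 1)) hGs,
    Nat.factorial_succ, ← Complex.coe_smul, ← Complex.coe_smul, smul_eq_mul, smul_eq_mul,
    ← mul_assoc]
  congr 1
  have : ((n : ℂ) + 1) ≠ 0 := by exact_mod_cast Nat.succ_ne_zero n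
  push_cast
  field_simp

/-! ### Elements of the Fock space and operators given by formulas -/

lemma mem_symmetricSubspace_iff {F : FullSpace d} :
    F ∈ symmetricSubspace d ↔ IsSymm (fun Q => F Q) := by
  rw [isSymm_iff_relabel]
  simp only [symmetricSubspace, Submodule.mem_iInf, LinearMap.mem_eqLocus]
  refine forall_congr' fun s => ?_
  have h := Lp.coeFn_compMeasurePreserving F (measurePreserving_relabel (d := d) s)
  constructor
  · intro hs
    have hs' : Lp.compMeasurePreserving (relabel s) (measurePreserving_relabel s) F = F := hs
    rw [hs'] at h
    exact h.symm
  · intro hs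
    exact Lp.ext (h.trans hs)

namespace Fock

lemma measurable_rep (F : Fock d) : Measurable F.rep := (Lp.stronglyMeasurable _).measurable

lemma memLp_rep (F : Fock d) : MemLp F.rep 2 (lebesguePoisson d) := Lp.memLp _

lemma isSymm_rep (F : Fock d) : IsSymm F.rep := mem_symmetricSubspace_iff.1 F.2

lemma ext_rep {F G : Fock d} (h : F.rep =ᵐ[lebesguePoisson d] G.rep) : F = G :=
  Subtype.ext (Lp.ext h)

lemma rep_add (F G : Fock d) : (F + G).rep =ᵐ[lebesguePoisson d] fun Q => F.rep Q + G.rep Q :=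
  Lp.coeFn_add _ _

lemma rep_sub (F G : Fock d) : (F - G).rep =ᵐ[lebesguePoisson d] fun Q => F.rep Q - G.rep Q :=
  Lp.coeFn_sub _ _

lemma rep_smul (c : ℂ) (F : Fock d) : (c • F).rep =ᵐ[lebesguePoisson d] fun Q => c • F.rep Q :=
  Lp.coeFn_smul c _

lemma rep_zero : (0 : Fock d).rep =ᵐ[lebesguePoisson d] fun _ => 0 :=
  Lp.coeFn_zero _ _ _

lemma inner_eq (F G : Fock d) :
    inner ℂ F G = ∫ Q, inner ℂ (F.rep Q) (G.rep Q) ∂lebesguePoisson d :=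
  L2.inner_def (𝕜 := ℂ) (F : FullSpace d) (G : FullSpace d)

lemma lintegral_rep (F : Fock d) :
    ∫⁻ Q, ‖F.rep Q‖ₑ ^ 2 ∂lebesguePoisson d = ENNReal.ofReal (‖F‖ ^ 2) :=
  lintegral_enorm_sq_coeFn (F : FullSpace d)

lemma norm_le_of_lintegral {F : Fock d} {C : ℝ} (hC : 0 ≤ C)
    (h : ∫⁻ Q, ‖F.rep Q‖ₑ ^ 2 ∂lebesguePoisson d ≤ ENNReal.ofReal (C ^ 2)) : ‖F‖ ≤ C := by
  rw [lintegral_rep, ENNReal.ofReal_le_ofReal_iff (by positivity)] at h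
  exact (le_abs_self _).trans (abs_le_of_sq_le_sq h hC)

/-- The Fock vector with a given representative. -/
def mk (F : Config d → Spin) (hF : MemLp F 2 (lebesguePoisson d)) (hs : IsSymm F) : Fock d :=
  ⟨hF.toLp F, mem_symmetricSubspace_iff.2 (hs.congr hF.coeFn_toLp.symm)⟩

lemma rep_mk (F : Config d → Spin) (hF : MemLp F 2 (lebesguePoisson d)) (hs : IsSymm F) :
    (mk F hF hs).rep =ᵐ[lebesguePoisson d] F := hF.coeFn_toLp

end Fock

/-- A formula defining a bounded linear operator into the Fock space. -/
structure OpFormula {E : Type*} [NormedAddCommGroup E] [NormedSpace ℂ E]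
    (T : E → Config d → Spin) (C : ℝ) : Prop where
  meas : ∀ x, Measurable (T x)
  symm : ∀ x, IsSymm (T x)
  add : ∀ x y, T (x + y) =ᵐ[lebesguePoisson d] fun Q => T x Q + T y Q
  smul : ∀ (c : ℂ) x, T (c • x) =ᵐ[lebesguePoisson d] fun Q => c • T x Q
  nonneg : 0 ≤ C
  bound : ∀ x, ∫⁻ Q, ‖T x Q‖ₑ ^ 2 ∂lebesguePoisson d ≤ ENNReal.ofReal ((C * ‖x‖) ^ 2)

namespace OpFormula

variable {E : Type*} [NormedAddCommGroup E] [NormedSpace ℂ E] {T : E → Config d → Spin} {C : ℝ}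

lemma memLp (h : OpFormula T C) (x : E) : MemLp (T x) 2 (lebesguePoisson d) :=
  memLp_two_iff_lintegral.2 ⟨(h.meas x).aestronglyMeasurable,
    (h.bound x).trans_lt ENNReal.ofReal_lt_top⟩

lemma norm_mk_le (h : OpFormula T C) (x : E) : ‖Fock.mk (T x) (h.memLp x) (h.symm x)‖ ≤ C * ‖x‖ := by
  refine Fock.norm_le_of_lintegral (mul_nonneg h.nonneg (norm_nonneg _)) ((h.bound x).trans' ?_)
  refine (lintegral_congr_ae ?_).le
  filter_upwards [Fock.rep_mk (T x) (h.memLp x) (h.symm x)] with Q hQ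
  rw [hQ]

/-- The operator defined by a formula. -/
def toOp (h : OpFormula T C) : E →L[ℂ] Fock d :=
  LinearMap.mkContinuous
    { toFun := fun x => Fock.mk (T x) (h.memLp x) (h.symm x)
      map_add' := fun x y => by
        refine Fock.ext_rep ?_
        filter_upwards [Fock.rep_mk _ (h.memLp (x + y)) (h.symm (x + y)), h.add x y,
          Fock.rep_add (Fock.mk _ (h.memLp x) (h.symm x)) (Fock.mk _ (h.memLp y) (h.symm y)),
          Fock.rep_mk _ (h.memLp x) (h.symm x), Fock.rep_mk _ (h.memLp y) (h.symm y)]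
          with Q h1 h2 h3 h4 h5
        rw [h1, h2, h3, h4, h5]
      map_smul' := fun c x => by
        refine Fock.ext_rep ?_
        filter_upwards [Fock.rep_mk _ (h.memLp (c • x)) (h.symm (c • x)), h.smul c x,
          Fock.rep_smul c (Fock.mk _ (h.memLp x) (h.symm x)),
          Fock.rep_mk _ (h.memLp x) (h.symm x)] with Q h1 h2 h3 h4
        rw [h1, h2, RingHom.id_apply, h3, h4] }
    C h.norm_mk_le

lemma rep_toOp (h : OpFormula T C) (x : E) : (h.toOp x).rep =ᵐ[lebesguePoisson d] T x :=
  Fock.rep_mk _ (h.memLp x) (h.symm x)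

lemma norm_toOp_le (h : OpFormula T C) : ‖h.toOp‖ ≤ C :=
  ContinuousLinearMap.opNorm_le_bound _ h.nonneg h.norm_mk_le

end OpFormula

lemma IsSymm.smul {g : Config d → ℂ} (hg : ∀ s Q, g (relabel s Q) = g Q) {F : Config d → Spin}
    (hF : IsSymm F) : IsSymm fun Q => g Q • F Q := by
  rw [isSymm_iff_relabel] at hF ⊢
  intro s
  filter_upwards [hF s] with Q hQ
  rw [hQ, hg]

lemma IsSymm.act {F : Config d → Spin} (hF : IsSymm F) (A : Matrix (Fin 2) (Fin 2) ℂ) :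
    IsSymm fun Q => act A (F Q) := fun n π => by
  filter_upwards [hF n π] with k hk
  rw [hk]

lemma opFormula_smul {g : Config d → ℂ} (hgm : Measurable g) (hg : ∀ s Q, g (relabel s Q) = g Q)
    {C : ℝ} (hC : 0 ≤ C) (hb : ∀ Q, ‖g Q‖ ≤ C) :
    OpFormula (fun (F : Fock d) Q => g Q • F.rep Q) C where
  meas F := hgm.smul F.measurable_rep
  symm F := F.isSymm_rep.smul hg
  add F G := by
    filter_upwards [Fock.rep_add F G] with Q hQ
    rw [hQ, smul_add]
  smul c F := by
    filter_upwards [Fock.rep_smul c F] with Q hQ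
    rw [hQ, smul_comm]
  nonneg := hC
  bound F := by
    rw [mul_pow, ENNReal.ofReal_mul (by positivity), ← F.lintegral_rep,
      ← lintegral_const_mul _ (F.measurable_rep.enorm.pow_const 2)]
    refine lintegral_mono fun Q => ?_
    rw [enorm_smul, mul_pow, ENNReal.ofReal_pow hC]
    gcongr
    rw [← ofReal_norm]
    exact ENNReal.ofReal_le_ofReal (hb Q)

lemma opFormula_act {A : Matrix (Fin 2) (Fin 2) ℂ} (hA : ∀ v, ‖act A v‖ = ‖v‖) :
    OpFormula (fun (F : Fock d) Q => act A (F.rep Q)) 1 where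
  meas F := (actL A).continuous.measurable.comp F.measurable_rep
  symm F := F.isSymm_rep.act A
  add F G := by
    filter_upwards [Fock.rep_add F G] with Q hQ
    rw [hQ, ← actL_apply, map_add]; rfl
  smul c F := by
    filter_upwards [Fock.rep_smul c F] with Q hQ
    rw [hQ, ← actL_apply, map_smul]; rfl
  nonneg := zero_le_one
  bound F := by
    rw [one_mul, ← F.lintegral_rep]
    refine lintegral_mono fun Q => le_of_eq ?_
    rw [← ofReal_norm, hA, ofReal_norm]

/-! ### The Hamiltonian as a perturbation of the field energy -/

/-- A measurable function with a bound on its `L²` norm. -/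
structure L2Bound (φ : Mom d → ℂ) (Λ : ℝ) : Prop where
  meas : Measurable φ
  nonneg : 0 ≤ Λ
  bound : ∫⁻ q, ‖φ q‖ₑ ^ 2 ≤ ENNReal.ofReal (Λ ^ 2)

lemma L2Bound.memLp {φ : Mom d → ℂ} {Λ : ℝ} (h : L2Bound φ Λ) : MemLp φ 2 volume :=
  memLp_two_iff_lintegral.2 ⟨h.meas.aestronglyMeasurable, h.bound.trans_lt ENNReal.ofReal_lt_top⟩

/-- The regularity of the data of the model that the operator theory uses, with a shift `c` of the
energy and a bound `Λ` on the norm of the form factor. -/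
structure Model.Regular (p : Model d) (c Λ : ℝ) : Prop where
  om_meas : Measurable p.om
  kappa_pos : 0 < p.kappa
  kappa_le : ∀ q, p.kappa ≤ p.om q
  kappa_le_shift : p.kappa ≤ c
  lam_bound : L2Bound p.lam Λ
  eps_nonneg : 0 ≤ p.eps
  alpha_nonneg : 0 ≤ p.alpha

/-- The projection onto the vectors with at most `n` bosons. -/
def numProj (d n : ℕ) : Fock d →L[ℂ] Fock d :=
  (opFormula_smul (g := fun Q : Config d => if Q.1 ≤ n then (1 : ℂ) else 0)
    ((Measurable.of_discrete (f := fun m : ℕ => if m ≤ n then (1 : ℂ) else 0)).comp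
      measurable_card) (fun _ _ => rfl) zero_le_one
    (fun Q => by split_ifs <;> simp)).toOp

lemma rep_numProj (n : ℕ) (F : Fock d) : (numProj d n F).rep =ᵐ[lebesguePoisson d]
    fun Q => (if Q.1 ≤ n then (1 : ℂ) else 0) • F.rep Q := OpFormula.rep_toOp _ F

/-- `σ₃` on the Fock space. -/
def spin3 (d : ℕ) : Fock d →L[ℂ] Fock d := (opFormula_act norm_act_sigma3).toOp

/-- `σ₁` on the Fock space. -/
def spin1 (d : ℕ) : Fock d →L[ℂ] Fock d := (opFormula_act norm_act_sigma1).toOp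

lemma rep_spin3 (F : Fock d) : (spin3 d F).rep =ᵐ[lebesguePoisson d] fun Q => act sigma3 (F.rep Q) :=
  OpFormula.rep_toOp _ F

lemma rep_spin1 (F : Fock d) : (spin1 d F).rep =ᵐ[lebesguePoisson d] fun Q => act sigma1 (F.rep Q) :=
  OpFormula.rep_toOp _ F

lemma norm_spin3_le : ‖spin3 d‖ ≤ 1 := OpFormula.norm_toOp_le _

lemma norm_spin1_le : ‖spin1 d‖ ≤ 1 := OpFormula.norm_toOp_le _

lemma Fock.inner_conj (F G : Fock d) : starRingEnd ℂ (inner ℂ F G) = inner ℂ G F :=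
  @inner_conj_symm ℂ (Fock d) _ _ _ G F

lemma Fock.inner_smul_left (a : ℂ) (F G : Fock d) :
    (inner ℂ (a • F) G : ℂ) = starRingEnd ℂ a * inner ℂ F G :=
  @_root_.inner_smul_left ℂ (Fock d) _ _ _ F G a

lemma Fock.inner_smul_right (a : ℂ) (F G : Fock d) :
    (inner ℂ F (a • G) : ℂ) = a * inner ℂ F G :=
  @_root_.inner_smul_right ℂ (Fock d) _ _ _ F G a

lemma Fock.norm_smul (a : ℂ) (F : Fock d) : ‖a • F‖ = ‖a‖ * ‖F‖ :=
  @_root_.norm_smul ℂ (Fock d) _ _ _ _ a F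

lemma inner_congr_rep {F G F' G' : Fock d}
    (h : ∀ᵐ Q ∂lebesguePoisson d, inner ℂ (F.rep Q) (G.rep Q) = inner ℂ (F'.rep Q) (G'.rep Q)) :
    (inner ℂ F G : ℂ) = inner ℂ F' G' := by
  rw [Fock.inner_eq, Fock.inner_eq]
  exact integral_congr_ae h

lemma inner_spin3 (F G : Fock d) : (inner ℂ (spin3 d F) G : ℂ) = inner ℂ F (spin3 d G) := by
  refine inner_congr_rep ?_
  filter_upwards [rep_spin3 F, rep_spin3 G] with Q h1 h2
  rw [h1, h2, inner_act_sigma3]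

lemma inner_spin1 (F G : Fock d) : (inner ℂ (spin1 d F) G : ℂ) = inner ℂ F (spin1 d G) := by
  refine inner_congr_rep ?_
  filter_upwards [rep_spin1 F, rep_spin1 G] with Q h1 h2
  rw [h1, h2, inner_act_sigma1]

lemma numProj_selfAdjoint (n : ℕ) : IsSelfAdjoint (numProj d n) := by
  rw [ContinuousLinearMap.isSelfAdjoint_iff_isSymmetric]
  intro F G
  refine inner_congr_rep ?_
  filter_upwards [rep_numProj n F, rep_numProj n G] with Q h1 h2
  simp only [ContinuousLinearMap.coe_coe]
  rw [h1, h2]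
  split_ifs <;> simp

lemma numProj_idem (n : ℕ) (F : Fock d) : numProj d n (numProj d n F) = numProj d n F := by
  refine Fock.ext_rep ?_
  filter_upwards [rep_numProj n (numProj d n F), rep_numProj n F] with Q h1 h2
  rw [h1, h2]
  split_ifs <;> simp

namespace Model

variable {p : Model d} {c Λ : ℝ}

/-- `(ω(Q) + c)⁻¹`. -/
def invEnergy (p : Model d) (c : ℝ) (Q : Config d) : ℝ := (p.omQ Q + c)⁻¹

lemma omQ_relabel (s : ∀ n : ℕ, Equiv.Perm (Fin n)) (Q : Config d) :
    p.omQ (relabel s Q) = p.omQ Q :=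
  Equiv.sum_comp (s Q.1) fun j => p.om (Q.2 j)

namespace Regular

lemma measurable_omQ (h : p.Regular c Λ) : Measurable p.omQ :=
  measurable_config fun n => by
    have : Measurable fun k : Fin n → Mom d => ∑ j : Fin n, p.om (k j) :=
      Finset.measurable_sum _ fun j _ => h.om_meas.comp (measurable_pi_apply j)
    exact this

lemma card_mul_le_omQ (h : p.Regular c Λ) (Q : Config d) : p.kappa * Q.1 ≤ p.omQ Q := by
  calc p.kappa * Q.1 = ∑ _j : Fin Q.1, p.kappa := by simp [mul_comm]
    _ ≤ _ := Finset.sum_le_sum fun j _ => h.kappa_le _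

lemma card_succ_mul_le (h : p.Regular c Λ) (Q : Config d) :
    p.kappa * (Q.1 + 1) ≤ p.omQ Q + c := by
  linarith [h.card_mul_le_omQ Q, h.kappa_le_shift]

lemma shift_pos (h : p.Regular c Λ) : 0 < c := h.kappa_pos.trans_le h.kappa_le_shift

lemma shift_le (h : p.Regular c Λ) (Q : Config d) : c ≤ p.omQ Q + c := by
  have := h.card_mul_le_omQ Q
  have : 0 ≤ p.kappa * Q.1 := mul_nonneg h.kappa_pos.le (Nat.cast_nonneg _)
  linarith

lemma energy_pos (h : p.Regular c Λ) (Q : Config d) : 0 < p.omQ Q + c :=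
  h.shift_pos.trans_le (h.shift_le Q)

lemma measurable_invEnergy (h : p.Regular c Λ) : Measurable (p.invEnergy c) :=
  (h.measurable_omQ.add_const c).inv

lemma invEnergy_pos (h : p.Regular c Λ) (Q : Config d) : 0 < p.invEnergy c Q :=
  inv_pos.2 (h.energy_pos Q)

/-- `(H₀ + c)⁻¹` for the free field energy `H₀`. -/
def S0 (h : p.Regular c Λ) : Fock d →L[ℂ] Fock d :=
  (opFormula_smul (g := fun Q : Config d => (p.invEnergy c Q : ℂ))
    (Complex.measurable_ofReal.comp h.measurable_invEnergy)
    (fun s Q => by simp only [invEnergy, omQ_relabel]) (C := c⁻¹) (inv_nonneg.2 h.shift_pos.le)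
    (fun Q => by
      rw [Complex.norm_real, Real.norm_of_nonneg (h.invEnergy_pos Q).le]
      exact inv_anti₀ h.shift_pos (h.shift_le Q))).toOp

lemma rep_S0 (h : p.Regular c Λ) (F : Fock d) : (h.S0 F).rep =ᵐ[lebesguePoisson d]
    fun Q => (p.invEnergy c Q : ℂ) • F.rep Q := OpFormula.rep_toOp _ F

lemma norm_S0_le (h : p.Regular c Λ) : ‖h.S0‖ ≤ c⁻¹ := OpFormula.norm_toOp_le _

lemma rep_eq_energy_smul (h : p.Regular c Λ) (F : Fock d) : F.rep =ᵐ[lebesguePoisson d]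
    fun Q => ((p.omQ Q + c : ℝ) : ℂ) • (h.S0 F).rep Q := by
  filter_upwards [h.rep_S0 F] with Q hQ
  rw [hQ, smul_smul, ← Complex.ofReal_mul, invEnergy, mul_inv_cancel₀ (h.energy_pos Q).ne']
  simp

lemma S0_selfAdjoint (h : p.Regular c Λ) : IsSelfAdjoint h.S0 := by
  rw [ContinuousLinearMap.isSelfAdjoint_iff_isSymmetric]
  intro F G
  refine inner_congr_rep ?_
  filter_upwards [h.rep_S0 F, h.rep_S0 G] with Q h1 h2
  simp only [ContinuousLinearMap.coe_coe]
  rw [h1, h2, inner_smul_left, inner_smul_right, Complex.conj_ofReal]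

lemma S0_injective (h : p.Regular c Λ) : Function.Injective h.S0 := by
  intro F G hFG
  refine Fock.ext_rep ?_
  filter_upwards [h.rep_eq_energy_smul F, h.rep_eq_energy_smul G] with Q h1 h2
  rw [h1, h2, hFG]

lemma S0_numProj (h : p.Regular c Λ) (n : ℕ) (F : Fock d) :
    numProj d n (h.S0 F) = h.S0 (numProj d n F) := by
  refine Fock.ext_rep ?_
  filter_upwards [rep_numProj n (h.S0 F), h.rep_S0 F, h.rep_S0 (numProj d n F), rep_numProj n F]
    with Q h1 h2 h3 h4
  rw [h1, h2, h3, h4, smul_comm]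

lemma S0_spin1 (h : p.Regular c Λ) (F : Fock d) : spin1 d (h.S0 F) = h.S0 (spin1 d F) := by
  refine Fock.ext_rep ?_
  filter_upwards [rep_spin1 (h.S0 F), h.rep_S0 F, h.rep_S0 (spin1 d F), rep_spin1 F]
    with Q h1 h2 h3 h4
  rw [h1, h2, h3, h4, ← actL_apply, map_smul]; rfl

/-- Each boson costs at least `κ`, and so does the shift `c`; hence `κ (N + 1) ≤ ω(Q) + c`, that is,
`(N + 1) (H₀ + c)⁻¹` is bounded by `κ⁻¹`. The square is what products of two field operators
require. -/
lemma lintegral_number_sq (h : p.Regular c Λ) (F : Fock d) :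
    ∫⁻ Q, ((Q.1 + 1 : ℕ) : ℝ≥0∞) ^ 2 * ‖(h.S0 F).rep Q‖ₑ ^ 2 ∂lebesguePoisson d
      ≤ ENNReal.ofReal ((p.kappa⁻¹ * ‖F‖) ^ 2) := by
  rw [mul_pow, ENNReal.ofReal_mul (by positivity), ← F.lintegral_rep,
    ← lintegral_const_mul _ (F.measurable_rep.enorm.pow_const 2)]
  refine lintegral_mono_ae ?_
  filter_upwards [h.rep_S0 F] with Q hQ
  rw [hQ, enorm_smul, mul_pow, ← mul_assoc]
  gcongr
  rw [← ofReal_norm, Complex.norm_real, Real.norm_of_nonneg (h.invEnergy_pos Q).le,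
    ← ENNReal.ofReal_natCast, ← ENNReal.ofReal_pow (by positivity), ← ENNReal.ofReal_pow
    (h.invEnergy_pos Q).le, ← ENNReal.ofReal_mul (by positivity), ← mul_pow]
  refine ENNReal.ofReal_le_ofReal ?_
  have h1 := h.invEnergy_pos Q
  gcongr
  rw [invEnergy, ← div_eq_mul_inv, div_le_iff₀ (h.energy_pos Q), inv_mul_eq_div,
    le_div_iff₀ h.kappa_pos, mul_comm]
  push_cast
  exact h.card_succ_mul_le Q

lemma lintegral_number (h : p.Regular c Λ) (F : Fock d) :
    ∫⁻ Q, ((Q.1 + 1 : ℕ) : ℝ≥0∞) * ‖(h.S0 F).rep Q‖ₑ ^ 2 ∂lebesguePoisson d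
      ≤ ENNReal.ofReal ((p.kappa⁻¹ * ‖F‖) ^ 2) := by
  refine (lintegral_mono fun Q => ?_).trans (h.lintegral_number_sq F)
  gcongr
  exact le_self_pow (by exact_mod_cast Nat.succ_le_succ (Nat.zero_le _)) two_ne_zero

lemma opFormula_cre (h : p.Regular c Λ) {φ : Mom d → ℂ} {N : ℝ} (hφ : L2Bound φ N) :
    OpFormula (fun F : Fock d => addOne φ (h.S0 F).rep) (N * p.kappa⁻¹) where
  meas F := measurable_addOne hφ.meas (h.S0 F).measurable_rep
  symm F := (h.S0 F).isSymm_rep.addOne φ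
  add F G := by
    rw [map_add, ← addOne_add]
    exact addOne_congr ae_eq_rfl (Fock.rep_add _ _)
  smul a F := by
    rw [map_smul, ← addOne_smul]
    exact addOne_congr ae_eq_rfl (Fock.rep_smul _ _)
  nonneg := mul_nonneg hφ.nonneg (inv_nonneg.2 h.kappa_pos.le)
  bound F := by
    have h1 := lintegral_addOne_le hφ.meas (h.S0 F).measurable_rep (fun _ => 1)
    simp only [one_mul] at h1
    refine h1.trans ?_
    rw [mul_assoc, mul_pow, ENNReal.ofReal_mul (by positivity)]
    gcongr
    · exact hφ.bound
    · exact h.lintegral_number F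

/-- `a*(φ) (H₀ + c)⁻¹`. -/
def creL (h : p.Regular c Λ) {φ : Mom d → ℂ} {N : ℝ} (hφ : L2Bound φ N) : Fock d →L[ℂ] Fock d :=
  (h.opFormula_cre hφ).toOp

lemma rep_creL (h : p.Regular c Λ) {φ : Mom d → ℂ} {N : ℝ} (hφ : L2Bound φ N) (F : Fock d) :
    (h.creL hφ F).rep =ᵐ[lebesguePoisson d] addOne φ (h.S0 F).rep := OpFormula.rep_toOp _ F

lemma norm_creL_le (h : p.Regular c Λ) {φ : Mom d → ℂ} {N : ℝ} (hφ : L2Bound φ N) :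
    ‖h.creL hφ‖ ≤ N * p.kappa⁻¹ := OpFormula.norm_toOp_le _

lemma opFormula_ann (h : p.Regular c Λ) {φ : Mom d → ℂ} {N : ℝ} (hφ : L2Bound φ N) :
    OpFormula (fun F : Fock d => annOne φ (h.S0 F).rep) (N * p.kappa⁻¹) where
  meas F := measurable_annOne hφ.meas (h.S0 F).measurable_rep
  symm F := (h.S0 F).isSymm_rep.annOne φ
  add F G := by
    rw [map_add]
    exact (annOne_congr ae_eq_rfl (Fock.rep_add _ _)).trans
      (annOne_add hφ.memLp (h.S0 F).measurable_rep (h.S0 F).memLp_rep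
        (h.S0 G).measurable_rep (h.S0 G).memLp_rep)
  smul a F := by
    rw [map_smul, ← annOne_smul]
    exact annOne_congr ae_eq_rfl (Fock.rep_smul _ _)
  nonneg := mul_nonneg hφ.nonneg (inv_nonneg.2 h.kappa_pos.le)
  bound F := by
    have h1 := lintegral_annOne_le hφ.meas.aemeasurable (h.S0 F).measurable_rep (fun _ => 1)
    simp only [one_mul] at h1
    refine h1.trans ?_
    rw [mul_assoc, mul_pow, ENNReal.ofReal_mul (by positivity)]
    gcongr
    · exact hφ.bound
    · refine (lintegral_mono fun Q => ?_).trans (h.lintegral_number F)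
      gcongr
      exact Nat.le_succ _

/-- `a(φ) (H₀ + c)⁻¹`. -/
def annL (h : p.Regular c Λ) {φ : Mom d → ℂ} {N : ℝ} (hφ : L2Bound φ N) : Fock d →L[ℂ] Fock d :=
  (h.opFormula_ann hφ).toOp

lemma rep_annL (h : p.Regular c Λ) {φ : Mom d → ℂ} {N : ℝ} (hφ : L2Bound φ N) (F : Fock d) :
    (h.annL hφ F).rep =ᵐ[lebesguePoisson d] annOne φ (h.S0 F).rep := OpFormula.rep_toOp _ F

lemma norm_annL_le (h : p.Regular c Λ) {φ : Mom d → ℂ} {N : ℝ} (hφ : L2Bound φ N) :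
    ‖h.annL hφ‖ ≤ N * p.kappa⁻¹ := OpFormula.norm_toOp_le _

lemma memLp_addOne (h : p.Regular c Λ) {φ : Mom d → ℂ} {N : ℝ} (hφ : L2Bound φ N) (F : Fock d) :
    MemLp (addOne φ (h.S0 F).rep) 2 (lebesguePoisson d) := (h.opFormula_cre hφ).memLp F

lemma memLp_annOne (h : p.Regular c Λ) {φ : Mom d → ℂ} {N : ℝ} (hφ : L2Bound φ N) (F : Fock d) :
    MemLp (annOne φ (h.S0 F).rep) 2 (lebesguePoisson d) := (h.opFormula_ann hφ).memLp F

lemma inner_creL (h : p.Regular c Λ) {φ : Mom d → ℂ} {N : ℝ} (hφ : L2Bound φ N) (F G : Fock d) :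
    (inner ℂ (h.creL hφ F) (h.S0 G) : ℂ) = inner ℂ (h.S0 F) (h.annL hφ G) := by
  rw [Fock.inner_eq, Fock.inner_eq]
  have e1 : ∫ Q, inner ℂ ((h.creL hφ F).rep Q) ((h.S0 G).rep Q) ∂lebesguePoisson d
      = ∫ Q, inner ℂ (addOne φ (h.S0 F).rep Q) ((h.S0 G).rep Q) ∂lebesguePoisson d := by
    refine integral_congr_ae ?_
    filter_upwards [h.rep_creL hφ F] with Q hQ
    rw [hQ]
  have e2 : ∫ Q, inner ℂ ((h.S0 F).rep Q) ((h.annL hφ G).rep Q) ∂lebesguePoisson d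
      = ∫ Q, inner ℂ ((h.S0 F).rep Q) (annOne φ (h.S0 G).rep Q) ∂lebesguePoisson d := by
    refine integral_congr_ae ?_
    filter_upwards [h.rep_annL hφ G] with Q hQ
    rw [hQ]
  rw [e1, e2]
  exact integral_inner_addOne hφ.memLp (h.S0 F).measurable_rep (h.S0 G).measurable_rep
    (h.S0 F).memLp_rep (h.S0 G).memLp_rep (h.S0 G).isSymm_rep (h.memLp_addOne hφ F)
    (h.memLp_annOne hφ G)

lemma annL_spin1 (h : p.Regular c Λ) {φ : Mom d → ℂ} {N : ℝ} (hφ : L2Bound φ N) (F : Fock d) :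
    h.annL hφ (spin1 d F) = spin1 d (h.annL hφ F) := by
  refine Fock.ext_rep ?_
  have h1 := annOne_congr (φ := φ) ae_eq_rfl (rep_spin1 (h.S0 F))
  have h2 := annOne_act sigma1 hφ.memLp (h.S0 F).measurable_rep (h.S0 F).memLp_rep
  rw [S0_spin1] at h1
  filter_upwards [h.rep_annL hφ (spin1 d F), rep_spin1 (h.annL hφ F), h.rep_annL hφ F, h1, h2]
    with Q h1 h2 h3 h4 h5
  rw [h1, h2, h3, h4, h5]

/-! ### The Hamiltonian -/

/-- `(H - H₀) (H₀ + c)⁻¹`. -/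
def K (h : p.Regular c Λ) : Fock d →L[ℂ] Fock d :=
  (p.eps : ℂ) • (spin3 d ∘L h.S0)
    + (p.alpha : ℂ) • (spin1 d ∘L (h.creL h.lam_bound + h.annL h.lam_bound))

lemma K_apply (h : p.Regular c Λ) (F : Fock d) : h.K F = (p.eps : ℂ) • spin3 d (h.S0 F)
    + (p.alpha : ℂ) • (spin1 d (h.creL h.lam_bound F) + spin1 d (h.annL h.lam_bound F)) := by
  rw [K, add_apply]
  refine congrArg₂ _ rfl ?_
  rw [← map_add]; rfl

lemma rep_K (h : p.Regular c Λ) (w : Fock d) : (h.K w).rep =ᵐ[lebesguePoisson d] fun Q =>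
    (p.eps : ℂ) • act sigma3 ((h.S0 w).rep Q) + p.cre (h.S0 w).rep Q + p.ann (h.S0 w).rep Q := by
  rw [K_apply]
  filter_upwards [Fock.rep_add ((p.eps : ℂ) • spin3 d (h.S0 w)) ((p.alpha : ℂ) •
      (spin1 d (h.creL h.lam_bound w) + spin1 d (h.annL h.lam_bound w))),
    Fock.rep_smul (p.eps : ℂ) (spin3 d (h.S0 w)), rep_spin3 (h.S0 w),
    Fock.rep_smul (p.alpha : ℂ)
      (spin1 d (h.creL h.lam_bound w) + spin1 d (h.annL h.lam_bound w)),
    Fock.rep_add (spin1 d (h.creL h.lam_bound w)) (spin1 d (h.annL h.lam_bound w)),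
    rep_spin1 (h.creL h.lam_bound w), rep_spin1 (h.annL h.lam_bound w),
    h.rep_creL h.lam_bound w, h.rep_annL h.lam_bound w] with Q h1 h2 h3 h4 h5 h6 h7 h8 h9
  rw [h1, h2, h3, h4, h5, h6, h7, h8, h9, smul_add, add_assoc]
  rfl

/-- Every vector of the domain has the form `S0 w`, and `H` is then expressed through the bounded
operators `K` and `S0`. In this way the whole analysis avoids unbounded operators. -/
lemma rep_ham (h : p.Regular c Λ) (w : Fock d) : p.ham (h.S0 w).rep =ᵐ[lebesguePoisson d]
    fun Q => (w + h.K w - (c : ℂ) • h.S0 w).rep Q := by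
  filter_upwards [h.rep_K w, h.rep_eq_energy_smul w, Fock.rep_sub (w + h.K w) ((c : ℂ) • h.S0 w),
    Fock.rep_add w (h.K w), Fock.rep_smul (c : ℂ) (h.S0 w)] with Q h1 h2 h3 h4 h5
  rw [h3, h4, h5, h1, h2]
  rw [Complex.ofReal_add, add_smul]
  unfold ham
  abel

lemma inDomain_S0 (h : p.Regular c Λ) (w : Fock d) : p.InDomain (h.S0 w) := by
  have h1 : MemLp (fun Q => w.rep Q - (c : ℂ) • (h.S0 w).rep Q) 2 (lebesguePoisson d) :=
    w.memLp_rep.sub ((h.S0 w).memLp_rep.const_smul (c : ℂ))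
  refine h1.ae_eq ?_
  filter_upwards [h.rep_eq_energy_smul w] with Q hQ
  rw [hQ, Complex.ofReal_add, add_smul, add_sub_cancel_right]

lemma exists_eq_S0 (h : p.Regular c Λ) {u : Fock d} (hu : p.InDomain u) : ∃ w, u = h.S0 w := by
  have h1 : MemLp (fun Q => ((p.omQ Q + c : ℝ) : ℂ) • u.rep Q) 2 (lebesguePoisson d) := by
    refine (MemLp.add hu (u.memLp_rep.const_smul (c : ℂ))).ae_eq (.of_forall fun Q => ?_)
    simp [add_smul]
  have h2 : IsSymm (fun Q => ((p.omQ Q + c : ℝ) : ℂ) • u.rep Q) :=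
    u.isSymm_rep.smul fun s Q => by simp only [omQ_relabel]
  refine ⟨Fock.mk _ h1 h2, Fock.ext_rep ?_⟩
  filter_upwards [h.rep_S0 (Fock.mk _ h1 h2), Fock.rep_mk _ h1 h2] with Q h3 h4
  rw [h3, h4, smul_smul, ← Complex.ofReal_mul, invEnergy, inv_mul_cancel₀ (h.energy_pos Q).ne']
  simp

lemma hamRel_S0_iff (h : p.Regular c Λ) (w G : Fock d) :
    p.HamRel (h.S0 w) G ↔ G = w + h.K w - (c : ℂ) • h.S0 w := by
  constructor
  · intro hG
    refine Fock.ext_rep ?_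
    filter_upwards [hG.2, h.rep_ham w] with Q h1 h2
    rw [h1, h2]
  · rintro rfl
    refine ⟨h.inDomain_S0 w, ?_⟩
    filter_upwards [h.rep_ham w] with Q h2
    rw [h2]

lemma inner_S0 (h : p.Regular c Λ) (F G : Fock d) :
    (inner ℂ (h.S0 F) G : ℂ) = inner ℂ F (h.S0 G) :=
  (ContinuousLinearMap.isSelfAdjoint_iff_isSymmetric.1 h.S0_selfAdjoint) F G

lemma inner_S0_cre (h : p.Regular c Λ) (u v : Fock d) :
    (inner ℂ (h.S0 u) (spin1 d (h.creL h.lam_bound v)) : ℂ)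
      = inner ℂ (spin1 d (h.annL h.lam_bound u)) (h.S0 v) := by
  rw [← inner_spin1, S0_spin1, ← Fock.inner_conj, inner_creL, Fock.inner_conj, annL_spin1]

lemma inner_S0_K (h : p.Regular c Λ) (u v : Fock d) :
    (inner ℂ (h.S0 u) (h.K v) : ℂ) = inner ℂ (h.K u) (h.S0 v) := by
  have h1 := h.inner_S0_cre u v
  have h2 := h.inner_S0_cre v u
  have h3 : (inner ℂ (h.S0 u) (spin1 d (h.annL h.lam_bound v)) : ℂ)
      = inner ℂ (spin1 d (h.creL h.lam_bound u)) (h.S0 v) := by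
    rw [← Fock.inner_conj, ← h2, Fock.inner_conj]
  simp only [K_apply, inner_add_left, inner_add_right, Fock.inner_smul_left,
    Fock.inner_smul_right, Complex.conj_ofReal, h1, h3, inner_spin3]
  ring

lemma K_symm (h : p.Regular c Λ) (v : Fock d) :
    h.S0 (h.K v) = ContinuousLinearMap.adjoint h.K (h.S0 v) := by
  refine ext_inner_left ℂ fun u => ?_
  rw [ContinuousLinearMap.adjoint_inner_right, ← inner_S0, inner_S0_K]

lemma norm_K_apply_le (h : p.Regular c Λ) (w : Fock d) :
    ‖h.K w‖ ≤ (p.eps * c⁻¹ + p.alpha * (2 * (Λ * p.kappa⁻¹))) * ‖w‖ := by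
  have h3 : ‖spin3 d (h.S0 w)‖ ≤ c⁻¹ * ‖w‖ :=
    (ContinuousLinearMap.le_of_opNorm_le _ norm_spin3_le _).trans
      (by rw [one_mul]; exact ContinuousLinearMap.le_of_opNorm_le _ h.norm_S0_le w)
  have h4 : ‖spin1 d (h.creL h.lam_bound w)‖ ≤ Λ * p.kappa⁻¹ * ‖w‖ :=
    (ContinuousLinearMap.le_of_opNorm_le _ norm_spin1_le _).trans
      (by rw [one_mul]; exact ContinuousLinearMap.le_of_opNorm_le _ (h.norm_creL_le _) w)
  have h5 : ‖spin1 d (h.annL h.lam_bound w)‖ ≤ Λ * p.kappa⁻¹ * ‖w‖ :=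
    (ContinuousLinearMap.le_of_opNorm_le _ norm_spin1_le _).trans
      (by rw [one_mul]; exact ContinuousLinearMap.le_of_opNorm_le _ (h.norm_annL_le _) w)
  rw [K_apply]
  refine (norm_add_le _ _).trans ?_
  rw [Fock.norm_smul, Fock.norm_smul, Complex.norm_real, Complex.norm_real,
    Real.norm_of_nonneg h.eps_nonneg, Real.norm_of_nonneg h.alpha_nonneg]
  have h6 := norm_add_le (spin1 d (h.creL h.lam_bound w)) (spin1 d (h.annL h.lam_bound w))
  have h7 := mul_le_mul_of_nonneg_left h3 h.eps_nonneg
  have h8 := mul_le_mul_of_nonneg_left (h6.trans (add_le_add h4 h5)) h.alpha_nonneg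
  linarith

end Regular
end Model

/-! ### Lower bounds of the Hamiltonian -/

variable {d : ℕ} {p : Model d} {c Λ η : ℝ}

lemma ofReal_norm_sq_eq_enorm_sq {V : Type*} [NormedAddCommGroup V] (v : V) :
    ENNReal.ofReal (‖v‖ ^ 2) = ‖v‖ₑ ^ 2 := by
  rw [ENNReal.ofReal_pow (norm_nonneg _), ofReal_norm]

lemma Fock.norm_sq_eq (F : Fock d) : ‖F‖ ^ 2 = ∫ Q, ‖F.rep Q‖ ^ 2 ∂lebesguePoisson d := by
  have h := F.lintegral_rep
  rw [integral_eq_lintegral_of_nonneg_ae (.of_forall fun Q => by positivity)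
    (F.measurable_rep.norm.pow_const 2).aestronglyMeasurable]
  simp_rw [ofReal_norm_sq_eq_enorm_sq]
  rw [h, ENNReal.toReal_ofReal (by positivity)]

lemma Fock.integrable_norm_sq (F : Fock d) :
    Integrable (fun Q => ‖F.rep Q‖ ^ 2) (lebesguePoisson d) :=
  (memLp_two_iff_integrable_sq_norm F.memLp_rep.1).1 F.memLp_rep

namespace Model.Regular

lemma measurable_natCast_card : Measurable fun Q : Config d => (Q.1 : ℝ) :=
  (Measurable.of_discrete (f := fun n : ℕ => (n : ℝ))).comp measurable_card

lemma integrable_card_mul (h : p.Regular c Λ) (w : Fock d) :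
    Integrable (fun Q => (Q.1 : ℝ) * ‖(h.S0 w).rep Q‖ ^ 2) (lebesguePoisson d) := by
  refine ⟨(measurable_natCast_card.mul
    ((h.S0 w).measurable_rep.norm.pow_const 2)).aestronglyMeasurable, ?_⟩
  rw [hasFiniteIntegral_iff_norm]
  refine ((lintegral_mono fun Q => ?_).trans (h.lintegral_number w)).trans_lt
    ENNReal.ofReal_lt_top
  rw [Real.norm_of_nonneg (by positivity), ENNReal.ofReal_mul (by positivity),
    ofReal_norm_sq_eq_enorm_sq, ENNReal.ofReal_natCast]
  gcongr
  exact Nat.le_succ _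

lemma re_inner_S0_self (h : p.Regular c Λ) (w : Fock d) :
    Integrable (fun Q => (p.omQ Q + c) * ‖(h.S0 w).rep Q‖ ^ 2) (lebesguePoisson d) ∧
    (inner ℂ (h.S0 w) w : ℂ).re
      = ∫ Q, (p.omQ Q + c) * ‖(h.S0 w).rep Q‖ ^ 2 ∂lebesguePoisson d := by
  have hi := (MemLp.integrable_inner (h.S0 w).memLp_rep w.memLp_rep)
  have he : (fun Q => ((inner ℂ ((h.S0 w).rep Q) (w.rep Q) : ℂ)).re) =ᵐ[lebesguePoisson d]
      fun Q => (p.omQ Q + c) * ‖(h.S0 w).rep Q‖ ^ 2 := by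
    filter_upwards [h.rep_eq_energy_smul w] with Q hQ
    rw [hQ, inner_smul_right, inner_self_eq_norm_sq_to_K]
    change (((p.omQ Q + c : ℝ) : ℂ) * ((‖(h.S0 w).rep Q‖ : ℝ) : ℂ) ^ 2).re = _
    rw [← Complex.ofReal_pow, ← Complex.ofReal_mul, Complex.ofReal_re]
  refine ⟨hi.re.congr he, ?_⟩
  rw [Fock.inner_eq, ← integral_congr_ae he]
  exact (integral_re hi).symm

/-- Annihilation is bounded by the square root of the number operator. In the form estimate this
permits absorption into `κ N`, which the operator bound by `‖w‖` does not. -/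
lemma norm_annL_sq_le (h : p.Regular c Λ) {φ : Mom d → ℂ} {N : ℝ} (hφ : L2Bound φ N)
    (w : Fock d) : ‖h.annL hφ w‖ ^ 2
      ≤ N ^ 2 * ∫ Q, (Q.1 : ℝ) * ‖(h.S0 w).rep Q‖ ^ 2 ∂lebesguePoisson d := by
  have h1 := lintegral_annOne_le hφ.meas.aemeasurable (h.S0 w).measurable_rep (fun _ => 1)
  simp only [one_mul] at h1
  have h2 : ∫⁻ Q, ‖(h.annL hφ w).rep Q‖ₑ ^ 2 ∂lebesguePoisson d
      = ∫⁻ Q, ‖annOne φ (h.S0 w).rep Q‖ₑ ^ 2 ∂lebesguePoisson d := by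
    refine lintegral_congr_ae ?_
    filter_upwards [h.rep_annL hφ w] with Q hQ
    rw [hQ]
  have h3 : ∫⁻ Q : Config d, (Q.1 : ℝ≥0∞) * ‖(h.S0 w).rep Q‖ₑ ^ 2 ∂lebesguePoisson d
      = ENNReal.ofReal (∫ Q, (Q.1 : ℝ) * ‖(h.S0 w).rep Q‖ ^ 2 ∂lebesguePoisson d) := by
    rw [ofReal_integral_eq_lintegral_ofReal (h.integrable_card_mul w)
      (.of_forall fun Q => by positivity)]
    refine lintegral_congr fun Q => ?_
    rw [ENNReal.ofReal_mul (by positivity), ofReal_norm_sq_eq_enorm_sq, ENNReal.ofReal_natCast]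
  rw [← h2, Fock.lintegral_rep, h3] at h1
  have hb : 0 ≤ ∫ Q, (Q.1 : ℝ) * ‖(h.S0 w).rep Q‖ ^ 2 ∂lebesguePoisson d :=
    integral_nonneg fun Q => by positivity
  have h4 := h1.trans (mul_le_mul_left hφ.bound _)
  rw [← ENNReal.ofReal_mul (by positivity)] at h4
  exact (ENNReal.ofReal_le_ofReal_iff (by positivity)).1 h4

/-- Lower bound of the quadratic form of `H + c`. -/
lemma form_ge (h : p.Regular c Λ) (w : Fock d) :
    ∫ Q : Config d, ((p.kappa - p.alpha * Λ) * Q.1 + (c - p.eps - p.alpha * Λ))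
        * ‖(h.S0 w).rep Q‖ ^ 2 ∂lebesguePoisson d
      ≤ (inner ℂ (h.S0 w) (w + h.K w) : ℂ).re := by
  set u := h.S0 w with hu
  set a := ∫ Q, ‖u.rep Q‖ ^ 2 ∂lebesguePoisson d with ha
  set b := ∫ Q, (Q.1 : ℝ) * ‖u.rep Q‖ ^ 2 ∂lebesguePoisson d with hb
  have hai := u.integrable_norm_sq
  have hbi := h.integrable_card_mul w
  have hb0 : 0 ≤ b := integral_nonneg fun Q => by positivity
  have hau : ‖u‖ ^ 2 = a := u.norm_sq_eq
  have hL : ∫ Q : Config d, ((p.kappa - p.alpha * Λ) * Q.1 + (c - p.eps - p.alpha * Λ))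
      * ‖u.rep Q‖ ^ 2 ∂lebesguePoisson d
      = (p.kappa - p.alpha * Λ) * b + (c - p.eps - p.alpha * Λ) * a := by
    rw [ha, hb, ← integral_const_mul, ← integral_const_mul,
      ← integral_add (hbi.const_mul _) (hai.const_mul _)]
    congr 1; ext Q; ring
  obtain ⟨hwi, hw⟩ := h.re_inner_S0_self w
  have h1 : p.kappa * b + c * a ≤ (inner ℂ u w : ℂ).re := by
    rw [hw, ha, hb, ← integral_const_mul, ← integral_const_mul,
      ← integral_add (hbi.const_mul _) (hai.const_mul _)]
    refine integral_mono ((hbi.const_mul _).add (hai.const_mul _)) hwi fun Q => ?_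
    have := h.card_mul_le_omQ Q
    change p.kappa * (Q.1 * ‖u.rep Q‖ ^ 2) + c * ‖u.rep Q‖ ^ 2 ≤ _
    have h2 : 0 ≤ ‖u.rep Q‖ ^ 2 := by positivity
    nlinarith
  have h3 : ‖(inner ℂ u (spin3 d u) : ℂ)‖ ≤ a := by
    rw [← hau, sq]
    refine (norm_inner_le_norm (𝕜 := ℂ) u (spin3 d u)).trans ?_
    refine mul_le_mul_of_nonneg_left ?_ (norm_nonneg _)
    simpa using ContinuousLinearMap.le_of_opNorm_le _ norm_spin3_le u
  have h4 : ‖h.annL h.lam_bound w‖ ≤ Λ * √b := by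
    refine le_of_sq_le_sq ?_ (mul_nonneg h.lam_bound.nonneg (Real.sqrt_nonneg _))
    rw [mul_pow, Real.sq_sqrt hb0]
    exact h.norm_annL_sq_le h.lam_bound w
  have h5 : ‖(inner ℂ u (spin1 d (h.annL h.lam_bound w)) : ℂ)‖ ≤ ‖u‖ * (Λ * √b) := by
    refine (norm_inner_le_norm (𝕜 := ℂ) u _).trans ?_
    refine mul_le_mul_of_nonneg_left ?_ (norm_nonneg _)
    refine le_trans ?_ h4
    simpa using ContinuousLinearMap.le_of_opNorm_le _ norm_spin1_le (h.annL h.lam_bound w)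
  -- The interaction is bounded by `α Λ (N + 1)` in the sense of forms, which accounts for the two
  -- losses `α Λ` in the statement.
  have h6 : 2 * (‖u‖ * (Λ * √b)) ≤ Λ * (a + b) := by
    have h7 := two_mul_le_add_sq ‖u‖ √b
    rw [Real.sq_sqrt hb0, hau] at h7
    have h8 := mul_le_mul_of_nonneg_left h7 h.lam_bound.nonneg
    linarith
  have h9 : (inner ℂ u (spin1 d (h.creL h.lam_bound w)) : ℂ).re
      = (inner ℂ u (spin1 d (h.annL h.lam_bound w)) : ℂ).re := by
    rw [hu, h.inner_S0_cre, ← Fock.inner_conj, Complex.conj_re]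
  have h10 : (inner ℂ u (w + h.K w) : ℂ).re = (inner ℂ u w : ℂ).re
      + p.eps * (inner ℂ u (spin3 d u) : ℂ).re
      + p.alpha * (2 * (inner ℂ u (spin1 d (h.annL h.lam_bound w)) : ℂ).re) := by
    rw [K_apply, inner_add_right, inner_add_right, Fock.inner_smul_right, Fock.inner_smul_right,
      inner_add_right]
    simp only [Complex.add_re, Complex.re_ofReal_mul, h9, ← hu]
    ring
  rw [hL, h10]
  have h11 := (abs_le.1 ((Complex.abs_re_le_norm _).trans h3)).1
  have h12 := (abs_le.1 ((Complex.abs_re_le_norm _).trans h5)).1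
  have h13 := mul_le_mul_of_nonneg_left h11 h.eps_nonneg
  have h14 : -(Λ * (a + b)) ≤ 2 * (inner ℂ u (spin1 d (h.annL h.lam_bound w)) : ℂ).re := by
    linarith
  have h15 := mul_le_mul_of_nonneg_left h14 h.alpha_nonneg
  linarith

lemma norm_sub_numProj_sq (n : ℕ) (u : Fock d) : ‖u - numProj d n u‖ ^ 2
    = ∫ Q : Config d, (if Q.1 ≤ n then 0 else 1) * ‖u.rep Q‖ ^ 2 ∂lebesguePoisson d := by
  rw [Fock.norm_sq_eq]
  refine integral_congr_ae ?_
  filter_upwards [Fock.rep_sub u (numProj d n u), rep_numProj n u] with Q h1 h2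
  rw [h1, h2]
  split_ifs <;> simp

/-- The lower bound of the form is a function of the boson number, as is the projection, so the
operator inequality reduces to one of numbers. -/
lemma form_ge_numProj (h : p.Regular c Λ) {n : ℕ} {E : ℝ}
    (hE : ∀ m : ℕ, E * (if m ≤ n then 0 else 1)
      ≤ (p.kappa - p.alpha * Λ) * m + (c - p.eps - p.alpha * Λ)) (w : Fock d) :
    E * ‖h.S0 w - numProj d n (h.S0 w)‖ ^ 2 ≤ (inner ℂ (h.S0 w) (w + h.K w) : ℂ).re := by
  refine le_trans ?_ (h.form_ge w)
  rw [norm_sub_numProj_sq, ← integral_const_mul]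
  have hai := (h.S0 w).integrable_norm_sq
  have hbi := h.integrable_card_mul w
  have hm : Measurable fun Q : Config d => E * ((if Q.1 ≤ n then (0 : ℝ) else 1)
      * ‖(h.S0 w).rep Q‖ ^ 2) :=
    measurable_const.mul (((Measurable.of_discrete
      (f := fun m : ℕ => if m ≤ n then (0 : ℝ) else 1)).comp measurable_card).mul
        ((h.S0 w).measurable_rep.norm.pow_const 2))
  refine integral_mono ((hai.const_mul |E|).mono' hm.aestronglyMeasurable
    (.of_forall fun Q => ?_)) (((hbi.const_mul (p.kappa - p.alpha * Λ)).add
      (hai.const_mul (c - p.eps - p.alpha * Λ))).congr (.of_forall fun Q => ?_)) fun Q => ?_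
  · rw [norm_mul, Real.norm_eq_abs]
    refine mul_le_mul_of_nonneg_left ?_ (abs_nonneg _)
    split_ifs <;> simp
  · simp only [Pi.add_apply]; ring
  · simp only [← mul_assoc]
    exact mul_le_mul_of_nonneg_right (hE Q.1) (by positivity)

end Model.Regular

/-- The coupling is weak enough for the spectral gaps that the construction uses. -/
structure Model.Weak (p : Model d) (c Λ η : ℝ) : Prop extends p.Regular c Λ where
  eta_pos : 0 < η
  eight_eps_le : 8 * p.eps ≤ c
  sum_le : p.eps + p.kappa + η ≤ c
  coupling_kappa : 8 * (p.alpha * Λ) ≤ p.kappa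
  coupling_eta : 6 * (p.alpha * Λ) ≤ η

namespace Model.Weak

lemma coupling_nonneg (h : p.Weak c Λ η) : 0 ≤ p.alpha * Λ :=
  mul_nonneg h.alpha_nonneg h.lam_bound.nonneg

lemma norm_K_le (h : p.Weak c Λ η) : ‖h.toRegular.K‖ ≤ 1 / 2 := by
  refine ContinuousLinearMap.opNorm_le_bound _ (by norm_num) fun w => ?_
  refine (h.toRegular.norm_K_apply_le w).trans ?_
  refine mul_le_mul_of_nonneg_right ?_ (norm_nonneg _)
  have hc := h.toRegular.shift_pos
  have hk := h.kappa_pos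
  -- The spin term contributes `1/8`, creation and annihilation `1/8` each, in total less than
  -- `1/2`.
  have h1 : p.eps * c⁻¹ ≤ 1 / 8 := by
    rw [← div_eq_mul_inv, div_le_iff₀ hc]; linarith [h.eight_eps_le]
  have h2 : (p.alpha * Λ) * p.kappa⁻¹ ≤ 1 / 8 := by
    rw [← div_eq_mul_inv, div_le_iff₀ hk]; linarith [h.coupling_kappa]
  linarith

/-- The bottom of the spectrum of `H + c` on more than `n` bosons is above this. -/
def gap (p : Model d) (c η : ℝ) (n : ℕ) : ℝ := p.threshold (n + 1) - η / 2 + c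

lemma formBound (h : p.Weak c Λ η) {n : ℕ} (hn : n ≤ 1) :
    FormBound h.toRegular.S0 h.toRegular.K (numProj d n) (gap p c η n) where
  selfAdjoint := h.toRegular.S0_selfAdjoint
  injective := h.toRegular.S0_injective
  symm := h.toRegular.K_symm
  norm_le := h.norm_K_le
  proj_selfAdjoint := numProj_selfAdjoint n
  proj_idem := numProj_idem n
  proj_comm := h.toRegular.S0_numProj n
  pos := by
    have h1 : 0 ≤ (n + 1 : ℝ) * p.kappa := mul_nonneg (by positivity) h.kappa_pos.le
    have := h.sum_le
    have := h.kappa_pos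
    have := h.eta_pos
    unfold gap threshold
    push_cast
    linarith
  form := h.toRegular.form_ge_numProj fun m => by
    have hk := h.kappa_pos
    have hs := h.sum_le
    have he := h.eta_pos
    have hck := h.coupling_kappa
    have hce := h.coupling_eta
    have hc0 := h.coupling_nonneg
    have hpos : 0 ≤ p.kappa - p.alpha * Λ := by linarith
    split_ifs with hm
    · have : 0 ≤ (p.kappa - p.alpha * Λ) * m := mul_nonneg hpos (Nat.cast_nonneg _)
      linarith
    -- From `n + 1` bosons on, the loss is `(n + 2) α Λ ≤ 3 α Λ ≤ η / 2`; this is the reason for the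
    -- constant `6` in `coupling_eta` and for the restriction to `n ≤ 1`.
    · have h1 : ((n : ℝ) + 1) ≤ m := by exact_mod_cast not_le.1 hm
      have h2 := mul_le_mul_of_nonneg_left h1 hpos
      have h3 : (n : ℝ) ≤ 1 := by exact_mod_cast hn
      have h4 : p.alpha * Λ * n ≤ p.alpha * Λ * 1 := mul_le_mul_of_nonneg_left h3 hc0
      unfold gap threshold
      push_cast
      nlinarith

/-- Strict positivity of `H + c` on the whole space. Applied to the bound state it gives `e + c >
0`. -/
lemma form_lower (h : p.Weak c Λ η) (w : Fock d) :
    p.kappa / 2 * ‖h.toRegular.S0 w‖ ^ 2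
      ≤ (inner ℂ (h.toRegular.S0 w) (w + h.toRegular.K w) : ℂ).re := by
  refine le_trans ?_ (h.toRegular.form_ge w)
  rw [Fock.norm_sq_eq, ← integral_const_mul]
  have hai := (h.toRegular.S0 w).integrable_norm_sq
  have hbi := h.toRegular.integrable_card_mul w
  refine integral_mono (hai.const_mul _) (((hbi.const_mul (p.kappa - p.alpha * Λ)).add
      (hai.const_mul (c - p.eps - p.alpha * Λ))).congr (.of_forall fun Q => ?_)) fun Q => ?_
  · simp only [Pi.add_apply]; ring
  · refine mul_le_mul_of_nonneg_right ?_ (by positivity)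
    have hk := h.kappa_pos
    have hs := h.sum_le
    have he := h.eta_pos
    have hck := h.coupling_kappa
    have : 0 ≤ (p.kappa - p.alpha * Λ) * Q.1 :=
      mul_nonneg (by linarith) (Nat.cast_nonneg _)
    linarith

end Model.Weak

/-! ### Elimination of components -/

/-- Creation raises the boson number by one. The truncated subtraction is harmless: without bosons
`addOne` is zero in any case. -/
lemma addOne_eq_zero_of_level {F : Config d → Spin} {s : ℕ → Prop}
    (hF : ∀ᵐ Q ∂lebesguePoisson d, s Q.1 → F Q = 0) (φ : Mom d → ℂ) :
    ∀ᵐ Q ∂lebesguePoisson d, s (Q.1 - 1) → addOne φ F Q = 0 := by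
  classical
  have h1 : F =ᵐ[lebesguePoisson d] fun Q => if s Q.1 then 0 else F Q := by
    filter_upwards [hF] with Q hQ
    split_ifs with hs
    · exact hQ hs
    · rfl
  filter_upwards [addOne_congr (φ := φ) ae_eq_rfl h1] with Q hQ hs
  rw [hQ]
  rcases Q with ⟨_ | n, k⟩
  · rfl
  · exact Finset.sum_eq_zero fun j _ => by
      change φ (k j) • (if s n then (0 : Spin) else _) = 0
      rw [if_pos (show s n from hs), smul_zero]

lemma annOne_eq_zero_of_level {F : Config d → Spin} {s : ℕ → Prop}
    (hF : ∀ᵐ Q ∂lebesguePoisson d, s Q.1 → F Q = 0) (φ : Mom d → ℂ) :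
    ∀ᵐ Q ∂lebesguePoisson d, s (Q.1 + 1) → annOne φ F Q = 0 := by
  classical
  have h1 : F =ᵐ[lebesguePoisson d] fun Q => if s Q.1 then 0 else F Q := by
    filter_upwards [hF] with Q hQ
    split_ifs with hs
    · exact hQ hs
    · rfl
  filter_upwards [annOne_congr (φ := φ) ae_eq_rfl h1] with Q hQ hs
  rw [hQ, annOne]
  simp [hs]

lemma numProj_eq_iff {n : ℕ} {F G : Fock d} : numProj d n F = numProj d n G ↔
    ∀ᵐ Q ∂lebesguePoisson d, Q.1 ≤ n → F.rep Q = G.rep Q := by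
  constructor
  · intro h
    have h2 := rep_numProj n G
    rw [← h] at h2
    filter_upwards [rep_numProj n F, h2] with Q h3 h4 hQ
    simpa [hQ] using h3.symm.trans h4
  · intro h
    refine Fock.ext_rep ?_
    filter_upwards [rep_numProj n F, rep_numProj n G, h] with Q h1 h2 h3
    rw [h1, h2]
    split_ifs with hQ
    · rw [h3 hQ]
    · simp

lemma numProj_eq_zero_iff {n : ℕ} {F : Fock d} : numProj d n F = 0 ↔
    ∀ᵐ Q ∂lebesguePoisson d, Q.1 ≤ n → F.rep Q = 0 := by
  rw [← map_zero (numProj d n), numProj_eq_iff]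
  constructor <;> intro h <;> filter_upwards [h, Fock.rep_zero] with Q h1 h2 hQ
  · rw [h1 hQ, h2]
  · rw [h1 hQ, h2]

lemma numProj_eq_self_iff {n : ℕ} {F : Fock d} : numProj d n F = F ↔
    ∀ᵐ Q ∂lebesguePoisson d, n < Q.1 → F.rep Q = 0 := by
  constructor
  · intro h
    have h2 := rep_numProj n F
    rw [h] at h2
    filter_upwards [h2] with Q h3 hQ
    rw [h3, if_neg (not_le.2 hQ), zero_smul]
  · intro h
    refine Fock.ext_rep ?_
    filter_upwards [rep_numProj n F, h] with Q h1 h3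
    rw [h1]
    split_ifs with hQ
    · rw [one_smul]
    · rw [h3 (not_le.1 hQ), smul_zero]

lemma numProj_sub_eq_self_iff {n : ℕ} {F G : Fock d} : numProj d n (F - G) = F - G ↔
    ∀ᵐ Q ∂lebesguePoisson d, n < Q.1 → F.rep Q = G.rep Q := by
  rw [numProj_eq_self_iff]
  constructor <;> intro h <;> filter_upwards [h, Fock.rep_sub F G] with Q h1 h2 hQ
  · rw [← sub_eq_zero, ← h2, h1 hQ]
  · rw [h2, h1 hQ, sub_self]

/-! ### The Schur complement for the elimination of many-boson components -/

namespace Model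
variable {p : Model d} {c Λ η : ℝ}

namespace Regular

/-- The map `w ↦ (H + c - m) (H₀ + c)⁻¹ w`. -/
def pencil (h : p.Regular c Λ) (m : ℂ) : Fock d →L[ℂ] Fock d :=
  ContinuousLinearMap.id ℂ (Fock d) + h.K + (-m) • h.S0

lemma pencil_apply (h : p.Regular c Λ) (m : ℂ) (w : Fock d) :
    h.pencil m w = w + h.K w + (-m) • h.S0 w := rfl

lemma rep_pencil (h : p.Regular c Λ) (z : ℂ) (w : Fock d) : ∀ᵐ Q ∂lebesguePoisson d,
    p.ham (h.S0 w).rep Q - z • (h.S0 w).rep Q = (h.pencil (z + c) w).rep Q := by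
  have he : h.pencil (z + c) w = (w + h.K w - (c : ℂ) • h.S0 w) - z • h.S0 w := by
    rw [pencil_apply, neg_add, add_smul, neg_smul, neg_smul]; abel
  rw [he]
  filter_upwards [h.rep_ham w, Fock.rep_sub (w + h.K w - (c : ℂ) • h.S0 w) (z • h.S0 w),
    Fock.rep_smul z (h.S0 w)] with Q h1 h2 h3
  rw [h1, h2, h3]

lemma hamRel_iff_pencil (h : p.Regular c Λ) (z : ℂ) (w : Fock d) :
    p.HamRel (h.S0 w) (z • h.S0 w) ↔ h.pencil (z + c) w = 0 := by
  rw [hamRel_S0_iff, pencil_apply, neg_add, add_smul, neg_smul, neg_smul, eq_comm,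
    ← sub_eq_zero]
  constructor <;> intro hh <;> rw [← hh] <;> abel

lemma S0_eq_zero_of_level (h : p.Regular c Λ) {s : ℕ → Prop} {w : Fock d}
    (hw : ∀ᵐ Q ∂lebesguePoisson d, s Q.1 → w.rep Q = 0) :
    ∀ᵐ Q ∂lebesguePoisson d, s Q.1 → (h.S0 w).rep Q = 0 := by
  filter_upwards [hw, h.rep_S0 w] with Q h1 h2 hs
  rw [h2, h1 hs, smul_zero]

lemma cre_eq_zero_of_level {F : Config d → Spin} {s : ℕ → Prop}
    (hF : ∀ᵐ Q ∂lebesguePoisson d, s Q.1 → F Q = 0) :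
    ∀ᵐ Q ∂lebesguePoisson d, s (Q.1 - 1) → p.cre F Q = 0 := by
  filter_upwards [addOne_eq_zero_of_level hF p.lam] with Q hQ hs
  rw [cre, hQ hs, ← actL_apply, map_zero, smul_zero]

lemma ann_eq_zero_of_level {F : Config d → Spin} {s : ℕ → Prop}
    (hF : ∀ᵐ Q ∂lebesguePoisson d, s Q.1 → F Q = 0) :
    ∀ᵐ Q ∂lebesguePoisson d, s (Q.1 + 1) → p.ann F Q = 0 := by
  filter_upwards [annOne_eq_zero_of_level hF p.lam] with Q hQ hs
  change (p.alpha : ℂ) • act sigma1 (annOne p.lam F Q) = 0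
  rw [hQ hs, ← actL_apply, map_zero, smul_zero]

lemma act_zero (A : Matrix (Fin 2) (Fin 2) ℂ) : act A 0 = 0 := by
  rw [← actL_apply, map_zero]

/-- Above `n` bosons, `H` acts on vectors with at most `n` bosons by creation. -/
lemma pencil_high (h : p.Regular c Λ) {n : ℕ} {w : Fock d} (hw : numProj d n w = w) (z : ℂ) :
    ∀ᵐ Q ∂lebesguePoisson d, n < Q.1 →
      (h.pencil (z + c) w).rep Q = p.cre (h.S0 w).rep Q ∧
      (n + 1 < Q.1 → p.cre (h.S0 w).rep Q = 0) := by
  have h0 := h.S0_eq_zero_of_level (s := fun m => n < m) (numProj_eq_self_iff.1 hw)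
  filter_upwards [h0, cre_eq_zero_of_level (p := p) (s := fun m => n < m) h0,
    ann_eq_zero_of_level (p := p) (s := fun m => n < m) h0,
    h.rep_pencil z w] with Q h1 h2 h3 h4 hQ
  refine ⟨?_, fun hQ' => h2 (by omega)⟩
  rw [← h4, ham, h1 hQ, h3 (by omega), act_zero]
  simp

/-- On at most `n` bosons, `H` acts on vectors with more than `n` bosons by annihilation. -/
lemma pencil_low (h : p.Regular c Λ) {n : ℕ} {w : Fock d} (hw : numProj d n w = 0) (z : ℂ) :
    ∀ᵐ Q ∂lebesguePoisson d, Q.1 ≤ n →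
      (h.pencil (z + c) w).rep Q = p.ann (h.S0 w).rep Q ∧
      (Q.1 < n → p.ann (h.S0 w).rep Q = 0) := by
  have h0 := h.S0_eq_zero_of_level (s := fun m => m ≤ n) (numProj_eq_zero_iff.1 hw)
  filter_upwards [h0, cre_eq_zero_of_level (p := p) (s := fun m => m ≤ n) h0,
    ann_eq_zero_of_level (p := p) (s := fun m => m ≤ n) h0,
    h.rep_pencil z w] with Q h1 h2 h3 h4 hQ
  refine ⟨?_, fun hQ' => h3 (Nat.succ_le_of_lt hQ')⟩
  have h5 : p.cre (h.S0 w).rep Q = 0 := h2 ((Nat.sub_le _ _).trans hQ)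
  rw [← h4, ham, h1 hQ, h5, act_zero, smul_zero, smul_zero, smul_zero, zero_add, zero_add,
    zero_add, sub_zero]

lemma numProj_S0_eq_zero (h : p.Regular c Λ) {n : ℕ} {w : Fock d} :
    numProj d n (h.S0 w) = 0 ↔ numProj d n w = 0 := by
  rw [h.S0_numProj]
  exact ⟨fun hw => h.S0_injective (by rw [hw, map_zero]), fun hw => by rw [hw, map_zero]⟩

lemma numProj_S0_eq_self (h : p.Regular c Λ) {n : ℕ} {w : Fock d} :
    numProj d n (h.S0 w) = h.S0 w ↔ numProj d n w = w := by
  rw [h.S0_numProj]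
  exact ⟨fun hw => h.S0_injective hw, fun hw => by rw [hw]⟩

end Regular

namespace Weak

/-- The hypothesis says that the two equations agree above `n` bosons, so `w - w'` is in the kernel
of the compression, which is injective below the gap. As `resB` and `M1` are defined by choice, all
their algebraic properties come from this uniqueness. -/
lemma compression_unique (h : p.Weak c Λ η) {n : ℕ} (hn : n ≤ 1) {m : ℝ}
    (hm : m < gap p c η n) {w w' : Fock d} (hw : numProj d n w = 0) (hw' : numProj d n w' = 0)
    (hE : numProj d n (h.toRegular.pencil m w - h.toRegular.pencil m w')
      = h.toRegular.pencil m w - h.toRegular.pencil m w') : w = w' := by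
  rw [← sub_eq_zero]
  have hv : numProj d n (w - w') = 0 := by rw [map_sub, hw, hw', sub_zero]
  rw [← map_sub] at hE
  set v := w - w' with hvdef
  refine ((h.formBound hn).bijective_compression hm).1 ?_
  have h1 : numProj d n (h.toRegular.S0 v) = 0 := h.toRegular.numProj_S0_eq_zero.2 hv
  simp only [hv, h1, sub_zero, map_zero, smul_zero, add_zero]
  rw [h.toRegular.pencil_apply, map_add, map_add, map_smul, hv, h1, smul_zero, zero_add,
    add_zero] at hE
  rw [hE]
  abel

/-- The compression is inverted on the part of `g` above `n` bosons; its identity block on the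
remaining components forces `numProj d n w = 0`. -/
lemma compression_exists (h : p.Weak c Λ η) {n : ℕ} (hn : n ≤ 1) {m : ℝ}
    (hm : m < gap p c η n) (g : Fock d) : ∃ w : Fock d, numProj d n w = 0 ∧
      numProj d n (h.toRegular.pencil m w - g) = h.toRegular.pencil m w - g := by
  obtain ⟨w, hw⟩ := ((h.formBound hn).bijective_compression hm).2 (g - numProj d n g)
  simp only at hw
  have hP : numProj d n w = 0 := by
    have := congrArg (numProj d n) hw
    simpa only [map_add, map_sub, map_smul, numProj_idem, sub_self, smul_zero, add_zero] using this
  have h1 : numProj d n (h.toRegular.S0 w) = 0 := h.toRegular.numProj_S0_eq_zero.2 hP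
  refine ⟨w, hP, ?_⟩
  simp only [hP, h1, sub_zero] at hw
  have h2 : h.toRegular.pencil m w - g = numProj d n (h.toRegular.K w) - numProj d n g := by
    rw [h.toRegular.pencil_apply]
    rw [eq_sub_iff_add_eq, ← eq_sub_iff_add_eq', ← sub_eq_zero] at hw
    rw [← sub_eq_zero, ← hw]
    abel
  rw [h2, map_sub, numProj_idem, numProj_idem]

/-- Replaces the chosen solution of a pointwise equation by an operator identity. That the
difference lies in the range of `numProj d n` expresses that the equation is required above `n`
bosons only. -/
lemma resB_spec (h : p.Weak c Λ η) {n : ℕ} (hn : n ≤ 1) {z : ℝ} (hz : z + c < gap p c η n)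
    (g : Fock d) {γ : Config d → Spin}
    (hγ : ∀ᵐ Q ∂lebesguePoisson d, n < Q.1 → g.rep Q = γ Q) :
    ∃ w : Fock d, p.resB n z γ = h.toRegular.S0 w ∧ numProj d n w = 0 ∧
      numProj d n (h.toRegular.pencil (z + c) w - g) = h.toRegular.pencil (z + c) w - g := by
  have hex : ∃ u : Fock d, p.InDomain u ∧
      (∀ᵐ Q ∂(lebesguePoisson d), Q.1 ≤ n → u.rep Q = 0) ∧
      (∀ᵐ Q ∂(lebesguePoisson d), n < Q.1 → p.ham u.rep Q - (z : ℂ) • u.rep Q = γ Q) := by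
    obtain ⟨w, h1, h2⟩ := h.compression_exists hn hz g
    refine ⟨h.toRegular.S0 w, h.toRegular.inDomain_S0 w,
      numProj_eq_zero_iff.1 (h.toRegular.numProj_S0_eq_zero.2 h1), ?_⟩
    rw [Complex.ofReal_add] at h2
    filter_upwards [numProj_sub_eq_self_iff.1 h2, hγ, h.toRegular.rep_pencil z w]
      with Q h3 h4 h5 hQ
    rw [h5, h3 hQ, h4 hQ]
  rw [resB, dif_pos hex]
  obtain ⟨h1, h2, h3⟩ := hex.choose_spec
  obtain ⟨w, hw⟩ := h.toRegular.exists_eq_S0 h1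
  rw [hw] at h2 h3 ⊢
  refine ⟨w, rfl, h.toRegular.numProj_S0_eq_zero.1 (numProj_eq_zero_iff.2 h2),
    numProj_sub_eq_self_iff.2 ?_⟩
  filter_upwards [h3, hγ, h.toRegular.rep_pencil z w] with Q h4 h5 h6 hQ
  rw [← h6, h4 hQ, h5 hQ]

/-- The source of `M1` is restricted to two bosons, but creation from at most one boson reaches no
further, so it is the full part of `H` that maps to more than one boson. -/
lemma M1_spec (h : p.Weak c Λ η) {z : ℝ} (hz : z + c < gap p c η 1) {w : Fock d}
    (hw : numProj d 1 w = w) : ∃ w' : Fock d, p.M1 z (h.toRegular.S0 w) = h.toRegular.S0 w' ∧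
      numProj d 1 w' = 0 ∧
      numProj d 1 (h.toRegular.pencil (z + c) w' - h.toRegular.pencil (z + c) w)
        = h.toRegular.pencil (z + c) w' - h.toRegular.pencil (z + c) w := by
  refine h.resB_spec le_rfl hz _ ?_
  filter_upwards [h.toRegular.pencil_high hw z] with Q h1 hQ
  obtain ⟨h2, h3⟩ := h1 hQ
  rw [h2]
  split_ifs with h4
  · rfl
  · exact h3 (by omega)

/-- The equation that defines `resA`, in terms of the eliminated components. -/
lemma resA_equation_iff (h : p.Weak c Λ η) {x t : ℝ} {w w' g : Fock d}
    {γ : Config d → Spin} (hγ : ∀ᵐ Q ∂lebesguePoisson d, Q.1 ≤ 1 → g.rep Q = γ Q)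
    (hM : p.M1 x (h.toRegular.S0 w) = h.toRegular.S0 w') (hw : numProj d 1 w = w)
    (hw' : numProj d 1 w' = 0)
    (hE : numProj d 1 (h.toRegular.pencil (x + c) w' - h.toRegular.pencil (x + c) w)
        = h.toRegular.pencil (x + c) w' - h.toRegular.pencil (x + c) w) :
    (∀ᵐ Q ∂(lebesguePoisson d), Q.1 ≤ 1 → p.ham (h.toRegular.S0 w).rep Q
        - (if Q.1 = 1 then p.ann (p.M1 x (h.toRegular.S0 w)).rep Q else 0)
        - ((x : ℂ) - t * Complex.I) • (h.toRegular.S0 w).rep Q = γ Q) ↔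
      h.toRegular.pencil (x + c) (w - w')
        + (Complex.I * t) • numProj d 1 (h.toRegular.S0 (w - w')) = numProj d 1 g := by
  set E := h.toRegular.pencil (x + c) with hEdef
  have h1 : numProj d 1 (h.toRegular.S0 (w - w')) = h.toRegular.S0 w := by
    rw [map_sub, map_sub, h.toRegular.numProj_S0_eq_zero.2 hw',
      h.toRegular.numProj_S0_eq_self.2 hw, sub_zero]
  have h2 : numProj d 1 (E (w - w')) = E (w - w') := by
    rw [map_sub E, ← neg_sub, map_neg, hE]
  have h3 : numProj d 1 (E (w - w') + (Complex.I * t) • h.toRegular.S0 w)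
      = E (w - w') + (Complex.I * t) • h.toRegular.S0 w := by
    rw [map_add, map_smul, h2, h.toRegular.numProj_S0_eq_self.2 hw]
  rw [h1, ← h3, numProj_eq_iff, hM]
  have key : ∀ᵐ Q ∂lebesguePoisson d, Q.1 ≤ 1 → p.ham (h.toRegular.S0 w).rep Q
        - (if Q.1 = 1 then p.ann (h.toRegular.S0 w').rep Q else 0)
        - ((x : ℂ) - t * Complex.I) • (h.toRegular.S0 w).rep Q
      = (E (w - w') + (Complex.I * t) • h.toRegular.S0 w).rep Q := by
    rw [map_sub E]
    filter_upwards [h.toRegular.rep_pencil x w, h.toRegular.pencil_low hw' x,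
      Fock.rep_add (E w - E w') ((Complex.I * t) • h.toRegular.S0 w), Fock.rep_sub (E w) (E w'),
      Fock.rep_smul (Complex.I * t) (h.toRegular.S0 w)] with Q h4 h5 h6 h7 h8 hQ
    obtain ⟨h9, h10⟩ := h5 hQ
    have h11 : (if Q.1 = 1 then p.ann (h.toRegular.S0 w').rep Q else 0) = (E w').rep Q := by
      split_ifs with hQ1
      · rw [h9]
      · rw [h9, h10 (by omega)]
    rw [h11, h6, h7, h8, ← h4, sub_smul, mul_comm (t : ℂ)]
    abel
  constructor <;> intro hh <;> filter_upwards [key, hh, hγ] with Q h4 h5 h6 hQ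
  · rw [← h4 hQ, h5 hQ, h6 hQ]
  · rw [h4 hQ, h5 hQ, h6 hQ]

lemma bijective_pencil (h : p.Weak c Λ η) {m t : ℝ} (hm : m < gap p c η 1) (ht : t ≠ 0) :
    Function.Bijective fun w => h.toRegular.pencil m w
      + (Complex.I * t) • numProj d 1 (h.toRegular.S0 w) := by
  have := (h.formBound le_rfl).bijective_im hm ht
  simp only [← add_assoc] at this
  exact this

/-- The vector `(ψ, -M₁ ψ)` over `ψ = (A(x) - x + it)⁻¹ g` solves an equation for `H`. -/
lemma resA_sub_M1 (h : p.Weak c Λ η) {x t : ℝ} (hx : x + c < gap p c η 1) (ht : t ≠ 0)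
    (g : Fock d) {γ : Config d → Spin}
    (hγ : ∀ᵐ Q ∂lebesguePoisson d, Q.1 ≤ 1 → g.rep Q = γ Q) :
    ∃ w : Fock d, -p.resA x ((x : ℂ) - t * Complex.I) γ
        - p.M1 x (-p.resA x ((x : ℂ) - t * Complex.I) γ) = -h.toRegular.S0 w ∧
      h.toRegular.pencil (x + c) w + (Complex.I * t) • numProj d 1 (h.toRegular.S0 w)
        = numProj d 1 g := by
  have hx' : ((x + c : ℝ) : ℂ) = (x : ℂ) + c := Complex.ofReal_add _ _
  have hex : ∃ u : Fock d, p.InDomain u ∧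
      (∀ᵐ Q ∂(lebesguePoisson d), 1 < Q.1 → u.rep Q = 0) ∧
      (∀ᵐ Q ∂(lebesguePoisson d), Q.1 ≤ 1 →
        p.ham u.rep Q - (if Q.1 = 1 then p.ann (p.M1 x u).rep Q else 0)
          - ((x : ℂ) - t * Complex.I) • u.rep Q = γ Q) := by
    obtain ⟨v, hv⟩ := (h.bijective_pencil hx ht).2 (numProj d 1 g)
    simp only at hv
    have h1 : numProj d 1 (numProj d 1 v) = numProj d 1 v := numProj_idem 1 v
    obtain ⟨w', h2, h3, h4⟩ := h.M1_spec hx h1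
    refine ⟨h.toRegular.S0 (numProj d 1 v), h.toRegular.inDomain_S0 _,
      numProj_eq_self_iff.1 (h.toRegular.numProj_S0_eq_self.2 h1), ?_⟩
    rw [h.resA_equation_iff hγ h2 h1 h3 h4]
    -- The Schur complement: the components of `v` above one boson are `-M₁` of its components
    -- below, because both solve the same compressed equation.
    have h5 : w' = numProj d 1 v - v := by
      refine h.compression_unique le_rfl hx h3 (by rw [map_sub, h1, sub_self]) ?_
      rw [hx']
      have h6 : numProj d 1 (h.toRegular.pencil (x + c) v) = h.toRegular.pencil (x + c) v := by
        rw [← hx', eq_sub_of_add_eq hv]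
        simp only [map_sub, map_smul, numProj_idem]
      have h7 : h.toRegular.pencil (x + c) w'
            - h.toRegular.pencil (x + c) (numProj d 1 v - v)
          = (h.toRegular.pencil (x + c) w' - h.toRegular.pencil (x + c) (numProj d 1 v))
            + h.toRegular.pencil (x + c) v := by
        rw [map_sub (h.toRegular.pencil (x + c)) (numProj d 1 v) v]; abel
      rw [h7, map_add, h4, h6]
    rw [h5, sub_sub_cancel, ← hx', hv]
  have hspec := hex.choose_spec
  have hr : p.resA x ((x : ℂ) - t * Complex.I) γ = hex.choose := by rw [resA, dif_pos hex]
  rw [hr]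
  obtain ⟨h1, h2, h3⟩ := hspec
  obtain ⟨w, hw⟩ := h.toRegular.exists_eq_S0 h1
  rw [hw] at h2 h3 ⊢
  have h4 : numProj d 1 w = w := h.toRegular.numProj_S0_eq_self.1 (numProj_eq_self_iff.2 h2)
  obtain ⟨w', h5, h6, h7⟩ := h.M1_spec hx h4
  rw [h.resA_equation_iff hγ h5 h4 h6 h7] at h3
  -- `M1` is a choice, so even its compatibility with a change of sign has to be taken from
  -- uniqueness.
  obtain ⟨w'', h8, h9, h10⟩ := h.M1_spec (w := -w) hx (by rw [map_neg, h4])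
  have h11 : w'' = -w' := by
    refine h.compression_unique le_rfl hx h9 (by rw [map_neg, h6, neg_zero]) ?_
    rw [hx']
    have h12 : h.toRegular.pencil (x + c) w'' - h.toRegular.pencil (x + c) (-w')
        = (h.toRegular.pencil (x + c) w'' - h.toRegular.pencil (x + c) (-w))
          + (h.toRegular.pencil (x + c) w' - h.toRegular.pencil (x + c) w) := by
      rw [map_neg, map_neg]; abel
    rw [h12, map_add, h10, h7]
  refine ⟨w - w', ?_, h3⟩
  rw [← map_neg, h8, h11, map_sub, map_neg, map_neg]
  abel

end Weak
end Model

/-! ### The bound state and the generalised eigenvectors -/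

lemma ae_vacuum {P : Config d → Prop} (h : ∀ᵐ Q ∂lebesguePoisson d, P Q) : P ⟨0, Fin.elim0⟩ := by
  obtain ⟨k, hk⟩ := (ae_config_iff.1 h 0).exists
  rwa [Subsingleton.elim Fin.elim0 k]

lemma numProj_zero_eq_zero {F : Fock d} (hF : F.rep ⟨0, Fin.elim0⟩ = 0) : numProj d 0 F = 0 := by
  refine numProj_eq_zero_iff.2 (.of_forall fun Q hQ => ?_)
  rcases Q with ⟨n, k⟩
  obtain rfl : n = 0 := Nat.le_zero.1 hQ
  rwa [Subsingleton.elim k Fin.elim0]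

lemma config_eq_vacuum {Q : Config d} (hQ : Q.1 = 0) : Q = ⟨0, Fin.elim0⟩ := by
  rcases Q with ⟨n, k⟩
  obtain rfl : n = 0 := hQ
  rw [Subsingleton.elim k Fin.elim0]

namespace Model

lemma lintegral_vac (v : Spin) : ∫⁻ Q, ‖vac v Q‖ₑ ^ 2 ∂lebesguePoisson d = ‖v‖ₑ ^ 2 := by
  rw [lintegral_config, tsum_eq_single 0 fun n hn => by simp [vac, hn]]
  simp only [Nat.factorial_zero, Nat.cast_one, inv_one, one_mul, vac, if_true]
  have : (volume : Measure (Fin 0 → Mom d)) Set.univ = 1 := by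
    rw [volume_pi, Measure.pi_of_empty, Measure.dirac_apply_of_mem (Set.mem_univ _)]
  rw [lintegral_const, this, mul_one]

lemma opFormula_vac : OpFormula (vac : Spin → Config d → Spin) 1 where
  meas v := measurable_config fun n => by
    by_cases hn : n = 0
    · simp only [vac, hn, if_true]
      exact measurable_const
    · simp only [vac, hn, if_false]
      exact measurable_const
  symm v := isSymm_iff_relabel.2 fun _ => ae_eq_rfl
  add v w := .of_forall fun Q => by
    by_cases hQ : Q.1 = 0 <;> simp [vac, hQ]
  smul a v := .of_forall fun Q => by
    by_cases hQ : Q.1 = 0 <;> simp [vac, hQ]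
  nonneg := zero_le_one
  bound v := by
    rw [lintegral_vac, one_mul, ENNReal.ofReal_pow (norm_nonneg _), ofReal_norm]

/-- The embedding of the spin space as the vectors without bosons. -/
def vacL (d : ℕ) : Spin →L[ℂ] Fock d := opFormula_vac.toOp

lemma rep_vacL (v : Spin) : (vacL d v).rep =ᵐ[lebesguePoisson d] vac v := OpFormula.rep_toOp _ v

lemma norm_vacL (v : Spin) : ‖vacL d v‖ = ‖v‖ := by
  have h1 := (vacL d v).lintegral_rep
  rw [lintegral_congr_ae (g := fun Q => ‖vac v Q‖ₑ ^ 2)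
    (by filter_upwards [rep_vacL (d := d) v] with Q hQ; rw [hQ]), lintegral_vac,
    ← ofReal_norm, ← ENNReal.ofReal_pow (norm_nonneg _),
    ENNReal.ofReal_eq_ofReal_iff (by positivity) (by positivity)] at h1
  exact ((pow_left_inj₀ (norm_nonneg _) (norm_nonneg _) two_ne_zero).1 h1).symm

lemma numProj_vacL (n : ℕ) (v : Spin) : numProj d n (vacL d v) = vacL d v := by
  rw [numProj_eq_self_iff]
  filter_upwards [rep_vacL (d := d) v] with Q hQ h
  rw [hQ, vac, if_neg (by omega)]

variable {p : Model d} {c Λ η : ℝ}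

lemma Regular.S0_vacL (h : p.Regular c Λ) (v : Spin) :
    h.S0 ((c : ℂ) • vacL d v) = vacL d v := by
  refine Fock.ext_rep ?_
  filter_upwards [h.rep_S0 ((c : ℂ) • vacL d v), Fock.rep_smul (c : ℂ) (vacL d v), rep_vacL (d := d) v]
    with Q h1 h2 h3
  rw [h1, h2, h3, vac]
  split_ifs with hQ
  · rw [config_eq_vacuum hQ, smul_smul, invEnergy, omQ]
    simp [h.shift_pos.ne']
  · simp

namespace Weak

/-- `c • vacL d v` is the `S0`-preimage of the vacuum vector with spin `v`. Above zero bosons its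
pencil is creation from the vacuum, so `mu0` cancels it except in the vacuum component. -/
lemma mu0_spec (h : p.Weak c Λ η) {e : ℝ} (he : e + c < gap p c η 0) (v : Spin) :
    ∃ w : Fock d, p.mu0 e v = h.toRegular.S0 w ∧ numProj d 0 w = 0 ∧
      numProj d 0 (h.toRegular.pencil (e + c) w - h.toRegular.pencil (e + c) ((c : ℂ) • vacL d v))
      = h.toRegular.pencil (e + c) w - h.toRegular.pencil (e + c) ((c : ℂ) • vacL d v) := by
  refine h.resB_spec zero_le_one he _ ?_
  have h1 : numProj d 0 ((c : ℂ) • vacL d v) = (c : ℂ) • vacL d v := by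
    rw [map_smul, numProj_vacL]
  filter_upwards [h.toRegular.pencil_high h1 e,
    addOne_congr (φ := p.lam) ae_eq_rfl (rep_vacL (d := d) v)] with Q h2 h3 hQ
  rw [(h2 hQ).1, h.toRegular.S0_vacL, cre, h3, cre]

lemma mVec_eq (h : p.Weak c Λ η) {e : ℝ} {v : Spin} {w : Fock d}
    (hw : p.mu0 e v = h.toRegular.S0 w) (hw0 : numProj d 0 w = 0) :
    p.mVec e v = (h.toRegular.pencil (e + c) w).rep ⟨0, Fin.elim0⟩ := by
  rw [mVec, hw, ((ae_vacuum (h.toRegular.pencil_low hw0 e)) le_rfl).1]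

/-- Linearity is again a consequence of the uniqueness of the solution above zero bosons. -/
lemma mVec_comb (h : p.Weak c Λ η) {e : ℝ} (he : e + c < gap p c η 0) (a b : ℂ) (u v : Spin) :
    p.mVec e (a • u + b • v) = a • p.mVec e u + b • p.mVec e v := by
  obtain ⟨w1, h1, h2, h3⟩ := h.mu0_spec he u
  obtain ⟨w2, h4, h5, h6⟩ := h.mu0_spec he v
  obtain ⟨w3, h7, h8, h9⟩ := h.mu0_spec he (a • u + b • v)
  have h10 : w3 = a • w1 + b • w2 := by
    refine h.compression_unique zero_le_one he h8 (by rw [map_add, map_smul, map_smul, h2, h5,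
      smul_zero, smul_zero, add_zero]) ?_
    rw [Complex.ofReal_add]
    set E := h.toRegular.pencil (e + c)
    have h11 : E w3 - E (a • w1 + b • w2)
        = (E w3 - E ((c : ℂ) • vacL d (a • u + b • v)))
          - (a • (E w1 - E ((c : ℂ) • vacL d u)) + b • (E w2 - E ((c : ℂ) • vacL d v))) := by
      simp only [map_add, map_smul, smul_add, smul_sub, smul_comm (c : ℂ) a,
        smul_comm (c : ℂ) b]
      abel
    rw [h11, map_sub (numProj d 0), map_add (numProj d 0), map_smul (numProj d 0),
      map_smul (numProj d 0), h3, h6, h9]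
  rw [h.mVec_eq h1 h2, h.mVec_eq h4 h5, h.mVec_eq h7 h8, h10, map_add, map_smul, map_smul]
  refine (ae_vacuum (Fock.rep_add _ _)).trans ?_
  exact congrArg₂ (· + ·) (ae_vacuum (Fock.rep_smul a _)) (ae_vacuum (Fock.rep_smul b _))

/-- The null vector condition involves a matrix assembled from the values of `mVec` on basis
vectors; linearity turns it into an identity for `f` itself, the vacuum component of the eigenvalue
equation. -/
lemma act_eq_of_null (h : p.Weak c Λ η) {e : ℝ} (he : e + c < gap p c η 0) {f : Spin}
    (hf : p.IsNullVector e f) :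
    (p.eps : ℂ) • act sigma3 f - (e : ℂ) • f = p.mVec e f := by
  have hf' : f = f 0 • EuclideanSpace.single 0 (1 : ℂ) + f 1 • EuclideanSpace.single 1 (1 : ℂ) := by
    ext i
    fin_cases i <;> simp
  have h1 := h.mVec_comb he (f 0) (f 1) (EuclideanSpace.single 0 1) (EuclideanSpace.single 1 1)
  rw [← hf'] at h1
  have h2 := hf.2
  rw [h1]
  ext i
  have h3 := congrArg (fun v : Spin => v i) h2
  simp only [act, Matrix.sub_mulVec, Matrix.smul_mulVec, Matrix.one_mulVec, PiLp.sub_apply,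
    PiLp.add_apply, PiLp.smul_apply, smul_eq_mul, Pi.sub_apply, Pi.smul_apply,
    PiLp.zero_apply, mMat, Matrix.mulVec, dotProduct, Fin.sum_univ_two, Matrix.of_apply] at h3 ⊢
  linear_combination h3

lemma rep_pencil_vacL (h : p.Weak c Λ η) (z : ℂ) (f : Spin) :
    (h.toRegular.pencil (z + c) ((c : ℂ) • vacL d f)).rep ⟨0, Fin.elim0⟩
      = (p.eps : ℂ) • act sigma3 f - z • f := by
  have hv : ∀ᵐ Q ∂lebesguePoisson d, 0 < Q.1 → (vacL d f).rep Q = 0 :=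
    numProj_eq_self_iff.1 (numProj_vacL 0 f)
  have h1 := h.toRegular.rep_pencil z ((c : ℂ) • vacL d f)
  rw [h.toRegular.S0_vacL] at h1
  have h2 := ae_vacuum (Regular.ann_eq_zero_of_level (p := p) (s := fun m => 0 < m) hv)
    Nat.one_pos
  have h3 : (vacL d f).rep ⟨0, Fin.elim0⟩ = f := ae_vacuum (rep_vacL (d := d) f)
  have h4 : p.cre (vacL d f).rep ⟨0, Fin.elim0⟩ = 0 := by
    rw [cre, addOne, Regular.act_zero, smul_zero]
  have h5 : p.omQ ⟨0, Fin.elim0⟩ = 0 := by simp [omQ]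
  rw [← ae_vacuum h1, ham, h2, h4, h5, h3, Complex.ofReal_zero, zero_smul, add_zero, add_zero,
    add_zero]

/-- `F₀` is an eigenvector. -/
lemma exists_boundState (h : p.Weak c Λ η) {e : ℝ} (he : e + c < gap p c η 0) {f : Spin}
    (hf : p.IsNullVector e f) :
    ∃ w : Fock d, p.IsBoundState e f (h.toRegular.S0 w) ∧
      h.toRegular.pencil (e + c) w = 0 ∧ 1 ≤ ‖h.toRegular.S0 w‖ ∧
      ∀ᵐ Q ∂lebesguePoisson d, Q.1 = 0 → (p.mu0 e f).rep Q = 0 := by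
  obtain ⟨w, h1, h2, h3⟩ := h.mu0_spec he f
  have h0 : numProj d 0 (h.toRegular.S0 ((c : ℂ) • vacL d f - w)) = vacL d f := by
    rw [map_sub, map_sub, h.toRegular.S0_vacL, numProj_vacL,
      h.toRegular.numProj_S0_eq_zero.2 h2, sub_zero]
  refine ⟨(c : ℂ) • vacL d f - w, ?_, ?_, ?_, ?_⟩
  · rw [map_sub, h.toRegular.S0_vacL, ← h1]
    filter_upwards [Fock.rep_sub (vacL d f) (p.mu0 e f), rep_vacL (d := d) f] with Q h4 h5
    rw [h4, h5]
  -- Above zero bosons the eigenvalue equation holds by the choice of `mu0`; only the vacuum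
  -- component is left, and there it is the null vector condition.
  · have h4 : numProj d 0 (h.toRegular.pencil (e + c) ((c : ℂ) • vacL d f - w))
        = h.toRegular.pencil (e + c) ((c : ℂ) • vacL d f - w) := by
      rw [map_sub, ← neg_sub, map_neg, h3]
    rw [← h4]
    refine numProj_zero_eq_zero ?_
    rw [map_sub]
    refine (ae_vacuum (Fock.rep_sub _ _)).trans ?_
    rw [sub_eq_zero, ← h.mVec_eq h1 h2, ← h.act_eq_of_null he hf]
    exact h.rep_pencil_vacL e f
  -- The vacuum component of the eigenvector is the unit vector `f`.
  · have h4 := norm_proj_le (numProj_selfAdjoint 0) (numProj_idem 0)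
      (h.toRegular.S0 ((c : ℂ) • vacL d f - w))
    rwa [h0, norm_vacL, hf.1] at h4
  · rw [h1]
    filter_upwards [numProj_eq_zero_iff.1 (h.toRegular.numProj_S0_eq_zero.2 h2)] with Q hQ h4
    exact hQ h4.le

/-- The regular part of the regularised generalised eigenvectors. -/
lemma eigReg_eq (h : p.Weak c Λ η) {e : ℝ} {f : Spin} {F : Fock d} (hF : p.IsBoundState e f F)
    (hmu : ∀ᵐ Q ∂lebesguePoisson d, Q.1 = 0 → (p.mu0 e f).rep Q = 0) {t : ℝ} (ht : t ≠ 0)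
    {k : Mom d} (hk : p.xi e k + c < gap p c η 1) {v : Fock d}
    (hv : h.toRegular.pencil (p.xi e k + c) v
      + (Complex.I * t) • numProj d 1 (h.toRegular.S0 v) = spin1 d F) :
    p.eigReg e f t k = -(((p.alpha : ℂ) * starRingEnd ℂ (p.lam k)) • h.toRegular.S0 v) := by
  set x := p.xi e k with hx
  set a : ℂ := (p.alpha : ℂ) * starRingEnd ℂ (p.lam k) with ha
  have hz : (x : ℂ) - p.om k = (e : ℂ) := by
    rw [hx, xi, Complex.ofReal_add, add_sub_cancel_right]
  have hχ : (a • spin1 d F).rep =ᵐ[lebesguePoisson d]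
      fun Q => a • (act sigma1 (vac f Q - (p.mu0 e f).rep Q)) := by
    filter_upwards [Fock.rep_smul a (spin1 d F), rep_spin1 F, hF] with Q h1 h2 h3
    rw [h1, h2, h3]
  -- Above one boson `σ₁ F₀` equals `-σ₁ μ₀(e) f`. So the source of `mu1` is the part of `a σ₁ F₀`
  -- above one boson, with `a = α conj λ(k)`.
  obtain ⟨w1, h1, h2, h3⟩ := h.resB_spec le_rfl hk (a • spin1 d F)
    (γ := fun Q => -a • act sigma1 ((p.mu0 (x - p.om k) f).rep Q)) (by
      filter_upwards [hχ] with Q hQ hQ1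
      rw [hQ, hz, vac, if_neg (by omega), zero_sub, ← actL_apply, map_neg, smul_neg, neg_smul]
      rfl)
  have hmu1 : p.mu1 x k f = h.toRegular.S0 w1 := h1
  obtain ⟨w2, h4, h5⟩ := h.resA_sub_M1 hk ht (a • spin1 d F - h.toRegular.pencil (x + c) w1)
    (γ := p.couplingA x k f) (by
      filter_upwards [hχ, h.toRegular.pencil_low h2 x, hmu,
        Fock.rep_sub (a • spin1 d F) (h.toRegular.pencil (x + c) w1)] with Q h6 h7 h8 h9 hQ
      obtain ⟨h10, h11⟩ := h7 hQ
      rw [h9, h6, h10, couplingA]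
      split_ifs with hQ0 hQ1
      · rw [h8 hQ0, h11 (by omega), vac, if_pos hQ0, sub_zero, sub_zero]
      · rw [D11, hmu1, hz, vac, if_neg hQ0, zero_sub, ← actL_apply, map_neg, smul_neg,
          neg_add', sub_eq_add_neg, sub_eq_add_neg, add_comm, actL_apply]
      · omega)
  have h6 : numProj d 1 (a • spin1 d F - h.toRegular.pencil (x + c) w1)
      = a • spin1 d F - h.toRegular.pencil (x + c) w1 := by
    rw [← neg_sub, map_neg, h3]
  rw [h6] at h5
  -- Both sides solve the damped equation for `H` with source `a σ₁ F₀`: `w1` covers the source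
  -- above one boson and leaves the residual that is the source of `w2`. The damping does not see
  -- `w1`, which has no components with at most one boson.
  have h7 : w1 + w2 = a • v := by
    refine (h.bijective_pencil hk ht).1 ?_
    simp only [map_add, map_smul, h.toRegular.numProj_S0_eq_zero.2 h2, zero_add,
      Complex.ofReal_add]
    rw [add_assoc, h5, smul_comm _ a, ← smul_add, hv]
    abel
  rw [eigReg, hmu1, ← map_smul, ← h7, map_add]
  rw [psiReg, h4]
  abel

end Weak
end Model

/-! ### Canonical commutation relations on the domain -/

lemma MemLp.act {F : Config d → Spin} (hF : MemLp F 2 (lebesguePoisson d))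
    (A : Matrix (Fin 2) (Fin 2) ℂ) : MemLp (fun Q => act A (F Q)) 2 (lebesguePoisson d) := by
  simp only [← actL_apply]
  exact (actL A).comp_memLp' hF

lemma Fock.inner_self (F : Fock d) : (inner ℂ F F : ℂ) = ((‖F‖ ^ 2 : ℝ) : ℂ) := by
  rw [Complex.ofReal_pow]
  exact @inner_self_eq_norm_sq_to_K ℂ (Fock d) _ _ _ F

namespace Model
variable {p : Model d} {c Λ η : ℝ}

namespace Regular

lemma memLp_addOne_of_lintegral {φ : Mom d → ℂ} {N : ℝ} (hφ : L2Bound φ N)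
    {F : Config d → Spin} (hF : Measurable F)
    (h : ∫⁻ Q, (Q.1 + 1 : ℕ) * ‖F Q‖ₑ ^ 2 ∂lebesguePoisson d < ∞) :
    MemLp (addOne φ F) 2 (lebesguePoisson d) := by
  refine memLp_two_iff_lintegral.2 ⟨(measurable_addOne hφ.meas hF).aestronglyMeasurable, ?_⟩
  have h1 := lintegral_addOne_le hφ.meas hF (fun _ => 1)
  simp only [one_mul] at h1
  exact h1.trans_lt (ENNReal.mul_lt_top (hφ.bound.trans_lt ENNReal.ofReal_lt_top) h)

/-- Two creations cost `(N + 1) (N + 2) ≤ 2 (N + 1)²`, which the square of the free resolvent bound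
controls. -/
lemma memLp_addOne_addOne (h : p.Regular c Λ) {φ ψ : Mom d → ℂ} {N N' : ℝ} (hφ : L2Bound φ N)
    (hψ : L2Bound ψ N') (w : Fock d) :
    MemLp (addOne φ (addOne ψ (h.S0 w).rep)) 2 (lebesguePoisson d) := by
  refine memLp_addOne_of_lintegral hφ (measurable_addOne hψ.meas (h.S0 w).measurable_rep) ?_
  refine (lintegral_addOne_le hψ.meas (h.S0 w).measurable_rep
    (fun n => ((n + 1 : ℕ) : ℝ≥0∞))).trans_lt
    (ENNReal.mul_lt_top (hψ.bound.trans_lt ENNReal.ofReal_lt_top) ?_)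
  calc ∫⁻ Q, ((Q.1 + 1 + 1 : ℕ) : ℝ≥0∞) * (Q.1 + 1 : ℕ) * ‖(h.S0 w).rep Q‖ₑ ^ 2
        ∂lebesguePoisson d
      ≤ ∫⁻ Q, 2 * (((Q.1 + 1 : ℕ) : ℝ≥0∞) ^ 2 * ‖(h.S0 w).rep Q‖ₑ ^ 2) ∂lebesguePoisson d := by
        refine lintegral_mono fun Q => ?_
        have h2 : Q.1 + 1 + 1 ≤ 2 * (Q.1 + 1) := by omega
        have h3 : ((Q.1 + 1 + 1 : ℕ) : ℝ≥0∞) ≤ 2 * (Q.1 + 1 : ℕ) := by exact_mod_cast h2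
        calc _ ≤ (2 * ((Q.1 + 1 : ℕ) : ℝ≥0∞)) * (Q.1 + 1 : ℕ) * ‖(h.S0 w).rep Q‖ₑ ^ 2 :=
              mul_le_mul_left (mul_le_mul_left h3 _) _
          _ = _ := by ring
    _ = 2 * ∫⁻ Q, ((Q.1 + 1 : ℕ) : ℝ≥0∞) ^ 2 * ‖(h.S0 w).rep Q‖ₑ ^ 2 ∂lebesguePoisson d :=
        lintegral_const_mul' _ _ (by simp)
    _ < ∞ := ENNReal.mul_lt_top (by simp) ((h.lintegral_number_sq w).trans_lt
        ENNReal.ofReal_lt_top)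

lemma memLp_addOne_annOne (h : p.Regular c Λ) {φ ψ : Mom d → ℂ} {N N' : ℝ} (hφ : L2Bound φ N)
    (hψ : L2Bound ψ N') (w : Fock d) :
    MemLp (addOne φ (annOne ψ (h.S0 w).rep)) 2 (lebesguePoisson d) := by
  refine memLp_addOne_of_lintegral hφ (measurable_annOne hψ.meas (h.S0 w).measurable_rep) ?_
  refine (lintegral_annOne_le hψ.meas.aemeasurable (h.S0 w).measurable_rep
    (fun n => (n : ℝ≥0∞))).trans_lt
    (ENNReal.mul_lt_top (hψ.bound.trans_lt ENNReal.ofReal_lt_top) ?_)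
  refine (lintegral_mono fun Q => ?_).trans_lt ((h.lintegral_number_sq w).trans_lt
    ENNReal.ofReal_lt_top)
  have h1 : (Q.1 : ℝ≥0∞) ≤ (Q.1 + 1 : ℕ) := by exact_mod_cast Nat.le_succ _
  rw [← mul_assoc, ← pow_two]
  exact mul_le_mul_left (pow_le_pow_left' h1 2) _

/-- Creation commutes with `H` up to `a*(ω ψ) + α ⟨λ, ψ⟩ σ₁`; on an eigenvector with eigenvalue `e`
the energy `ω` is completed to `ξ = e + ω`. The vector `v` also witnesses that `a*(ψ) F` lies in the
domain of `H`. -/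
lemma ham_creation (h : p.Regular c Λ) {e : ℝ} {w : Fock d} (hw : h.pencil (e + c) w = 0)
    {φ ψ : Mom d → ℂ} {N N' : ℝ} (hφ : L2Bound φ N) (hψ : L2Bound ψ N')
    (hφψ : ∀ᵐ q, ((p.xi e q + c : ℝ) : ℂ) * ψ q = φ q) :
    ∃ v : Fock d, h.S0 v = h.creL hψ w ∧ v + h.K v = h.creL hφ w
      + ((p.alpha : ℂ) * ∫ q, starRingEnd ℂ (p.lam q) * ψ q) • spin1 d (h.S0 w) := by
  set F := (h.S0 w).rep with hF
  have hFm : Measurable F := (h.S0 w).measurable_rep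
  have hF2 : MemLp F 2 (lebesguePoisson d) := (h.S0 w).memLp_rep
  -- the eigenvalue equation
  have hom : ∀ᵐ Q ∂lebesguePoisson d, (p.omQ Q : ℂ) • F Q
      = (e : ℂ) • F Q - ((p.eps : ℂ) • act sigma3 (F Q)
        + (p.alpha : ℂ) • act sigma1 (addOne p.lam F Q)
        + (p.alpha : ℂ) • act sigma1 (annOne p.lam F Q)) := by
    have h1 := h.rep_pencil e w
    rw [hw] at h1
    filter_upwards [h1, Fock.rep_zero (d := d)] with Q h2 h3
    rw [h3, ham, sub_eq_zero] at h2
    rw [← h2]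
    change _ = (p.eps : ℂ) • act sigma3 (F Q) + (p.omQ Q : ℂ) • F Q
      + (p.alpha : ℂ) • act sigma1 (addOne p.lam F Q)
      + (p.alpha : ℂ) • act sigma1 (annOne p.lam F Q) - _
    abel
  -- `(H₀ + c) a*(ψ) F`, with the field energy of `F` eliminated by the eigenvalue equation. Every
  -- term is then a product of at most two field operators applied to `F`, so square integrability
  -- is visible.
  set X : Config d → Spin := fun Q => addOne φ F Q
    - ((p.eps : ℂ) • act sigma3 (addOne ψ F Q)
      + (p.alpha : ℂ) • act sigma1 (addOne ψ (addOne p.lam F) Q)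
      + (p.alpha : ℂ) • act sigma1 (addOne ψ (annOne p.lam F) Q)) with hX
  have hkey : ∀ᵐ Q ∂lebesguePoisson d, ((p.omQ Q + c : ℝ) : ℂ) • addOne ψ F Q = X Q := by
    have h1 := addOne_congr (φ := ψ) ae_eq_rfl hom
    have h2 : addOne ψ (fun Q => (e : ℂ) • F Q - ((p.eps : ℂ) • act sigma3 (F Q)
        + (p.alpha : ℂ) • act sigma1 (addOne p.lam F Q)
        + (p.alpha : ℂ) • act sigma1 (annOne p.lam F Q)))
        = fun Q => (e : ℂ) • addOne ψ F Q - ((p.eps : ℂ) • act sigma3 (addOne ψ F Q)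
          + (p.alpha : ℂ) • act sigma1 (addOne ψ (addOne p.lam F) Q)
          + (p.alpha : ℂ) • act sigma1 (addOne ψ (annOne p.lam F) Q)) := by
      simp only [sub_eq_add_neg, ← neg_one_smul ℂ (_ : Spin), addOne_add, addOne_smul, addOne_act]
    rw [h2] at h1
    have h3 := addOne_congr (F := F) (F' := F) hφψ ae_eq_rfl
    filter_upwards [h1, h3] with Q h4 h5
    rw [Complex.ofReal_add, add_smul, omQ_smul_addOne, h4, hX]
    simp only
    rw [← h5]
    have h6 : (fun q => ((p.xi e q + c : ℝ) : ℂ) * ψ q)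
        = fun q => ((p.om q : ℂ) * ψ q) + ((e + c : ℝ) : ℂ) * ψ q := by
      funext q
      rw [xi]
      push_cast
      ring
    rw [h6, addOne_add_left, addOne_smul_left, Complex.ofReal_add]
    simp only [add_smul]
    abel
  have hXm : MemLp X 2 (lebesguePoisson d) := by
    have m1 := (MemLp.act (h.memLp_addOne hψ w) sigma3).const_smul (p.eps : ℂ)
    have m2 := (MemLp.act (h.memLp_addOne_addOne hψ h.lam_bound w) sigma1).const_smul (p.alpha : ℂ)
    have m3 := (MemLp.act (h.memLp_addOne_annOne hψ h.lam_bound w) sigma1).const_smul (p.alpha : ℂ)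
    exact (h.memLp_addOne hφ w).sub ((m1.add m2).add m3)
  have hXs : IsSymm X := by
    refine IsSymm.congr (F := fun Q => ((p.omQ Q + c : ℝ) : ℂ) • addOne ψ F Q)
      (IsSymm.smul (fun s Q => by simp only [omQ_relabel]) ((h.S0 w).isSymm_rep.addOne ψ)) hkey
  have hv := Fock.rep_mk X hXm hXs
  set v := Fock.mk X hXm hXs
  have hS : (h.S0 v).rep =ᵐ[lebesguePoisson d] addOne ψ F := by
    filter_upwards [h.rep_S0 v, hv, hkey] with Q h1 h2 h3
    rw [h1, h2, ← h3, smul_smul, ← Complex.ofReal_mul, invEnergy,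
      inv_mul_cancel₀ (h.energy_pos Q).ne', Complex.ofReal_one, one_smul]
  refine ⟨v, Fock.ext_rep (hS.trans (h.rep_creL hψ w).symm), Fock.ext_rep ?_⟩
  have hcre := addOne_congr (φ := p.lam) ae_eq_rfl hS
  have hann := (annOne_congr (φ := p.lam) ae_eq_rfl hS).trans
    (annOne_addOne h.lam_bound.memLp hψ.memLp hFm hF2)
  set b : ℂ := ∫ q, starRingEnd ℂ (p.lam q) * ψ q
  filter_upwards [Fock.rep_add v (h.K v), hv, h.rep_K v, hS, hcre, hann,
    Fock.rep_add (h.creL hφ w) (((p.alpha : ℂ) * b) • spin1 d (h.S0 w)), h.rep_creL hφ w,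
    Fock.rep_smul ((p.alpha : ℂ) * b) (spin1 d (h.S0 w)), rep_spin1 (h.S0 w)]
    with Q h1 h2 h3 h4 h5 h6 h7 h8 h9 h10
  rw [h1, h2, h3, h4, h7, h8, h9, h10, hX]
  have h11 : p.cre (h.S0 v).rep Q
      = (p.alpha : ℂ) • act sigma1 (addOne ψ (addOne p.lam F) Q) := by
    rw [cre, h5, addOne_comm]
  have h12 : p.ann (h.S0 v).rep Q = (p.alpha : ℂ) • act sigma1 (addOne ψ (annOne p.lam F) Q)
      + ((p.alpha : ℂ) * b) • act sigma1 (F Q) := by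
    change (p.alpha : ℂ) • act sigma1 (annOne p.lam (h.S0 v).rep Q) = _
    rw [h6, ← actL_apply, map_add, map_smul, smul_add, smul_smul]
    rfl
  rw [h11, h12, ← hF]
  simp only
  generalize (p.eps : ℂ) • act sigma3 (addOne ψ F Q) = x₁
  generalize (p.alpha : ℂ) • act sigma1 (addOne ψ (addOne p.lam F) Q) = x₂
  generalize (p.alpha : ℂ) • act sigma1 (addOne ψ (annOne p.lam F) Q) = x₃
  abel

/-- `a(φ) a*(ψ) = a*(ψ) a(φ) + ⟨φ, ψ⟩`, with the remaining creation moved to the left factor. Only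
the scalar term survives the limit of large times. -/
lemma inner_creL_creL (h : p.Regular c Λ) {φ ψ : Mom d → ℂ} {N N' : ℝ} (hφ : L2Bound φ N)
    (hψ : L2Bound ψ N') (w : Fock d) :
    (inner ℂ (h.creL hφ w) (h.creL hψ w) : ℂ) = inner ℂ (h.annL hψ w) (h.annL hφ w)
      + (∫ q, starRingEnd ℂ (φ q) * ψ q) * ((‖h.S0 w‖ ^ 2 : ℝ) : ℂ) := by
  set F := (h.S0 w).rep with hF
  have hFm : Measurable F := (h.S0 w).measurable_rep
  have hF2 : MemLp F 2 (lebesguePoisson d) := (h.S0 w).memLp_rep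
  have hFs : IsSymm F := (h.S0 w).isSymm_rep
  set b : ℂ := ∫ q, starRingEnd ℂ (φ q) * ψ q with hb
  have hccr := annOne_addOne hφ.memLp hψ.memLp hFm hF2
  have hm1 : MemLp (addOne ψ (annOne φ F)) 2 (lebesguePoisson d) := h.memLp_addOne_annOne hψ hφ w
  have hm2 : MemLp (annOne φ (addOne ψ F)) 2 (lebesguePoisson d) :=
    (hm1.add (hF2.const_smul b)).ae_eq hccr.symm
  have h1 := integral_inner_addOne hφ.memLp hFm (measurable_addOne hψ.meas hFm) hF2
    (h.memLp_addOne hψ w) (hFs.addOne ψ) (h.memLp_addOne hφ w) hm2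
  have h2 := integral_inner_addOne hψ.memLp (measurable_annOne hφ.meas hFm) hFm
    (h.memLp_annOne hφ w) hF2 hFs hm1 (h.memLp_annOne hψ w)
  have e1 : (inner ℂ (h.creL hφ w) (h.creL hψ w) : ℂ)
      = ∫ Q, inner ℂ (addOne φ F Q) (addOne ψ F Q) ∂lebesguePoisson d := by
    rw [Fock.inner_eq]
    refine integral_congr_ae ?_
    filter_upwards [h.rep_creL hφ w, h.rep_creL hψ w] with Q h3 h4
    rw [h3, h4]
  have e2 : (inner ℂ (h.annL hψ w) (h.annL hφ w) : ℂ)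
      = ∫ Q, inner ℂ (F Q) (addOne ψ (annOne φ F) Q) ∂lebesguePoisson d := by
    have e3 : (inner ℂ (h.annL hφ w) (h.annL hψ w) : ℂ)
        = ∫ Q, inner ℂ (annOne φ F Q) (annOne ψ F Q) ∂lebesguePoisson d := by
      rw [Fock.inner_eq]
      refine integral_congr_ae ?_
      filter_upwards [h.rep_annL hφ w, h.rep_annL hψ w] with Q h3 h4
      rw [h3, h4]
    rw [← Fock.inner_conj, e3, ← h2, ← integral_conj]
    simp only [inner_conj_symm]
  rw [e1, h1, e2]
  have e3 : ∫ Q, inner ℂ (F Q) (annOne φ (addOne ψ F) Q) ∂lebesguePoisson d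
      = ∫ Q, (inner ℂ (F Q) (addOne ψ (annOne φ F) Q) + b * inner ℂ (F Q) (F Q))
        ∂lebesguePoisson d := by
    refine integral_congr_ae ?_
    filter_upwards [hccr] with Q hQ
    rw [hQ, inner_add_right, inner_smul_right]
  rw [e3, integral_add (MemLp.integrable_inner hF2 hm1)
    ((MemLp.integrable_inner hF2 hF2).const_mul b), integral_const_mul,
    ← Fock.inner_eq, Fock.inner_self]

/-- Smeared annihilation operators with oscillating phases vanish asymptotically. -/
lemma tendsto_annL_phase (h : p.Regular c Λ) {y : Mom d → ℝ} (hy : Measurable y)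
    (hac : (volume : Measure (Mom d)).map y ≪ volume) {φ : Mom d → ℂ} {N : ℝ}
    (hφ : L2Bound φ N) {M : ℝ → ℝ} (hs : ∀ s, L2Bound (fun q => phase y s q * φ q) (M s))
    (w : Fock d) : Tendsto (fun s => h.annL (hs s) w) atTop (𝓝 0) := by
  set F := (h.S0 w).rep with hF
  have hFm : Measurable F := (h.S0 w).measurable_rep
  have hF2 : MemLp F 2 (lebesguePoisson d) := (h.S0 w).memLp_rep
  have hnorm : ∀ s q, ‖phase y s q * φ q‖ₑ = ‖φ q‖ₑ := fun s q => by
    rw [enorm_mul, ← ofReal_norm, norm_phase, ENNReal.ofReal_one, one_mul]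
  have hlim : Tendsto (fun s => ∫⁻ Q, ‖annOne (fun q => phase y s q * φ q) F Q‖ₑ ^ 2
      ∂lebesguePoisson d) atTop (𝓝 (∫⁻ _Q : Config d, 0 ∂lebesguePoisson d)) := by
    -- For almost every configuration the inserted function is square integrable, so the scalar
    -- Riemann-Lebesgue lemma applies to each spin component; the phases do not affect the
    -- dominating function, which is integrable by the number bound.
    refine tendsto_lintegral_filter_of_dominated_convergence
      (fun Q => (∫⁻ q, ‖φ q‖ₑ ^ 2) * ∫⁻ q, ‖F (insertMom Q q)‖ₑ ^ 2)
      (.of_forall fun s => (measurable_annOne (hs s).meas hFm).enorm.pow_const 2)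
      (.of_forall fun s => .of_forall fun Q => ?_) ?_ ?_
    · have := enorm_annOne_sq_le (hs s).meas.aemeasurable hFm Q
      simpa only [hnorm] using this
    · have hm : Measurable fun Q : Config d => ‖F Q‖ₑ ^ 2 := hFm.enorm.pow_const 2
      rw [lintegral_const_mul' _ _ (hφ.bound.trans_lt ENNReal.ofReal_lt_top).ne,
        lintegral_insertMom hm]
      refine (ENNReal.mul_lt_top (hφ.bound.trans_lt ENNReal.ofReal_lt_top) ?_).ne
      refine (lintegral_mono fun Q => ?_).trans_lt ((h.lintegral_number w).trans_lt
        ENNReal.ofReal_lt_top)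
      exact mul_le_mul_left (Nat.cast_le.2 (Nat.le_succ Q.1)) _
    · filter_upwards [ae_memLp_insertMom hFm hF2] with Q hQ
      have h1 : Tendsto (fun s => annOne (fun q => phase y s q * φ q) F Q) atTop (𝓝 0) := by
        have h2 : ∀ s, Integrable fun q => (starRingEnd ℂ (phase y s q * φ q))
            • F (insertMom Q q) := fun s => integrable_conj_smul (hs s).memLp hQ
        have h3 : ∀ i : Fin 2, Tendsto (fun s => annOne (fun q => phase y s q * φ q) F Q i)
            atTop (𝓝 0) := by
          intro i
          have hi : MemLp (fun q => F (insertMom Q q) i) 2 volume :=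
            (EuclideanSpace.proj (𝕜 := ℂ) i).comp_memLp' hQ
          have hint : Integrable fun q => φ q * starRingEnd ℂ (F (insertMom Q q) i) :=
            hφ.memLp.integrable_mul hi.star
          have h4 := (Complex.continuous_conj.tendsto 0).comp (tendsto_integral_phase hy hac hint)
          rw [map_zero] at h4
          refine h4.congr fun s => ?_
          have h5 : annOne (fun q => phase y s q * φ q) F Q i
              = ∫ q, (starRingEnd ℂ (phase y s q * φ q)) * F (insertMom Q q) i :=
            ((EuclideanSpace.proj (𝕜 := ℂ) i).integral_comp_comm (h2 s)).symm
          rw [h5, Function.comp_apply, ← integral_conj]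
          refine integral_congr_ae (.of_forall fun q => ?_)
          simp only [map_mul, Complex.conj_conj]
          ring
        rw [tendsto_zero_iff_norm_tendsto_zero]
        have h4 : Tendsto (fun s => √(∑ i, ‖annOne (fun q => phase y s q * φ q) F Q i‖ ^ 2)) atTop
            (𝓝 (√(∑ _i : Fin 2, 0 ^ 2))) :=
          (tendsto_finsetSum _ fun i _ => (tendsto_zero_iff_norm_tendsto_zero.1 (h3 i)).pow 2).sqrt
        simpa [EuclideanSpace.norm_eq] using h4
      have h2 := ((ENNReal.continuous_pow 2).tendsto _).comp ((continuous_enorm.tendsto _).comp h1)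
      simpa [Function.comp_def] using h2
  rw [lintegral_zero] at hlim
  rw [tendsto_zero_iff_norm_tendsto_zero]
  have h1 : ∀ s, ENNReal.ofReal (‖h.annL (hs s) w‖ ^ 2)
      = ∫⁻ Q, ‖annOne (fun q => phase y s q * φ q) F Q‖ₑ ^ 2 ∂lebesguePoisson d := by
    intro s
    rw [← Fock.lintegral_rep]
    refine lintegral_congr_ae ?_
    filter_upwards [h.rep_annL (hs s) w] with Q hQ
    rw [hQ]
  have h2 := ((ENNReal.continuousAt_toReal ENNReal.zero_ne_top).tendsto.comp hlim).sqrt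
  rw [ENNReal.toReal_zero, Real.sqrt_zero] at h2
  refine h2.congr fun s => ?_
  rw [Function.comp_apply, ← h1, ENNReal.toReal_ofReal (by positivity),
    Real.sqrt_sq (norm_nonneg _)]

end Regular
end Model

/-! ### Dressed one-boson states -/

/-- Inversion is differentiable on the positive half-line and therefore maps null sets to null sets.
-/
lemma map_inv_absolutelyContinuous {X : Type*} [MeasurableSpace X] {μ : Measure X} {g : X → ℝ}
    (hg : Measurable g) (hpos : ∀ x, 0 < g x) (hac : μ.map g ≪ volume) :
    μ.map (fun x => (g x)⁻¹) ≪ volume := by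
  refine Measure.AbsolutelyContinuous.mk fun N hN hN0 => ?_
  rw [Measure.map_apply (f := fun x => (g x)⁻¹) hg.inv hN]
  have h1 : volume ((fun x : ℝ => x⁻¹) '' (N ∩ Set.Ioi 0)) = 0 := by
    refine addHaar_image_eq_zero_of_differentiableOn_of_addHaar_eq_zero _ ?_
      (measure_mono_null Set.inter_subset_left hN0)
    intro x hx
    exact (differentiableAt_inv (ne_of_gt hx.2)).differentiableWithinAt
  have h2 := hac h1
  refine measure_mono_null (fun x hx => ?_) (Measure.preimage_null_of_map_null hg.aemeasurable h2)
  exact ⟨(g x)⁻¹, ⟨hx, inv_pos.2 (hpos x)⟩, inv_inv _⟩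

lemma inner_phaseOp_phaseOp {X : Type*} [MeasurableSpace X] {μ : Measure X} {y : X → ℝ}
    (hy : Measurable y) (s : ℝ) (φ ψ : Lp ℂ 2 μ) :
    (inner ℂ (phaseOp hy s φ) (phaseOp hy s ψ) : ℂ) = inner ℂ φ ψ :=
  (⟨(phaseOp hy s : Lp ℂ 2 μ →L[ℂ] Lp ℂ 2 μ).toLinearMap, norm_phaseOp hy s⟩ :
    Lp ℂ 2 μ →ₗᵢ[ℂ] Lp ℂ 2 μ).inner_map_map φ ψ

section Extension
variable {A : Set (Mom d)}

lemma l2Bound_indicator (hA : MeasurableSet A) (φ : Lp ℂ 2 (volume.restrict A)) :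
    L2Bound (A.indicator φ) ‖φ‖ where
  meas := (Lp.stronglyMeasurable φ).measurable.indicator hA
  nonneg := norm_nonneg _
  bound := by
    rw [← lintegral_enorm_sq_coeFn, ← lintegral_indicator hA]
    refine (lintegral_congr fun q => ?_).le
    by_cases hq : q ∈ A <;> simp [hq]

lemma indicator_ae_eq (hA : MeasurableSet A) {f g : Mom d → ℂ}
    (h : f =ᵐ[volume.restrict A] g) : A.indicator f =ᵐ[volume] A.indicator g := by
  filter_upwards [(ae_restrict_iff' hA).1 h] with q hq
  by_cases hqA : q ∈ A
  · simp [hqA, hq hqA]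
  · simp [hqA]

lemma integral_conj_indicator (hA : MeasurableSet A) (φ ψ : Lp ℂ 2 (volume.restrict A)) :
    ∫ q, starRingEnd ℂ (A.indicator φ q) * A.indicator ψ q = inner ℂ φ ψ := by
  rw [L2.inner_def, ← integral_indicator hA]
  refine integral_congr_ae (.of_forall fun q => ?_)
  by_cases hq : q ∈ A
  · simp [hq, mul_comm]
  · simp [hq]

end Extension

namespace Model
variable {p : Model d} {c Λ η : ℝ}

namespace Regular
variable {A : Set (Mom d)}

lemma opFormula_dress (h : p.Regular c Λ) (hA : MeasurableSet A) (w : Fock d) :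
    OpFormula (fun φ : Lp ℂ 2 (volume.restrict A) => addOne (A.indicator φ) (h.S0 w).rep)
      (p.kappa⁻¹ * ‖w‖) where
  meas φ := measurable_addOne (l2Bound_indicator hA φ).meas (h.S0 w).measurable_rep
  symm φ := (h.S0 w).isSymm_rep.addOne _
  add φ ψ := by
    rw [← addOne_add_left]
    refine addOne_congr ?_ ae_eq_rfl
    refine (indicator_ae_eq hA (Lp.coeFn_add φ ψ)).trans (.of_forall fun q => ?_)
    by_cases hq : q ∈ A <;> simp [hq]
  smul a φ := by
    rw [← addOne_smul_left]
    refine addOne_congr ?_ ae_eq_rfl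
    refine (indicator_ae_eq hA (Lp.coeFn_smul a φ)).trans (.of_forall fun q => ?_)
    by_cases hq : q ∈ A <;> simp [hq]
  nonneg := mul_nonneg (inv_nonneg.2 h.kappa_pos.le) (norm_nonneg _)
  bound φ := by
    refine ((h.opFormula_cre (l2Bound_indicator hA φ)).bound w).trans_eq ?_
    congr 2
    ring

/-- `φ ↦ a*(φ) F`, for the vector `F = (H₀ + c)⁻¹ w`. -/
def dress (h : p.Regular c Λ) (hA : MeasurableSet A) (w : Fock d) :
    Lp ℂ 2 (volume.restrict A) →L[ℂ] Fock d := (h.opFormula_dress hA w).toOp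

lemma rep_dress (h : p.Regular c Λ) (hA : MeasurableSet A) (w : Fock d)
    (φ : Lp ℂ 2 (volume.restrict A)) :
    (h.dress hA w φ).rep =ᵐ[lebesguePoisson d] addOne (A.indicator φ) (h.S0 w).rep :=
  OpFormula.rep_toOp _ φ

lemma dress_eq (h : p.Regular c Λ) (hA : MeasurableSet A) (w : Fock d)
    (φ : Lp ℂ 2 (volume.restrict A)) :
    h.dress hA w φ = h.creL (l2Bound_indicator hA φ) w :=
  Fock.ext_rep ((h.rep_dress hA w φ).trans (h.rep_creL _ w).symm)

/-- `S` applied to `(H + c) a*(y φ) F = a*(φ) F + ⟨u, φ⟩ σ₁ F`, with `u = α y λ`. The interaction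
enters only through this one functional, whence the rank one. -/
lemma resolvent_commutator (h : p.Regular c Λ) (hA : MeasurableSet A) {e : ℝ} {w : Fock d}
    (hw : h.pencil (e + c) w = 0) {S : Fock d →L[ℂ] Fock d}
    (hS : ∀ w, S (w + h.K w) = h.S0 w) {y : Mom d → ℝ} (hy : ∀ q, (p.xi e q + c) * y q = 1)
    (hyb : EssBdd (fun q => (y q : ℂ)) (volume.restrict A))
    (hu : MemLp (fun q => (p.alpha : ℂ) * y q * p.lam q) 2 (volume.restrict A))
    (φ : Lp ℂ 2 (volume.restrict A)) :
    S (h.dress hA w φ) - h.dress hA w (mulOp _ hyb φ)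
      = -(inner ℂ (hu.toLp _) φ : ℂ) • S (spin1 d (h.S0 w)) := by
  have hY := mulOp_coeFn _ hyb φ
  obtain ⟨v, h1, h2⟩ := h.ham_creation hw (l2Bound_indicator hA φ)
    (l2Bound_indicator hA (mulOp _ hyb φ)) (by
      filter_upwards [indicator_ae_eq hA hY] with q hq
      rw [hq]
      by_cases hqA : q ∈ A
      · rw [Set.indicator_of_mem hqA, Set.indicator_of_mem hqA, smul_eq_mul, ← mul_assoc,
          ← Complex.ofReal_mul, hy, Complex.ofReal_one, one_mul]
      · rw [Set.indicator_of_notMem hqA, Set.indicator_of_notMem hqA, mul_zero])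
  rw [dress_eq, dress_eq, ← h1, ← hS v, h2, map_add, map_smul]
  have h3 : (inner ℂ (hu.toLp _) φ : ℂ)
      = (p.alpha : ℂ) * ∫ q, starRingEnd ℂ (p.lam q) * A.indicator (mulOp _ hyb φ) q := by
    rw [L2.inner_def, ← integral_const_mul, ← integral_indicator hA]
    refine integral_congr_ae ?_
    filter_upwards [indicator_ae_eq hA hY, indicator_ae_eq hA hu.coeFn_toLp] with q h4 h5
    rw [h4]
    by_cases hqA : q ∈ A
    · rw [Set.indicator_of_mem hqA, Set.indicator_of_mem hqA] at h5
      rw [Set.indicator_of_mem hqA, Set.indicator_of_mem hqA, h5]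
      simp only [RCLike.inner_apply, map_mul, Complex.conj_ofReal, smul_eq_mul]
      ring
    · rw [Set.indicator_of_notMem hqA, Set.indicator_of_notMem hqA, mul_zero, mul_zero]
  rw [h3, neg_smul]
  abel

/-- The phases cancel in the scalar part of the commutation relation, while the smeared annihilation
terms tend to zero. This makes the wave operator a multiple of an isometry. -/
lemma inner_dress_limit (h : p.Regular c Λ) (hA : MeasurableSet A) (w : Fock d)
    {y : Mom d → ℝ} (hy : Measurable y) (hac : (volume : Measure (Mom d)).map y ≪ volume)
    (φ ψ : Lp ℂ 2 (volume.restrict A)) :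
    Tendsto (fun s => (inner ℂ (h.dress hA w (phaseOp hy s φ)) (h.dress hA w (phaseOp hy s ψ)) : ℂ))
      atTop (𝓝 (((‖h.S0 w‖ ^ 2 : ℝ) : ℂ) * inner ℂ φ ψ)) := by
  have hann : ∀ φ : Lp ℂ 2 (volume.restrict A),
      Tendsto (fun s => h.annL (l2Bound_indicator hA (phaseOp hy s φ)) w) atTop (𝓝 0) := by
    intro φ
    have hb : ∀ s, L2Bound (fun q => phase y s q * A.indicator φ q) ‖φ‖ := fun s =>
      { meas := (measurable_phase hy s).mul (l2Bound_indicator hA φ).meas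
        nonneg := norm_nonneg _
        bound := by
          refine le_trans (le_of_eq (lintegral_congr fun q => ?_)) (l2Bound_indicator hA φ).bound
          rw [enorm_mul, ← ofReal_norm (phase y s q), norm_phase, ENNReal.ofReal_one, one_mul] }
    refine (h.tendsto_annL_phase hy hac (l2Bound_indicator hA φ) hb w).congr fun s => ?_
    refine Fock.ext_rep ((h.rep_annL (hb s) w).trans (.trans ?_ (h.rep_annL _ w).symm))
    refine annOne_congr ?_ ae_eq_rfl
    refine EventuallyEq.symm ((indicator_ae_eq hA (mulOp_coeFn _ (essBdd_phase hy s) φ)).trans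
      (.of_forall fun q => ?_))
    by_cases hq : q ∈ A <;> simp [hq]
  have h1 : ∀ s, (inner ℂ (h.dress hA w (phaseOp hy s φ)) (h.dress hA w (phaseOp hy s ψ)) : ℂ)
      = inner ℂ (h.annL (l2Bound_indicator hA (phaseOp hy s ψ)) w)
          (h.annL (l2Bound_indicator hA (phaseOp hy s φ)) w)
        + ((‖h.S0 w‖ ^ 2 : ℝ) : ℂ) * inner ℂ φ ψ := by
    intro s
    rw [dress_eq, dress_eq, inner_creL_creL, integral_conj_indicator hA, inner_phaseOp_phaseOp,
      mul_comm (inner ℂ φ ψ : ℂ)]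
  rw [funext h1]
  have h2 : Tendsto (fun s => (inner ℂ (h.annL (l2Bound_indicator hA (phaseOp hy s ψ)) w)
      (h.annL (l2Bound_indicator hA (phaseOp hy s φ)) w) : ℂ)) atTop
      (𝓝 (inner ℂ (0 : Fock d) 0)) := (hann ψ).inner (𝕜 := ℂ) (hann φ)
  have h3 : (inner ℂ (0 : Fock d) 0 : ℂ) = 0 := by
    rw [Fock.inner_self]; simp
  rw [h3] at h2
  have h4 := h2.add_const (((‖h.S0 w‖ ^ 2 : ℝ) : ℂ) * (inner ℂ φ ψ : ℂ))
  rwa [zero_add] at h4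

end Regular
end Model

/-! ### Damped generalised eigenvectors -/

namespace Model
variable {p : Model d} {c Λ η : ℝ}

namespace Weak

open Classical in
/-- The solution `v` of `(H + c - m + i t P) v = χ`, where `P` projects onto at most one boson. -/
def damped (h : p.Weak c Λ η) (χ : Fock d) (t m : ℝ) : Fock d :=
  if hmt : m < gap p c η 1 ∧ t ≠ 0 then
    h.toRegular.S0 ((h.bijective_pencil hmt.1 hmt.2).2 χ).choose
  else 0

lemma damped_spec (h : p.Weak c Λ η) (χ : Fock d) {t m : ℝ} (hm : m < gap p c η 1) (ht : t ≠ 0) :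
    ∃ w, h.damped χ t m = h.toRegular.S0 w ∧
      h.toRegular.pencil m w + (Complex.I * t) • numProj d 1 (h.toRegular.S0 w) = χ := by
  refine ⟨_, ?_, ((h.bijective_pencil hm ht).2 χ).choose_spec⟩
  rw [damped, dif_pos ⟨hm, ht⟩]

lemma norm_S0_le_pencil (h : p.Weak c Λ η) {t m : ℝ} (hm : m < gap p c η 1) (ht : t ≠ 0)
    (w : Fock d) : ‖h.toRegular.S0 w‖ ≤ (gap p c η 1 - m)⁻¹ * (1 + gap p c η 1 / |t|) *
      ‖h.toRegular.pencil m w + (Complex.I * t) • numProj d 1 (h.toRegular.S0 w)‖ := by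
  have h1 := (h.formBound le_rfl).norm_le_of_im hm ht w
  rw [← add_assoc] at h1
  exact h1

lemma norm_damped_le (h : p.Weak c Λ η) (χ : Fock d) {t m : ℝ} (hm : m < gap p c η 1)
    (ht : t ≠ 0) :
    ‖h.damped χ t m‖ ≤ (gap p c η 1 - m)⁻¹ * (1 + gap p c η 1 / |t|) * ‖χ‖ := by
  obtain ⟨w, h1, h2⟩ := h.damped_spec χ hm ht
  have h3 := h.norm_S0_le_pencil hm ht w
  rwa [h2, ← h1] at h3

/-- The resolvent identity: the difference of two solutions solves the same equation with source `(m
- m₀)` times one of them. Continuity is what makes the damped packets measurable in the momentum. -/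
lemma continuousOn_damped (h : p.Weak c Λ η) (χ : Fock d) {t : ℝ} (ht : t ≠ 0) :
    ContinuousOn (h.damped χ t) (Set.Iio (gap p c η 1)) := by
  intro m₀ hm₀
  refine ContinuousAt.continuousWithinAt ?_
  obtain ⟨w₀, h1, h2⟩ := h.damped_spec χ hm₀ ht
  have hbound : ∀ᶠ m in 𝓝 m₀, ‖h.damped χ t m - h.damped χ t m₀‖
      ≤ (gap p c η 1 - m)⁻¹ * (1 + gap p c η 1 / |t|) * (|m - m₀| * ‖h.damped χ t m₀‖) := by
    filter_upwards [Iio_mem_nhds hm₀] with m hm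
    obtain ⟨w, h3, h4⟩ := h.damped_spec χ hm ht
    have h5 := h.norm_S0_le_pencil hm ht (w - w₀)
    have h6 : h.toRegular.pencil m (w - w₀)
        + (Complex.I * t) • numProj d 1 (h.toRegular.S0 (w - w₀))
        = ((m - m₀ : ℝ) : ℂ) • h.toRegular.S0 w₀ := by
      have h7 : h.toRegular.pencil m w₀ = h.toRegular.pencil m₀ w₀
          - ((m - m₀ : ℝ) : ℂ) • h.toRegular.S0 w₀ := by
        rw [h.toRegular.pencil_apply, h.toRegular.pencil_apply, Complex.ofReal_sub, sub_smul,
          neg_smul, neg_smul]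
        abel
      rw [map_sub, map_sub, map_sub, smul_sub, h7]
      rw [← sub_eq_zero] at h2 h4
      have h8 := sub_eq_zero.2 (h4.trans h2.symm)
      rw [← sub_eq_zero, ← h8]
      abel
    rw [h6, map_sub, ← h3, ← h1, Fock.norm_smul, Complex.norm_real, Real.norm_eq_abs] at h5
    exact h5
  rw [ContinuousAt, tendsto_iff_norm_sub_tendsto_zero]
  refine squeeze_zero' (.of_forall fun _ => norm_nonneg _) hbound ?_
  have h3 : ContinuousAt (fun m => (gap p c η 1 - m)⁻¹ * (1 + gap p c η 1 / |t|) *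
      (|m - m₀| * ‖h.damped χ t m₀‖)) m₀ := by
    have h4 : gap p c η 1 - m₀ ≠ 0 := (sub_pos.2 hm₀).ne'
    fun_prop (disch := exact h4)
  have h4 := h3.tendsto
  simpa using h4

lemma damped_eq_resolvent (h : p.Weak c Λ η) (χ : Fock d) {S : Fock d →L[ℂ] Fock d}
    (hS : ∀ w, S (w + h.toRegular.K w) = h.toRegular.S0 w) {t m : ℝ} (hm : m < gap p c η 1)
    (ht : t ≠ 0) : h.damped χ t m = S (χ + (m : ℂ) • h.damped χ t m
      - (Complex.I * t) • numProj d 1 (h.damped χ t m)) := by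
  obtain ⟨w, h1, h2⟩ := h.damped_spec χ hm ht
  rw [h1]
  nth_rewrite 1 [← hS]
  congr 1
  rw [← h2, h.toRegular.pencil_apply, neg_smul]
  abel

end Weak
end Model

/-! ### Wave packets -/

namespace Model
variable {p : Model d} {c Λ η e : ℝ}

/-- The value of the resolvent `(H + c)⁻¹` on the branch. -/
def branchVal (p : Model d) (c e : ℝ) (q : Mom d) : ℝ := (p.xi e q + c)⁻¹

lemma measurable_branchVal (hom : DispersionLaw p.om) (c e : ℝ) :
    Measurable (p.branchVal c e) := ((measurable_xi hom e).add_const c).inv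

lemma branch_energy_pos (hom : DispersionLaw p.om) (hec : 0 < e + c) (q : Mom d) :
    e + c + p.kappa ≤ p.xi e q + c ∧ 0 < p.xi e q + c := by
  have h1 := kappa_le hom q
  have h2 : 0 < p.kappa := hom.pos 0
  constructor <;> rw [xi] <;> linarith

lemma mul_branchVal (hom : DispersionLaw p.om) (hec : 0 < e + c) (q : Mom d) :
    (p.xi e q + c) * p.branchVal c e q = 1 :=
  mul_inv_cancel₀ (branch_energy_pos hom hec q).2.ne'

lemma abs_branchVal_le (hom : DispersionLaw p.om) (hec : 0 < e + c) (q : Mom d) :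
    |p.branchVal c e q| ≤ (e + c)⁻¹ := by
  have h1 := branch_energy_pos hom hec q
  have h2 : 0 < p.kappa := hom.pos 0
  rw [branchVal, abs_of_pos (inv_pos.2 h1.2)]
  exact inv_anti₀ hec (by linarith)

lemma map_branchVal (hd : 0 < d) (hom : DispersionLaw p.om) (hec : 0 < e + c) :
    (volume : Measure (Mom d)).map (p.branchVal c e) ≪ volume := by
  refine map_inv_absolutelyContinuous (g := fun q => p.xi e q + c)
    ((measurable_xi hom e).add_const c) (fun q => (branch_energy_pos hom hec q).2) ?_
  have h1 : (volume : Measure (Mom d)).map (fun q => p.xi e q + c)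
      = ((volume : Measure (Mom d)).map (p.xi e)).map (fun x => x + c) := by
    rw [Measure.map_map (measurable_add_const c) (measurable_xi hom e)]
    rfl
  rw [h1]
  exact ((map_xi_absolutelyContinuous hd hom e).map (measurable_add_const c)).trans
    (by rw [map_add_right_eq_self])

/-- The energies of the branch, shifted by `c`, stay at least `η / 2` below the compression of `H +
c` to more than one boson, so the bounds of the damped solutions are uniform on `G`. -/
lemma gap_one (p : Model d) (c η : ℝ) : Weak.gap p c η 1 = p.threshold 2 - η + c + η / 2 := by
  rw [Weak.gap]
  norm_num
  ring

lemma essBdd_branchVal (hom : DispersionLaw p.om) (hec : 0 < e + c) (η : ℝ) :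
    EssBdd (fun q => (p.branchVal c e q : ℂ)) (volume.restrict (p.G η e)) :=
  essBdd_ofReal (measurable_branchVal hom c e) (inv_nonneg.2 hec.le)
    (.of_forall (abs_branchVal_le hom hec))

lemma memLp_branchCoupling (h : p.Regular c Λ) (hom : DispersionLaw p.om) (hec : 0 < e + c) (η : ℝ) :
    MemLp (fun q => (p.alpha : ℂ) * p.branchVal c e q * p.lam q) 2 (volume.restrict (p.G η e)) :=
  by
  have h1 := ((essBdd_branchVal hom hec η).memLp (h.lam_bound.memLp.restrict (p.G η e))).const_smul
    (p.alpha : ℂ)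
  refine h1.ae_eq (.of_forall fun q => ?_)
  simp [mul_assoc]

/-- The singular part of the packet is `J u`, and by `eigReg_eq` the regular part is `-∫ θ v` with
`θ = α φ conj λ` and damped solutions `v`. Their sum is the quantity whose limit `tendsto_packet`
identifies as the wave operator. -/
lemma isPacket_of_tendsto (h : p.Weak c Λ η) (hom : DispersionLaw p.om) (hec : 0 < e + c)
    (hd : 0 < d) {f : Spin} {w : Fock d} (hF : p.IsBoundState e f (h.toRegular.S0 w))
    (hw : h.toRegular.pencil (e + c) w = 0)
    (hmu : ∀ᵐ Q ∂lebesguePoisson d, Q.1 = 0 → (p.mu0 e f).rep Q = 0)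
    {S : Fock d →L[ℂ] Fock d} (hSb : ResolventBound S (numProj d 1) (Weak.gap p c η 1))
    (hS : ∀ w, S (w + h.toRegular.K w) = h.toRegular.S0 w)
    {φ : Mom d → ℂ} (hφ : p.IsTest η e φ) {u : p.L2G η e}
    (hu : ∀ᵐ q ∂(volume.restrict (p.G η e)), u q = φ q) {F : Fock d}
    (hlim : Tendsto (fun s => wave S (h.toRegular.dress (measurableSet_G hom η e) w)
      (phaseOp (measurable_branchVal hom c e)) s u) atTop (𝓝 F)) :
    p.IsPacket e f φ F := by
  set A := p.G η e with hA
  have hAm : MeasurableSet A := measurableSet_G hom η e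
  set μ : Measure (Mom d) := volume.restrict A with hμ
  set y := p.branchVal c e with hy
  have hym : Measurable y := measurable_branchVal hom c e
  set χ := spin1 d (h.toRegular.S0 w) with hχ
  have hη := h.eta_pos
  have hsum := h.sum_le
  have hk := h.kappa_pos
  have hgap := gap_one p c η
  have hE : 0 < p.threshold 2 - η + c := by
    rw [threshold]; push_cast; linarith
  have hlt : ∀ k ∈ A, p.xi e k + c < p.threshold 2 - η + c := fun k hk => by
    have : p.xi e k < p.threshold 2 - η := hk
    linarith
  have hltg : ∀ k ∈ A, p.xi e k + c < Weak.gap p c η 1 := fun k hk => by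
    have := hlt k hk
    linarith
  have hyinv : ∀ k, (y k)⁻¹ = p.xi e k + c := fun k => inv_inv _
  set θ : Mom d → ℂ := fun k => φ k * ((p.alpha : ℂ) * starRingEnd ℂ (p.lam k)) with hθ
  set v : ℝ → Mom d → Fock d := fun t k => h.damped χ t (p.xi e k + c) with hv
  have hlam2 : MemLp (fun k => starRingEnd ℂ (p.lam k)) 2 μ :=
    (h.lam_bound.memLp.restrict A).star
  have hφ2 : MemLp φ 2 μ := hφ.memLp
  have hθi : Integrable θ μ := by
    have h1 : Integrable (fun k => φ k * starRingEnd ℂ (p.lam k)) μ := hφ2.integrable_mul hlam2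
    refine (h1.const_mul (p.alpha : ℂ)).congr (.of_forall fun k => ?_)
    simp only [hθ]; ring
  have hvb : ∀ t : ℝ, t ≠ 0 → ∀ k ∈ A, ‖v t k‖
      ≤ (η / 2)⁻¹ * (1 + Weak.gap p c η 1 / |t|) * ‖χ‖ := by
    intro t ht k hk
    refine (h.norm_damped_le χ (hltg k hk) ht).trans ?_
    have h1 : 0 ≤ 1 + Weak.gap p c η 1 / |t| := by
      have : 0 < Weak.gap p c η 1 := by linarith
      positivity
    have h2 : (Weak.gap p c η 1 - (p.xi e k + c))⁻¹ ≤ (η / 2)⁻¹ :=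
      inv_anti₀ (by linarith) (by have := hlt k hk; linarith)
    gcongr
  have hvm : ∀ t : ℝ, t ≠ 0 → AEStronglyMeasurable (v t) μ := by
    intro t ht
    have hg : Measurable fun k => p.xi e k + c := (measurable_xi hom e).add_const c
    have h1 : (μ.map fun k => p.xi e k + c).restrict (Set.Iio (Weak.gap p c η 1))
        = μ.map fun k => p.xi e k + c := by
      refine Measure.restrict_eq_self_of_ae_mem ?_
      refine (ae_map_iff hg.aemeasurable (p := fun x => x < Weak.gap p c η 1)
        measurableSet_Iio).2 ?_
      filter_upwards [ae_restrict_mem hAm] with k hk using hltg k hk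
    have h2 := (h.continuousOn_damped χ ht).aestronglyMeasurable
      (μ := μ.map fun k => p.xi e k + c) measurableSet_Iio
    rw [h1] at h2
    exact h2.comp_measurable hg
  have hvi : ∀ t : ℝ, 0 < t → Integrable (fun k => θ k • v t k) μ := by
    intro t ht
    refine hθi.smul_bdd ((η / 2)⁻¹ * (1 + Weak.gap p c η 1 / |t|) * ‖χ‖) (hvm t ht.ne') ?_
    filter_upwards [ae_restrict_mem hAm] with k hk using hvb t ht.ne' k hk
  have heig : ∀ t : ℝ, 0 < t → (fun k => φ k • p.eigReg e f t k)
      = A.indicator fun k => -(θ k • v t k) := by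
    intro t ht
    funext k
    by_cases hkA : k ∈ A
    · obtain ⟨w', h1, h2⟩ := h.damped_spec χ (hltg k hkA) ht.ne'
      rw [Complex.ofReal_add] at h2
      rw [Set.indicator_of_mem hkA, h.eigReg_eq hF hmu ht.ne' (hltg k hkA) h2, ← h1, smul_neg,
        smul_smul]
    · have h1 : φ k = 0 := by
        by_contra h2
        exact hkA (hφ.2.2 (subset_tsupport φ h2))
      rw [Set.indicator_of_notMem hkA, h1, zero_smul]
  have hJ := h.toRegular.resolvent_commutator hAm hw hS (mul_branchVal hom hec)
    (essBdd_branchVal hom hec η) (memLp_branchCoupling h.toRegular hom hec η)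
  have hU := flow_phaseOp (V := ℂ) (μ := μ) hym (inv_nonneg.2 hec.le)
    (.of_forall (abs_branchVal_le hom hec))
    ((Measure.absolutelyContinuous_of_le (Measure.map_mono Measure.restrict_le_self hym)).trans (map_branchVal hd hom hec))
  -- On `G` the value of `ξ + c` lies below `λ⁰_{0,2} - η + c`, which is smaller than the gap by `η
  -- / 2`; so `y₀` exceeds the inverse of the gap strictly, as the regularisation requires.
  have hmain := hSb.tendsto_packet hU hJ hym (y₀ := (p.threshold 2 - η + c)⁻¹)
    (y₁ := (e + c)⁻¹) (inv_strictAnti₀ hE (by linarith)) (by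
      filter_upwards [ae_restrict_mem hAm] with k hk
      exact ⟨inv_anti₀ (branch_energy_pos hom hec k).2 (hlt k hk).le,
        (le_abs_self _).trans (abs_branchVal_le hom hec k)⟩) hθi (φ := u) (by
      intro s
      rw [inner_phaseOp]
      refine integral_congr_ae ?_
      filter_upwards [hu, (memLp_branchCoupling h.toRegular hom hec η).coeFn_toLp] with k h1 h2
      rw [h1, h2, phase]
      simp only [RCLike.inner_apply, map_mul, Complex.conj_ofReal, hθ]
      ring) (v := v) (C₁ := (η / 2)⁻¹ * (1 + Weak.gap p c η 1) * ‖χ‖) (by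
      intro t ht
      filter_upwards [ae_restrict_mem hAm] with k hk
      rw [hyinv]
      exact h.damped_eq_resolvent χ hS (hltg k hk) ht.ne') (by
      intro t ht ht1
      filter_upwards [ae_restrict_mem hAm] with k hk
      refine (hvb t ht.ne' k hk).trans ?_
      rw [abs_of_pos ht, le_div_iff₀ ht]
      have h1 : (1 + Weak.gap p c η 1 / t) * t ≤ 1 + Weak.gap p c η 1 := by
        rw [add_mul, div_mul_cancel₀ _ ht.ne']; linarith
      calc (η / 2)⁻¹ * (1 + Weak.gap p c η 1 / t) * ‖χ‖ * t
          = (η / 2)⁻¹ * ((1 + Weak.gap p c η 1 / t) * t) * ‖χ‖ := by ring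
        _ ≤ _ := by gcongr) hvi hlim
  refine ⟨h.toRegular.dress hAm w u, ?_, fun t ht => ?_, hmain.congr' ?_⟩
  · have h1 : A.indicator u =ᵐ[volume] φ := by
      refine (indicator_ae_eq hAm hu).trans (.of_forall fun q => ?_)
      by_cases hq : q ∈ A
      · simp [hq]
      · have : φ q = 0 := by
          by_contra h2
          exact hq (hφ.2.2 (subset_tsupport φ h2))
        simp [hq, this]
    exact (h.toRegular.rep_dress hAm w u).trans (addOne_congr h1 hF)
  · rw [heig t ht]
    exact (integrable_indicator_iff hAm).2 (hvi t ht).neg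
  · filter_upwards [self_mem_nhdsWithin] with t ht
    have h1 : ∫ k, φ k • p.eigReg e f t k = -∫ k, θ k • v t k ∂μ := by
      rw [heig t ht, integral_indicator hAm]
      exact integral_neg _
    rw [h1]
    exact sub_eq_add_neg _ _

end Model

/-! ### The wave operator of the branch -/

lemma FormFactor.exists_l2Bound {lam : Mom d → ℂ} (hlam : FormFactor lam) :
    ∃ Λ : ℝ, L2Bound lam Λ := by
  obtain ⟨g, hg, -, hle, -⟩ := hlam.dominated
  have hm : Measurable lam := hlam.contDiff.continuous.measurable
  have h1 : MemLp lam 2 volume :=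
    hg.mono hm.aestronglyMeasurable (.of_forall fun q => (hle q).trans (le_abs_self _))
  have h2 := (memLp_two_iff_lintegral.1 h1).2
  refine ⟨√(∫⁻ q, ‖lam q‖ₑ ^ 2).toReal, hm, Real.sqrt_nonneg _, ?_⟩
  rw [Real.sq_sqrt ENNReal.toReal_nonneg, ENNReal.ofReal_toReal h2.ne]

namespace Model
variable {p : Model d} {c Λ η e : ℝ}

/-- The wave operator of the one-boson branch. It is a multiple of an isometry, it intertwines
multiplication by `ξ` with `H`, and it maps `φ` to the wave packet `F_φ`. -/
theorem Weak.exists_waveOperator (h : p.Weak c Λ η) (hd : 0 < d) (hom : DispersionLaw p.om)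
    (he : e < p.threshold 1 - η) {f : Spin} (hf : p.IsNullVector e f) :
    ∃ (F₀ : Fock d) (T : p.L2G η e →L[ℂ] Fock d), p.IsBoundState e f F₀ ∧
      p.HamRel F₀ ((e : ℂ) • F₀) ∧ 1 ≤ ‖F₀‖ ∧
      (∀ (φ : Mom d → ℂ) (u : p.L2G η e), p.IsTest η e φ →
          (∀ᵐ q ∂(volume.restrict (p.G η e)), u q = φ q) → p.IsPacket e f φ (T u)) ∧
      (∀ φ ψ : p.L2G η e, (inner ℂ (T φ) (T ψ) : ℂ)
          = ((‖F₀‖ ^ 2 : ℝ) : ℂ) * inner ℂ φ ψ) ∧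
      ∀ φ ψ : p.L2G η e, (∀ᵐ q ∂(volume.restrict (p.G η e)), ψ q = (p.xi e q : ℂ) * φ q) →
          p.HamRel (T φ) (T ψ) := by
  have hgap0 : e + c < gap p c η 0 := by
    have := h.eta_pos
    rw [gap, zero_add]; linarith
  obtain ⟨w, hF, hw, hnorm, hmu⟩ := h.exists_boundState hgap0 hf
  have hweq : w + h.toRegular.K w = ((e + c : ℝ) : ℂ) • h.toRegular.S0 w := by
    rw [h.toRegular.pencil_apply, neg_smul, ← sub_eq_add_neg, sub_eq_zero] at hw
    rw [hw, Complex.ofReal_add]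
  -- The form of `H + c` on the bound state is `(e + c) ‖F₀‖²`, so the lower bound of the form
  -- yields `e + c ≥ κ / 2`.
  have hec : 0 < e + c := by
    have h1 := h.form_lower w
    rw [hweq, Fock.inner_smul_right, Fock.inner_self, ← Complex.ofReal_mul,
      Complex.ofReal_re] at h1
    have h2 : 0 < p.kappa / 2 := half_pos h.kappa_pos
    have h3 : 0 < ‖h.toRegular.S0 w‖ ^ 2 := by positivity
    exact h2.trans_le (le_of_mul_le_mul_right h1 h3)
  obtain ⟨S, hSa, -, hS, hform⟩ := (h.formBound le_rfl).exists_resolvent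
  have hSb : ResolventBound S (numProj d 1) (gap p c η 1) :=
    ⟨hSa, numProj_selfAdjoint 1, numProj_idem 1, (h.formBound le_rfl).pos, hform⟩
  have hAm := measurableSet_G hom η e
  have hym := measurable_branchVal hom c e
  have hac := map_branchVal hd hom hec
  have hacG := (Measure.absolutelyContinuous_of_le (Measure.map_mono
    (Measure.restrict_le_self (s := p.G η e)) hym)).trans hac
  have hJ := h.toRegular.resolvent_commutator hAm hw hS (mul_branchVal hom hec)
    (essBdd_branchVal hom hec η) (memLp_branchCoupling h.toRegular hom hec η)
  have hU := flow_phaseOp (V := ℂ) (μ := volume.restrict (p.G η e)) hym (inv_nonneg.2 hec.le)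
    (.of_forall (abs_branchVal_le hom hec)) hacG
  obtain ⟨Ω, hΩ⟩ := exists_wave_limit hSa hU hJ (dense_isKato hym hacG)
  refine ⟨h.toRegular.S0 w, Ω, hF, (h.toRegular.hamRel_iff_pencil e w).2 hw, hnorm, ?_, ?_, ?_⟩
  · intro φ u hφ hu
    exact isPacket_of_tendsto h hom hec hd hF hw hmu hSb hS hφ hu (hΩ u)
  · intro φ ψ
    -- The Gram form of the packets is computed twice: as that of the limit, and from the
    -- commutation relations.
    exact tendsto_nhds_unique (tendsto_inner_wave hSa hΩ φ ψ)
      (h.toRegular.inner_dress_limit hAm w hym hac φ ψ)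
  · intro φ ψ hψ
    -- `θ = (ξ + c) φ`, so that `Y θ = φ` and `Ω φ = S Ω θ`; this exhibits `Ω φ` in the range of
    -- `S`, the domain of `H`.
    set θ : p.L2G η e := ψ + (c : ℂ) • φ with hθ
    have hY : mulOp _ (essBdd_branchVal hom hec η) θ = φ := by
      refine Lp.ext ?_
      filter_upwards [mulOp_coeFn _ (essBdd_branchVal hom hec η) θ, hψ, Lp.coeFn_add ψ ((c : ℂ) • φ),
        Lp.coeFn_smul (c : ℂ) φ] with q h1 h2 h3 h4
      rw [h1, hθ, h3, Pi.add_apply, h2, h4, Pi.smul_apply, smul_eq_mul, smul_eq_mul, ← add_mul,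
        ← Complex.ofReal_add, ← mul_assoc, ← Complex.ofReal_mul, mul_comm (p.branchVal c e q),
        mul_branchVal hom hec, Complex.ofReal_one, one_mul]
    have h1 : Ω φ = S (Ω θ) := by
      conv_lhs => rw [← hY]
      exact wave_limit_intertwines hSa hU hJ hΩ θ
    obtain ⟨v, hv⟩ := (bijective_one_add h.norm_K_le).2 (Ω θ)
    simp only at hv
    have h2 : Ω φ = h.toRegular.S0 v := by rw [h1, ← hv, hS]
    rw [h2, h.toRegular.hamRel_S0_iff, hv, ← h2, hθ, map_add, map_smul, add_sub_cancel_right]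

lemma exists_weak {om : Mom d → ℝ} (hom : DispersionLaw om) {lam : Mom d → ℂ}
    (hlam : FormFactor lam) {ε : ℝ} (hε : 0 ≤ ε) (hη : 0 < η) :
    ∃ α₀ c Λ : ℝ, 0 < α₀ ∧ ∀ α : ℝ, 0 ≤ α → α < α₀ →
      (⟨ε, om, lam, α⟩ : Model d).Weak c Λ η := by
  obtain ⟨Λ, hΛ⟩ := hlam.exists_l2Bound
  have hk : 0 < om 0 := hom.pos 0
  have hΛ1 : 0 < Λ + 1 := by linarith [hΛ.nonneg]
  -- `Λ + 1` replaces `Λ` in the denominator because the bound on the form factor may be zero; `8 ε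
  -- + κ + η` is a shift that meets all the requirements on `c`.
  refine ⟨min (om 0 / 8) (η / 6) / (Λ + 1), 8 * ε + om 0 + η, Λ, by positivity, ?_⟩
  intro α hα hα0
  have h1 : α * Λ ≤ min (om 0 / 8) (η / 6) := by
    have h2 := (lt_div_iff₀ hΛ1).1 hα0
    nlinarith
  have h2 := h1.trans (min_le_left _ _)
  have h3 := h1.trans (min_le_right _ _)
  exact
    { om_meas := hom.contDiff.continuous.measurable
      kappa_pos := hk
      kappa_le := fun q => kappa_le (p := ⟨ε, om, lam, α⟩) hom q
      kappa_le_shift := by change om 0 ≤ _; linarith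
      lam_bound := hΛ
      eps_nonneg := hε
      alpha_nonneg := hα
      eta_pos := hη
      eight_eps_le := by change 8 * ε ≤ _; linarith
      sum_le := by change ε + om 0 + η ≤ _; linarith
      coupling_kappa := by change 8 * (α * Λ) ≤ om 0; linarith
      coupling_eta := by change 6 * (α * Λ) ≤ η; linarith }

end Model

/-! ### The branch subspace -/

namespace Model
variable {p : Model d} {c Λ η e : ℝ}

lemma Regular.hamRel_smul (h : p.Regular c Λ) (a : ℂ) {F K : Fock d} (hF : p.HamRel F K) :
    p.HamRel (a • F) (a • K) := by
  obtain ⟨w, rfl⟩ := h.exists_eq_S0 hF.1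
  rw [h.hamRel_S0_iff] at hF
  rw [← map_smul, h.hamRel_S0_iff, hF, map_smul, map_smul, smul_sub, smul_add,
    smul_comm a (c : ℂ)]

/-- The branch is spanned by all packets in the sense of `IsPacket`, so the inclusion of the branch
in the range of the wave operator needs that a test function has only one packet. -/
lemma IsPacket.unique {f : Spin} {φ : Mom d → ℂ} {F F' : Fock d} (h : p.IsPacket e f φ F)
    (h' : p.IsPacket e f φ F') : F = F' := by
  obtain ⟨S, hS, -, hlim⟩ := h
  obtain ⟨S', hS', -, hlim'⟩ := h'
  obtain rfl : S = S' := Fock.ext_rep (by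
    filter_upwards [hS, hS'] with Q h1 h2
    rw [h1, h2])
  exact tendsto_nhds_unique hlim hlim'

/-- A multiple of an isometry that maps test functions to wave packets maps onto the branch. -/
lemma range_eq_branch (hom : DispersionLaw p.om) {f : Spin} {T : p.L2G η e →L[ℂ] Fock d} {N : ℝ}
    (hN : 1 ≤ N) (hT : ∀ φ, ‖T φ‖ = N * ‖φ‖)
    (hpacket : ∀ (φ : Mom d → ℂ) (u : p.L2G η e), p.IsTest η e φ →
      (∀ᵐ q ∂(volume.restrict (p.G η e)), u q = φ q) → p.IsPacket e f φ (T u)) :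
    Set.range T = (p.branch η e f : Set (Fock d)) := by
  apply Set.Subset.antisymm
  · rintro _ ⟨φ, rfl⟩
    refine map_mem_closure T.continuous (dense_test hom η e φ) fun u hu => ?_
    refine Submodule.span_induction (fun v hv => ?_) ?_ (fun x y _ _ hx hy => ?_)
      (fun a x _ hx => ?_) hu
    · obtain ⟨φ, hφ, hv⟩ := hv
      exact Submodule.subset_span ⟨φ, hφ, hpacket φ v hφ hv⟩
    · rw [map_zero]; exact Submodule.zero_mem _
    · rw [map_add]; exact Submodule.add_mem _ hx hy
    · rw [map_smul]; exact Submodule.smul_mem _ a hx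
  -- Since `‖T φ‖ ≥ ‖φ‖`, the range is closed, so the closure in the definition of the branch adds
  -- nothing outside it.
  · have hclosed : IsClosed (Set.range T) := by
      have h1 : AntilipschitzWith 1 T := by
        refine AddMonoidHomClass.antilipschitz_of_bound T fun φ => ?_
        rw [hT, NNReal.coe_one, one_mul]
        exact le_mul_of_one_le_left (norm_nonneg _) hN
      exact h1.isClosed_range T.uniformContinuous
    have h2 : p.branch η e f ≤ LinearMap.range T.toLinearMap := by
      refine Submodule.topologicalClosure_minimal _ (Submodule.span_le.2 ?_) hclosed
      rintro F ⟨φ, hφ, hF⟩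
      refine ⟨hφ.memLp.toLp φ, ?_⟩
      exact (hpacket φ _ hφ hφ.memLp.coeFn_toLp).unique hF
    exact h2

lemma essBdd_xi (hom : DispersionLaw p.om) (η e : ℝ) :
    EssBdd (fun q => (p.xi e q : ℂ)) (volume.restrict (p.G η e)) := by
  refine essBdd_ofReal (measurable_xi hom e) (C := |e + p.kappa| + |p.threshold 2 - η|)
    (by positivity) ?_
  filter_upwards [ae_restrict_mem (measurableSet_G hom η e)] with q hq
  have h1 : p.xi e q < p.threshold 2 - η := hq
  have h2 : e + p.kappa ≤ p.xi e q := by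
    have := kappa_le hom q
    rw [xi]; linarith
  rw [abs_le]
  constructor
  · linarith [neg_abs_le (e + p.kappa), abs_nonneg (p.threshold 2 - η)]
  · linarith [le_abs_self (p.threshold 2 - η), abs_nonneg (e + p.kappa)]

lemma isDirectIntegral_zero {ν : ProbabilityTheory.Kernel ℝ (Mom d)}
    (hν : p.IsGelfandLeray η e ν) : p.IsDirectIntegral η e ν 0 fun _ => 0 := by
  intro φ
  have h1 : ∀ᵐ q ∂(volume.restrict (p.G η e)), ((0 : p.L2G η e →L[ℂ] p.L2G η e) φ) q = 0 :=
    Lp.coeFn_zero ℂ 2 _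
  filter_upwards [hν.ae_memLp φ, hν.ae_ae h1] with x hx h2
  refine ⟨hx, ?_⟩
  filter_upwards [h2, Lp.coeFn_zero ℂ 2 (ν x)] with q h3 h4
  rw [h3]
  exact h4.symm

lemma isDirectIntegral_smul_id {ν : ProbabilityTheory.Kernel ℝ (Mom d)}
    (hν : p.IsGelfandLeray η e ν) (a : ℂ) :
    p.IsDirectIntegral η e ν (a • ContinuousLinearMap.id ℂ _)
      fun _ => a • ContinuousLinearMap.id ℂ _ := by
  intro φ
  filter_upwards [hν.ae_memLp φ, hν.ae_ae (Lp.coeFn_smul a φ)] with x hx h2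
  refine ⟨hx, ?_⟩
  filter_upwards [h2, hx.coeFn_toLp, Lp.coeFn_smul a (hx.toLp fun q => φ q)] with q h3 h4 h5
  refine h3.trans (Eq.trans ?_ h5.symm)
  rw [Pi.smul_apply, Pi.smul_apply, h4]

lemma isInvSqrt_id (E : Type*) [NormedAddCommGroup E] [InnerProductSpace ℂ E] :
    IsInvSqrt (ContinuousLinearMap.id ℂ E) (ContinuousLinearMap.id ℂ E + 0) := by
  rw [add_zero]
  exact ⟨ContinuousLinearMap.isPositive_one, rfl, rfl⟩

end Model

end SpinBoson

end

/-! ### Assembly of the theorem -/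

/-- Spectral analysis of the one-boson branch. The map `φ ↦ F_φ` is the wave operator
`lim exp (-i s S) a*(exp (i s y) φ) F₀` as `s → ∞`, with `S = (H + c)⁻¹` and `y = (ξ + c)⁻¹`, and
the smeared annihilation operators vanish in this limit. Hence the scalar product of the wave
packets is exactly `‖F₀‖²` times that of `L²(G)`: the fibre operators `M x` are zero. -/
theorem mainTheorem8 (d : ℕ) (hd : 3 ≤ d)
    (ε : ℝ) (hε : 0 < ε) (om : SpinBoson.Mom d → ℝ) (lam : SpinBoson.Mom d → ℂ)
    (hom : SpinBoson.DispersionLaw om) (hlam : SpinBoson.FormFactor lam)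
    (hlevel : SpinBoson.NonvanishingOnLevels om lam) (η : ℝ) (hη : 0 < η) :
    ∃ α₀ : ℝ, 0 < α₀ ∧ ∀ α : ℝ, 0 ≤ α → α < α₀ →
      ∀ p : SpinBoson.Model d, p = ⟨ε, om, lam, α⟩ →
      ∀ (e : ℝ) (f : SpinBoson.Spin), e < p.threshold 1 - η → p.IsNullVector e f →
      -- the map `φ ↦ F_φ` on `L²(G)`
      ∃ T : p.L2G η e →L[ℂ] SpinBoson.Fock d,
        (∀ (φ : SpinBoson.Mom d → ℂ) (u : p.L2G η e), p.IsTest η e φ →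
          (∀ᵐ q ∂(volume.restrict (p.G η e)), u q = φ q) → p.IsPacket e f φ (T u)) ∧
        Function.Injective T ∧
        Set.range T = (p.branch η e f : Set (SpinBoson.Fock d)) ∧
      -- the branch subspace is invariant under `H`
        (∀ F ∈ p.branch η e f, ∃ K ∈ p.branch η e f, p.HamRel F K) ∧
      ∃ F₀ : SpinBoson.Fock d, p.IsBoundState e f F₀ ∧ p.HamRel F₀ ((e : ℂ) • F₀) ∧
      -- the scalar product of the vectors `F_φ` in terms of the fibre operators `M x`
      ∃ (ν : ProbabilityTheory.Kernel ℝ (SpinBoson.Mom d))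
        (M r : ∀ x : ℝ, Lp ℂ 2 (ν x) →L[ℂ] Lp ℂ 2 (ν x))
        (MG BG : p.L2G η e →L[ℂ] p.L2G η e)
        (B : p.branch η e f →L[ℂ] p.branch η e f),
        p.IsGelfandLeray η e ν ∧
        (∀ x, IsSelfAdjoint (M x) ∧ ‖M x‖ < 1) ∧
        p.IsDirectIntegral η e ν MG M ∧
        (∀ φ₁ φ₂ : p.L2G η e, inner ℂ (T φ₂) (T φ₁)
          = ((‖F₀‖ ^ 2 : ℝ) : ℂ) * inner ℂ φ₂ (φ₁ + MG φ₁)) ∧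
      -- `B` is the direct integral of `‖F₀‖⁻¹ (1 + M x)^(-1/2)`
        (∀ x, SpinBoson.IsInvSqrt (r x) (ContinuousLinearMap.id ℂ _ + M x)) ∧
        p.IsDirectIntegral η e ν BG (fun x => ((‖F₀‖⁻¹ : ℝ) : ℂ) • r x) ∧
        (∀ (φ : p.L2G η e) (F : p.branch η e f), (F : SpinBoson.Fock d) = T φ →
          (B F : SpinBoson.Fock d) = T (BG φ)) ∧
      -- `B` commutes with the restriction of `H` to the branch subspace
        (∀ F K : p.branch η e f, p.HamRel F K → p.HamRel (B F) (B K)) ∧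
      -- `φ ↦ F_{B φ}` preserves scalar products, maps onto the branch subspace, and
      -- transforms `H` into multiplication by `ξ`
        (∀ φ₁ φ₂ : p.L2G η e, inner ℂ (T (BG φ₂)) (T (BG φ₁)) = inner ℂ φ₂ φ₁) ∧
        (Set.range fun φ => T (BG φ)) = (p.branch η e f : Set (SpinBoson.Fock d)) ∧
        (∀ φ ψ : p.L2G η e, (∀ᵐ q ∂(volume.restrict (p.G η e)), ψ q = (p.xi e q : ℂ) * φ q) →
          p.HamRel (T φ) (T ψ) ∧ p.HamRel (T (BG φ)) (T (BG ψ))) := by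
  obtain ⟨α₀, c, Λ, hα₀, hweak⟩ := SpinBoson.Model.exists_weak hom hlam hε.le hη
  refine ⟨α₀, hα₀, fun α hα hα' p hp e f he hf => ?_⟩
  have hd0 : 0 < d := by omega
  have h : p.Weak c Λ η := by rw [hp]; exact hweak α hα hα'
  have hom' : SpinBoson.DispersionLaw p.om := by rw [hp]; exact hom
  obtain ⟨F₀, T, hF₀, hHF₀, hnorm, hpacket, hinner, hham⟩ :=
    h.exists_waveOperator hd0 hom' he hf
  have hpos : 0 < ‖F₀‖ := one_pos.trans_le hnorm
  have hT : ∀ φ, ‖T φ‖ = ‖F₀‖ * ‖φ‖ := by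
    intro φ
    have h1 := hinner φ φ
    have h3 : (inner ℂ φ φ : ℂ) = ((‖φ‖ ^ 2 : ℝ) : ℂ) := by
      rw [Complex.ofReal_pow]; exact inner_self_eq_norm_sq_to_K φ
    rw [SpinBoson.Fock.inner_self, h3, ← Complex.ofReal_mul, ← mul_pow] at h1
    have h2 : ‖T φ‖ ^ 2 = (‖F₀‖ * ‖φ‖) ^ 2 := Complex.ofReal_injective h1
    exact (pow_left_inj₀ (norm_nonneg _) (by positivity) two_ne_zero).1 h2
  have hinj : Function.Injective T := by
    rw [injective_iff_map_eq_zero]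
    intro φ hφ
    have h1 := hT φ
    rw [hφ, norm_zero] at h1
    exact norm_eq_zero.1 ((mul_eq_zero.1 h1.symm).resolve_left hpos.ne')
  have hrange := SpinBoson.Model.range_eq_branch hom' hnorm hT hpacket
  -- The scalar that normalises the wave operator; as the fibre operators vanish, it is all that
  -- remains of `B`.
  set a : ℂ := ((‖F₀‖⁻¹ : ℝ) : ℂ) with ha
  have ha0 : a ≠ 0 := by
    rw [ha]; exact_mod_cast (inv_pos.2 hpos).ne'
  have haF : starRingEnd ℂ a * (a * ((‖F₀‖ ^ 2 : ℝ) : ℂ)) = 1 := by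
    rw [ha, Complex.conj_ofReal, ← Complex.ofReal_mul, ← Complex.ofReal_mul]
    norm_cast
    field_simp
  obtain ⟨ν, hν⟩ := SpinBoson.Model.exists_isGelfandLeray hd0 hom' η e
  have hTa : ∀ φ, T ((a • ContinuousLinearMap.id ℂ (p.L2G η e)) φ) = a • T φ :=
    fun φ => map_smul T a φ
  -- The witnesses are `M x = 0`, `(1 + M x)^(-1/2) = 1`, and for `B` the scalar `‖F₀‖⁻¹`, on
  -- `L²(G)` and on the branch.
  refine ⟨T, hpacket, hinj, hrange, ?_, F₀, hF₀, hHF₀, ν, fun _ => 0,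
    fun _ => ContinuousLinearMap.id ℂ _, 0, a • ContinuousLinearMap.id ℂ _,
    a • ContinuousLinearMap.id ℂ _, hν, fun x => ⟨IsSelfAdjoint.zero _, by simp⟩,
    SpinBoson.Model.isDirectIntegral_zero hν, ?_, fun x => SpinBoson.Model.isInvSqrt_id _,
    SpinBoson.Model.isDirectIntegral_smul_id hν a, ?_, ?_, ?_, ?_, ?_⟩
  · intro F hF
    rw [← SetLike.mem_coe, ← hrange] at hF
    obtain ⟨φ, rfl⟩ := hF
    refine ⟨T (SpinBoson.mulOp _ (SpinBoson.Model.essBdd_xi hom' η e) φ), ?_, hham _ _ ?_⟩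
    · rw [← SetLike.mem_coe, ← hrange]
      exact Set.mem_range_self _
    · exact SpinBoson.mulOp_coeFn _ _ φ
  · intro φ₁ φ₂
    rw [hinner, zero_apply, add_zero]
  · intro φ F hF
    rw [hTa, ← hF]
    rfl
  · intro F K hFK
    exact h.toRegular.hamRel_smul a hFK
  · intro φ₁ φ₂
    rw [hTa, hTa, SpinBoson.Fock.inner_smul_left, SpinBoson.Fock.inner_smul_right, hinner,
      ← mul_assoc, ← mul_assoc, mul_assoc (starRingEnd ℂ a), haF, one_mul]
  · rw [← hrange]
    apply Set.Subset.antisymm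
    · rintro _ ⟨φ, rfl⟩
      exact Set.mem_range_self _
    · rintro _ ⟨φ, rfl⟩
      refine ⟨a⁻¹ • φ, ?_⟩
      simp only [hTa, map_smul]
      rw [smul_smul, inv_mul_cancel₀ ha0, one_smul]
  · intro φ ψ hψ
    refine ⟨hham φ ψ hψ, ?_⟩
    rw [hTa, hTa]
    exact h.toRegular.hamRel_smul a (hham φ ψ hψ)
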